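/- **Conventions.** The machine is the randomized word RAM: a program is a fixed finite list of instructions (constants, the usual binary arithmetic and bit operations on words, indirect load and store, reading the input, drawing an independent uniformly random word, conditional jumps), each costing one step. On $n$-node graphs the words have $\Theta(\log n)$ bits. A real number $\omega$ is called a *matrix multiplication exponent* if one program (deterministic, or correct for all outcomes of its random words) multiplies any two $m\times m$ matrices over any prime field $\mathbb Z_p$ in $O(m^\omega)$ steps on words of $O(\log(m+p))$ bits, with constants independent of $m$ and $p$. **Theorem.** Let $\omega$ be a matrix multiplication exponent and let $c$ be a constant. There are three programs (preprocess, update, query), working for all $n\ge 2$, with the following properties; the constants in $O(\cdot)$ depend only on $\omega$ and its multiplication program and on $c$. 1. Given a directed graph $G$ with $n$ nodes, the preprocessing takes $O(n^\omega)$ time, and the data structure that it leaves has $O(n^2\log n)$ bits. 2. Given, after the preprocessing, any set of $f$ updates, each an edge insertion, an edge deletion or a node deletion, the update program takes $O(f^\omega)$ time and the updated data structure has $O(f^2\log n)$ additional bits. There is no bound on $f$. (The updates come as a list without repetition and are applied in the listed order; for $f=0$ the bounds are read with $f$ replaced by $1$.) 3. The updated data structure then answers any sequence of queries. Each query $(u,v)$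 is answered in $O(f^2)$ time and asks whether the updated graph has a directed path (possibly of length zero) from $u$ to $v$ that uses no deleted node. The time and space bounds hold for every outcome of the random words. The oracle is Monte Carlo with one-sided error: for every fixed $G$, set of updates and sequence of queries, a query is never answered "yes" if there is no such path, and each query is answered incorrectly with probability at most $n^{-c}$. -/

import Mathlib

open MeasureTheory

/-! ## The randomized word RAM

Memory is an array of words indexed by words.  A word of size `W` is a natural number below `2 ^ W`.
A program is a fixed finite list of instructions; every executed instruction costs one time unit.
Besides its memory, a run has a read-only array of input words and a source of random words. -/

namespace WordRAM

/-- Binary operations on words. `sub` is truncated at zero, `div` and `mod` are Euclidean division. -/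
inductive Op
  | add | sub | mul | div | mod | land | lor | xor | shl | shr

/-- The value of a binary operation. -/
def Op.eval : Op → ℕ → ℕ → ℕ
  | .add, x, y => x + y
  | .sub, x, y => x - y
  | .mul, x, y => x * y
  | .div, x, y => x / y
  | .mod, x, y => x % y
  | .land, x, y => x &&& y
  | .lor, x, y => x ||| y
  | .xor, x, y => x ^^^ y
  | .shl, x, y => x <<< y
  | .shr, x, y => x >>> y

/-- Instructions. `M` denotes the memory, `d a b` are addresses and `l` is a position in the
program. -/
inductive Instr
  /-- `M[d] := k` -/
  | const (d k : ℕ)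
  /-- `M[d] := M[a] op M[b]` -/
  | op (o : Op) (d a b : ℕ)
  /-- `M[d] := M[M[a]]` -/
  | load (d a : ℕ)
  /-- `M[M[d]] := M[a]` -/
  | store (d a : ℕ)
  /-- `M[d] := input[M[a]]` (zero past the end of the input) -/
  | read (d a : ℕ)
  /-- `M[d] :=` a fresh uniformly random word -/
  | rand (d : ℕ)
  /-- continue at `l` -/
  | jmp (l : ℕ)
  /-- continue at `l` if `M[a] = 0` -/
  | jz (a l : ℕ)
  /-- continue at `l` if `M[a] < M[b]` -/
  | jlt (a b l : ℕ)
  /-- stop -/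
  | halt

/-- A program is a finite list of instructions. -/
abbrev Program := List Instr

/-- A configuration: position in the program, memory, number of random words consumed so far. -/
structure Config where
  pc : ℕ
  mem : ℕ → ℕ
  used : ℕ

/-- A source of random words of size `W`. -/
abbrev Coins (W : ℕ) := ℕ → Fin (2 ^ W)

/-- The initial configuration: all cells are zero. -/
def Config.initial : Config := ⟨0, fun _ => 0, 0⟩

/-- What remains of a configuration between two phases: only the first `s` cells of the memory
survive, the others are reset to zero. (Random words are never reused.) -/
def Config.keep (s : ℕ) (c : Config) : Config :=
  ⟨0, fun a => if a < s then c.mem a else 0, c.used⟩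

/-- Write `x` to cell `d` and go to the next instruction. A value that does not fit into a word is
an overflow, which is a fatal error (`none`). -/
def Config.write (W : ℕ) (c : Config) (d x : ℕ) : Option Config :=
  if x < 2 ^ W then some ⟨c.pc + 1, Function.update c.mem d x, c.used⟩ else none

/-- The effect of one instruction other than `halt`. -/
def Instr.step (W : ℕ) (input : List ℕ) (coins : Coins W) (c : Config) : Instr → Option Config
  | .const d k => c.write W d k
  | .op o d a b => c.write W d (o.eval (c.mem a) (c.mem b))
  | .load d a => c.write W d (c.mem (c.mem a))
  | .store d a => c.write W (c.mem d) (c.mem a)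
  | .read d a => c.write W d (input.getD (c.mem a) 0)
  | .rand d => ({ c with used := c.used + 1 } : Config).write W d (coins c.used)
  | .jmp l => some { c with pc := l }
  | .jz a l => some { c with pc := if c.mem a = 0 then l else c.pc + 1 }
  | .jlt a b l => some { c with pc := if c.mem a < c.mem b then l else c.pc + 1 }
  | .halt => none

/-- `run W P input coins T c = some c'` means that the program `P`, started in the configuration
`c`, executes a `halt` instruction within `T` steps and does so in the configuration `c'`. The value
is `none` if the program needs more time, or commits an error. -/
def run (W : ℕ) (P : Program) (input : List ℕ) (coins : Coins W) : ℕ → Config → Option Config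
  | 0, _ => none
  | T + 1, c =>
    match P[c.pc]? with
    | none => none
    | some .halt => some c
    | some i => (i.step W input coins c).bind (run W P input coins T)

/-- The random words are independent and uniformly distributed. -/
noncomputable def coinMeasure (W : ℕ) : Measure (Coins W) :=
  Measure.infinitePi fun _ : ℕ => ProbabilityTheory.uniformOn (Set.univ : Set (Fin (2 ^ W)))

instance (W : ℕ) : IsProbabilityMeasure (coinMeasure W) := by
  have : Nonempty (Fin (2 ^ W)) := ⟨⟨0, by positivity⟩⟩
  have : IsProbabilityMeasure (ProbabilityTheory.uniformOn (Set.univ : Set (Fin (2 ^ W)))) :=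
    ProbabilityTheory.isProbabilityMeasure_uniformOn Set.finite_univ Set.univ_nonempty
  unfold coinMeasure
  infer_instance

end WordRAM

open WordRAM

/-! ## Matrix multiplication in time `O(m ^ ω)` -/

/-- The entries of a matrix over `ℤ/pℤ`, row by row, as natural numbers below `p`. -/
def matrixWords {p m : ℕ} (A : Matrix (Fin m) (Fin m) (ZMod p)) : List ℕ :=
  (List.ofFn fun i => List.ofFn fun j => (A i j).val).flatten

/-- `ω` is an exponent for matrix multiplication: one program multiplies any two `m × m` matrices
over any prime field `ℤ/pℤ` in `O(m ^ ω)` steps, on words of `O(log (m + p))` bits. The constants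
depend neither on `m` nor on `p`. The product is found in `m ^ 2` consecutive cells, row by row,
starting at the address given in cell `0`. -/
def MatMulExponent (ω : ℝ) : Prop :=
  ∃ (P : Program) (κ C : ℕ), ∀ p m : ℕ, p.Prime → 1 ≤ m →
    ∀ (A B : Matrix (Fin m) (Fin m) (ZMod p)) (coins : Coins (κ * Nat.clog 2 (max m p))),
      ∃ c : Config,
        run (κ * Nat.clog 2 (max m p)) P ([m, p] ++ matrixWords A ++ matrixWords B) coins
          ⌊(C : ℝ) * (m : ℝ) ^ ω⌋₊ Config.initial = some c ∧
        ∀ i j : Fin m, c.mem (c.mem 0 + i * m + j) = ((A * B) i j).val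

/-! ## Graphs under updates -/

/-- A single update of a directed graph with node set `Fin n`. -/
inductive GraphUpdate (n : ℕ)
  | insertEdge (a b : Fin n)
  | deleteEdge (a b : Fin n)
  | deleteNode (x : Fin n)

/-- A directed graph on `Fin n` together with the set of its deleted nodes. -/
structure UpdatedGraph (n : ℕ) where
  graph : Digraph (Fin n)
  deleted : Set (Fin n)

/-- The effect of a single update. -/
def UpdatedGraph.apply {n : ℕ} (H : UpdatedGraph n) : GraphUpdate n → UpdatedGraph n
  | .insertEdge a b => ⟨⟨fun x y => H.graph.Adj x y ∨ (x = a ∧ y = b)⟩, H.deleted⟩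
  | .deleteEdge a b => ⟨⟨fun x y => H.graph.Adj x y ∧ ¬(x = a ∧ y = b)⟩, H.deleted⟩
  | .deleteNode x => ⟨H.graph, insert x H.deleted⟩

/-- The graph after a batch of updates. -/
def applyUpdates {n : ℕ} (G : Digraph (Fin n)) (U : List (GraphUpdate n)) : UpdatedGraph n :=
  U.foldl UpdatedGraph.apply ⟨G, ∅⟩

/-- There is a directed path (possibly of length zero) from `u` to `v` all of whose nodes, including
`u` and `v`, have not been deleted. -/
def UpdatedGraph.Reachable {n : ℕ} (H : UpdatedGraph n) (u v : Fin n) : Prop :=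
  u ∉ H.deleted ∧ Relation.ReflTransGen (fun x y => H.graph.Adj x y ∧ y ∉ H.deleted) u v

/-! ## Sensitive reachability oracles -/

open scoped Classical in
/-- The input of the preprocessing: the number of nodes and the adjacency matrix, row by row. -/
noncomputable def graphWords {n : ℕ} (G : Digraph (Fin n)) : List ℕ :=
  n :: (List.ofFn fun i => List.ofFn fun j => if G.Adj i j then 1 else 0).flatten

/-- The three words that describe an update. -/
def GraphUpdate.words {n : ℕ} : GraphUpdate n → List ℕ
  | .insertEdge a b => [0, a, b]
  | .deleteEdge a b => [1, a, b]
  | .deleteNode x => [2, x, 0]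

/-- The input of the update phase: the number of updates and the list of updates. -/
def updateWords {n : ℕ} (U : List (GraphUpdate n)) : List ℕ :=
  U.length :: U.flatMap GraphUpdate.words

/-- The programs of the three phases, and the factor in the word size. -/
structure OraclePrograms where
  preprocess : Program
  update : Program
  query : Program
  wordFactor : ℕ

namespace OraclePrograms

/-- The word size on graphs with `n` nodes: `O(log n)` bits. -/
def wordSize (O : OraclePrograms) (n : ℕ) : ℕ := O.wordFactor * Nat.clog 2 n

/-- Time limits (in steps) of the three phases and storage limits (in cells): `cells` for the result
of the preprocessing, `extraCells` for what the update phase stores in addition. -/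
structure Limits where
  preprocessTime : ℕ
  updateTime : ℕ
  queryTime : ℕ
  cells : ℕ
  extraCells : ℕ

variable (O : OraclePrograms) (L : Limits) {n : ℕ}

/-- The data structure after preprocessing `G`; it fits into `L.cells` cells. -/
noncomputable def afterPreprocess (G : Digraph (Fin n)) (coins : Coins (O.wordSize n)) :
    Option Config :=
  (run (O.wordSize n) O.preprocess (graphWords G) coins L.preprocessTime Config.initial).map
    (Config.keep L.cells)

/-- The data structure after preprocessing `G` and then updating by the batch `U`. -/
noncomputable def afterUpdate (G : Digraph (Fin n)) (U : List (GraphUpdate n))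
    (coins : Coins (O.wordSize n)) : Option Config :=
  (O.afterPreprocess L G coins).bind fun c =>
    (run (O.wordSize n) O.update (updateWords U) coins L.updateTime c).map
      (Config.keep (L.cells + L.extraCells))

/-- Run the query program for the pair `q`. -/
def runQuery (coins : Coins (O.wordSize n)) (c : Config) (q : Fin n × Fin n) : Option Config :=
  run (O.wordSize n) O.query [q.1, q.2] coins L.queryTime c

/-- The answer (`true` iff cell `0` is nonzero) to the query `q`, asked after preprocessing `G`,
updating by `U` and answering the queries in the list `qs` one after the other. It is `none` if some
phase or query exceeds its time limit, or commits an error. -/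
noncomputable def answer (G : Digraph (Fin n)) (U : List (GraphUpdate n))
    (qs : List (Fin n × Fin n)) (q : Fin n × Fin n) (coins : Coins (O.wordSize n)) : Option Bool :=
  (O.afterUpdate L G U coins).bind fun c₀ =>
    (qs.foldlM (m := Option) (fun c q' =>
      (O.runQuery L coins c q').map (Config.keep (L.cells + L.extraCells))) c₀).bind fun c =>
        (O.runQuery L coins c q).map fun c' => decide (c'.mem 0 ≠ 0)

end OraclePrograms

/-! Reachability is read off a matrix inverse. Over `ℤ/pℤ`, give every edge a random weight, let `W`
be the weighted adjacency matrix and `M = 1 - W`. Suppose `M * N = μ • 1` with `μ ≠ 0`. If `v`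
cannot be reached from `u`, then `N u v = 0`, because `M` is block triangular with respect to the
set of nodes that reach `v` (`reflTransGen_of_ne_zero`). So a nonzero entry certifies a path,
whatever the random words are, and this makes the error one-sided. If there is a path, the entry of
the adjugate is a nonzero polynomial in the weights, since the weights of a shortest-path forest
towards `v` make it `1` (`exists_adjugate_ne_zero`). Its degree is at most the number `q` of nodes,
so by Schwartz–Zippel it rarely vanishes (`card_badWeights_le`).

The inverse is computed by recursive block elimination without divisions (`blockInv`), which always
yields some relation `M * N = μ • 1` (`blockInv_mul`). The scale `μ` is nonzero as soon as all
leading minors are (`blockInv_ne_zero`). The leading minors of `1 - W` are determinants `det (1 -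
W')` for subgraphs, hence polynomials with constant term `1`, and Schwartz–Zippel applies to them
too.

After `f` updates only the rows of the `k ≤ 2 * f` nodes that occur in them change. It suffices to
remove the edges that leave deleted nodes: a path with live end points then avoids them
(`reachable_iff`). The new matrix is `M + U * E` with `k` columns in `U`, and a division-free
Woodbury formula reduces its inversion to that of the `k × k` matrix `μ • 1 + E * N * U`. A row of
`E` that belongs to a deleted node is dense, but it is a unit row minus a row of `M`, so that its
product with `N` is known without computation (`changeRows_mul`). Thus the update uses only the
entries of `N` at changed nodes, and a query is a bilinear form in `k` entries of a row and `k`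
entries of a column of `N` (`exists_updated_inverse`). The leading minors of the small matrix are
governed by graphs in which only some of the nodes have been changed (`coreMat_minor_ne_zero`).

With `q = 16 ^ a ≥ n` and weights below `4 * q ^ 3`, one round fails with probability at most `1 /
q`. All `c + 1` independent rounds share one random prime, found by trial division among random
candidates. Failure to find a prime is as unlikely as failure of all rounds, and the extra round
absorbs the factor `2` (`coinMeasure_badCoins_le`).

The algorithms are written in a small structured language with a cost semantics, compiled to the
machine with constant overhead (`Exec.code_run`). The multiplication program is a black box that may
use its memory arbitrarily; it is interpreted, and a log of the addresses it writes permits its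
memory to be cleared in proportion to its running time (`interp_runs`, `gemm_runs`). Since an `m ×
m` product has to be written out, `2 ≤ ω` (`MatMulExponent.two_le`), so all quadratic overhead is
free and the recursion of the inversion costs no more than its top level (`invTime_le`). -/

/-! ## A structured language on top of the word RAM -/

namespace WordRAM

/-- The state of a structured program: variables, arrays, and the number of random words used. -/
structure St where
  v : ℕ → ℕ
  h : ℕ → ℕ → ℕ
  used : ℕ

namespace St

/-- Assignment to a variable. -/
def set (σ : St) (x a : ℕ) : St := { σ with v := Function.update σ.v x a }

/-- Assignment to an array cell. -/
def put (σ : St) (k a b : ℕ) : St :=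
  { σ with h := Function.update σ.h k (Function.update (σ.h k) a b) }

/-- Consumption of a random word. -/
def draw (σ : St) : St := { σ with used := σ.used + 1 }

@[simp] theorem set_v (σ : St) (x a y : ℕ) : (σ.set x a).v y = if y = x then a else σ.v y := by
  simp [set, Function.update_apply]
@[simp] theorem set_h (σ : St) (x a : ℕ) : (σ.set x a).h = σ.h := rfl
@[simp] theorem set_used (σ : St) (x a : ℕ) : (σ.set x a).used = σ.used := rfl
@[simp] theorem put_v (σ : St) (k a b : ℕ) : (σ.put k a b).v = σ.v := rfl
@[simp] theorem put_used (σ : St) (k a b : ℕ) : (σ.put k a b).used = σ.used := rfl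
theorem put_h (σ : St) (k a b l c : ℕ) :
    (σ.put k a b).h l c = if l = k ∧ c = a then b else σ.h l c := by
  simp only [put, Function.update_apply]
  by_cases h1 : l = k
  · subst h1; by_cases h2 : c = a <;> simp [h2]
  · simp [h1]
@[simp] theorem put_h_ne (σ : St) {k l : ℕ} (a b : ℕ) (h : l ≠ k) : (σ.put k a b).h l = σ.h l := by
  ext c; simp [put_h, h]
@[simp] theorem put_h_same (σ : St) (k a b c : ℕ) :
    (σ.put k a b).h k c = if c = a then b else σ.h k c := by
  simp [put_h]
@[simp] theorem draw_v (σ : St) : σ.draw.v = σ.v := rfl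
@[simp] theorem draw_h (σ : St) : σ.draw.h = σ.h := rfl
@[simp] theorem draw_used (σ : St) : σ.draw.used = σ.used + 1 := rfl

/-- All values are below `V`. -/
def Bounded (V : ℕ) (σ : St) : Prop := (∀ x, σ.v x < V) ∧ ∀ k a, σ.h k a < V

theorem Bounded.set {V : ℕ} {σ : St} (hσ : σ.Bounded V) (x : ℕ) {a : ℕ} (ha : a < V) :
    (σ.set x a).Bounded V := by
  refine ⟨fun y => ?_, hσ.2⟩
  rw [set_v]; split_ifs
  exacts [ha, hσ.1 y]

theorem Bounded.put {V : ℕ} {σ : St} (hσ : σ.Bounded V) (k a : ℕ) {b : ℕ} (hb : b < V) :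
    (σ.put k a b).Bounded V := by
  refine ⟨hσ.1, fun l c => ?_⟩
  rw [put_h]; split_ifs
  exacts [hb, hσ.2 l c]

end St

/-! ### Expressions and their machine code -/

/-- The arithmetic operations that may occur in expressions. -/
inductive BinOp
  | add | sub | mul | div | mod

/-- The corresponding machine operation. -/
def BinOp.toOp : BinOp → Op
  | .add => .add
  | .sub => .sub
  | .mul => .mul
  | .div => .div
  | .mod => .mod

/-- Expressions. -/
inductive Ex
  | lit (k : ℕ)
  | var (x : ℕ)
  | bin (o : BinOp) (a b : Ex)
  | ld (k : ℕ) (a : Ex)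
  | inp (a : Ex)

namespace Ex

/-- The value of an expression. -/
def eval (inp : List ℕ) (σ : St) : Ex → ℕ
  | lit k => k
  | var x => σ.v x
  | bin o a b => o.toOp.eval (a.eval inp σ) (b.eval inp σ)
  | ld k a => σ.h k (a.eval inp σ)
  | .inp a => inp.getD (a.eval inp σ) 0

instance : Add Ex := ⟨bin .add⟩
instance : Sub Ex := ⟨bin .sub⟩
instance : Mul Ex := ⟨bin .mul⟩
instance : Div Ex := ⟨bin .div⟩
instance : Mod Ex := ⟨bin .mod⟩
instance (k : ℕ) : OfNat Ex k := ⟨lit k⟩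

section
variable (i : List ℕ) (σ : St) (a b : Ex) (k : ℕ)
@[simp] theorem eval_lit : (lit k).eval i σ = k := rfl
@[simp] theorem eval_ofNat : (no_index (OfNat.ofNat k : Ex)).eval i σ = k := rfl
@[simp] theorem eval_var : (var k).eval i σ = σ.v k := rfl
@[simp] theorem eval_add : (a + b).eval i σ = a.eval i σ + b.eval i σ := rfl
@[simp] theorem eval_sub : (a - b).eval i σ = a.eval i σ - b.eval i σ := rfl
@[simp] theorem eval_mul : (a * b).eval i σ = a.eval i σ * b.eval i σ := rfl
@[simp] theorem eval_div : (a / b).eval i σ = a.eval i σ / b.eval i σ := rfl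
@[simp] theorem eval_mod : (a % b).eval i σ = a.eval i σ % b.eval i σ := rfl
@[simp] theorem eval_ld : (ld k a).eval i σ = σ.h k (a.eval i σ) := rfl
@[simp] theorem eval_inp : (Ex.inp a).eval i σ = i.getD (a.eval i σ) 0 := rfl
end

/-- If all values are below `V` then the value of an expression is below `V ^ deg`. -/
def deg : Ex → ℕ
  | lit _ => 1
  | var _ => 1
  | bin .add a b => max a.deg b.deg + 1
  | bin .mul a b => a.deg + b.deg
  | bin _ a _ => a.deg
  | ld _ _ => 1
  | .inp _ => 1

/-- The degree of all values that occur in the computation of an expression. -/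
def maxdeg : Ex → ℕ
  | lit _ => 1
  | var _ => 1
  | bin o a b => max (max a.maxdeg b.maxdeg) (bin o a b).deg
  | ld _ a => max a.maxdeg (a.deg + 1)
  | .inp a => a.maxdeg

/-- The largest literal. -/
def maxlit : Ex → ℕ
  | lit k => k
  | var _ => 0
  | bin _ a b => max a.maxlit b.maxlit
  | ld _ a => a.maxlit
  | .inp a => a.maxlit

/-- The largest name of an array. -/
def maxarr : Ex → ℕ
  | lit _ => 0
  | var _ => 0
  | bin _ a b => max a.maxarr b.maxarr
  | ld k a => max k a.maxarr
  | .inp a => a.maxarr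

/-- The machine code that computes the value of an expression in the temporary cell `3 * t + 1`,
when there are `H` arrays. -/
def code (H : ℕ) : Ex → ℕ → List Instr
  | lit k, t => [.const (3 * t + 1) k]
  | var x, t => [.op .lor (3 * t + 1) (3 * x) (3 * x)]
  | bin o a b, t => a.code H t ++ (b.code H (t + 1) ++
      [.op o.toOp (3 * t + 1) (3 * t + 1) (3 * (t + 1) + 1)])
  | ld k a, t => a.code H t ++ [.const (3 * (t + 1) + 1) (3 * H),
      .op .mul (3 * t + 1) (3 * t + 1) (3 * (t + 1) + 1), .const (3 * (t + 1) + 1) (3 * k + 2),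
      .op .add (3 * t + 1) (3 * t + 1) (3 * (t + 1) + 1), .load (3 * t + 1) (3 * t + 1)]
  | .inp a, t => a.code H t ++ [.read (3 * t + 1) (3 * t + 1)]

theorem one_le_maxdeg (e : Ex) : 1 ≤ e.maxdeg := by
  induction e <;> simp [maxdeg, *]

/-- Overflow is fatal on the machine, so every intermediate value needs an a priori bound.
Subtraction, quotient and remainder never exceed their left operand; a sum of two values costs one
more factor `V`, for which `2 ≤ V` is enough. -/
theorem eval_lt {inp : List ℕ} {σ : St} {V : ℕ} (hV : 2 ≤ V) (hσ : σ.Bounded V)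
    (hi : ∀ a, inp.getD a 0 < V) (e : Ex) (hl : e.maxlit < V) : e.eval inp σ < V ^ e.deg := by
  induction e with
  | lit k => simpa [eval, deg, maxlit] using hl
  | var x => simpa [eval, deg] using hσ.1 x
  | ld k a => simpa [eval, deg] using hσ.2 k _
  | inp a => simpa [eval, deg] using hi _
  | bin o a b iha ihb =>
    simp only [maxlit, max_lt_iff] at hl
    replace iha := iha hl.1
    replace ihb := ihb hl.2
    cases o with
    | add =>
      have h1 := Nat.pow_le_pow_right (by omega : 0 < V) (le_max_left a.deg b.deg)
      have h2 := Nat.pow_le_pow_right (by omega : 0 < V) (le_max_right a.deg b.deg)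
      have h3 : V ^ (max a.deg b.deg) * 2 ≤ V ^ (max a.deg b.deg + 1) := by
        rw [pow_succ]; exact Nat.mul_le_mul_left _ hV
      simp only [eval, BinOp.toOp, Op.eval, deg]; omega
    | sub => exact lt_of_le_of_lt (Nat.sub_le _ _) iha
    | mul => simp only [eval, BinOp.toOp, Op.eval, deg, pow_add]; exact Nat.mul_lt_mul'' iha ihb
    | div => exact lt_of_le_of_lt (Nat.div_le_self _ _) iha
    | mod => exact lt_of_le_of_lt (Nat.mod_le _ _) iha

theorem deg_le_maxdeg (e : Ex) : e.deg ≤ e.maxdeg := by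
  cases e with
  | bin o a b => simp [maxdeg]
  | lit => simp [deg, maxdeg]
  | var => simp [deg, maxdeg]
  | ld k a => simp only [deg]; exact one_le_maxdeg _
  | inp a => simp only [deg]; exact one_le_maxdeg _

end Ex

/-- `Steps` expresses that the machine gets from `c` to `c'` in `k` steps. -/
def Steps (W : ℕ) (P : Program) (inp : List ℕ) (coins : Coins W) (k : ℕ) (c c' : Config) : Prop :=
  ∀ T, run W P inp coins (k + T) c = run W P inp coins T c'

section Steps
variable {W : ℕ} {P : Program} {inp : List ℕ} {coins : Coins W}

theorem Steps.refl (c : Config) : Steps W P inp coins 0 c c := fun T => by simp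

theorem Steps.trans {k l : ℕ} {c c' c'' : Config} (h1 : Steps W P inp coins k c c')
    (h2 : Steps W P inp coins l c' c'') : Steps W P inp coins (k + l) c c'' := fun T => by
  rw [add_assoc, h1, h2]

theorem Steps.single {c c' : Config} {i : Instr} (hi : P[c.pc]? = some i) (hh : i ≠ .halt)
    (hs : i.step W inp coins c = some c') : Steps W P inp coins 1 c c' := fun T => by
  rw [add_comm]
  cases i <;> simp_all [run]

theorem Steps.write {c : Config} {i : Instr} (hi : P[c.pc]? = some i) (hh : i ≠ .halt)
    (d x : ℕ) (hs : i.step W inp coins c = c.write W d x) (hx : x < 2 ^ W) :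
    Steps W P inp coins 1 c ⟨c.pc + 1, Function.update c.mem d x, c.used⟩ :=
  Steps.single hi hh (by rw [hs, Config.write, if_pos hx])

end Steps

/-- The instructions `l` stand in the program `P` from position `k` on. -/
def CodeAt (P : Program) (k : ℕ) (l : List Instr) : Prop :=
  ∀ i < l.length, P[k + i]? = l[i]?

theorem CodeAt.left {P : Program} {k : ℕ} {l l' : List Instr} (h : CodeAt P k (l ++ l')) :
    CodeAt P k l := fun i hi => by
  rw [h i (by simp; omega), List.getElem?_append_left hi]

theorem CodeAt.right {P : Program} {k : ℕ} {l l' : List Instr} (h : CodeAt P k (l ++ l')) :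
    CodeAt P (k + l.length) l' := fun i hi => by
  rw [add_assoc, h _ (by simp; omega), List.getElem?_append_right (by omega)]
  congr 1; omega

theorem CodeAt.head {P : Program} {k : ℕ} {i : Instr} {l : List Instr} (h : CodeAt P k (i :: l)) :
    P[k]? = some i := by simpa using h 0 (by simp)

theorem CodeAt.tail {P : Program} {k : ℕ} {i : Instr} {l : List Instr} (h : CodeAt P k (i :: l)) :
    CodeAt P (k + 1) l := CodeAt.right (l := [i]) h

/-- The configuration `c` represents the state `σ`. -/
structure Rep (H : ℕ) (σ : St) (c : Config) : Prop where
  var : ∀ x, c.mem (3 * x) = σ.v x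
  arr : ∀ k < H, ∀ a, c.mem (3 * (a * H + k) + 2) = σ.h k a
  used : c.used = σ.used

/-- Cells congruent to `1` modulo `3` are scratch space that represents nothing, so the evaluation
of an expression is invisible on the level of states. -/
theorem Rep.congr {H : ℕ} {σ : St} {c c' : Config} (h : Rep H σ c)
    (hm : ∀ a, (∀ t, a ≠ 3 * t + 1) → c'.mem a = c.mem a) (hu : c'.used = c.used) : Rep H σ c' :=
  ⟨fun x => by rw [hm _ (by omega), h.var], fun k hk a => by rw [hm _ (by omega), h.arr k hk],
    by rw [hu, h.used]⟩

/-- Word size `W`, bound `V` for values, `H` arrays, and degree `D` of expressions. -/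
structure Fit (W V H D : ℕ) : Prop where
  two_le : 2 ≤ V
  arr_lt : 3 * H < V
  pow_le : V ^ D ≤ 2 ^ W

theorem Fit.lt {W V H D d x : ℕ} (h : Fit W V H D) (hx : x < V ^ d) (hd : d ≤ D) : x < 2 ^ W :=
  hx.trans_le ((Nat.pow_le_pow_right (by have := h.two_le; omega) hd).trans h.pow_le)

/-- The temporary cells act as a stack: at level `t` only levels from `t` on are touched. Hence the
value of a left operand survives at level `t` while the right operand is evaluated at level `t + 1`.
-/
theorem Ex.code_run {W V H D : ℕ} (hf : Fit W V H D) {P : Program} {inp : List ℕ}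
    {coins : Coins W} {σ : St} (hσ : σ.Bounded V) (hi : ∀ a, inp.getD a 0 < V) (e : Ex)
    (hl : e.maxlit < V) (ha : e.maxarr < H) (hd : e.maxdeg ≤ D) (t : ℕ) (c : Config)
    (hr : Rep H σ c) (hc : CodeAt P c.pc (e.code H t)) :
    ∃ c', Steps W P inp coins (e.code H t).length c c' ∧
      c'.pc = c.pc + (e.code H t).length ∧ c'.mem (3 * t + 1) = e.eval inp σ ∧
      (∀ a, (∀ t' ≥ t, a ≠ 3 * t' + 1) → c'.mem a = c.mem a) ∧ c'.used = c.used := by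
  have hlt : e.eval inp σ < 2 ^ W :=
    hf.lt (Ex.eval_lt hf.two_le hσ hi e hl) ((Ex.deg_le_maxdeg e).trans hd)
  induction e generalizing t c with
  | lit k =>
    exact ⟨_, Steps.write hc.head (by simp) _ _ rfl hlt, rfl, by simp [eval],
      fun a h => by simp [h t le_rfl], rfl⟩
  | var x =>
    refine ⟨_, Steps.write hc.head (by simp) (3 * t + 1) (σ.v x) ?_ hlt, rfl, by simp [eval],
      fun a h => by simp [h t le_rfl], rfl⟩
    simp [Instr.step, Op.eval, hr.var]
  | inp a ih =>
    simp only [maxlit, maxarr, maxdeg] at hl ha hd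
    have h1 := hf.lt (Ex.eval_lt hf.two_le hσ hi a hl) ((Ex.deg_le_maxdeg a).trans hd)
    obtain ⟨c1, s1, p1, m1, f1, u1⟩ := ih hl ha hd t c hr hc.left h1
    have hc2 := hc.right
    rw [← p1] at hc2
    have g := Steps.write (coins := coins) (inp := inp) hc2.head (by simp) (3 * t + 1)
      (inp.getD (a.eval inp σ) 0) (by simp [Instr.step, m1]) hlt
    rw [code, List.length_append]
    refine ⟨_, s1.trans g, ?_, ?_, ?_, ?_⟩
    · simp [p1]; omega
    · simp [eval]
    · intro b hb; simp [hb t le_rfl, f1 b hb]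
    · exact u1
  | bin o a b iha ihb =>
    simp only [maxlit, maxarr, maxdeg, max_lt_iff, max_le_iff] at hl ha hd
    have h1 := hf.lt (Ex.eval_lt hf.two_le hσ hi a hl.1) ((Ex.deg_le_maxdeg a).trans hd.1.1)
    have h2 := hf.lt (Ex.eval_lt hf.two_le hσ hi b hl.2) ((Ex.deg_le_maxdeg b).trans hd.1.2)
    obtain ⟨c1, s1, p1, m1, f1, u1⟩ := iha hl.1 ha.1 hd.1.1 t c hr hc.left h1
    have hc2 := hc.right
    rw [← p1] at hc2
    obtain ⟨c2, s2, p2, m2, f2, u2⟩ := ihb hl.2 ha.2 hd.1.2 (t + 1) c1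
      (hr.congr (fun x hx => f1 x fun t' _ => hx t') u1) hc2.left h2
    have hc3 := hc2.right
    rw [← p2] at hc3
    have m1' : c2.mem (3 * t + 1) = a.eval inp σ := by rw [f2 _ (by omega), m1]
    have g := Steps.write (coins := coins) (inp := inp) hc3.head (by simp) (3 * t + 1)
      (o.toOp.eval (a.eval inp σ) (b.eval inp σ)) (by simp only [Instr.step, m1', m2]) hlt
    rw [code, List.length_append, List.length_append]
    refine ⟨_, s1.trans (s2.trans g), ?_, ?_, ?_, ?_⟩
    · simp [p1, p2]; omega
    · simp [eval]
    · intro x hx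
      simp only [Function.update_of_ne (hx t le_rfl)]
      rw [f2 x fun t' ht' => hx t' (by omega), f1 x hx]
    · exact u2.trans u1
  | ld k a ih =>
    simp only [maxlit, maxarr, maxdeg, max_lt_iff, max_le_iff] at hl ha hd
    have h0 := Ex.eval_lt hf.two_le hσ hi a hl
    have h1 := hf.lt h0 ((Ex.deg_le_maxdeg a).trans hd.1)
    obtain ⟨c1, s1, p1, m1, f1, u1⟩ := ih hl ha.2 hd.1 t c hr hc.left h1
    have hc2 := hc.right
    rw [← p1] at hc2
    have hH := hf.arr_lt
    -- For an array `k < H` the address is below this product. The extra factor `3 * H < V` is why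
    -- `maxdeg` of a load contains `a.deg + 1`.
    have h2 : (a.eval inp σ + 1) * (3 * H) < 2 ^ W := by
      have : (a.eval inp σ + 1) * (3 * H) < V ^ a.deg * V :=
        Nat.mul_lt_mul_of_le_of_lt h0 hH (by have := hf.two_le; positivity)
      rw [← pow_succ] at this
      have h4 := Nat.pow_le_pow_right (by have := hf.two_le; omega : 0 < V) hd.2
      have := hf.pow_le
      omega
    rw [add_mul, one_mul] at h2
    have g1 := Steps.write (coins := coins) (inp := inp) hc2.head (by simp) _ _ rfl (by omega)
    set c2 : Config := ⟨c1.pc + 1, Function.update c1.mem (3 * (t + 1) + 1) (3 * H), c1.used⟩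
    have g2 := Steps.write (coins := coins) (inp := inp) (c := c2) hc2.tail.head (by simp)
      (3 * t + 1) (a.eval inp σ * (3 * H)) (by simp [Instr.step, Op.eval, c2, m1]) (by omega)
    set c3 : Config := ⟨c2.pc + 1, Function.update c2.mem (3 * t + 1) (a.eval inp σ * (3 * H)), c2.used⟩
    have g3 := Steps.write (coins := coins) (inp := inp) (c := c3) hc2.tail.tail.head (by simp)
      _ _ rfl (by omega)
    set c4 : Config := ⟨c3.pc + 1, Function.update c3.mem (3 * (t + 1) + 1) (3 * k + 2), c3.used⟩
    have g4 := Steps.write (coins := coins) (inp := inp) (c := c4) hc2.tail.tail.tail.head (by simp)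
      (3 * t + 1) (3 * (a.eval inp σ * H + k) + 2) (by
        simp only [Instr.step, Op.eval, c4, c3]
        simp; congr 1; ring)
      (by
        have : 3 * (a.eval inp σ * H + k) + 2 = a.eval inp σ * (3 * H) + (3 * k + 2) := by ring
        omega)
    set c5 : Config := ⟨c4.pc + 1, Function.update c4.mem (3 * t + 1)
      (3 * (a.eval inp σ * H + k) + 2), c4.used⟩
    have hm5 : ∀ x, (∀ t' ≥ t, x ≠ 3 * t' + 1) → c5.mem x = c.mem x := by
      intro x hx
      simp only [c5, c4, c3, c2, Function.update_of_ne (hx t le_rfl),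
        Function.update_of_ne (hx (t + 1) (by omega))]
      exact f1 x hx
    have g5 := Steps.write (coins := coins) (inp := inp) (c := c5) hc2.tail.tail.tail.tail.head
      (by simp) (3 * t + 1) (σ.h k (a.eval inp σ)) (by
        simp only [Instr.step]
        have : c5.mem (3 * t + 1) = 3 * (a.eval inp σ * H + k) + 2 := by simp [c5]
        rw [this, hm5 _ (by omega), hr.arr k ha.1]) hlt
    rw [code, List.length_append]
    refine ⟨_, s1.trans (g1.trans (g2.trans (g3.trans (g4.trans g5)))), ?_, ?_, ?_, ?_⟩
    · simp [c5, c4, c3, c2, p1]; omega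
    · simp [eval]
    · intro x hx
      simp only [Function.update_of_ne (hx t le_rfl)]
      exact hm5 x hx
    · exact u1


/-! ### Commands, their cost and their compilation -/

/-- Commands. `rnd x e` assigns a random word modulo `e` to `x`. -/
inductive Cmd
  | skip
  | asg (x : ℕ) (e : Ex)
  | aop (x : ℕ) (o : Op) (y z : ℕ)
  | sto (k : ℕ) (a e : Ex)
  | rnd (x : ℕ) (e : Ex)
  | seq (c d : Cmd)
  | ite (e : Ex) (c d : Cmd)
  | loop (e : Ex) (c : Cmd)

infixr:30 " ;; " => Cmd.seq

/-- Word size, bound for values, input and random words. -/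
structure Env where
  W : ℕ
  V : ℕ
  inp : List ℕ
  coins : Coins W

/-- `Exec E c σ t σ'`: the command `c` leads from `σ` to `σ'` in `t` units of time. -/
inductive Exec (E : Env) : Cmd → St → ℕ → St → Prop
  | skip (σ) : Exec E .skip σ 0 σ
  | asg (σ x e) : e.eval E.inp σ < E.V → Exec E (.asg x e) σ 1 (σ.set x (e.eval E.inp σ))
  | aop (σ x o y z) : o.eval (σ.v y) (σ.v z) < E.V →
      Exec E (.aop x o y z) σ 1 (σ.set x (o.eval (σ.v y) (σ.v z)))
  | sto (σ k a e) : e.eval E.inp σ < E.V →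
      Exec E (.sto k a e) σ 1 (σ.put k (a.eval E.inp σ) (e.eval E.inp σ))
  | rnd (σ x e) : (E.coins σ.used : ℕ) % e.eval E.inp σ < E.V →
      Exec E (.rnd x e) σ 1 (σ.draw.set x ((E.coins σ.used : ℕ) % e.eval E.inp σ))
  | seq {c d σ σ' σ'' s t} : Exec E c σ s σ' → Exec E d σ' t σ'' →
      Exec E (.seq c d) σ (s + t) σ''
  | iteT {e c d σ σ' t} : e.eval E.inp σ ≠ 0 → Exec E c σ t σ' → Exec E (.ite e c d) σ (1 + t) σ'
  | iteF {e c d σ σ' t} : e.eval E.inp σ = 0 → Exec E d σ t σ' → Exec E (.ite e c d) σ (1 + t) σ'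
  | loopF {e c σ} : e.eval E.inp σ = 0 → Exec E (.loop e c) σ 1 σ
  | loopT {e c σ σ' σ'' s t} : e.eval E.inp σ ≠ 0 → Exec E c σ s σ' →
      Exec E (.loop e c) σ' t σ'' → Exec E (.loop e c) σ (1 + s + t) σ''

namespace Cmd

/-- The machine code of a command, to be placed at position `p`. -/
def code (H : ℕ) : Cmd → ℕ → List Instr
  | skip, _ => []
  | asg x e, _ => e.code H 0 ++ [.op .lor (3 * x) 1 1]
  | aop x o y z, _ => [.op o (3 * x) (3 * y) (3 * z)]
  | sto k a e, _ => e.code H 0 ++ (a.code H 1 ++ [.const 7 (3 * H), .op .mul 4 4 7,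
      .const 7 (3 * k + 2), .op .add 4 4 7, .store 4 1])
  | rnd x e, _ => e.code H 0 ++ [.rand 4, .op .mod (3 * x) 4 1]
  | seq c d, p => c.code H p ++ d.code H (p + (c.code H p).length)
  | ite e c d, p =>
      e.code H 0 ++ (.jz 1 (p + (e.code H 0).length + 1 +
          (c.code H (p + (e.code H 0).length + 1)).length + 1) ::
        (c.code H (p + (e.code H 0).length + 1) ++
        (.jmp (p + (e.code H 0).length + 1 + (c.code H (p + (e.code H 0).length + 1)).length + 1 +
          (d.code H 0).length) ::
        d.code H (p + (e.code H 0).length + 1 +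
          (c.code H (p + (e.code H 0).length + 1)).length + 1))))
  | loop e c, p =>
      e.code H 0 ++ (.jz 1 (p + (e.code H 0).length + 1 +
          (c.code H (p + (e.code H 0).length + 1)).length + 1) ::
        (c.code H (p + (e.code H 0).length + 1) ++ [.jmp p]))

/-- The position enters the code only through jump targets. This makes the length at position `0`
usable in forward jumps over code that is placed elsewhere. -/
theorem code_length (H : ℕ) (c : Cmd) (p : ℕ) : (c.code H p).length = (c.code H 0).length := by
  induction c generalizing p with
  | seq c d ihc ihd =>
    simp only [code, List.length_append]
    rw [ihc p, ihd (p + _), ihd (0 + _)]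
  | ite e c d ihc ihd =>
    simp only [code, List.length_append, List.length_cons]
    rw [ihc (p + _ + 1), ihc (0 + _ + 1), ihd (p + _ + 1 + _ + 1), ihd (0 + _ + 1 + _ + 1)]
  | loop e c ih =>
    simp only [code, List.length_append, List.length_cons]
    rw [ih (p + _ + 1), ih (0 + _ + 1)]
  | _ => rfl

/-- The degree of all values that occur. -/
def maxdeg : Cmd → ℕ
  | skip => 0
  | asg _ e => e.maxdeg
  | aop _ _ _ _ => 1
  | sto _ a e => max (max a.maxdeg (a.deg + 1)) e.maxdeg
  | rnd _ e => e.maxdeg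
  | seq c d => max c.maxdeg d.maxdeg
  | ite e c d => max e.maxdeg (max c.maxdeg d.maxdeg)
  | loop e c => max e.maxdeg c.maxdeg

/-- The largest literal. -/
def maxlit : Cmd → ℕ
  | skip => 0
  | asg _ e => e.maxlit
  | aop _ _ _ _ => 0
  | sto _ a e => max a.maxlit e.maxlit
  | rnd _ e => e.maxlit
  | seq c d => max c.maxlit d.maxlit
  | ite e c d => max e.maxlit (max c.maxlit d.maxlit)
  | loop e c => max e.maxlit c.maxlit

/-- The largest name of an array. -/
def maxarr : Cmd → ℕ
  | skip => 0
  | asg _ e => e.maxarr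
  | aop _ _ _ _ => 0
  | sto k a e => max k (max a.maxarr e.maxarr)
  | rnd _ e => e.maxarr
  | seq c d => max c.maxarr d.maxarr
  | ite e c d => max e.maxarr (max c.maxarr d.maxarr)
  | loop e c => max e.maxarr c.maxarr

end Cmd

theorem Rep.set {H : ℕ} {σ : St} {c : Config} (hr : Rep H σ c) (p x a : ℕ) :
    Rep H (σ.set x a) ⟨p, Function.update c.mem (3 * x) a, c.used⟩ := by
  refine ⟨fun y => ?_, fun k hk b => ?_, hr.used⟩
  · simp only [St.set_v, Function.update_apply]
    simp [hr.var y]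
  · simp only [Function.update_of_ne (show 3 * (b * H + k) + 2 ≠ 3 * x by omega)]
    exact hr.arr k hk b

theorem Rep.put {H : ℕ} {σ : St} {c : Config} (hr : Rep H σ c) (p : ℕ) {k : ℕ} (hk : k < H)
    (a b : ℕ) : Rep H (σ.put k a b) ⟨p, Function.update c.mem (3 * (a * H + k) + 2) b, c.used⟩ := by
  refine ⟨fun y => ?_, fun l hl d => ?_, hr.used⟩
  · simp only [Function.update_of_ne (show 3 * y ≠ 3 * (a * H + k) + 2 by omega)]
    exact hr.var y
  · simp only [St.put_h, Function.update_apply]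
    -- The arrays are interleaved; remainder and quotient by `H` recover the array and the index.
    have : 3 * (d * H + l) + 2 = 3 * (a * H + k) + 2 ↔ l = k ∧ d = a := by
      constructor
      · intro h
        have h' : d * H + l = a * H + k := by omega
        have e1 := congrArg (· % H) h'
        have e2 := congrArg (· / H) h'
        have hH : 0 < H := by omega
        simp only [Nat.mul_add_mod', Nat.mod_eq_of_lt hl, Nat.mod_eq_of_lt hk] at e1
        rw [mul_comm d, mul_comm a] at e2
        simp only [Nat.mul_add_div hH, Nat.div_eq_of_lt hl, Nat.div_eq_of_lt hk] at e2
        omega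
      · rintro ⟨rfl, rfl⟩; rfl
    simp only [this]
    split_ifs
    · rfl
    · exact hr.arr l hl d

theorem Exec.bounded {E : Env} {c : Cmd} {σ σ' : St} {t : ℕ} (h : Exec E c σ t σ')
    (hσ : σ.Bounded E.V) : σ'.Bounded E.V := by
  induction h with
  | skip => exact hσ
  | asg _ _ _ h => exact hσ.set _ h
  | aop _ _ _ _ _ h => exact hσ.set _ h
  | sto _ _ _ _ h => exact hσ.put _ _ h
  | rnd _ _ _ h => exact St.Bounded.set ⟨hσ.1, hσ.2⟩ _ h
  | seq _ _ h1 h2 => exact h2 (h1 hσ)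
  | iteT _ _ h1 => exact h1 hσ
  | iteF _ _ h1 => exact h1 hσ
  | loopF => exact hσ
  | loopT _ _ _ h1 h2 => exact h2 (h1 hσ)

/-- Running the code of a command. -/
theorem Exec.code_run {E : Env} {H D : ℕ} (hf : Fit E.W E.V H D) {P : Program}
    (hi : ∀ a, E.inp.getD a 0 < E.V) {B : ℕ} {c : Cmd} {σ σ' : St} {t : ℕ} (hx : Exec E c σ t σ')
    (hσ : σ.Bounded E.V) (hl : c.maxlit < E.V) (ha : c.maxarr < H) (hd : c.maxdeg ≤ D)
    (hB : (c.code H 0).length ≤ B)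
    (C : Config) (hr : Rep H σ C) (hc : CodeAt P C.pc (c.code H C.pc)) :
    ∃ C' k, k ≤ t * B ∧ Steps E.W P E.inp E.coins k C C' ∧
      C'.pc = C.pc + (c.code H C.pc).length ∧ Rep H σ' C' := by
  induction hx generalizing C with
  | skip => exact ⟨C, 0, by simp, Steps.refl _, by simp [Cmd.code], hr⟩
  | asg σ x e h =>
    obtain ⟨C1, s1, p1, m1, f1, u1⟩ := Ex.code_run hf hσ hi e hl ha hd 0 C hr hc.left
    have hc2 := hc.right
    rw [← p1] at hc2
    have hD := (Ex.one_le_maxdeg e).trans hd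
    have g := Steps.write (coins := E.coins) (inp := E.inp) hc2.head (by simp) (3 * x)
      (e.eval E.inp σ) (by simp at m1; simp [Instr.step, Op.eval, m1])
      (hf.lt (d := 1) (by simpa using h) hD)
    simp only [Cmd.code, List.length_append, List.length_singleton] at hB ⊢
    refine ⟨_, _, by omega, s1.trans g, by simp [p1]; omega,
      (hr.congr (fun a h => f1 a fun t _ => h t) u1).set _ _ _⟩
  | aop σ x o y z h =>
    have g := Steps.write (coins := E.coins) (inp := E.inp) hc.head (by simp) (3 * x)
      (o.eval (σ.v y) (σ.v z)) (by simp [Instr.step, hr.var])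
      (hf.lt (d := 1) (by simpa using h) hd)
    refine ⟨_, _, by simpa [Cmd.code] using hB, g, rfl, hr.set _ _ _⟩
  | sto σ k a e h =>
    simp only [Cmd.maxlit, Cmd.maxarr, Cmd.maxdeg, max_lt_iff, max_le_iff] at hl ha hd
    obtain ⟨C1, s1, p1, m1, f1, u1⟩ := Ex.code_run hf hσ hi e hl.2 ha.2.2 hd.2 0 C hr hc.left
    have hc2 := hc.right
    rw [← p1] at hc2
    obtain ⟨C2, s2, p2, m2, f2, u2⟩ := Ex.code_run hf hσ hi a hl.1 ha.2.1 hd.1.1 1 C1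
      (hr.congr (fun x hx => f1 x fun t' _ => hx t') u1) hc2.left
    have hc3 := hc2.right
    rw [← p2] at hc3
    have m1' : C2.mem 1 = e.eval E.inp σ := by rw [f2 _ (by omega)]; simpa using m1
    simp only [mul_one] at m2
    have hr2 := (hr.congr (fun x hx => f1 x fun t' _ => hx t') u1).congr
      (fun x hx => f2 x fun t' _ => hx t') u2
    have h0 := Ex.eval_lt hf.two_le hσ hi a hl.1
    have h2 : (a.eval E.inp σ + 1) * (3 * H) < 2 ^ E.W := by
      have : (a.eval E.inp σ + 1) * (3 * H) < E.V ^ a.deg * E.V :=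
        Nat.mul_lt_mul_of_le_of_lt h0 hf.arr_lt (by have := hf.two_le; positivity)
      rw [← pow_succ] at this
      have h4 := Nat.pow_le_pow_right (by have := hf.two_le; omega : 0 < E.V) hd.1.2
      have := hf.pow_le
      omega
    rw [add_mul, one_mul] at h2
    have hve : e.eval E.inp σ < 2 ^ E.W := hf.lt (d := 1) (by simpa using h)
      ((Ex.one_le_maxdeg e).trans hd.2)
    have g1 := Steps.write (coins := E.coins) (inp := E.inp) hc3.head (by simp) _ _ rfl (by omega)
    set C3 : Config := ⟨C2.pc + 1, Function.update C2.mem 7 (3 * H), C2.used⟩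
    have g2 := Steps.write (coins := E.coins) (inp := E.inp) (c := C3) hc3.tail.head (by simp)
      4 (a.eval E.inp σ * (3 * H)) (by simp [Instr.step, Op.eval, C3, m2]) (by omega)
    set C4 : Config := ⟨C3.pc + 1, Function.update C3.mem 4 (a.eval E.inp σ * (3 * H)), C3.used⟩
    have g3 := Steps.write (coins := E.coins) (inp := E.inp) (c := C4) hc3.tail.tail.head (by simp)
      _ _ rfl (by omega)
    set C5 : Config := ⟨C4.pc + 1, Function.update C4.mem 7 (3 * k + 2), C4.used⟩
    have g4 := Steps.write (coins := E.coins) (inp := E.inp) (c := C5) hc3.tail.tail.tail.head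
      (by simp) 4 (3 * (a.eval E.inp σ * H + k) + 2) (by
        simp only [Instr.step, Op.eval, C5, C4]
        simp; congr 1; ring)
      (by
        have : 3 * (a.eval E.inp σ * H + k) + 2 = a.eval E.inp σ * (3 * H) + (3 * k + 2) := by ring
        omega)
    set C6 : Config := ⟨C5.pc + 1, Function.update C5.mem 4
      (3 * (a.eval E.inp σ * H + k) + 2), C5.used⟩
    have hr6 : Rep H σ C6 := by
      refine hr2.congr (fun x hx => ?_) rfl
      simp only [C6, C5, C4, C3, Function.update_of_ne (hx 1), Function.update_of_ne (hx 2)]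
    have g5 := Steps.write (coins := E.coins) (inp := E.inp) (c := C6)
      hc3.tail.tail.tail.tail.head (by simp) (3 * (a.eval E.inp σ * H + k) + 2) (e.eval E.inp σ)
      (by simp [Instr.step, C6, C5, C4, C3, m1']) hve
    simp only [Cmd.code, List.length_append] at hB ⊢
    refine ⟨_, _, ?_, s1.trans (s2.trans (g1.trans (g2.trans (g3.trans (g4.trans g5))))), ?_, hr6.put _ ha.1 _ _⟩
    · simp at hB; omega
    · simp [C6, C5, C4, C3, p1, p2]; omega
  | rnd σ x e h =>
    obtain ⟨C1, s1, p1, m1, f1, u1⟩ := Ex.code_run hf hσ hi e hl ha hd 0 C hr hc.left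
    have hc2 := hc.right
    rw [← p1] at hc2
    have hD := (Ex.one_le_maxdeg e).trans hd
    simp only [mul_zero, zero_add] at m1
    have hu : C1.used = σ.used := u1.trans hr.used
    have g1 : Steps E.W P E.inp E.coins 1 C1
        ⟨C1.pc + 1, Function.update C1.mem 4 (E.coins σ.used), C1.used + 1⟩ := by
      refine Steps.single hc2.head (by simp) ?_
      simp only [Instr.step, Config.write]
      rw [if_pos (E.coins C1.used).2, hu]
    have g2 := Steps.write (coins := E.coins) (inp := E.inp)
      (c := ⟨C1.pc + 1, Function.update C1.mem 4 (E.coins σ.used), C1.used + 1⟩)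
      hc2.tail.head (by simp) (3 * x) ((E.coins σ.used : ℕ) % e.eval E.inp σ)
      (by simp [Instr.step, Op.eval, m1]) (hf.lt (d := 1) (by simpa using h) hD)
    simp only [Cmd.code, List.length_append] at hB ⊢
    simp at hB
    refine ⟨_, _, by omega, s1.trans (g1.trans g2), by simp [p1]; omega,
      Rep.set (c := ⟨C1.pc + 1, Function.update C1.mem 4 (E.coins σ.used), C1.used + 1⟩) ?_ _ _ _⟩
    have hr1 := hr.congr (c' := ⟨C1.pc + 1, Function.update C1.mem 4 (E.coins σ.used), C1.used⟩)
      (fun a h => by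
        simp only [Function.update_of_ne (h 1)]
        exact f1 a fun t _ => h t) u1
    exact ⟨hr1.var, hr1.arr, by simp [hu]⟩
  | @seq c d σ σ' σ'' s t hc1 hd1 ihc ihd =>
    simp only [Cmd.maxlit, Cmd.maxarr, Cmd.maxdeg, max_lt_iff, max_le_iff] at hl ha hd
    simp only [Cmd.code, List.length_append, zero_add] at hB
    rw [Cmd.code_length H d] at hB
    obtain ⟨C1, k1, b1, s1, p1, r1⟩ := ihc hσ hl.1 ha.1 hd.1 (by omega) C hr hc.left
    have hc2 := hc.right
    rw [← p1] at hc2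
    obtain ⟨C2, k2, b2, s2, p2, r2⟩ := ihd (hc1.bounded hσ) hl.2 ha.2 hd.2 (by omega) C1 r1 hc2
    refine ⟨C2, k1 + k2, by rw [add_mul]; omega, s1.trans s2, ?_, r2⟩
    rw [p2, p1, Cmd.code, List.length_append]; omega
  | @iteT e c d σ σ' t he hc1 ih =>
    simp only [Cmd.maxlit, Cmd.maxarr, Cmd.maxdeg, max_lt_iff, max_le_iff] at hl ha hd
    simp only [Cmd.code, List.length_append, List.length_cons] at hB
    rw [Cmd.code_length H c, Cmd.code_length H d] at hB
    obtain ⟨C1, s1, p1, m1, f1, u1⟩ := Ex.code_run hf hσ hi e hl.1 ha.1 hd.1 0 C hr hc.left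
    have hc2 := hc.right
    rw [← p1] at hc2
    simp only [mul_zero, zero_add] at m1
    have g1 : Steps E.W P E.inp E.coins 1 C1 ⟨C1.pc + 1, C1.mem, C1.used⟩ := by
      refine Steps.single hc2.head (by simp) ?_
      simp [Instr.step, m1, he]
    have hc3 := hc2.tail
    obtain ⟨C2, k2, b2, s2, p2, r2⟩ := ih hσ hl.2.1 ha.2.1 hd.2.1 (by omega)
      ⟨C1.pc + 1, C1.mem, C1.used⟩ (hr.congr (fun a h => f1 a fun t _ => h t) u1) hc3.left
    have hc4 := hc3.right
    simp only at p2
    rw [← p2] at hc4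
    have g3 := Steps.single (inp := E.inp) (coins := E.coins) hc4.head (by simp) rfl
    refine ⟨_, _, ?_, s1.trans (g1.trans (s2.trans g3)), ?_, ⟨r2.var, r2.arr, r2.used⟩⟩
    · rw [add_mul]; omega
    · simp only [Cmd.code, List.length_append, List.length_cons]
      rw [p2, p1, Cmd.code_length H d (_ + 1)]
      omega
  | @iteF e c d σ σ' t he hc1 ih =>
    simp only [Cmd.maxlit, Cmd.maxarr, Cmd.maxdeg, max_lt_iff, max_le_iff] at hl ha hd
    simp only [Cmd.code, List.length_append, List.length_cons] at hB
    rw [Cmd.code_length H c, Cmd.code_length H d] at hB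
    obtain ⟨C1, s1, p1, m1, f1, u1⟩ := Ex.code_run hf hσ hi e hl.1 ha.1 hd.1 0 C hr hc.left
    have hc2 := hc.right
    rw [← p1] at hc2
    simp only [mul_zero, zero_add] at m1
    have g1 := Steps.single (inp := E.inp) (coins := E.coins) hc2.head (by simp)
      (by simp only [Instr.step, m1, he, if_pos]; rfl)
    have hc4 := hc2.tail.right.tail
    obtain ⟨C2, k2, b2, s2, p2, r2⟩ := ih hσ hl.2.2 ha.2.2 hd.2.2 (by omega)
      ⟨C1.pc + 1 + (Cmd.code H c (C1.pc + 1)).length + 1, C1.mem, C1.used⟩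
      (hr.congr (fun a h => f1 a fun t _ => h t) u1) hc4
    refine ⟨_, _, ?_, s1.trans (g1.trans s2), ?_, r2⟩
    · rw [add_mul]; omega
    · rw [p2]
      simp only [Cmd.code, List.length_append, List.length_cons, p1]
      omega
  | @loopF e c σ he =>
    simp only [Cmd.maxlit, Cmd.maxarr, Cmd.maxdeg, max_lt_iff, max_le_iff] at hl ha hd
    simp only [Cmd.code, List.length_append, List.length_cons] at hB
    obtain ⟨C1, s1, p1, m1, f1, u1⟩ := Ex.code_run hf hσ hi e hl.1 ha.1 hd.1 0 C hr hc.left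
    have hc2 := hc.right
    rw [← p1] at hc2
    simp only [mul_zero, zero_add] at m1
    have g1 := Steps.single (inp := E.inp) (coins := E.coins) hc2.head (by simp)
      (by simp only [Instr.step, m1, he, if_pos]; rfl)
    simp only [zero_add, one_mul, Cmd.code_length H c (_ + 1)] at hB
    refine ⟨_, _, by omega, s1.trans g1, ?_, Rep.congr hr (fun a h => f1 a fun t _ => h t) u1⟩
    simp only [Cmd.code, List.length_append, List.length_cons, List.length_nil, p1]
    omega
  | @loopT e c σ σ' σ'' s t he hc1 hc' ih ih' =>
    have hl0 := hl
    have ha0 := ha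
    have hd0 := hd
    have hB0 := hB
    simp only [Cmd.maxlit, Cmd.maxarr, Cmd.maxdeg, max_lt_iff, max_le_iff] at hl ha hd
    simp only [Cmd.code, List.length_append, List.length_cons] at hB
    rw [Cmd.code_length H c] at hB
    obtain ⟨C1, s1, p1, m1, f1, u1⟩ := Ex.code_run hf hσ hi e hl.1 ha.1 hd.1 0 C hr hc.left
    have hc2 := hc.right
    rw [← p1] at hc2
    simp only [mul_zero, zero_add] at m1
    have g1 : Steps E.W P E.inp E.coins 1 C1 ⟨C1.pc + 1, C1.mem, C1.used⟩ := by
      refine Steps.single hc2.head (by simp) ?_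
      simp [Instr.step, m1, he]
    have hc3 := hc2.tail
    obtain ⟨C2, k2, b2, s2, p2, r2⟩ := ih hσ hl.2 ha.2 hd.2 (by omega)
      ⟨C1.pc + 1, C1.mem, C1.used⟩ (hr.congr (fun a h => f1 a fun t _ => h t) u1) hc3.left
    have hc4 := hc3.right
    simp only at p2
    rw [← p2] at hc4
    have g3 := Steps.single (inp := E.inp) (coins := E.coins) hc4.head (by simp) rfl
    obtain ⟨C3, k3, b3, s3, p3, r3⟩ := ih' (hc1.bounded hσ) hl0 ha0 hd0 hB0
      ⟨C.pc, C2.mem, C2.used⟩ ⟨r2.var, r2.arr, r2.used⟩ hc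
    -- The test, the conditional jump and the jump back are part of the code of the loop, so
    -- together they cost at most `B` steps; the `1` in `1 + s + t` pays for them.
    refine ⟨_, _, ?_, s1.trans (g1.trans (s2.trans (g3.trans s3))), p3, r3⟩
    simp only [add_mul]; omega


/-! ### Frame conditions -/

/-- The command does not assign to the variable `x`. -/
def Cmd.NoV (x : ℕ) : Cmd → Prop
  | .skip => True
  | .asg y _ => x ≠ y
  | .aop y _ _ _ => x ≠ y
  | .sto _ _ _ => True
  | .rnd y _ => x ≠ y
  | .seq c d => c.NoV x ∧ d.NoV x
  | .ite _ c d => c.NoV x ∧ d.NoV x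
  | .loop _ c => c.NoV x

/-- The command does not change the array `k`. -/
def Cmd.NoA (k : ℕ) : Cmd → Prop
  | .skip => True
  | .asg _ _ => True
  | .aop _ _ _ _ => True
  | .sto l _ _ => k ≠ l
  | .rnd _ _ => True
  | .seq c d => c.NoA k ∧ d.NoA k
  | .ite _ c d => c.NoA k ∧ d.NoA k
  | .loop _ c => c.NoA k

/-- The command does not use random words. -/
def Cmd.NoR : Cmd → Prop
  | .rnd _ _ => False
  | .seq c d => c.NoR ∧ d.NoR
  | .ite _ c d => c.NoR ∧ d.NoR
  | .loop _ c => c.NoR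
  | _ => True

section simp
variable (x y z k : ℕ) (e a : Ex) (o : Op) (c d : Cmd)
@[simp] theorem Cmd.noV_skip : Cmd.skip.NoV x := trivial
@[simp] theorem Cmd.noV_asg : (Cmd.asg y e).NoV x ↔ x ≠ y := Iff.rfl
@[simp] theorem Cmd.noV_aop {w : ℕ} : (Cmd.aop y o z w).NoV x ↔ x ≠ y := Iff.rfl
@[simp] theorem Cmd.noV_sto : (Cmd.sto k a e).NoV x := trivial
@[simp] theorem Cmd.noV_rnd : (Cmd.rnd y e).NoV x ↔ x ≠ y := Iff.rfl
@[simp] theorem Cmd.noV_seq : (c ;; d).NoV x ↔ c.NoV x ∧ d.NoV x := Iff.rfl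
@[simp] theorem Cmd.noV_ite : (Cmd.ite e c d).NoV x ↔ c.NoV x ∧ d.NoV x := Iff.rfl
@[simp] theorem Cmd.noV_loop : (Cmd.loop e c).NoV x ↔ c.NoV x := Iff.rfl
@[simp] theorem Cmd.noA_skip : Cmd.skip.NoA x := trivial
@[simp] theorem Cmd.noA_asg : (Cmd.asg y e).NoA x := trivial
@[simp] theorem Cmd.noA_aop {w : ℕ} : (Cmd.aop y o z w).NoA x := trivial
@[simp] theorem Cmd.noA_sto : (Cmd.sto k a e).NoA x ↔ x ≠ k := Iff.rfl
@[simp] theorem Cmd.noA_rnd : (Cmd.rnd y e).NoA x := trivial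
@[simp] theorem Cmd.noA_seq : (c ;; d).NoA x ↔ c.NoA x ∧ d.NoA x := Iff.rfl
@[simp] theorem Cmd.noA_ite : (Cmd.ite e c d).NoA x ↔ c.NoA x ∧ d.NoA x := Iff.rfl
@[simp] theorem Cmd.noA_loop : (Cmd.loop e c).NoA x ↔ c.NoA x := Iff.rfl
@[simp] theorem Cmd.noR_skip : Cmd.skip.NoR := trivial
@[simp] theorem Cmd.noR_asg : (Cmd.asg y e).NoR := trivial
@[simp] theorem Cmd.noR_aop {w : ℕ} : (Cmd.aop y o z w).NoR := trivial
@[simp] theorem Cmd.noR_sto : (Cmd.sto k a e).NoR := trivial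
@[simp] theorem Cmd.noR_rnd : ¬(Cmd.rnd y e).NoR := id
@[simp] theorem Cmd.noR_seq : (c ;; d).NoR ↔ c.NoR ∧ d.NoR := Iff.rfl
@[simp] theorem Cmd.noR_ite : (Cmd.ite e c d).NoR ↔ c.NoR ∧ d.NoR := Iff.rfl
@[simp] theorem Cmd.noR_loop : (Cmd.loop e c).NoR ↔ c.NoR := Iff.rfl
end simp

/-- The states `σ` and `σ'` agree on everything that the command `c` does not change. -/
structure Fr (c : Cmd) (σ σ' : St) : Prop where
  v : ∀ x, c.NoV x → σ'.v x = σ.v x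
  h : ∀ k, c.NoA k → σ'.h k = σ.h k
  used : c.NoR → σ'.used = σ.used

theorem Fr.refl (c : Cmd) (σ : St) : Fr c σ σ := ⟨fun _ _ => rfl, fun _ _ => rfl, fun _ => rfl⟩

theorem Fr.trans {c : Cmd} {σ σ' σ'' : St} (h : Fr c σ σ') (h' : Fr c σ' σ'') : Fr c σ σ'' :=
  ⟨fun x hx => (h'.v x hx).trans (h.v x hx), fun x hx => (h'.h x hx).trans (h.h x hx),
    fun hx => (h'.used hx).trans (h.used hx)⟩

theorem Fr.weaken {c d : Cmd} {σ σ' : St} (h : Fr c σ σ') (hv : ∀ x, d.NoV x → c.NoV x)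
    (hh : ∀ x, d.NoA x → c.NoA x) (hu : d.NoR → c.NoR) : Fr d σ σ' :=
  ⟨fun x hx => h.v x (hv x hx), fun x hx => h.h x (hh x hx), fun hx => h.used (hu hx)⟩

/-- The frame rule. It is syntactic, so `simp` decides what a command preserves, and specifications
need to mention only what changes. -/
theorem Exec.fr {E : Env} {c : Cmd} {σ σ' : St} {t : ℕ} (h : Exec E c σ t σ') : Fr c σ σ' := by
  induction h with
  | skip => exact Fr.refl _ _
  | asg => exact ⟨fun x hx => by simp_all, fun _ _ => rfl, fun _ => rfl⟩
  | aop => exact ⟨fun x hx => by simp_all, fun _ _ => rfl, fun _ => rfl⟩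
  | sto => exact ⟨fun x hx => rfl, fun _ hx => by simp_all, fun _ => rfl⟩
  | rnd => exact ⟨fun x hx => by simp_all, fun _ _ => rfl, fun h => h.elim⟩
  | seq _ _ h1 h2 =>
    exact (h1.weaken (d := _ ;; _) (fun _ h => h.1) (fun _ h => h.1) fun h => h.1).trans
      (h2.weaken (fun _ h => h.2) (fun _ h => h.2) fun h => h.2)
  | iteT _ _ h1 => exact h1.weaken (fun _ h => h.1) (fun _ h => h.1) fun h => h.1
  | iteF _ _ h1 => exact h1.weaken (fun _ h => h.2) (fun _ h => h.2) fun h => h.2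
  | loopF => exact Fr.refl _ _
  | loopT _ _ _ h1 h2 => exact (h1.weaken (d := .loop _ _) (fun _ h => h) (fun _ h => h) fun h => h).trans h2

/-! ### A program logic with time bounds -/

/-- The command `c`, started in `σ`, stops after at most `t` units of time in a state with the
property `Q`. -/
def Runs (E : Env) (c : Cmd) (σ : St) (t : ℕ) (Q : St → Prop) : Prop :=
  ∃ s ≤ t, ∃ σ', Exec E c σ s σ' ∧ Q σ'

namespace Runs
variable {E : Env} {c d : Cmd} {σ : St} {s t : ℕ} {Q R : St → Prop} {e a : Ex} {x k : ℕ}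

/-- The rule of consequence. The frame of the command is handed to the new postcondition at no cost.
-/
theorem mono (h : Runs E c σ s R) (hst : s ≤ t) (hQ : ∀ σ', R σ' → Fr c σ σ' → Q σ') :
    Runs E c σ t Q := by
  obtain ⟨r, hr, σ', hx, hq⟩ := h
  exact ⟨r, hr.trans hst, σ', hx, hQ _ hq hx.fr⟩

theorem time (h : Runs E c σ s Q) (hst : s ≤ t) : Runs E c σ t Q := h.mono hst fun _ h _ => h

theorem skip (h : Q σ) : Runs E .skip σ 0 Q := ⟨0, le_rfl, σ, .skip σ, h⟩

theorem asg (h1 : e.eval E.inp σ < E.V) (h2 : Q (σ.set x (e.eval E.inp σ))) :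
    Runs E (.asg x e) σ 1 Q := ⟨1, le_rfl, _, .asg _ _ _ h1, h2⟩

theorem aop {o : Op} {y z : ℕ} (h1 : o.eval (σ.v y) (σ.v z) < E.V)
    (h2 : Q (σ.set x (o.eval (σ.v y) (σ.v z)))) : Runs E (.aop x o y z) σ 1 Q :=
  ⟨1, le_rfl, _, .aop _ _ _ _ _ h1, h2⟩

theorem sto (h1 : e.eval E.inp σ < E.V) (h2 : Q (σ.put k (a.eval E.inp σ) (e.eval E.inp σ))) :
    Runs E (.sto k a e) σ 1 Q := ⟨1, le_rfl, _, .sto _ _ _ _ h1, h2⟩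

theorem rnd (h1 : (E.coins σ.used : ℕ) % e.eval E.inp σ < E.V)
    (h2 : Q (σ.draw.set x ((E.coins σ.used : ℕ) % e.eval E.inp σ))) :
    Runs E (.rnd x e) σ 1 Q := ⟨1, le_rfl, _, .rnd _ _ _ h1, h2⟩

theorem seq (h1 : Runs E c σ s R) (h2 : ∀ σ', R σ' → Fr c σ σ' → Runs E d σ' t Q) :
    Runs E (c ;; d) σ (s + t) Q := by
  obtain ⟨r, hr, σ', hx, hq⟩ := h1
  obtain ⟨r', hr', σ'', hx', hq'⟩ := h2 σ' hq hx.fr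
  exact ⟨r + r', by omega, σ'', .seq hx hx', hq'⟩

theorem asg_seq (h1 : e.eval E.inp σ < E.V) (h2 : Runs E d (σ.set x (e.eval E.inp σ)) t Q) :
    Runs E (.asg x e ;; d) σ (t + 1) Q := by
  obtain ⟨r', hr', σ'', hx', hq'⟩ := h2
  exact ⟨1 + r', by omega, σ'', .seq (.asg _ _ _ h1) hx', hq'⟩

theorem sto_seq (h1 : e.eval E.inp σ < E.V)
    (h2 : Runs E d (σ.put k (a.eval E.inp σ) (e.eval E.inp σ)) t Q) :
    Runs E (.sto k a e ;; d) σ (t + 1) Q := by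
  obtain ⟨r', hr', σ'', hx', hq'⟩ := h2
  exact ⟨1 + r', by omega, σ'', .seq (.sto _ _ _ _ h1) hx', hq'⟩

theorem ite (h1 : e.eval E.inp σ ≠ 0 → Runs E c σ t Q) (h2 : e.eval E.inp σ = 0 → Runs E d σ t Q) :
    Runs E (.ite e c d) σ (t + 1) Q := by
  by_cases h : e.eval E.inp σ = 0
  · obtain ⟨r', hr', σ'', hx', hq'⟩ := h2 h
    exact ⟨1 + r', by omega, σ'', .iteF h hx', hq'⟩
  · obtain ⟨r', hr', σ'', hx', hq'⟩ := h1 h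
    exact ⟨1 + r', by omega, σ'', .iteT h hx', hq'⟩

theorem loop_end (h : e.eval E.inp σ = 0) (hq : Q σ) : Runs E (.loop e c) σ 1 Q :=
  ⟨1, le_rfl, σ, .loopF h, hq⟩

theorem loop_step (h : e.eval E.inp σ ≠ 0)
    (h1 : Runs E c σ s fun σ' => Runs E (.loop e c) σ' t Q) :
    Runs E (.loop e c) σ (t + s + 1) Q := by
  obtain ⟨r, hr, σ', hx, r', hr', σ'', hx', hq'⟩ := h1
  exact ⟨1 + r + r', by omega, σ'', .loopT h hx hx', hq'⟩

end Runs

/-- `for i < e do c`. -/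
def Cmd.forC (i : ℕ) (e : Ex) (c : Cmd) : Cmd :=
  .asg i 0 ;; .loop (e - .var i) (c ;; .asg i (.var i + 1))

@[simp] theorem Cmd.noV_forC (x i : ℕ) (e : Ex) (c : Cmd) :
    (Cmd.forC i e c).NoV x ↔ x ≠ i ∧ c.NoV x := by
  simp [Cmd.forC]; tauto
@[simp] theorem Cmd.noA_forC (x i : ℕ) (e : Ex) (c : Cmd) :
    (Cmd.forC i e c).NoA x ↔ c.NoA x := by simp [Cmd.forC]
@[simp] theorem Cmd.noR_forC (i : ℕ) (e : Ex) (c : Cmd) :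
    (Cmd.forC i e c).NoR ↔ c.NoR := by simp [Cmd.forC]

/-- The bound `e` is evaluated anew before each pass, hence the hypothesis that it keeps its value
under the invariant. A pass costs the body, one test and one increment; the initialization and the
last test give the final `2`. -/
theorem Runs.forC {E : Env} {i : ℕ} {e : Ex} {c : Cmd} {σ : St} {N t : ℕ} {Q : St → Prop}
    (I : ℕ → St → Prop) (hN : N < E.V) (hi : c.NoV i)
    (he : ∀ σ' k, k ≤ N → I k σ' → σ'.v i = k → Fr (.forC i e c) σ σ' → e.eval E.inp σ' = N)
    (h0 : I 0 (σ.set i 0))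
    (hs : ∀ σ' k, k < N → I k σ' → σ'.v i = k → Fr (.forC i e c) σ σ' →
      Runs E c σ' t fun σ'' => I (k + 1) (σ''.set i (k + 1)))
    (hQ : ∀ σ', I N σ' → σ'.v i = N → Fr (.forC i e c) σ σ' → Q σ') :
    Runs E (.forC i e c) σ (N * (t + 2) + 2) Q := by
  have key : ∀ m k σ', k + m = N → I k σ' → σ'.v i = k → Fr (.forC i e c) σ σ' →
      Runs E (.loop (e - .var i) (c ;; .asg i (.var i + 1))) σ' (m * (t + 2) + 1) Q := by
    intro m
    induction m with
    | zero =>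
      intro k σ' hk hI hv hf
      obtain rfl : k = N := by omega
      rw [zero_mul, zero_add]
      refine Runs.loop_end ?_ (hQ _ hI hv hf)
      simp [he σ' k le_rfl hI hv hf, hv]
    | succ m ih =>
      intro k σ' hk hI hv hf
      have h1 := hs σ' k (by omega) hI hv hf
      refine (Runs.loop_step (s := t + 1) (t := m * (t + 2) + 1) ?_ ?_).time ?_
      · simp only [Ex.eval_sub, he σ' k (by omega) hI hv hf, Ex.eval_var, hv]; omega
      · refine Runs.seq h1 fun σ'' hI' hf' => ?_
        have hv' : σ''.v i = k := by rw [hf'.v i hi, hv]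
        refine Runs.asg ?_ ?_
        · simp [hv']; omega
        · simp only [Ex.eval_add, Ex.eval_var, hv', Ex.eval_ofNat]
          refine ih (k + 1) _ (by omega) hI' (by simp) (hf.trans ?_)
          refine ⟨fun x hx => ?_, fun x hx => ?_, fun hx => ?_⟩
          · simp only [Cmd.noV_forC] at hx
            rw [St.set_v, if_neg hx.1, hf'.v x hx.2]
          · exact hf'.h x (by simpa using hx)
          · exact hf'.used (by simpa using hx)
      · rw [add_mul]; omega
  refine Runs.time (Runs.asg_seq (by simpa using Nat.pos_of_ne_zero (by omega))
    (key N 0 _ (by omega) (by simpa using h0) (by simp)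
      ⟨fun x hx => ?_, fun x hx => rfl, fun hx => rfl⟩)) (by omega)
  simp only [Cmd.noV_forC] at hx
  simp [hx.1]

/-- Fill the array `k`: for all `i < n₁`, `j < n₂` put `val` into the cell `addr`. -/
def Cmd.fill (i j : ℕ) (n₁ n₂ : Ex) (k : ℕ) (addr val : Ex) : Cmd :=
  .forC i n₁ (.forC j n₂ (.sto k addr val))

@[simp] theorem Cmd.noV_fill (x i j k : ℕ) (n₁ n₂ a v : Ex) :
    (Cmd.fill i j n₁ n₂ k a v).NoV x ↔ x ≠ i ∧ x ≠ j := by simp [Cmd.fill]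
@[simp] theorem Cmd.noA_fill (x i j k : ℕ) (n₁ n₂ a v : Ex) :
    (Cmd.fill i j n₁ n₂ k a v).NoA x ↔ x ≠ k := by simp [Cmd.fill]
@[simp] theorem Cmd.noR_fill (i j k : ℕ) (n₁ n₂ a v : Ex) :
    (Cmd.fill i j n₁ n₂ k a v).NoR := by simp [Cmd.fill]

/-- The value may depend on the old content of the very cell that is written, because injectivity of
the addresses keeps it intact until then. This permits in-place operations. -/
theorem Runs.fill {E : Env} {i j k : ℕ} {n₁ n₂ addr val : Ex} {σ : St} {N₁ N₂ : ℕ}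
    (ad f : ℕ → ℕ → ℕ) (hij : i ≠ j) (h₁ : N₁ < E.V) (h₂ : N₂ < E.V)
    (e₁ : ∀ σ', Fr (.fill i j n₁ n₂ k addr val) σ σ' → n₁.eval E.inp σ' = N₁)
    (e₂ : ∀ σ', Fr (.fill i j n₁ n₂ k addr val) σ σ' → n₂.eval E.inp σ' = N₂)
    (hv : ∀ σ' a b, a < N₁ → b < N₂ → Fr (.fill i j n₁ n₂ k addr val) σ σ' → σ'.v i = a →
      σ'.v j = b → σ'.h k (ad a b) = σ.h k (ad a b) →
      addr.eval E.inp σ' = ad a b ∧ val.eval E.inp σ' = f a b ∧ f a b < E.V)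
    (inj : ∀ a b a' b', a < N₁ → b < N₂ → a' < N₁ → b' < N₂ → ad a b = ad a' b' → a = a' ∧ b = b') :
    Runs E (.fill i j n₁ n₂ k addr val) σ (N₁ * (N₂ * 3 + 4) + 2) fun σ' =>
      (∀ a b, a < N₁ → b < N₂ → σ'.h k (ad a b) = f a b) ∧
      ∀ c, (∀ a b, a < N₁ → b < N₂ → c ≠ ad a b) → σ'.h k c = σ.h k c := by
  let I : ℕ → ℕ → St → Prop := fun l m σ' =>
    (∀ a b, a < N₁ → b < N₂ → (a < l ∨ a = l ∧ b < m) → σ'.h k (ad a b) = f a b) ∧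
      ∀ c, (∀ a b, a < N₁ → b < N₂ → (a < l ∨ a = l ∧ b < m) → c ≠ ad a b) → σ'.h k c = σ.h k c
  refine Runs.forC (fun l => I l 0) h₁ (by simp [hij]) (fun σ' _ _ _ _ h => e₁ σ' h) ?_ ?_ ?_
  · exact ⟨fun a b _ _ h => by omega, fun c _ => rfl⟩
  · intro σ₁ l hl hI hvi hf₁
    refine (Runs.forC (t := 1) (fun m => I l m) h₂ (by simp) (fun σ' _ _ _ _ h => e₂ σ' ?_)
      hI ?_ ?_).time (by omega)
    · exact hf₁.trans (h.weaken (by simp) (by simp) (by simp))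
    · intro σ₂ m hm hI₂ hvj hf₂
      have hf : Fr (.fill i j n₁ n₂ k addr val) σ σ₂ :=
        hf₁.trans (hf₂.weaken (by simp) (by simp) (by simp))
      have hvi₂ : σ₂.v i = l := by rw [hf₂.v i (by simp [hij]), hvi]
      have hold : σ₂.h k (ad l m) = σ.h k (ad l m) := by
        refine hI₂.2 _ fun a b ha hb hab h => ?_
        obtain ⟨rfl, rfl⟩ := inj _ _ _ _ hl hm ha hb h
        omega
      obtain ⟨h1, h2, h3⟩ := hv σ₂ l m hl hm hf hvi₂ hvj hold
      refine Runs.sto (by rw [h2]; exact h3) ?_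
      rw [h1, h2]
      refine ⟨fun a b ha hb hab => ?_, fun c hc => ?_⟩
      · simp only [St.set_h, St.put_h_same]
        split_ifs with h
        · obtain ⟨rfl, rfl⟩ := inj _ _ _ _ ha hb hl hm h; rfl
        · refine hI₂.1 a b ha hb ?_
          rcases hab with hab | ⟨rfl, hab⟩
          · exact Or.inl hab
          · refine Or.inr ⟨rfl, ?_⟩
            rcases Nat.lt_succ_iff_lt_or_eq.mp hab with h' | rfl
            · exact h'
            · exact absurd rfl h
      · simp only [St.set_h, St.put_h_same]
        rw [if_neg (hc l m hl hm (by omega))]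
        exact hI₂.2 c fun a b ha hb hab => hc a b ha hb (by omega)
    · intro σ₂ hI₂ _ _
      refine ⟨fun a b ha hb hab => hI₂.1 a b ha hb (by omega),
        fun c hc => hI₂.2 c fun a b ha hb hab => hc a b ha hb (by omega)⟩
  · intro σ₁ hI _ _
    exact ⟨fun a b ha hb => hI.1 a b ha hb (by omega),
      fun c hc => hI.2 c fun a b ha hb _ => hc a b ha hb⟩


/-! ### From commands to machine programs -/

/-- The program that executes a command. -/
def Cmd.prog (H : ℕ) (c : Cmd) : Program := c.code H 0 ++ [.halt]

/-- Truncation of the memory, on the level of states. -/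
def St.keep (H s : ℕ) (σ : St) : St :=
  ⟨fun x => if 3 * x < s then σ.v x else 0,
    fun k a => if 3 * (a * H + k) + 2 < s then σ.h k a else 0, σ.used⟩

theorem Rep.keep {H : ℕ} {σ : St} {c : Config} (h : Rep H σ c) (s : ℕ) :
    Rep H (σ.keep H s) (c.keep s) :=
  ⟨fun x => by simp [St.keep, Config.keep, h.var], fun k hk a => by
    simp [St.keep, Config.keep, h.arr k hk], h.used⟩

theorem St.Bounded.keep {V : ℕ} {σ : St} (h : σ.Bounded V) (H s : ℕ) : (σ.keep H s).Bounded V := by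
  refine ⟨fun x => ?_, fun k a => ?_⟩
  · have := h.1 x
    simp only [St.keep]; split_ifs <;> omega
  · have := h.2 k a
    simp only [St.keep]; split_ifs <;> omega

/-- The state in which all variables and cells are zero. -/
def St.zero : St := ⟨fun _ => 0, fun _ _ => 0, 0⟩

theorem rep_zero (H : ℕ) : Rep H St.zero Config.initial :=
  ⟨fun _ => rfl, fun _ _ _ => rfl, rfl⟩

/-- The bridge to the machine: `B` machine steps for each unit of time, and one more unit in the
budget for the final `halt`. -/
theorem run_prog {E : Env} {H D B : ℕ} (hf : Fit E.W E.V H D)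
    (hi : ∀ a, E.inp.getD a 0 < E.V) {c : Cmd} {σ : St} {t : ℕ} {Q : St → Prop}
    (hx : Runs E c σ t Q) (hσ : σ.Bounded E.V) (hl : c.maxlit < E.V) (ha : c.maxarr < H)
    (hd : c.maxdeg ≤ D) (hB : (c.code H 0).length < B) (C : Config) (hr : Rep H σ C)
    (hp : C.pc = 0) {T : ℕ} (hT : (t + 1) * B ≤ T) :
    ∃ C', run E.W (c.prog H) E.inp E.coins T C = some C' ∧
      ∃ σ', Rep H σ' C' ∧ σ'.Bounded E.V ∧ Q σ' ∧ Fr c σ σ' := by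
  obtain ⟨s, hs, σ', hex, hq⟩ := hx
  obtain ⟨C', k, hk, hst, hpc, hr'⟩ := hex.code_run hf (P := c.prog H) hi hσ hl ha hd hB.le C hr (by
    rw [hp]
    intro i hi
    rw [zero_add, Cmd.prog, List.getElem?_append_left hi])
  refine ⟨C', ?_, σ', hr', hex.bounded hσ, hq, hex.fr⟩
  have h1 : k + 1 ≤ T := by
    have : s * B ≤ t * B := Nat.mul_le_mul_right _ hs
    rw [add_mul] at hT
    omega
  obtain ⟨T', rfl⟩ := Nat.exists_eq_add_of_le h1
  rw [add_assoc, hst, hp, zero_add] at *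
  rw [add_comm, run]
  simp [hpc, Cmd.prog]

/-! ## Interpreting a machine program -/

/-- The part common to all instructions that write: the value in variable `15` goes to the
address in variable `14`, which is logged. -/
def interpTail : Cmd :=
  .sto 0 (.var 14) (.var 15) ;; .sto 1 (.var 13) (.var 14) ;; .asg 13 (.var 13 + 1) ;;
    .asg 11 (.var 11 + 1)

/-- Interpretation of an instruction on the memory in array `0`; the random words are zero. -/
def interpInstr : Instr → Cmd
  | .const d k => .asg 15 (.lit k) ;; .asg 14 (.lit d) ;; interpTail
  | .op o d a b => .asg 15 (.ld 0 (.lit a)) ;; .asg 16 (.ld 0 (.lit b)) ;; .aop 15 o 15 16 ;;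
      .asg 14 (.lit d) ;; interpTail
  | .load d a => .asg 15 (.ld 0 (.ld 0 (.lit a))) ;; .asg 14 (.lit d) ;; interpTail
  | .store d a => .asg 15 (.ld 0 (.lit a)) ;; .asg 14 (.ld 0 (.lit d)) ;; interpTail
  | .read d a => .asg 16 (.ld 0 (.lit a)) ;;
      .ite (.var 17 - .var 16) (.asg 15 (.ld 2 (.var 16))) (.asg 15 0) ;;
      .asg 14 (.lit d) ;; interpTail
  | .rand d => .asg 15 0 ;; .asg 14 (.lit d) ;; interpTail
  | .jmp l => .asg 11 (.lit l)
  | .jz a l => .ite (.ld 0 (.lit a)) (.asg 11 (.var 11 + 1)) (.asg 11 (.lit l))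
  | .jlt a b l => .ite (.ld 0 (.lit b) - .ld 0 (.lit a)) (.asg 11 (.lit l)) (.asg 11 (.var 11 + 1))
  | .halt => .asg 12 0

/-- Interpretation of the instruction in position `pc - k` of a list. -/
def interpDispatch : List Instr → ℕ → Cmd
  | [], _ => .asg 12 0
  | i :: l, k => .ite ((.var 11 - .lit k) + (.lit k - .var 11)) (interpDispatch l (k + 1))
      (interpInstr i)

/-- Interpretation of a program. -/
def interp (P : Program) : Cmd :=
  .asg 11 0 ;; .asg 12 1 ;; .asg 13 0 ;; .loop (.var 12) (interpDispatch P 0)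

theorem interpInstr_noV (i : Instr) {x : ℕ} (h : x < 11 ∨ 16 < x) : (interpInstr i).NoV x := by
  cases i <;> simp [interpInstr, interpTail] <;> omega

theorem interpInstr_noA (i : Instr) {x : ℕ} (h : 1 < x) : (interpInstr i).NoA x := by
  cases i <;> simp [interpInstr, interpTail] <;> omega

theorem interpInstr_noR (i : Instr) : (interpInstr i).NoR := by
  cases i <;> simp [interpInstr, interpTail]

theorem interp_noV (P : Program) {x : ℕ} (h : x < 11 ∨ 16 < x) : (interp P).NoV x := by
  have : ∀ k, (interpDispatch P k).NoV x := by
    induction P with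
    | nil => intro k; simp [interpDispatch]; omega
    | cons i P ih => intro k; simp [interpDispatch, ih, interpInstr_noV i h]
  simp [interp, this]; omega

theorem interp_noA (P : Program) {x : ℕ} (h : 1 < x) : (interp P).NoA x := by
  have : ∀ k, (interpDispatch P k).NoA x := by
    induction P with
    | nil => intro k; simp [interpDispatch]
    | cons i P ih => intro k; simp [interpDispatch, ih, interpInstr_noA i h]
  simp [interp, this]

theorem interp_noR (P : Program) : (interp P).NoR := by
  have : ∀ k, (interpDispatch P k).NoR := by
    induction P with
    | nil => intro k; simp [interpDispatch]
    | cons i P ih => intro k; simp [interpDispatch, ih, interpInstr_noR i]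
  simp [interp, this]

/-- The constants in an instruction that appear as values in its interpretation. -/
def Instr.bound : Instr → ℕ
  | .const d _ => d
  | .op _ d _ _ => d
  | .load d _ => d
  | .store _ _ => 0
  | .read d _ => d
  | .rand d => d
  | .jmp l => l
  | .jz _ l => l
  | .jlt _ _ l => l
  | .halt => 0

/-- The state `σ` of the interpreter represents the configuration `c`. -/
structure Sim (V : ℕ) (σ : St) (c : Config) : Prop where
  mem : ∀ a, σ.h 0 a = c.mem a
  pc : σ.v 11 = c.pc
  lt : ∀ a, c.mem a < V
  log : ∀ a, c.mem a ≠ 0 → ∃ j < σ.v 13, σ.h 1 j = a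

theorem interpTail_runs {E : Env} {σ : St} {c : Config} (hs : Sim E.V σ c) {d x u : ℕ}
    (hd : σ.v 14 = d) (hx : σ.v 15 = x) (hd' : d < E.V) (hx' : x < E.V) (hp : c.pc + 1 < E.V)
    (hl : σ.v 13 + 1 < E.V) : Runs E interpTail σ 4 fun σ' =>
      Sim E.V σ' ⟨c.pc + 1, Function.update c.mem d x, u⟩ ∧ σ'.v 13 = σ.v 13 + 1 := by
  refine Runs.sto_seq (by simpa [hx] using hx') (Runs.sto_seq (by simpa [hd] using hd')
    (Runs.asg_seq (by simpa using hl) (Runs.asg (by simpa [hs.pc] using hp) ⟨⟨?_, ?_, ?_, ?_⟩, ?_⟩)))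
  · intro a
    simp [hd, hx, hs.mem, Function.update_apply]
  · simp [hs.pc]
  · intro a
    simp only [Function.update_apply]; split_ifs
    exacts [hx', hs.lt a]
  · intro a ha
    simp only [Function.update_apply] at ha
    by_cases h : a = d
    · exact ⟨σ.v 13, by simp, by simp [hd, h]⟩
    · rw [if_neg h] at ha
      obtain ⟨j, hj, hj'⟩ := hs.log a ha
      refine ⟨j, by simp; omega, ?_⟩
      simp [hj', hj.ne]
  · simp

theorem Sim.congr {V : ℕ} {σ σ' : St} {c : Config} (hs : Sim V σ c) (h0 : σ'.h = σ.h)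
    (h1 : σ'.v 11 = σ.v 11) (h3 : σ'.v 13 = σ.v 13) : Sim V σ' c :=
  ⟨by rw [h0]; exact hs.mem, by rw [h1, hs.pc], hs.lt, by rw [h0, h3]; exact hs.log⟩

theorem Sim.jump {V : ℕ} {σ : St} {c : Config} (hs : Sim V σ c) (l : ℕ) :
    Sim V (σ.set 11 l) { c with pc := l } :=
  ⟨hs.mem, by simp, hs.lt, by simpa using hs.log⟩

/-- The interpreted machine may have shorter words. A step that succeeds there produced no overflow,
so its value is below `2 ^ W ≤ E.V`. Reads are guarded by the input length since the input array may
contain remains of earlier calls. -/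
theorem interpInstr_runs {E : Env} {W : ℕ} (hW : 2 ^ W ≤ E.V) {inp : List ℕ} {σ : St}
    {c c' : Config} (hs : Sim E.V σ c)
    (hin : ∀ a < inp.length, σ.h 2 a = inp.getD a 0) (hlen : σ.v 17 = inp.length)
    (hl : σ.v 13 + 1 < E.V) (hp : c.pc + 1 < E.V) (i : Instr) (hb : i.bound < E.V)
    (hi : i.step W inp (fun _ => ⟨0, by positivity⟩) c = some c') :
    Runs E (interpInstr i) σ 8 fun σ' => Sim E.V σ' c' ∧ σ'.v 13 ≤ σ.v 13 + 1 := by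
  have hw : ∀ {C : Config} {d x : ℕ}, C.write W d x = some c' →
      x < E.V ∧ c' = ⟨C.pc + 1, Function.update C.mem d x, C.used⟩ := by
    intro C d x h
    simp only [Config.write] at h
    split_ifs at h with h1
    exact ⟨by omega, by simpa using h.symm⟩
  have tail : ∀ {σ' : St} {d x u : ℕ}, σ'.h = σ.h → σ'.v 11 = σ.v 11 → σ'.v 13 = σ.v 13 →
      σ'.v 14 = d → σ'.v 15 = x → d < E.V → x < E.V → Runs E interpTail σ' 4 fun σ' =>
        Sim E.V σ' ⟨c.pc + 1, Function.update c.mem d x, u⟩ ∧ σ'.v 13 ≤ σ.v 13 + 1 := by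
    intro σ' d x u h1 h2 h3 h4 h5 h6 h7
    exact (interpTail_runs (hs.congr h1 h2 h3) h4 h5 h6 h7 hp (by omega)).mono le_rfl
      fun σ'' h _ => ⟨h.1, by omega⟩
  cases i with
  | const d k =>
    simp only [Instr.bound] at hb
    obtain ⟨h1, rfl⟩ := hw hi
    exact (Runs.asg_seq (by simpa using h1) (Runs.asg_seq (by simpa using hb)
      (tail rfl (by simp) (by simp) (by simp) (by simp) hb h1))).time (by norm_num)
  | op o d a b =>
    simp only [Instr.bound] at hb
    obtain ⟨h1, rfl⟩ := hw hi
    refine Runs.asg_seq (by simpa [hs.mem] using hs.lt a) (Runs.asg_seq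
      (by simpa [hs.mem] using hs.lt b) (Runs.time (Runs.seq
        (R := fun σ' => σ'.h = σ.h ∧ σ'.v 11 = σ.v 11 ∧ σ'.v 13 = σ.v 13 ∧
          σ'.v 15 = o.eval (c.mem a) (c.mem b))
        (Runs.aop ?_ ?_) fun σ' h _ => Runs.asg_seq (by simpa using hb) (tail ?_ ?_ ?_ ?_ ?_ hb h1))
        (by norm_num : 1 + (4 + 1) ≤ 6)))
    · simpa [hs.mem] using h1
    · simp [hs.mem]
    all_goals simp [h]
  | load d a =>
    simp only [Instr.bound] at hb
    obtain ⟨h1, rfl⟩ := hw hi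
    exact (Runs.asg_seq (by simpa [hs.mem] using h1) (Runs.asg_seq (by simpa using hb)
      (tail rfl (by simp) (by simp) (by simp) (by simp [hs.mem]) hb h1))).time (by norm_num)
  | store d a =>
    simp only [Instr.bound] at hb
    obtain ⟨h1, rfl⟩ := hw hi
    exact (Runs.asg_seq (by simpa [hs.mem] using h1) (Runs.asg_seq
      (by simpa [hs.mem] using hs.lt d)
      (tail rfl (by simp) (by simp) (by simp [hs.mem]) (by simp [hs.mem]) (hs.lt d) h1))).time (by norm_num)
  | read d a =>
    simp only [Instr.bound] at hb
    obtain ⟨h1, rfl⟩ := hw hi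
    refine Runs.asg_seq (by simpa [hs.mem] using hs.lt a) (Runs.time (Runs.seq
        (R := fun σ' => σ'.h = σ.h ∧ σ'.v 11 = σ.v 11 ∧ σ'.v 13 = σ.v 13 ∧
          σ'.v 15 = inp.getD (c.mem a) 0)
        (Runs.ite (fun h => ?_) (fun h => ?_)) fun σ' h _ =>
          Runs.asg_seq (by simpa using hb) (tail ?_ ?_ ?_ ?_ ?_ hb h1))
        (by norm_num : 1 + 1 + (4 + 1) ≤ 7))
    · simp [hs.mem, hlen] at h
      have h2 : σ.h 2 (c.mem a) = inp.getD (c.mem a) 0 := hin _ (by omega)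
      refine Runs.asg ?_ ?_
      · simp [hs.mem, h2]; simpa using h1
      · simp [hs.mem, h2]
    · simp [hs.mem, hlen] at h
      have h2 : inp.getD (c.mem a) 0 = 0 := by
        rw [List.getD_eq_default]; omega
      refine Runs.asg (by simp; omega) ?_
      simp only [Ex.eval_ofNat, h2]
      simp
    all_goals simp [h]
  | rand d =>
    simp only [Instr.bound] at hb
    obtain ⟨h1, rfl⟩ := hw hi
    exact (Runs.asg_seq (by simpa using h1) (Runs.asg_seq (by simpa using hb)
      (tail rfl (by simp) (by simp) (by simp) (by simp) hb h1))).time (by norm_num)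
  | jmp l =>
    simp only [Instr.bound] at hb
    simp only [Instr.step, Option.some.injEq] at hi
    subst hi
    exact (Runs.asg (by simpa using hb) ⟨hs.jump l, by simp⟩).time (by norm_num)
  | jz a l =>
    simp only [Instr.bound] at hb
    simp only [Instr.step, Option.some.injEq] at hi
    subst hi
    refine (Runs.ite (t := 1) (fun h => ?_) (fun h => ?_)).time (by norm_num)
    · simp [hs.mem] at h
      rw [if_neg h]
      exact Runs.asg (by simpa [hs.pc] using hp) ⟨by simpa [hs.pc] using hs.jump _, by simp⟩
    · simp [hs.mem] at h
      rw [if_pos h]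
      exact Runs.asg (by simpa using hb) ⟨hs.jump l, by simp⟩
  | jlt a b l =>
    simp only [Instr.bound] at hb
    simp only [Instr.step, Option.some.injEq] at hi
    subst hi
    refine (Runs.ite (t := 1) (fun h => ?_) (fun h => ?_)).time (by norm_num)
    · simp [hs.mem] at h
      rw [if_pos (by omega)]
      exact Runs.asg (by simpa using hb) ⟨hs.jump l, by simp⟩
    · simp [hs.mem] at h
      rw [if_neg (by omega)]
      exact Runs.asg (by simpa [hs.pc] using hp) ⟨by simpa [hs.pc] using hs.jump _, by simp⟩
  | halt => simp [Instr.step] at hi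

/-- The program counter is compared with all positions one after the other. The interpreted program
is fixed, so this linear search is a constant overhead. -/
theorem interpDispatch_runs {E : Env} {Q : St → Prop} {t : ℕ} {i : Instr} {σ : St} (P : List Instr) :
    ∀ (k a : ℕ), σ.v 11 = k + a → P[a]? = some i → Runs E (interpInstr i) σ t Q →
      Runs E (interpDispatch P k) σ (t + P.length) Q := by
  induction P with
  | nil => intro k a _ h; simp at h
  | cons j P ih =>
    intro k a hk hj hr
    rw [List.length_cons, ← add_assoc]
    refine Runs.ite (fun h => ?_) (fun h => ?_)
    · simp [hk] at h
      obtain ⟨a, rfl⟩ := Nat.exists_eq_succ_of_ne_zero h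
      exact ih (k + 1) a (by omega) (by simpa using hj) hr
    · simp [hk] at h
      subst h
      simp at hj
      exact hj ▸ hr.time (by omega)

/-- Besides the final memory, the conclusion provides a log of length at most `T`, added to what was
logged before, that contains the address of every nonzero cell. This is what makes it cheap to reset
the memory of the interpreter. -/
theorem interpLoop_runs {E : Env} {W : ℕ} (hW : 2 ^ W ≤ E.V) {P : Program}
    (hP : ∀ i ∈ P, i.bound < E.V) (hPl : P.length < E.V) {inp : List ℕ} (T : ℕ) :
    ∀ (σ : St) (c c' : Config), Sim E.V σ c → σ.v 12 = 1 →
    (∀ a < inp.length, σ.h 2 a = inp.getD a 0) → σ.v 17 = inp.length → σ.v 13 + T < E.V →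
    run W P inp (fun _ => ⟨0, by positivity⟩) T c = some c' →
    Runs E (.loop (.var 12) (interpDispatch P 0)) σ (T * (P.length + 9) + 1) fun σ' =>
      (∀ a, σ'.h 0 a = c'.mem a) ∧ (∀ a, c'.mem a < E.V) ∧
      (∀ a, c'.mem a ≠ 0 → ∃ j < σ'.v 13, σ'.h 1 j = a) ∧ σ'.v 13 ≤ σ.v 13 + T := by
  induction T with
  | zero => intro σ c c' _ _ _ _ _ h; simp [run] at h
  | succ T ih =>
    intro σ c c' hs h12 hin hlen hl hr
    have hstep : ∀ i : Instr, P[c.pc]? = some i → i ≠ .halt →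
        (i.step W inp (fun _ => ⟨0, by positivity⟩) c).bind
          (run W P inp (fun _ => ⟨0, by positivity⟩) T) = some c' → Runs E
          (.loop (.var 12) (interpDispatch P 0)) σ ((T + 1) * (P.length + 9) + 1) fun σ' =>
          (∀ a, σ'.h 0 a = c'.mem a) ∧ (∀ a, c'.mem a < E.V) ∧
          (∀ a, c'.mem a ≠ 0 → ∃ j < σ'.v 13, σ'.h 1 j = a) ∧ σ'.v 13 ≤ σ.v 13 + (T + 1) := by
      intro i hi hne hb
      obtain ⟨d, hd, hd'⟩ := Option.bind_eq_some_iff.mp hb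
      have hpc : c.pc < P.length := by
        by_contra h
        rw [List.getElem?_eq_none (by omega)] at hi
        simp at hi
      have h1 := interpInstr_runs hW hs hin hlen (by omega) (by omega) i
        (hP i (List.mem_of_getElem? hi)) hd
      replace h1 := h1.mono (Q := fun σ' => (Sim E.V σ' d ∧ σ'.v 13 ≤ σ.v 13 + 1) ∧
        σ'.v 12 = 1 ∧ σ'.v 17 = σ.v 17 ∧ σ'.h 2 = σ.h 2) le_rfl fun τ h hf => ⟨h, by
          rw [hf.v 12, h12]
          cases i <;> simp_all [interpInstr, interpTail], hf.v 17 (interpInstr_noV i (by omega)),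
          hf.h 2 (interpInstr_noA i (by omega))⟩
      have h2 := interpDispatch_runs P 0 c.pc (by rw [hs.pc, zero_add]) hi h1
      refine (Runs.loop_step (t := T * (P.length + 9) + 1) (s := 8 + P.length) (by simp [h12])
        (h2.mono le_rfl fun σ' hh _ => ?_)).time (by rw [add_mul]; omega)
      obtain ⟨h, hfr⟩ := hh
      refine (ih σ' d c' h.1 hfr.1 ?_ ?_ (by omega) hd').mono le_rfl ?_
      · rw [hfr.2.2]; exact hin
      · rw [hfr.2.1]; exact hlen
      · rintro τ ⟨a1, a2, a3, a4⟩ _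
        exact ⟨a1, a2, a3, by omega⟩
    rw [run] at hr
    split at hr
    · simp at hr
    · rename_i hi
      obtain rfl := Option.some.inj hr
      have h1 : Runs E (interpInstr .halt) σ 1 fun σ' => σ' = σ.set 12 0 :=
        Runs.asg (by simp; omega) rfl
      have h2 := interpDispatch_runs P 0 c.pc (by rw [hs.pc, zero_add]) hi h1
      refine (Runs.loop_step (t := 1) (s := 1 + P.length) (by simp [h12])
        (h2.mono le_rfl fun σ' h _ => ?_)).time (by rw [add_mul]; omega)
      subst h
      exact Runs.loop_end (by simp) ⟨hs.mem, hs.lt, by simpa using hs.log, by simp⟩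
    · rename_i i hne hi
      exact hstep i hi hne hr

theorem interp_runs {E : Env} {W : ℕ} (hW : 2 ^ W ≤ E.V) {P : Program}
    (hP : ∀ i ∈ P, i.bound < E.V) (hPl : P.length < E.V) (hV : 1 < E.V) {inp : List ℕ} {T : ℕ}
    {σ : St} {c' : Config} (h0 : ∀ a, σ.h 0 a = 0)
    (hin : ∀ a < inp.length, σ.h 2 a = inp.getD a 0) (hlen : σ.v 17 = inp.length) (hT : T < E.V)
    (hr : run W P inp (fun _ => ⟨0, by positivity⟩) T Config.initial = some c') :
    Runs E (interp P) σ (T * (P.length + 9) + 4) fun σ' =>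
      (∀ a, σ'.h 0 a = c'.mem a) ∧ (∀ a, c'.mem a < E.V) ∧
      (∀ a, c'.mem a ≠ 0 → ∃ j < σ'.v 13, σ'.h 1 j = a) ∧ σ'.v 13 ≤ T := by
  refine Runs.asg_seq (by simp; omega) (Runs.asg_seq (by simpa using hV) (Runs.asg_seq
    (by simp; omega) ((interpLoop_runs hW hP hPl T _ Config.initial c' ⟨?_, ?_, ?_, ?_⟩ ?_ ?_ ?_ ?_
      hr).mono le_rfl ?_)))
  · simpa [Config.initial] using h0
  · simp [Config.initial]
  · simp [Config.initial]; omega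
  · simp [Config.initial]
  · simp
  · simpa using hin
  · simpa using hlen
  · simpa using hT
  · rintro σ' ⟨h1, h2, h3, h4⟩ _
    exact ⟨h1, h2, h3, by simpa using h4⟩


/-! ### Matrices stored row by row, and the block product -/

theorem idx_inj {Q i j i' j' : ℕ} (hj : j < Q) (hj' : j' < Q) (h : i * Q + j = i' * Q + j') :
    i = i' ∧ j = j' := by
  have e1 := congrArg (· % Q) h
  have e2 := congrArg (· / Q) h
  have hQ : 0 < Q := by omega
  simp only [Nat.mul_add_mod', Nat.mod_eq_of_lt hj, Nat.mod_eq_of_lt hj'] at e1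
  rw [mul_comm i, mul_comm i'] at e2
  simp only [Nat.mul_add_div hQ, Nat.div_eq_of_lt hj, Nat.div_eq_of_lt hj'] at e2
  omega

theorem idx_lt {Q N i j : ℕ} (hi : i < N) (hj : j < Q) : i * Q + j < N * Q := by
  calc i * Q + j < (i + 1) * Q := by rw [add_mul]; omega
    _ ≤ N * Q := Nat.mul_le_mul_right _ hi

theorem flatten_ofFn_getD {m n : ℕ} (f : Fin m → Fin n → ℕ) (l : List ℕ) {i j : ℕ} (hi : i < m)
    (hj : j < n) :
    ((List.ofFn fun i => List.ofFn fun j => f i j).flatten ++ l).getD (i * n + j) 0 =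
      f ⟨i, hi⟩ ⟨j, hj⟩ := by
  have hn : 0 < n := by omega
  have key := List.ofFn_mul (fun k : Fin (m * n) =>
    f ⟨k / n, (Nat.div_lt_iff_lt_mul hn).mpr k.2⟩ ⟨k % n, Nat.mod_lt _ hn⟩)
  have h2 : (List.ofFn fun i : Fin m => List.ofFn fun j : Fin n => f i j).flatten =
      List.ofFn (fun k : Fin (m * n) =>
        f ⟨k / n, (Nat.div_lt_iff_lt_mul hn).mpr k.2⟩ ⟨k % n, Nat.mod_lt _ hn⟩) := by
    rw [key]
    congr 1
    congr 1
    funext a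
    congr 1
    funext b
    congr 1
    · ext; simp [Nat.add_div_of_dvd_right, Nat.div_eq_of_lt b.2, hn]
    · ext; simp [Nat.mod_eq_of_lt b.2]
  have hlt : i * n + j < m * n := idx_lt hi hj
  rw [h2, List.getD_append _ _ _ _ (by simpa using hlt)]
  rw [List.getD_eq_getElem _ _ (by simpa using hlt), List.getElem_ofFn]
  congr 1
  · ext; simp [Nat.add_div_of_dvd_right, Nat.div_eq_of_lt hj, hn]
  · ext; simp [Nat.mod_eq_of_lt hj]

theorem flatten_ofFn_length {m n : ℕ} (f : Fin m → Fin n → ℕ) :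
    (List.ofFn fun i => List.ofFn fun j => f i j).flatten.length = m * n := by
  simp [List.length_flatten, Function.comp_def]

/-- The array `a` holds the matrix `m` of size `Q`. -/
def HoldsMat {p : ℕ} (a : ℕ → ℕ) (Q : ℕ) (m : ℕ → ℕ → ZMod p) : Prop :=
  ∀ i j, i < Q → j < Q → a (i * Q + j) = (m i j).val

/-- The operation `X := x X + y Y Z` on blocks of size `h` of a matrix, where the block `X` starts
in row `rx` and column `cx`, and likewise for `Y` and `Z`. -/
def blockGemm {F : Type*} [CommRing F] (h rx cx ry cy rz cz : ℕ) (x y : F) (m : ℕ → ℕ → F) :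
    ℕ → ℕ → F := fun i j =>
  if rx ≤ i ∧ i < rx + h ∧ cx ≤ j ∧ j < cx + h then
    x * m i j + y * ∑ k ∈ Finset.range h, m (ry + (i - rx)) (cy + k) * m (rz + k) (cz + (j - cx))
  else m i j

/-- `P` multiplies matrices of size `m` in time `tm m` on words of size
`κ * Nat.clog 2 (max m p)`. -/
def MulProgram (P : Program) (κ : ℕ) (tm : ℕ → ℕ) : Prop :=
  ∀ p m : ℕ, p.Prime → 1 ≤ m →
    ∀ (A B : Matrix (Fin m) (Fin m) (ZMod p)) (coins : Coins (κ * Nat.clog 2 (max m p))),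
      ∃ c : Config,
        run (κ * Nat.clog 2 (max m p)) P ([m, p] ++ matrixWords A ++ matrixWords B) coins
          (tm m) Config.initial = some c ∧
        ∀ i j : Fin m, c.mem (c.mem 0 + i * m + j) = ((A * B) i j).val

/-- The bounds that the multiplication of matrices of size `h` over `ℤ/pℤ` requires. -/
structure MulFit (P : Program) (κ : ℕ) (tm : ℕ → ℕ) (V p h : ℕ) : Prop where
  word : 2 ^ (κ * Nat.clog 2 (max h p)) ≤ V
  bound : ∀ i ∈ P, i.bound < V
  length : P.length < V
  time : tm h < V
  size : 2 + 2 * (h * h) < V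
  prime : p < V

/-- Variables: `1` modulus, `2` stride, `3` block size, `4`, `5`, `6` offsets of the blocks `X`, `Y`,
`Z`, `7`, `8` the coefficients `x`, `y`. Array `3` contains the matrix. -/
def gemm (P : Program) : Cmd :=
  .sto 2 0 (.var 3) ;; .sto 2 1 (.var 1) ;;
  .fill 9 10 (.var 3) (.var 3) 2 (2 + (.var 9 * .var 3 + .var 10))
    (.ld 3 (.var 5 + (.var 9 * .var 2 + .var 10))) ;;
  .fill 9 10 (.var 3) (.var 3) 2 (2 + .var 3 * .var 3 + (.var 9 * .var 3 + .var 10))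
    (.ld 3 (.var 6 + (.var 9 * .var 2 + .var 10))) ;;
  .asg 17 (2 + 2 * (.var 3 * .var 3)) ;;
  interp P ;;
  .fill 9 10 (.var 3) (.var 3) 3 (.var 4 + (.var 9 * .var 2 + .var 10))
    ((.var 7 * .ld 3 (.var 4 + (.var 9 * .var 2 + .var 10)) +
      .var 8 * .ld 0 (.ld 0 0 + (.var 9 * .var 3 + .var 10))) % .var 1) ;;
  .forC 9 (.var 13) (.sto 0 (.ld 1 (.var 9)) 0)

theorem gemm_noV (P : Program) {x : ℕ} (h : x < 9 ∨ 17 < x) : (gemm P).NoV x := by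
  have := interp_noV P (x := x) (by omega)
  simp [gemm, this]; omega

theorem gemm_noA (P : Program) {x : ℕ} (h : 3 < x) : (gemm P).NoA x := by
  have := interp_noA P (x := x) (by omega)
  simp [gemm, this]; omega

theorem gemm_noR (P : Program) : (gemm P).NoR := by
  have := interp_noR P
  simp [gemm, this]

/-- The time of `gemm`. -/
def gemmTime (P : Program) (tm : ℕ → ℕ) (h : ℕ) : ℕ :=
  tm h * (P.length + 12) + (9 * (h * h) + 12 * h + 20)

/-- The operands are copied into the input array before the target is written, so `X` may coincide
with `Y` or `Z`; no disjointness is required. The interpreter's memory is zero before and after, so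
calls can be chained. -/
theorem gemm_runs {P : Program} {κ : ℕ} {tm : ℕ → ℕ} (hP : MulProgram P κ tm) {E : Env} {p h Q : ℕ}
    [hp : Fact p.Prime] (hf : MulFit P κ tm E.V p h) (hh : 1 ≤ h) {σ : St} (m : ℕ → ℕ → ZMod p)
    (rx cx ry cy rz cz : ℕ) (x y : ZMod p) (hm : HoldsMat (σ.h 3) Q m) (h0 : ∀ a, σ.h 0 a = 0)
    (h1 : σ.v 1 = p) (h2 : σ.v 2 = Q) (h3 : σ.v 3 = h) (h4 : σ.v 4 = rx * Q + cx)
    (h5 : σ.v 5 = ry * Q + cy) (h6 : σ.v 6 = rz * Q + cz) (h7 : (σ.v 7 : ZMod p) = x)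
    (h8 : (σ.v 8 : ZMod p) = y) (hrx : rx + h ≤ Q) (hcx : cx + h ≤ Q) (hry : ry + h ≤ Q)
    (hcy : cy + h ≤ Q) (hrz : rz + h ≤ Q) (hcz : cz + h ≤ Q) :
    Runs E (gemm P) σ (gemmTime P tm h) fun σ' =>
      HoldsMat (σ'.h 3) Q (blockGemm h rx cx ry cy rz cz x y m) ∧ ∀ a, σ'.h 0 a = 0 := by
  have hhV : h < E.V := by
    have := hf.size
    nlinarith
  have hval : ∀ z : ZMod p, z.val < E.V := fun z => (ZMod.val_lt z).trans hf.prime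
  let A : Matrix (Fin h) (Fin h) (ZMod p) := .of fun i j => m (ry + i) (cy + j)
  let B : Matrix (Fin h) (Fin h) (ZMod p) := .of fun i j => m (rz + i) (cz + j)
  -- The multiplication program is correct for all outcomes of its random words, in particular when
  -- they are all zero, as in the interpreter.
  obtain ⟨C, hC, hC'⟩ := hP p h hp.out hh A B (fun _ => ⟨0, by positivity⟩)
  have hlenA : (matrixWords A).length = h * h := flatten_ofFn_length _
  have hlenB : (matrixWords B).length = h * h := flatten_ofFn_length _
  have inj : ∀ c a b a' b' : ℕ, a < h → b < h → a' < h → b' < h →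
      c + (a * h + b) = c + (a' * h + b') → a = a' ∧ b = b' := fun c a b a' b' _ hb _ hb' he =>
    idx_inj hb hb' (by omega)
  have inj' : ∀ a b a' b' : ℕ, a < h → b < h → a' < h → b' < h →
      rx * Q + cx + (a * Q + b) = rx * Q + cx + (a' * Q + b') → a = a' ∧ b = b' :=
    fun a b a' b' _ hb _ hb' he => idx_inj (Q := Q) (by omega) (by omega) (by omega)
  have rearr : ∀ r c a b : ℕ, r * Q + c + (a * Q + b) = (r + a) * Q + (c + b) := by
    intros; ring
  refine Runs.time (s := h * (h * 3 + 4) + 2 + (h * (h * 3 + 4) + 2 + (tm h * (P.length + 9) + 4 +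
    (h * (h * 3 + 4) + 2 + (tm h * 3 + 2)) + 1)) + 1 + 1) (Runs.sto_seq (by simpa [h3] using hhV) (Runs.sto_seq
    (by simpa [h1] using hf.prime) (Runs.seq (Runs.fill (fun a b => 2 + (a * h + b))
      (fun a b => (m (ry + a) (cy + b)).val) (N₁ := h) (N₂ := h) (by norm_num) hhV hhV ?_ ?_ ?_
      (inj 2)) fun σ₁ g₁ f₁ => (Runs.seq (Runs.fill (fun a b => 2 + h * h + (a * h + b))
      (fun a b => (m (rz + a) (cz + b)).val) (N₁ := h) (N₂ := h) (by norm_num) hhV hhV ?_ ?_ ?_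
      (inj (2 + h * h))) fun σ₂ g₂ f₂ => ?_)))) ?_
  rotate_left 3
  · intro σ' hσ'
    simp [hσ'.v 3, f₁.v 3, h3]
  · intro σ' hσ'
    simp [hσ'.v 3, f₁.v 3, h3]
  · intro σ' a b ha hb hσ' hi hj _
    simp only [Ex.eval_add, Ex.eval_ofNat, Ex.eval_mul, Ex.eval_var, Ex.eval_ld, hi, hj]
    have e3 : σ'.v 3 = h := by simp [hσ'.v 3, f₁.v 3, h3]
    have e2 : σ'.v 2 = Q := by simp [hσ'.v 2, f₁.v 2, h2]
    have e6 : σ'.v 6 = rz * Q + cz := by simp [hσ'.v 6, f₁.v 6, h6]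
    have eh : σ'.h 3 = σ.h 3 := by simp [hσ'.h 3, f₁.h 3]
    refine ⟨by rw [e3], ?_, hval _⟩
    rw [e6, e2, eh, rearr, hm _ _ (by omega) (by omega)]
  · have e3 : σ₂.v 3 = h := by simp [f₂.v 3, f₁.v 3, h3]
    have e2 : σ₂.v 2 = Q := by simp [f₂.v 2, f₁.v 2, h2]
    have e1 : σ₂.v 1 = p := by simp [f₂.v 1, f₁.v 1, h1]
    have e4 : σ₂.v 4 = rx * Q + cx := by simp [f₂.v 4, f₁.v 4, h4]
    have e7 : σ₂.v 7 = σ.v 7 := by simp [f₂.v 7, f₁.v 7]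
    have e8 : σ₂.v 8 = σ.v 8 := by simp [f₂.v 8, f₁.v 8]
    have eh : σ₂.h 3 = σ.h 3 := by simp [f₂.h 3, f₁.h 3]
    have e0 : σ₂.h 0 = σ.h 0 := by simp [f₂.h 0, f₁.h 0]
    have hlen : ([h, p] ++ matrixWords A ++ matrixWords B).length = 2 + 2 * (h * h) := by
      simp [hlenA, hlenB]; ring
    have hin : ∀ a < ([h, p] ++ matrixWords A ++ matrixWords B).length,
        σ₂.h 2 a = ([h, p] ++ matrixWords A ++ matrixWords B).getD a 0 := by
      intro a ha
      rw [hlen] at ha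
      rw [List.append_assoc, List.cons_append, List.cons_append, List.nil_append]
      rcases a with _ | _ | a
      · rw [g₂.2 0 (fun a b _ _ => by omega), g₁.2 0 (fun a b _ _ => by omega)]
        simp [h3]
      · rw [g₂.2 _ (fun a b _ _ => by omega), g₁.2 _ (fun a b _ _ => by omega)]
        simp [h1]
      · simp only [List.getD_cons_succ]
        rcases lt_or_ge a (h * h) with hlt | hge
        · have hd : a / h < h := Nat.div_lt_of_lt_mul hlt
          have hr : a % h < h := Nat.mod_lt _ (by omega)
          have had : a = a / h * h + a % h := by rw [mul_comm]; exact (Nat.div_add_mod a h).symm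
          have := flatten_ofFn_getD (fun i j => (A i j).val) (matrixWords B) hd hr
          rw [← had] at this
          rw [g₂.2 _ (fun b c _ _ => by omega), matrixWords, this]
          have h' := g₁.1 _ _ hd hr
          rw [← had] at h'
          rw [show a + 1 + 1 = 2 + a by ring, h']
          rfl
        · obtain ⟨b, rfl⟩ := Nat.exists_eq_add_of_le hge
          have hlt : b < h * h := by omega
          have hd : b / h < h := Nat.div_lt_of_lt_mul hlt
          have hr : b % h < h := Nat.mod_lt _ (by omega)
          have had : b = b / h * h + b % h := by rw [mul_comm]; exact (Nat.div_add_mod b h).symm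
          have := flatten_ofFn_getD (fun i j => (B i j).val) [] hd hr
          rw [← had, List.append_nil] at this
          rw [List.getD_append_right _ _ _ _ (by omega), hlenA, Nat.add_sub_cancel_left, matrixWords,
            this]
          have h' := g₂.1 _ _ hd hr
          rw [← had] at h'
          rw [show h * h + b + 1 + 1 = 2 + h * h + b by ring, h']
          rfl
    refine Runs.asg_seq (by simpa [e3] using hf.size) (Runs.seq (interp_runs
      (inp := [h, p] ++ matrixWords A ++ matrixWords B) (T := tm h) (c' := C) hf.word hf.bound
      hf.length (by have := hf.size; omega) ?_ ?_ ?_ hf.time hC) fun σ₃ g₃ f₃ => ?_)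
    · intro a; rw [St.set_h, e0]; exact h0 a
    · exact hin
    · rw [hlen]; simp [e3]
    have f₃' : ∀ x, (x < 11 ∨ 17 < x) → σ₃.v x = σ₂.v x := by
      intro x hx
      rw [f₃.v x (interp_noV P (by omega)), St.set_v, if_neg (by omega)]
    have f₃h : σ₃.h 3 = σ.h 3 := by rw [f₃.h 3 (interp_noA P (by omega)), St.set_h, eh]
    let f : ℕ → ℕ → ℕ := fun a b => (blockGemm h rx cx ry cy rz cz x y m (rx + a) (cx + b)).val
    refine Runs.seq (Runs.fill (fun a b => rx * Q + cx + (a * Q + b)) f (N₁ := h) (N₂ := h)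
      (by norm_num) hhV hhV ?_ ?_ ?_ inj') fun σ₄ g₄ f₄ => ?_
    · intro σ' hσ'
      simp [hσ'.v 3, f₃' 3, e3]
    · intro σ' hσ'
      simp [hσ'.v 3, f₃' 3, e3]
    · intro σ' a b ha hb hσ' hi hj hold
      simp only [Ex.eval_add, Ex.eval_ofNat, Ex.eval_mul, Ex.eval_var, Ex.eval_ld, Ex.eval_mod, hi,
        hj]
      have w : ∀ x, (x < 9 ∨ 17 < x) → σ'.v x = σ₂.v x := fun x hx => by
        rw [hσ'.v x (by simp; omega), f₃' x (by omega)]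
      have w0 : σ'.h 0 = C.mem := by
        rw [hσ'.h 0 (by simp)]; funext a; exact g₃.1 a
      rw [w 4 (by omega), w 2 (by omega), w 7 (by omega), w 8 (by omega), w 1 (by omega),
        w 3 (by omega), e4, e2, e7, e8, e1, e3, w0, hold, f₃h, rearr, hm _ _ (by omega) (by omega)]
      refine ⟨rfl, ?_, hval _⟩
      have hab := hC' ⟨a, ha⟩ ⟨b, hb⟩
      simp only at hab
      rw [← add_assoc (C.mem 0), hab, ← ZMod.val_natCast]
      congr 1
      push_cast
      rw [ZMod.natCast_zmod_val, ZMod.natCast_zmod_val, h7, h8, blockGemm, if_pos (by omega)]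
      congr 2
      simp only [Matrix.mul_apply, A, B, Matrix.of_apply, Nat.add_sub_cancel_left]
      rw [Finset.sum_range]
    -- Clearing the memory along the log: a cell is already zero, or its address occurs in the part
    -- of the log not yet read.
    · refine (Runs.forC (N := σ₃.v 13) (t := 1) (Q := fun σ' =>
          HoldsMat (σ'.h 3) Q (blockGemm h rx cx ry cy rz cz x y m) ∧ ∀ a, σ'.h 0 a = 0)
          (fun k σ' => ∀ a, σ'.h 0 a = 0 ∨ ∃ j, k ≤ j ∧ j < σ₃.v 13 ∧ σ'.h 1 j = a)
        (lt_of_le_of_lt g₃.2.2.2 hf.time) (by simp) ?_ ?_ ?_ ?_).time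
        (t := tm h * 3 + 2) (by have := g₃.2.2.2; omega)
      · intro σ' k _ _ _ hf'
        simp [hf'.v 13, f₄.v 13]
      · intro a
        simp only [St.set_h, f₄.h 0 (by simp), f₄.h 1 (by simp)]
        by_cases hz : C.mem a = 0
        · left; rw [g₃.1, hz]
        · right
          obtain ⟨j, hj, hj'⟩ := g₃.2.2.1 a hz
          exact ⟨j, by omega, hj, hj'⟩
      · intro σ' k hk hI hi hf'
        refine Runs.sto (by simp; have := hf.size; omega) fun a => ?_
        simp only [St.set_h, St.put_h_same, Ex.eval_ld, Ex.eval_var, Ex.eval_ofNat, hi]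
        rw [St.put_h_ne _ _ _ (by norm_num)]
        split_ifs with ha
        · left; rfl
        · rcases hI a with h' | ⟨j, hj, hj', hja⟩
          · left; exact h'
          · right
            refine ⟨j, ?_, hj', hja⟩
            rcases Nat.lt_or_ge k j with h'' | h''
            · omega
            · exact absurd (by rw [show k = j by omega]; exact hja.symm) ha
      · intro σ' hI hi hf'
        refine ⟨fun i j hi hj => ?_, fun a => ?_⟩
        · rw [hf'.h 3 (by simp)]
          by_cases hb : rx ≤ i ∧ i < rx + h ∧ cx ≤ j ∧ j < cx + h
          · have := g₄.1 (i - rx) (j - cx) (by omega) (by omega)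
            rw [rearr] at this
            simp only [f] at this
            rwa [show rx + (i - rx) = i by omega, show cx + (j - cx) = j by omega] at this
          · rw [g₄.2, f₃h, hm i j hi hj, blockGemm, if_neg hb]
            intro a b ha hb' he
            rw [rearr] at he
            obtain ⟨rfl, rfl⟩ := idx_inj (Q := Q) (by omega) (by omega) he
            exact hb (by omega)
        · rcases hI a with h' | ⟨j, hj, hj', _⟩
          · exact h'
          · omega
  rotate_left 1
  · intro σ' hσ'
    simp [hσ'.v 3, h3]
  · intro σ' hσ'
    simp [hσ'.v 3, h3]
  · intro σ' a b ha hb hσ' hi hj _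
    simp only [Ex.eval_add, Ex.eval_ofNat, Ex.eval_mul, Ex.eval_var, Ex.eval_ld, hi, hj]
    have e3 : σ'.v 3 = h := by simp [hσ'.v 3, h3]
    have e2 : σ'.v 2 = Q := by simp [hσ'.v 2, h2]
    have e5 : σ'.v 5 = ry * Q + cy := by simp [hσ'.v 5, h5]
    have eh : σ'.h 3 = σ.h 3 := by simp [hσ'.h 3]
    refine ⟨by rw [e3], ?_, hval _⟩
    rw [e5, e2, eh, rearr, hm _ _ (by omega) (by omega)]
  · simp only [gemmTime]
    ring_nf
    omega


/-! ### Division-free block inversion -/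

section BlockInversion
variable {F : Type*} [Field F]

/-- The `a × b` block of `m` that starts in row `r` and column `c`. -/
def blk (m : ℕ → ℕ → F) (r c a b : ℕ) : Matrix (Fin a) (Fin b) F :=
  .of fun i j => m (r + i) (c + j)

/-- An entry of a product involves only one row and one column, so the formula holds for each upper
left part of the target block. Parts smaller than the block are needed for leading minors. -/
theorem blk_gemm (h rx cx ry cy rz cz : ℕ) (x y : F) (m : ℕ → ℕ → F) {a b : ℕ} (ha : a ≤ h)
    (hb : b ≤ h) : blk (blockGemm h rx cx ry cy rz cz x y m) rx cx a b =
      x • blk m rx cx a b + y • (blk m ry cy a h * blk m rz cz h b) := by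
  ext i j
  simp only [blk, Matrix.of_apply, Matrix.add_apply, Matrix.smul_apply, Matrix.mul_apply,
    smul_eq_mul, blockGemm]
  rw [if_pos (by omega), Finset.sum_range]
  simp

theorem blk_gemm_ne {h rx cx ry cy rz cz : ℕ} {x y : F} {m : ℕ → ℕ → F} {r c a b : ℕ}
    (hd : r + a ≤ rx ∨ rx + h ≤ r ∨ c + b ≤ cx ∨ cx + h ≤ c) :
    blk (blockGemm h rx cx ry cy rz cz x y m) r c a b = blk m r c a b := by
  ext i j
  simp only [blk, Matrix.of_apply, blockGemm]
  rw [if_neg (by omega)]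

/-- With the inverse of the upper left block in place, prepare the inversion of the Schur
complement. -/
def invMid (h s : ℕ) (α : F) (m : ℕ → ℕ → F) : ℕ → ℕ → F :=
  blockGemm h (s + h) (s + h) (s + h) s s (s + h) α (-1)
    (blockGemm h s (s + h) s s s (s + h) 0 1 m)

/-- With the inverse of the upper left block and that of the Schur complement in place, compute
the whole inverse. -/
def invPost (h s : ℕ) (α β : F) (m : ℕ → ℕ → F) : ℕ → ℕ → F :=
  blockGemm h (s + h) (s + h) s s s s (α * α) 0
    (blockGemm h s (s + h) s s s s (-α) 0
      (blockGemm h (s + h) s (s + h) (s + h) (s + h) s 0 (-α)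
        (blockGemm h s s s (s + h) (s + h) s β 1
          (blockGemm h s (s + h) s (s + h) (s + h) (s + h) 0 1
            (blockGemm h (s + h) s (s + h) s s s 0 1 m)))))

/-- Division-free inversion, in place, of the block of size `2 ^ j` that starts in row and column
`s`. The denominator is put into `d s`. -/
def blockInv : ℕ → ℕ → (ℕ → ℕ → F) × (ℕ → F) → (ℕ → ℕ → F) × (ℕ → F)
  | 0, s, (m, d) => (fun i j => if i = s ∧ j = s then 1 else m i j, Function.update d s (m s s))
  | j + 1, s, (m, d) =>
    let r := blockInv j s (m, d)
    let r' := blockInv j (s + 2 ^ j) (invMid (2 ^ j) s (r.2 s) r.1, r.2)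
    (invPost (2 ^ j) s (r'.2 s) (r'.2 (s + 2 ^ j)) r'.1,
      Function.update r'.2 s (r'.2 s * r'.2 (s + 2 ^ j)))

theorem blockGemm_of_outside {h rx cx ry cy rz cz : ℕ} {x y : F} {m : ℕ → ℕ → F} {i j s : ℕ}
    (hr : rx = s ∨ rx = s + h) (hc : cx = s ∨ cx = s + h)
    (hij : ¬(s ≤ i ∧ i < s + (h + h) ∧ s ≤ j ∧ j < s + (h + h))) :
    blockGemm h rx cx ry cy rz cz x y m i j = m i j := if_neg (by omega)

theorem invMid_of_outside {h s : ℕ} {α : F} {m : ℕ → ℕ → F} {i j : ℕ}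
    (hij : ¬(s ≤ i ∧ i < s + (h + h) ∧ s ≤ j ∧ j < s + (h + h))) : invMid h s α m i j = m i j := by
  rw [invMid, blockGemm_of_outside (by simp) (by simp) hij,
    blockGemm_of_outside (by simp) (by simp) hij]

theorem invPost_of_outside {h s : ℕ} {α β : F} {m : ℕ → ℕ → F} {i j : ℕ}
    (hij : ¬(s ≤ i ∧ i < s + (h + h) ∧ s ≤ j ∧ j < s + (h + h))) :
    invPost h s α β m i j = m i j := by
  rw [invPost, blockGemm_of_outside (by simp) (by simp) hij,
    blockGemm_of_outside (by simp) (by simp) hij, blockGemm_of_outside (by simp) (by simp) hij,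
    blockGemm_of_outside (by simp) (by simp) hij, blockGemm_of_outside (by simp) (by simp) hij,
    blockGemm_of_outside (by simp) (by simp) hij]

/-- The recursion works in place; each half must leave the other three blocks and the denominator of
the other half alone. -/
theorem blockInv_of_outside (j : ℕ) : ∀ (s : ℕ) (m : ℕ → ℕ → F) (d : ℕ → F),
    (∀ a b, ¬(s ≤ a ∧ a < s + 2 ^ j ∧ s ≤ b ∧ b < s + 2 ^ j) →
      (blockInv j s (m, d)).1 a b = m a b) ∧
    ∀ a, ¬(s ≤ a ∧ a < s + 2 ^ j) → (blockInv j s (m, d)).2 a = d a := by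
  induction j with
  | zero =>
    intro s m d
    refine ⟨fun a b h => if_neg (by rw [pow_zero] at h; omega), fun a h => ?_⟩
    exact Function.update_of_ne (by rw [pow_zero] at h; omega) _ _
  | succ j ih =>
    intro s m d
    rw [pow_succ, mul_two]
    refine ⟨fun a b h => ?_, fun a h => ?_⟩
    · simp only [blockInv]
      rw [invPost_of_outside h, (ih _ _ _).1 _ _ (by omega), invMid_of_outside h,
        (ih _ _ _).1 _ _ (by omega)]
    · have hp : 0 < 2 ^ j := by positivity
      simp only [blockInv]
      rw [Function.update_of_ne (by omega), (ih _ _ _).2 _ (by omega), (ih _ _ _).2 _ (by omega)]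

theorem blk_submatrix (m : ℕ → ℕ → F) (s h i : ℕ) :
    (blk m s s (h + i) (h + i)).submatrix finSumFinEquiv finSumFinEquiv =
      Matrix.fromBlocks (blk m s s h h) (blk m s (s + h) h i) (blk m (s + h) s i h)
        (blk m (s + h) (s + h) i i) := by
  ext a b
  rcases a with a | a <;> rcases b with b | b <;>
    simp [blk, add_assoc]

theorem blk_eq_submatrix (m : ℕ → ℕ → F) (s h i : ℕ) :
    blk m s s (h + i) (h + i) =
      (Matrix.fromBlocks (blk m s s h h) (blk m s (s + h) h i) (blk m (s + h) s i h)
        (blk m (s + h) (s + h) i i)).submatrix finSumFinEquiv.symm finSumFinEquiv.symm := by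
  rw [← blk_submatrix, Matrix.submatrix_submatrix]; simp

theorem blk_congr {m m' : ℕ → ℕ → F} {r c a b : ℕ}
    (h : ∀ i j, r ≤ i → i < r + a → c ≤ j → j < c + b → m i j = m' i j) :
    blk m r c a b = blk m' r c a b := by
  ext i j
  exact h _ _ (by omega) (by omega) (by omega) (by omega)

/-- The six products are ordered so that no operand is overwritten before its last use; in
particular, the lower right block is scaled only at the end. -/
theorem invPost_blk (h s : ℕ) (α β : F) (m : ℕ → ℕ → F) :
    blk (invPost h s α β m) s s h h = β • blk m s s h h +
        blk m s (s + h) h h * blk m (s + h) (s + h) h h * (blk m (s + h) s h h * blk m s s h h) ∧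
    blk (invPost h s α β m) s (s + h) h h =
      -α • (blk m s (s + h) h h * blk m (s + h) (s + h) h h) ∧
    blk (invPost h s α β m) (s + h) s h h =
      -α • (blk m (s + h) (s + h) h h * (blk m (s + h) s h h * blk m s s h h)) ∧
    blk (invPost h s α β m) (s + h) (s + h) h h = (α * α) • blk m (s + h) (s + h) h h := by
  have e : s + h + h ≤ s + h ∨ True := Or.inr trivial
  unfold invPost
  refine ⟨?_, ?_, ?_, ?_⟩
  all_goals
    repeat first
      | rw [blk_gemm _ _ _ _ _ _ _ _ _ _ le_rfl le_rfl]
      | rw [blk_gemm_ne (by omega)]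
    try simp

theorem invMid_blk (h s : ℕ) (α : F) (m : ℕ → ℕ → F) {i : ℕ} (hi : i ≤ h) :
    blk (invMid h s α m) (s + h) (s + h) i i = α • blk m (s + h) (s + h) i i -
      blk m (s + h) s i h * (blk m s s h h * blk m s (s + h) h i) ∧
    blk (invMid h s α m) s s h h = blk m s s h h ∧
    blk (invMid h s α m) s (s + h) h h = blk m s s h h * blk m s (s + h) h h ∧
    blk (invMid h s α m) (s + h) s h h = blk m (s + h) s h h := by
  unfold invMid
  refine ⟨?_, ?_, ?_, ?_⟩
  · rw [blk_gemm _ _ _ _ _ _ _ _ _ _ hi hi, blk_gemm_ne (by omega), blk_gemm_ne (by omega),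
      blk_gemm _ _ _ _ _ _ _ _ _ _ le_rfl hi]
    simp [sub_eq_add_neg]
  all_goals
    repeat first
      | rw [blk_gemm _ _ _ _ _ _ _ _ _ _ le_rfl le_rfl]
      | rw [blk_gemm_ne (by omega)]
    try simp

/-- The usual inversion through the Schur complement with denominators cleared: `α • D - C * (A' *
B)` is `α` times the Schur complement. Only right inverses enter, so the identity is polynomial and
survives when `α` or `β` vanishes. -/
theorem mul_fromBlocks_inv {n : Type*} [Fintype n] [DecidableEq n] {A B C D A' D' : Matrix n n F}
    {α β : F} (hA : A * A' = α • (1 : Matrix n n F))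
    (hD : (α • D - C * (A' * B)) * D' = β • (1 : Matrix n n F)) :
    Matrix.fromBlocks A B C D * Matrix.fromBlocks (β • A' + A' * B * D' * (C * A'))
      (-α • (A' * B * D')) (-α • (D' * (C * A'))) ((α * α) • D') =
      (α * β) • (1 : Matrix (n ⊕ n) (n ⊕ n) F) := by
  have h1 : A * (A' * B * D') = α • (B * D') := by
    rw [← mul_assoc, ← mul_assoc, hA]; simp
  have h2 : α • (D * D') = β • (1 : Matrix n n F) + C * (A' * B * D') := by
    rw [← hD]; simp only [sub_mul, smul_mul_assoc, mul_assoc]; abel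
  rw [Matrix.fromBlocks_multiply, ← Matrix.fromBlocks_one, Matrix.fromBlocks_smul]
  congr 1
  · rw [mul_add, ← mul_assoc A _ (C * A'), h1, mul_smul_comm, hA]
    simp only [smul_mul_assoc, mul_smul_comm, mul_assoc, smul_smul, mul_comm β α, neg_smul,
      mul_neg, neg_one_smul]
    abel
  · rw [mul_smul_comm, h1]
    simp [smul_smul]
  · rw [mul_add, ← mul_assoc C _ (C * A'), mul_smul_comm, mul_smul_comm, neg_smul, ← mul_assoc D,
      ← smul_mul_assoc α (D * D'), h2, add_mul]
    simp
  · rw [mul_smul_comm, mul_smul_comm, mul_smul, h2]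
    simp [smul_smul]

/-- No invertibility is assumed, so the program never tests for singular blocks. A failure shows
itself only in a vanishing scale. -/
theorem blockInv_mul (j : ℕ) : ∀ (s : ℕ) (m : ℕ → ℕ → F) (d : ℕ → F),
    blk m s s (2 ^ j) (2 ^ j) * blk (blockInv j s (m, d)).1 s s (2 ^ j) (2 ^ j) =
      (blockInv j s (m, d)).2 s • (1 : Matrix (Fin (2 ^ j)) (Fin (2 ^ j)) F) := by
  induction j with
  | zero =>
    intro s m d
    ext a b
    have ha : a = 0 := by have := a.2; ext; simp at this ⊢
    have hb : b = 0 := by have := b.2; ext; simp at this ⊢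
    subst ha hb
    simp [blockInv, blk, Matrix.mul_apply]
  | succ j ih =>
    intro s m d
    rw [pow_succ, mul_two]
    set h := 2 ^ j with hh
    have hpos : 0 < h := by positivity
    set r := blockInv j s (m, d) with hr
    have hr' : ∀ a b, ¬(s ≤ a ∧ a < s + h ∧ s ≤ b ∧ b < s + h) → r.1 a b = m a b :=
      (blockInv_of_outside j s m d).1
    set r₁ := invMid h s (r.2 s) r.1 with hr₁
    set r₂ := blockInv j (s + h) (r₁, r.2) with hr₂
    have hr₂' : ∀ a b, ¬(s + h ≤ a ∧ a < s + h + h ∧ s + h ≤ b ∧ b < s + h + h) →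
      r₂.1 a b = r₁ a b := (blockInv_of_outside j (s + h) r₁ r.2).1
    have hd : r₂.2 s = r.2 s := (blockInv_of_outside j (s + h) r₁ r.2).2 s (by omega)
    have hA := ih s m d
    have hD := ih (s + h) r₁ r.2
    rw [← hr] at hA
    rw [← hr₂] at hD
    have e : blockInv (j + 1) s (m, d) = (invPost h s (r₂.2 s) (r₂.2 (s + h)) r₂.1,
      Function.update r₂.2 s (r₂.2 s * r₂.2 (s + h))) := rfl
    rw [e]
    simp only [Function.update_self]
    obtain ⟨p1, p2, p3, p4⟩ := invPost_blk h s (r₂.2 s) (r₂.2 (s + h)) r₂.1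
    obtain ⟨q1, q2, q3, q4⟩ := invMid_blk h s (r.2 s) r.1 (le_refl h)
    have c1 : blk r₂.1 s s h h = blk r.1 s s h h := by
      rw [← q2]; exact blk_congr fun i j _ _ _ _ => hr₂' i j (by omega)
    have c2 : blk r₂.1 s (s + h) h h = blk r.1 s s h h * blk m s (s + h) h h := by
      rw [← blk_congr (m := r.1) (m' := m) (fun i j _ _ _ _ => hr' i j (by omega)), ← q3]
      exact blk_congr fun i j _ _ _ _ => hr₂' i j (by omega)
    have c3 : blk r₂.1 (s + h) s h h = blk m (s + h) s h h := by
      rw [← blk_congr (m := r.1) (m' := m) (fun i j _ _ _ _ => hr' i j (by omega)), ← q4]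
      exact blk_congr fun i j _ _ _ _ => hr₂' i j (by omega)
    have c4 : blk r₁ (s + h) (s + h) h h = r.2 s • blk m (s + h) (s + h) h h -
        blk m (s + h) s h h * (blk r.1 s s h h * blk m s (s + h) h h) := by
      rw [hr₁, q1, blk_congr (m := r.1) (m' := m) (r := s + h) (c := s + h)
        (fun i j _ _ _ _ => hr' i j (by omega)),
        blk_congr (m := r.1) (m' := m) (r := s + h) (c := s) (fun i j _ _ _ _ => hr' i j (by omega)),
        blk_congr (m := r.1) (m' := m) (r := s) (c := s + h) (fun i j _ _ _ _ => hr' i j (by omega))]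
    rw [c4] at hD
    have key := mul_fromBlocks_inv hA hD
    rw [blk_eq_submatrix, blk_eq_submatrix, Matrix.submatrix_mul_equiv, p1, p2, p3, p4, c1, c2, c3, hd, key]
    ext a b
    simp [Matrix.one_apply]

/-- The scale is the product of the scales of the two halves. The leading minors of the scaled Schur
complement are, up to powers of `α`, quotients of leading minors of the whole matrix, so the
hypothesis passes to the second half. -/
theorem blockInv_ne_zero (j : ℕ) : ∀ (s : ℕ) (m : ℕ → ℕ → F) (d : ℕ → F),
    (∀ i ≤ 2 ^ j, (blk m s s i i).det ≠ 0) → (blockInv j s (m, d)).2 s ≠ 0 := by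
  induction j with
  | zero =>
    intro s m d h
    have := h 1 le_rfl
    simpa [blockInv, blk] using this
  | succ j ih =>
    intro s m d hmin
    rw [pow_succ, mul_two] at hmin
    set h := 2 ^ j with hh
    have hpos : 0 < h := by positivity
    set r := blockInv j s (m, d) with hr
    have hr' : ∀ a b, ¬(s ≤ a ∧ a < s + h ∧ s ≤ b ∧ b < s + h) → r.1 a b = m a b :=
      (blockInv_of_outside j s m d).1
    set r₁ := invMid h s (r.2 s) r.1 with hr₁
    set r₂ := blockInv j (s + h) (r₁, r.2) with hr₂
    have hd : r₂.2 s = r.2 s := (blockInv_of_outside j (s + h) r₁ r.2).2 s (by omega)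
    have e : blockInv (j + 1) s (m, d) = (invPost h s (r₂.2 s) (r₂.2 (s + h)) r₂.1,
      Function.update r₂.2 s (r₂.2 s * r₂.2 (s + h))) := rfl
    rw [e]
    simp only [Function.update_self]
    have hα : r.2 s ≠ 0 := ih s m d fun i hi => hmin i (by omega)
    have hA := blockInv_mul j s m d
    rw [← hr] at hA
    refine mul_ne_zero (hd ▸ hα) (ih (s + h) r₁ r.2 fun i hi => ?_)
    obtain ⟨q1, -, -, -⟩ := invMid_blk h s (r.2 s) r.1 hi
    rw [hr₁, q1, blk_congr (m := r.1) (m' := m) (r := s + h) (c := s + h)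
        (fun i j _ _ _ _ => hr' i j (by omega)),
        blk_congr (m := r.1) (m' := m) (r := s + h) (c := s) (fun i j _ _ _ _ => hr' i j (by omega)),
        blk_congr (m := r.1) (m' := m) (r := s) (c := s + h) (fun i j _ _ _ _ => hr' i j (by omega))]
    have hi' := hmin (h + i) (by omega)
    rw [← Matrix.det_submatrix_equiv_self finSumFinEquiv, blk_submatrix] at hi'
    -- With the computed block as the chosen inverse, `⅟` unfolds to it by `rfl`, and the
    -- determinant formula speaks of the matrix that the algorithm uses.
    letI : Invertible (blk m s s h h) := invertibleOfRightInverse (blk m s s h h)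
      ((r.2 s)⁻¹ • blk r.1 s s h h) (by
        rw [mul_smul_comm, hA, smul_smul, inv_mul_cancel₀ hα, one_smul])
    rw [Matrix.det_fromBlocks₁₁] at hi'
    have hinv : ⅟(blk m s s h h) = (r.2 s)⁻¹ • blk r.1 s s h h := rfl
    have : r.2 s • blk m (s + h) (s + h) i i -
        blk m (s + h) s i h * (blk r.1 s s h h * blk m s (s + h) h i) =
        r.2 s • (blk m (s + h) (s + h) i i - blk m (s + h) s i h * ⅟(blk m s s h h) *
          blk m s (s + h) h i) := by
      rw [hinv, smul_sub, Matrix.mul_smul, Matrix.smul_mul, smul_smul, mul_inv_cancel₀ hα, one_smul,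
        Matrix.mul_assoc]
    rw [this, Matrix.det_smul]
    exact mul_ne_zero (pow_ne_zero _ hα) (right_ne_zero_of_mul hi')

end BlockInversion


/-! ### The inversion as a loop without a stack -/

/-- The offset of one of the four blocks of size `h` (variable `3`) that start in row and column
`s` (variable `20`). -/
def corner (a b : ℕ) : Ex :=
  (.var 20 + .lit a * .var 3) * .var 2 + (.var 20 + .lit b * .var 3)

/-- Apply `gemm` to three of these blocks. -/
def callGemm (P : Program) (xa xb ya yb za zb : ℕ) (x y : Ex) : Cmd :=
  .asg 4 (corner xa xb) ;; .asg 5 (corner ya yb) ;; .asg 6 (corner za zb) ;; .asg 7 x ;;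
    .asg 8 y ;; gemm P

theorem callGemm_noV (P : Program) (xa xb ya yb za zb : ℕ) (x y : Ex) {z : ℕ}
    (h : z < 4 ∨ 17 < z) : (callGemm P xa xb ya yb za zb x y).NoV z := by
  have := gemm_noV P (x := z) (by omega)
  simp [callGemm, this]; omega

theorem callGemm_noA (P : Program) (xa xb ya yb za zb : ℕ) (x y : Ex) {z : ℕ}
    (h : 3 < z) : (callGemm P xa xb ya yb za zb x y).NoA z := by
  simp [callGemm, gemm_noA P h]

theorem callGemm_noR (P : Program) (xa xb ya yb za zb : ℕ) (x y : Ex) :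
    (callGemm P xa xb ya yb za zb x y).NoR := by
  simp [callGemm, gemm_noR P]

/-- Modulus, stride, the matrix in array `3`, the denominators in array `4`; the memory of the
interpreter is zero. -/
structure MatSt {p : ℕ} (σ : St) (Q : ℕ) (m : ℕ → ℕ → ZMod p) (d : ℕ → ZMod p) : Prop where
  mat : HoldsMat (σ.h 3) Q m
  den : ∀ i < Q, σ.h 4 i = (d i).val
  sim : ∀ a, σ.h 0 a = 0
  mod : σ.v 1 = p
  str : σ.v 2 = Q

theorem MatSt.congr {p : ℕ} {σ σ' : St} {Q : ℕ} {m : ℕ → ℕ → ZMod p} {d : ℕ → ZMod p}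
    (h : MatSt σ Q m d) (hh : σ'.h = σ.h) (h1 : σ'.v 1 = σ.v 1) (h2 : σ'.v 2 = σ.v 2) :
    MatSt σ' Q m d :=
  ⟨hh ▸ h.mat, hh ▸ h.den, hh ▸ h.sim, h1.trans h.mod, h2.trans h.str⟩

theorem callGemm_runs {P : Program} {κ : ℕ} {tm : ℕ → ℕ} (hP : MulProgram P κ tm) {E : Env}
    {p h Q s : ℕ} [hp : Fact p.Prime] (hf : MulFit P κ tm E.V p h) (hh : 1 ≤ h) (hQ : Q * Q ≤ E.V)
    {σ : St} {m : ℕ → ℕ → ZMod p} {d : ℕ → ZMod p} (hm : MatSt σ Q m d) (h3 : σ.v 3 = h)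
    (h20 : σ.v 20 = s) (hs : s + (h + h) ≤ Q) {xa xb ya yb za zb : ℕ} (hxa : xa ≤ 1) (hxb : xb ≤ 1)
    (hya : ya ≤ 1) (hyb : yb ≤ 1) (hza : za ≤ 1) (hzb : zb ≤ 1) {x y : Ex} {X Y : ℕ}
    (hX : X < E.V) (hY : Y < E.V)
    (hx : ∀ σ' : St, (∀ z, z < 4 ∨ 8 < z → σ'.v z = σ.v z) → x.eval E.inp σ' = X)
    (hy : ∀ σ' : St, (∀ z, z < 4 ∨ 8 < z → σ'.v z = σ.v z) → y.eval E.inp σ' = Y) :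
    Runs E (callGemm P xa xb ya yb za zb x y) σ (gemmTime P tm h + 5) fun σ' =>
      MatSt σ' Q (blockGemm h (s + xa * h) (s + xb * h) (s + ya * h) (s + yb * h) (s + za * h)
        (s + zb * h) X Y m) d ∧ ∀ z, z < 4 ∨ 17 < z → σ'.v z = σ.v z := by
  have hb : ∀ a ≤ 1, s + a * h + h ≤ Q := by
    intro a ha
    have : a * h ≤ 1 * h := Nat.mul_le_mul_right _ ha
    omega
  have hc : ∀ a b, a ≤ 1 → b ≤ 1 → (s + a * h) * Q + (s + b * h) < E.V := fun a b ha hb' =>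
    (idx_lt (Q := Q) (N := Q) (by have := hb a ha; omega) (by have := hb b hb'; omega)).trans_le hQ
  have ev : ∀ (σ' : St) a b, σ'.v 2 = σ.v 2 → σ'.v 3 = σ.v 3 → σ'.v 20 = σ.v 20 →
      (corner a b).eval E.inp σ' = (s + a * h) * Q + (s + b * h) := by
    intro σ' a b e2 e3 e20
    simp [corner, e2, e3, e20, h3, h20, hm.str]
  refine (Runs.asg_seq ?_ (Runs.asg_seq ?_ (Runs.asg_seq ?_ (Runs.asg_seq ?_ (Runs.asg_seq ?_
    (gemm_runs (h := h) hP hf hh m (s + xa * h) (s + xb * h) (s + ya * h) (s + yb * h) (s + za * h)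
      (s + zb * h) (X : ZMod p) (Y : ZMod p) ?_ ?_ ?_ ?_ ?_ ?_ ?_ ?_ ?_ ?_ (hb _ hxa) (hb _ hxb)
      (hb _ hya) (hb _ hyb) (hb _ hza) (hb _ hzb))))))).mono le_rfl ?_
  · rw [ev _ _ _ rfl rfl rfl]; exact hc _ _ hxa hxb
  · rw [ev _ _ _ (by simp) (by simp) (by simp)]; exact hc _ _ hya hyb
  · rw [ev _ _ _ (by simp) (by simp) (by simp)]; exact hc _ _ hza hzb
  · rw [hx]
    · exact hX
    · intro z hz
      have h4 : z ≠ 4 := by omega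
      have h5 : z ≠ 5 := by omega
      have h6 : z ≠ 6 := by omega
      have h7 : z ≠ 7 := by omega
      have h8 : z ≠ 8 := by omega
      simp [h4, h5, h6, h7, h8]
  · rw [hy]
    · exact hY
    · intro z hz
      have h4 : z ≠ 4 := by omega
      have h5 : z ≠ 5 := by omega
      have h6 : z ≠ 6 := by omega
      have h7 : z ≠ 7 := by omega
      have h8 : z ≠ 8 := by omega
      simp [h4, h5, h6, h7, h8]
  · exact hm.mat
  · exact hm.sim
  · simp [hm.mod]
  · simp [hm.str]
  · simp [h3]
  · simp only [St.set_v]; norm_num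
    rw [ev _ _ _ (by simp) (by simp) (by simp)]
  · simp only [St.set_v]; norm_num
    rw [ev _ _ _ (by simp) (by simp) (by simp)]
  · simp only [St.set_v]; norm_num
    rw [ev _ _ _ (by simp) (by simp) (by simp)]
  · simp only [St.set_v]; norm_num
    rw [hx]
    · intro z hz
      have h4 : z ≠ 4 := by omega
      have h5 : z ≠ 5 := by omega
      have h6 : z ≠ 6 := by omega
      have h7 : z ≠ 7 := by omega
      have h8 : z ≠ 8 := by omega
      simp [h4, h5, h6, h7, h8]
  · simp only [St.set_v]; norm_num
    rw [hy]
    · intro z hz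
      have h4 : z ≠ 4 := by omega
      have h5 : z ≠ 5 := by omega
      have h6 : z ≠ 6 := by omega
      have h7 : z ≠ 7 := by omega
      have h8 : z ≠ 8 := by omega
      simp [h4, h5, h6, h7, h8]
  · rintro σ' ⟨g1, g2⟩ hfr
    have hv : ∀ z, z < 4 ∨ 17 < z → σ'.v z = σ.v z :=
      fun z hz => hfr.v z (callGemm_noV _ _ _ _ _ _ _ _ _ hz)
    refine ⟨⟨g1, ?_, g2, (hv 1 (by omega)).trans hm.mod, (hv 2 (by omega)).trans hm.str⟩, hv⟩
    rw [hfr.h 4 (callGemm_noA _ _ _ _ _ _ _ _ _ (by omega))]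
    exact hm.den

/-- The middle step of the inversion. -/
def invMidCmd (P : Program) : Cmd :=
  .asg 24 (.ld 4 (.var 20)) ;; callGemm P 0 1 0 0 0 1 0 1 ;;
    callGemm P 1 1 1 0 0 1 (.var 24) (.var 1 - 1) ;; .asg 20 (.var 20 + .var 3) ;; .asg 22 0

/-- The final step of the inversion. -/
def invPostCmd (P : Program) : Cmd :=
  .asg 20 (.var 20 - .var 3) ;; .asg 24 (.ld 4 (.var 20)) ;; .asg 25 (.ld 4 (.var 20 + .var 3)) ;;
    callGemm P 1 0 1 0 0 0 0 1 ;; callGemm P 0 1 0 1 1 1 0 1 ;;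
    callGemm P 0 0 0 1 1 0 (.var 25) 1 ;; callGemm P 1 0 1 1 1 0 0 (.var 1 - .var 24) ;;
    callGemm P 0 1 0 0 0 0 (.var 1 - .var 24) 0 ;;
    callGemm P 1 1 0 0 0 0 (.var 24 * .var 24 % .var 1) 0 ;;
    .sto 4 (.var 20) (.var 24 * .var 25 % .var 1) ;; .asg 3 (.var 3 + .var 3)

/-- The inversion of a block of size one. -/
def invLeafCmd : Cmd :=
  .sto 4 (.var 20) (.ld 3 (.var 20 * .var 2 + .var 20)) ;;
    .sto 3 (.var 20 * .var 2 + .var 20) 1 ;; .asg 22 1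

/-- One step of the traversal of the recursion tree: variable `22` is zero on the way down. -/
def invStep (P : Program) : Cmd :=
  .ite (1 - .var 22) (.ite (.var 3 - 1) (.asg 3 (.var 3 / 2)) invLeafCmd)
    (.ite (.var 20 / .var 3 % 2) (invPostCmd P) (invMidCmd P))

/-- The inversion of the upper left block whose size, a power of two, is in variable `23`. -/
def invCmd (P : Program) : Cmd :=
  .asg 20 0 ;; .asg 3 (.var 23) ;; .asg 22 0 ;;
    .loop ((1 - .var 22) + (.var 23 - .var 3)) (invStep P)

theorem invCmd_noV (P : Program) {x : ℕ} (h : x < 3 ∨ 17 < x ∧ x < 20 ∨ x = 23 ∨ 25 < x) :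
    (invCmd P).NoV x := by
  have := fun a b c d e f x' y' => callGemm_noV P a b c d e f x' y' (z := x) (by omega)
  simp [invCmd, invStep, invLeafCmd, invPostCmd, invMidCmd, this]; omega

theorem invCmd_noA (P : Program) {x : ℕ} (h : 4 < x) : (invCmd P).NoA x := by
  have := fun a b c d e f x' y' => callGemm_noA P a b c d e f x' y' (z := x) (by omega)
  simp [invCmd, invStep, invLeafCmd, invPostCmd, invMidCmd, this]; omega

theorem invCmd_noR (P : Program) : (invCmd P).NoR := by
  simp [invCmd, invStep, invLeafCmd, invPostCmd, invMidCmd, callGemm_noR P]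

/-- The time of the inversion of a matrix of size `2 ^ j`. -/
def invTime (P : Program) (tm : ℕ → ℕ) : ℕ → ℕ
  | 0 => 6
  | j + 1 => 2 * invTime P tm j + 8 * gemmTime P tm (2 ^ j) + 60

section
variable {P : Program} {κ : ℕ} {tm : ℕ → ℕ} {E : Env} {p h Q s : ℕ} [hp : Fact p.Prime] {σ : St}
  {m : ℕ → ℕ → ZMod p} {d : ℕ → ZMod p}

theorem val_mul_mod (a b : ZMod p) : a.val * b.val % p = (a * b).val := (ZMod.val_mul a b).symm

theorem cast_sub_val (a : ZMod p) : ((p - a.val : ℕ) : ZMod p) = -a := by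
  rw [Nat.cast_sub (ZMod.val_lt a).le]; simp

theorem invMidCmd_runs (hP : MulProgram P κ tm) (hf : MulFit P κ tm E.V p h) (hh : 1 ≤ h)
    (hQ : Q * Q ≤ E.V) (hm : MatSt σ Q m d) (h3 : σ.v 3 = h) (h20 : σ.v 20 = s)
    (hs : s + (h + h) ≤ Q) :
    Runs E (invMidCmd P) σ (2 * gemmTime P tm h + 13) fun σ' =>
      MatSt σ' Q (invMid h s (d s) m) d ∧ σ'.v 20 = s + h ∧ σ'.v 22 = 0 ∧
        ∀ z, z < 4 ∨ z = 23 → σ'.v z = σ.v z := by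
  have hV1 : 1 < E.V := hp.out.one_lt.trans hf.prime
  have hval : ∀ z : ZMod p, z.val < E.V := fun z => (ZMod.val_lt z).trans hf.prime
  have hds : (Ex.ld 4 (.var 20)).eval E.inp σ = (d s).val := by
    simp [h20, hm.den s (by omega)]
  have hp1 := hp.out.one_lt
  have b0 : (0 : ℕ) ≤ 1 := by norm_num
  have b1 : (1 : ℕ) ≤ 1 := le_rfl
  have hV0 : 0 < E.V := by omega
  have hsV : s + h < E.V := by
    have : 2 * Q ≤ Q * Q := Nat.mul_le_mul_right _ (by omega)
    omega
  set σ₀ : St := σ.set 24 (d s).val with hσ₀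
  refine Runs.time (s := (gemmTime P tm h + 5) + ((gemmTime P tm h + 5) + (1 + 1)) + 1) ?_
    (by omega)
  refine Runs.asg_seq (by rw [hds]; exact hval _) ?_
  rw [hds, ← hσ₀]
  have v24 : σ₀.v 24 = (d s).val := by simp [hσ₀]
  have v3 : σ₀.v 3 = h := by simp [hσ₀, h3]
  have v20 : σ₀.v 20 = s := by simp [hσ₀, h20]
  have hm₀ : MatSt σ₀ Q m d := hm.congr rfl (by simp [hσ₀]) (by simp [hσ₀])
  have hmod : σ₀.v 1 = p := hm₀.mod
  refine Runs.seq (callGemm_runs hP hf hh hQ (X := 0) (Y := 1) hm₀ v3 v20 hs b0 b1 b0 b0 b0 b1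
    hV0 hV1 (fun _ _ => rfl) (fun _ _ => rfl)) fun σ₁ g₁ _ => ?_
  refine Runs.seq (callGemm_runs hP hf hh hQ (X := (d s).val) (Y := p - 1) g₁.1
    (by rw [g₁.2 _ (by omega), v3]) (by rw [g₁.2 _ (by omega), v20]) hs b1 b1 b1 b0 b0 b1
    (hval _) (by have := hf.prime; omega) (fun σ' h' => by simp [h', g₁.2, v24])
    (fun σ' h' => by simp [h', g₁.2, hmod])) fun σ₂ g₂ _ => ?_
  have w : ∀ z, z < 4 ∨ 17 < z → σ₂.v z = σ₀.v z := fun z hz => (g₂.2 z hz).trans (g₁.2 z hz)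
  refine Runs.asg_seq ?_ (Runs.asg ?_ ⟨?_, ?_, ?_, ?_⟩)
  · simpa [w, v3, v20] using hsV
  · simpa using hV0
  · refine MatSt.congr (σ := σ₂) ?_ rfl (by simp) (by simp)
    have := g₂.1
    simp only [zero_mul, one_mul, add_zero, ZMod.natCast_zmod_val, Nat.cast_zero,
      Nat.cast_one, Nat.cast_sub hp1.le, ZMod.natCast_self, zero_sub] at this
    exact this
  · simp [w, v3, v20]
  · simp
  · intro z hz
    have a1 : z ≠ 22 := by omega
    have a2 : z ≠ 20 := by omega
    have a3 : z ≠ 24 := by omega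
    simp [a1, a2, w z (by omega), hσ₀, a3]

theorem invPostCmd_runs (hP : MulProgram P κ tm) (hf : MulFit P κ tm E.V p h) (hh : 1 ≤ h)
    (hQ : Q * Q ≤ E.V) (hm : MatSt σ Q m d) (h3 : σ.v 3 = h) (h20 : σ.v 20 = s + h)
    (hs : s + (h + h) ≤ Q) :
    Runs E (invPostCmd P) σ (6 * gemmTime P tm h + 35) fun σ' =>
      MatSt σ' Q (invPost h s (d s) (d (s + h)) m) (Function.update d s (d s * d (s + h))) ∧
        σ'.v 20 = s ∧ σ'.v 3 = h + h ∧ ∀ z, z < 3 ∨ z = 22 ∨ z = 23 → σ'.v z = σ.v z := by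
  have hV1 : 1 < E.V := hp.out.one_lt.trans hf.prime
  have hV0 : 0 < E.V := by omega
  have hval : ∀ z : ZMod p, z.val < E.V := fun z => (ZMod.val_lt z).trans hf.prime
  have hsub : ∀ z : ZMod p, p - z.val < E.V := fun z => by have := hf.prime; omega
  have hQ' : 2 * Q ≤ Q * Q := Nat.mul_le_mul_right _ (by omega)
  set σ₀ : St := ((σ.set 20 s).set 24 (d s).val).set 25 (d (s + h)).val with hσ₀
  have b0 : (0 : ℕ) ≤ 1 := by norm_num
  have b1 : (1 : ℕ) ≤ 1 := le_rfl
  refine Runs.time (s := (gemmTime P tm h + 5) + ((gemmTime P tm h + 5) + ((gemmTime P tm h + 5) +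
    ((gemmTime P tm h + 5) + ((gemmTime P tm h + 5) + ((gemmTime P tm h + 5) + (1 + 1)))))) +
      1 + 1 + 1) ?_ (by omega)
  have e0 : Ex.eval E.inp σ (.var 20 - .var 3) = s := by simp [h3, h20]
  have e1 : Ex.eval E.inp (σ.set 20 s) (.ld 4 (.var 20)) = (d s).val := by
    simp [hm.den s (by omega)]
  have e2 : Ex.eval E.inp ((σ.set 20 s).set 24 (d s).val) (.ld 4 (.var 20 + .var 3)) =
      (d (s + h)).val := by
    simp [h3, hm.den (s + h) (by omega)]
  refine Runs.asg_seq (by rw [e0]; omega) ?_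
  rw [e0]
  refine Runs.asg_seq (by rw [e1]; exact hval _) ?_
  rw [e1]
  refine Runs.asg_seq (by rw [e2]; exact hval _) ?_
  rw [e2, ← hσ₀]
  have v24 : σ₀.v 24 = (d s).val := by simp [hσ₀]
  have v25 : σ₀.v 25 = (d (s + h)).val := by simp [hσ₀]
  have v3 : σ₀.v 3 = h := by simp [hσ₀, h3]
  have v20 : σ₀.v 20 = s := by simp [hσ₀]
  have hm₀ : MatSt σ₀ Q m d := hm.congr rfl (by simp [hσ₀]) (by simp [hσ₀])
  refine Runs.seq (callGemm_runs hP hf hh hQ (X := 0) (Y := 1) hm₀ v3 v20 hs b1 b0 b1 b0 b0 b0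
    hV0 hV1 (fun _ _ => rfl) (fun _ _ => rfl)) fun σ₁ g₁ _ => ?_
  have w₁ : ∀ z, z < 4 ∨ 17 < z → σ₁.v z = σ₀.v z := g₁.2
  refine Runs.seq (callGemm_runs hP hf hh hQ (X := 0) (Y := 1) g₁.1 (by rw [w₁ _ (by omega), v3])
    (by rw [w₁ _ (by omega), v20]) hs b0 b1 b0 b1 b1 b1
    hV0 hV1 (fun _ _ => rfl) (fun _ _ => rfl)) fun σ₂ g₂ _ => ?_
  have w₂ : ∀ z, z < 4 ∨ 17 < z → σ₂.v z = σ₀.v z := fun z hz => (g₂.2 z hz).trans (w₁ z hz)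
  refine Runs.seq (callGemm_runs hP hf hh hQ (X := (d (s + h)).val) (Y := 1) g₂.1
    (by rw [w₂ _ (by omega), v3]) (by rw [w₂ _ (by omega), v20]) hs b0 b0 b0 b1 b1 b0
    (hval _) hV1 (fun σ' h' => by simp [h', w₂, v25]) (fun _ _ => rfl)) fun σ₃ g₃ _ => ?_
  have w₃ : ∀ z, z < 4 ∨ 17 < z → σ₃.v z = σ₀.v z := fun z hz => (g₃.2 z hz).trans (w₂ z hz)
  have hmod : σ₀.v 1 = p := hm₀.mod
  refine Runs.seq (callGemm_runs hP hf hh hQ (X := 0) (Y := p - (d s).val) g₃.1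
    (by rw [w₃ _ (by omega), v3]) (by rw [w₃ _ (by omega), v20]) hs b1 b0 b1 b1 b1 b0
    hV0 (hsub _) (fun _ _ => rfl) (fun σ' h' => by simp [h', w₃, v24, hmod])) fun σ₄ g₄ _ => ?_
  have w₄ : ∀ z, z < 4 ∨ 17 < z → σ₄.v z = σ₀.v z := fun z hz => (g₄.2 z hz).trans (w₃ z hz)
  refine Runs.seq (callGemm_runs hP hf hh hQ (X := p - (d s).val) (Y := 0) g₄.1
    (by rw [w₄ _ (by omega), v3]) (by rw [w₄ _ (by omega), v20]) hs b0 b1 b0 b0 b0 b0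
    (hsub _) hV0 (fun σ' h' => by simp [h', w₄, v24, hmod]) (fun _ _ => rfl)) fun σ₅ g₅ _ => ?_
  have w₅ : ∀ z, z < 4 ∨ 17 < z → σ₅.v z = σ₀.v z := fun z hz => (g₅.2 z hz).trans (w₄ z hz)
  refine Runs.seq (callGemm_runs hP hf hh hQ (X := (d s * d s).val) (Y := 0) g₅.1
    (by rw [w₅ _ (by omega), v3]) (by rw [w₅ _ (by omega), v20]) hs b1 b1 b0 b0 b0 b0
    (hval _) hV0 (fun σ' h' => by simp [h', w₅, v24, hmod, val_mul_mod]) (fun _ _ => rfl))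
    fun σ₆ g₆ _ => ?_
  have w₆ : ∀ z, z < 4 ∨ 17 < z → σ₆.v z = σ₀.v z := fun z hz => (g₆.2 z hz).trans (w₅ z hz)
  have e6 : Ex.eval E.inp σ₆ (.var 24 * .var 25 % .var 1) = (d s * d (s + h)).val := by
    simp [w₆, v24, v25, hmod, val_mul_mod]
  refine Runs.sto_seq (by rw [e6]; exact hval _) (Runs.asg ?_ ⟨⟨?_, ?_, ?_, ?_, ?_⟩, ?_, ?_, ?_⟩)
  · simp only [Ex.eval_add, Ex.eval_var, St.put_v, w₆ 3 (by omega), v3]; omega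
  · have := g₆.1.mat
    simp only [zero_mul, one_mul, add_zero, ZMod.natCast_zmod_val, cast_sub_val, Nat.cast_zero,
      Nat.cast_one] at this
    simpa [invPost] using this
  · intro i hi
    simp only [St.set_h, St.put_h_same, Ex.eval_var, w₆ 20 (by omega), v20, e6,
      Function.update_apply]
    split_ifs
    · rfl
    · exact g₆.1.den i hi
  · simpa using g₆.1.sim
  · simpa using g₆.1.mod
  · simpa using g₆.1.str
  · simp [w₆, v20]
  · simp [w₆, v3]
  · intro z hz
    have a1 : z ≠ 3 := by omega
    have a2 : z ≠ 20 := by omega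
    have a3 : z ≠ 24 := by omega
    have a4 : z ≠ 25 := by omega
    simp [a1, w₆ z (by omega), hσ₀, a2, a3, a4]

theorem invStep_down {R : St → Prop} (h22 : σ.v 22 = 0) (h3 : σ.v 3 ≠ 1 ∧ σ.v 3 ≠ 0)
    (hV : σ.v 3 / 2 < E.V) (h : R (σ.set 3 (σ.v 3 / 2))) : Runs E (invStep P) σ 3 R := by
  refine Runs.ite (t := 2) (fun _ => Runs.ite (t := 1) (fun _ => Runs.asg (by simpa using hV)
    (by simpa using h)) (fun h => ?_)) (fun h => ?_)
  · simp at h; omega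
  · simp [h22] at h

theorem invStep_mid {R : St → Prop} {t : ℕ} (h22 : σ.v 22 = 1) (hd : σ.v 20 / σ.v 3 % 2 = 0)
    (h : Runs E (invMidCmd P) σ t R) : Runs E (invStep P) σ (t + 2) R := by
  refine Runs.ite (t := t + 1) (fun h => ?_) (fun _ => Runs.ite (t := t) (fun h => ?_) fun _ => h)
  · simp [h22] at h
  · simp [hd] at h

theorem invStep_post {R : St → Prop} {t : ℕ} (h22 : σ.v 22 = 1) (hd : σ.v 20 / σ.v 3 % 2 = 1)
    (h : Runs E (invPostCmd P) σ t R) : Runs E (invStep P) σ (t + 2) R := by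
  refine Runs.ite (t := t + 1) (fun h => ?_) (fun _ => Runs.ite (t := t) (fun _ => h) fun h => ?_)
  · simp [h22] at h
  · simp [hd] at h

/-- The position in the recursion tree is determined by the block size, the offset `s` and the
direction, so no stack is kept. To allow induction on the level, the statement is in continuation
form: whatever the loop does after the block of size `2 ^ j` is finished, in time `t`, it does here
with `invTime P tm j` added. -/
theorem invLoop_runs (hP : MulProgram P κ tm) {lev : ℕ}
    (hf : ∀ j < lev, MulFit P κ tm E.V p (2 ^ j)) (hlev : 2 ^ lev ≤ Q) (hQ : Q * Q ≤ E.V)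
    (hpV : p < E.V) (j : ℕ) :
    ∀ (s : ℕ) (σ : St) (m : ℕ → ℕ → ZMod p) (d : ℕ → ZMod p) (t : ℕ) (R : St → Prop), j ≤ lev →
    MatSt σ Q m d → σ.v 20 = s → σ.v 3 = 2 ^ j → σ.v 22 = 0 → σ.v 23 = 2 ^ lev → 2 ^ j ∣ s →
    s + 2 ^ j ≤ Q →
    (∀ σ', MatSt σ' Q (blockInv j s (m, d)).1 (blockInv j s (m, d)).2 → σ'.v 20 = s →
      σ'.v 3 = 2 ^ j → σ'.v 22 = 1 → σ'.v 23 = 2 ^ lev →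
      Runs E (.loop ((1 - .var 22) + (.var 23 - .var 3)) (invStep P)) σ' t R) →
    Runs E (.loop ((1 - .var 22) + (.var 23 - .var 3)) (invStep P)) σ (invTime P tm j + t) R := by
  have hV1 : 1 < E.V := hp.out.one_lt.trans hpV
  have hQ' : Q ≤ Q * Q := Nat.le_mul_self Q
  induction j with
  | zero =>
    intro s σ m d t R _ hm h20 h3 h22 h23 hd hs hk
    refine (Runs.loop_step (s := 5) (t := t) (by simp [h22]) (Runs.ite (t := 4) (fun _ => Runs.ite
      (fun h => ?_) (fun _ => Runs.sto_seq (t := 2) ?_ (Runs.sto_seq (t := 1) ?_ (Runs.asg ?_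
        (hk _ ⟨?_, ?_, ?_, ?_, ?_⟩ ?_ ?_ ?_ ?_))))) (fun h => ?_))).time (by simp [invTime]; omega)
    · simp [h3] at h
    · simp only [Ex.eval_ld, Ex.eval_add, Ex.eval_mul, Ex.eval_var, h20, hm.str]
      rw [hm.mat s s (by omega) (by omega)]
      exact (ZMod.val_lt _).trans hpV
    · simpa using hV1
    · simpa using hV1
    · intro a b ha hb
      simp only [St.set_h, St.put_h_same, Ex.eval_add, Ex.eval_mul, Ex.eval_var, St.put_v, h20,
        hm.str, blockInv]
      split_ifs with h1 h2 h2
      · have : Fact (1 < p) := ⟨hp.out.one_lt⟩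
        simp [ZMod.val_one]
      · exact absurd (idx_inj hb (by omega) h1) h2
      · exact absurd (by rw [h2.1, h2.2]) h1
      · rw [St.put_h_ne _ _ _ (by norm_num)]
        exact hm.mat a b ha hb
    · intro i hi
      simp only [St.set_h, blockInv, Function.update_apply]
      rw [St.put_h_ne _ _ _ (by norm_num)]
      simp only [St.put_h_same, Ex.eval_add, Ex.eval_mul, Ex.eval_var, h20, hm.str, Ex.eval_ld]
      split_ifs with h1
      · exact hm.mat s s (by omega) (by omega)
      · exact hm.den i hi
    · intro a
      simp only [St.set_h]
      rw [St.put_h_ne _ _ _ (by norm_num), St.put_h_ne _ _ _ (by norm_num)]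
      exact hm.sim a
    · simpa using hm.mod
    · simpa using hm.str
    · simpa using h20
    · simpa using h3
    · simp
    · simpa using h23
    · simp [h22] at h
  | succ j ih =>
    intro s σ m d t R hj hm h20 h3 h22 h23 hd hs hk
    have hpos : 0 < 2 ^ j := by positivity
    have h2 : 2 ^ (j + 1) = 2 ^ j + 2 ^ j := by ring
    have hlt : 2 ^ j < 2 ^ lev := Nat.pow_lt_pow_right (by norm_num) (by omega)
    obtain ⟨k, rfl⟩ := hd
    set s := 2 ^ (j + 1) * k with hsdef
    -- The parity of `s / 2 ^ j` tells on the way up whether a left or a right half has been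
    -- finished.
    have hdiv : s / 2 ^ j = 2 * k := by
      rw [hsdef, pow_succ, mul_assoc]; exact Nat.mul_div_cancel_left _ hpos
    have hdiv' : (s + 2 ^ j) / 2 ^ j = 2 * k + 1 := by
      rw [Nat.add_div_right _ hpos, hdiv]
    have hdvd : 2 ^ j ∣ s := (Nat.pow_dvd_pow 2 (Nat.le_succ j)).trans (Dvd.intro _ rfl)
    set g := gemmTime P tm (2 ^ j) with hg
    refine Runs.time (s := (invTime P tm j + ((invTime P tm j +
      (t + (6 * g + 37) + 1)) + (2 * g + 15) + 1)) + 3 + 1) ?_ (by simp only [invTime]; omega)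
    refine Runs.loop_step (by simp [h22]) (invStep_down h22 (by omega) ?_ ?_)
    · omega
    · have e3 : σ.v 3 / 2 = 2 ^ j := by omega
      rw [e3]
      refine ih s _ m d _ R (by omega) (hm.congr rfl (by simp) (by simp)) (by simp [h20])
        (by simp) (by simp [h22]) (by simp [h23]) hdvd (by omega) fun σ₁ m₁ a20 a3 a22 a23 => ?_
      refine Runs.loop_step (by simp [a22, a23, a3]; omega) (invStep_mid a22
        (by rw [a20, a3, hdiv]; omega)
        ((invMidCmd_runs hP (hf j (by omega)) hpos hQ m₁ a3 a20 (by omega)).mono le_rfl ?_))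
      rintro σ₂ ⟨m₂, b20, b22, bz⟩ _
      refine ih (s + 2 ^ j) σ₂ _ _ _ R (by omega) m₂ b20 (by rw [bz 3 (by omega), a3]) b22
        (by rw [bz 23 (by omega), a23]) ((Nat.dvd_add_right hdvd).mpr dvd_rfl) (by omega)
        fun σ₃ m₃ c20 c3 c22 c23 => ?_
      refine Runs.loop_step (by simp [c22, c23, c3]; omega) (invStep_post c22
        (by rw [c20, c3, hdiv']; omega)
        ((invPostCmd_runs hP (hf j (by omega)) hpos hQ m₃ c3 c20 (by omega)).mono le_rfl ?_))
      rintro σ₄ ⟨m₄, d20, d3, dz⟩ _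
      exact hk σ₄ m₄ d20 (by rw [d3, h2]) (by rw [dz 22 (by omega), c22])
        (by rw [dz 23 (by omega), c23])

theorem invCmd_runs (hP : MulProgram P κ tm) {lev : ℕ}
    (hf : ∀ j < lev, MulFit P κ tm E.V p (2 ^ j)) (hlev : 2 ^ lev ≤ Q) (hQ : Q * Q ≤ E.V)
    (hpV : p < E.V) (hm : MatSt σ Q m d) (h23 : σ.v 23 = 2 ^ lev) :
    Runs E (invCmd P) σ (invTime P tm lev + 4) fun σ' =>
      MatSt σ' Q (blockInv lev 0 (m, d)).1 (blockInv lev 0 (m, d)).2 := by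
  have hQ' : Q ≤ Q * Q := Nat.le_mul_self Q
  have hV1 : 1 < E.V := hp.out.one_lt.trans hpV
  have hlev' : 2 ^ lev < E.V := by
    rcases Nat.lt_or_ge Q 2 with h | h
    · omega
    · have : Q < Q * Q := by nlinarith
      omega
  refine (Runs.asg_seq ?_ (Runs.asg_seq ?_ (Runs.asg_seq ?_ (invLoop_runs hP hf hlev hQ hpV lev
    0 _ m d 1 _ le_rfl (hm.congr rfl (by simp) (by simp)) (by simp) ?_ ?_ ?_ (by simp) (by omega)
    fun σ' h _ h3 h22 h23 => Runs.loop_end ?_ h)))).time (by omega)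
  · simp; omega
  · simpa [h23] using hlev'
  · simp; omega
  · simp [h23]
  · simp
  · simp [h23]
  · simp [h3, h22, h23]

end


/-! ### Weighted walk matrices and reachability -/

section Walks
variable {F : Type*} [Field F]

open scoped Classical in
/-- The matrix `1 - W`, where `W` holds the weights of the edges of `g`. -/
noncomputable def walk (g : ℕ → ℕ → Prop) (w : ℕ → ℕ → F) (i j : ℕ) : F :=
  (if i = j then 1 else 0) - if g i j then w i j else 0

/-- The matrix `1 - W` of a graph on `q` nodes. -/
noncomputable def walkMat (q : ℕ) (g : ℕ → ℕ → Prop) (w : ℕ → ℕ → F) :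
    Matrix (Fin q) (Fin q) F := blk (walk g w) 0 0 q q

theorem walkMat_apply (q : ℕ) (g : ℕ → ℕ → Prop) (w : ℕ → ℕ → F) (i j : Fin q) :
    walkMat q g w i j = walk g w i j := by simp [walkMat, blk]

theorem walk_congr {g g' : ℕ → ℕ → Prop} {w : ℕ → ℕ → F} {i j : ℕ} (h : g i j ↔ g' i j) :
    walk g w i j = walk g' w i j := by
  by_cases hg : g i j <;> simp [walk, hg, h.mp, ← h]

/-- An off-diagonal entry of a scaled inverse vanishes if there is no path. -/
theorem reflTransGen_of_ne_zero {q : ℕ} {g : ℕ → ℕ → Prop} {w : ℕ → ℕ → F}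
    {N : Matrix (Fin q) (Fin q) F} {d : F} (hd : d ≠ 0)
    (h : walkMat q g w * N = d • (1 : Matrix (Fin q) (Fin q) F)) {u v : Fin q} (huv : N u v ≠ 0) :
    Relation.ReflTransGen g (u : ℕ) v := by
  classical
  set M := walkMat q g w
  have hM : M * (d⁻¹ • N) = 1 := by rw [Matrix.mul_smul, h, smul_smul, inv_mul_cancel₀ hd, one_smul]
  letI : Invertible M := Matrix.invertibleOfIsUnitDet _ (Matrix.isUnit_det_of_right_inverse hM)
  have hinv : M⁻¹ = d⁻¹ • N := Matrix.inv_eq_right_inv hM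
  -- No edge leads from a node that does not reach `v` to one that does. So `M` is block triangular
  -- for these two classes, and its inverse inherits this.
  let b : Fin q → ℕ := fun x => if Relation.ReflTransGen g (x : ℕ) v then 0 else 1
  have hb : M.BlockTriangular b := by
    intro i j hij
    simp only [b] at hij
    split_ifs at hij with h1 h2
    all_goals try omega
    show walkMat q g w i j = 0
    rw [walkMat_apply, walk]
    have hne : (i : ℕ) ≠ j := by
      intro h'; rw [h'] at h2; exact h2 h1
    rw [if_neg hne, if_neg fun hg => h2 (Relation.ReflTransGen.head hg h1), sub_zero]
  have := Matrix.blockTriangular_inv_of_blockTriangular hb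
  by_contra hu
  refine huv ?_
  have h0 : M⁻¹ u v = 0 := this (by simp [b, hu, Relation.ReflTransGen.refl])
  rw [hinv, Matrix.smul_apply, smul_eq_mul] at h0
  exact (mul_eq_zero.mp h0).resolve_left (inv_ne_zero hd)

/-- If `v` can be reached from `u` then for suitable weights the entry of the adjugate does not
vanish. -/
theorem exists_adjugate_ne_zero {q : ℕ} {g : ℕ → ℕ → Prop} (hg : ∀ x y, g x y → x < q ∧ y < q)
    {u v : Fin q} (huv : Relation.ReflTransGen g (u : ℕ) v) :
    ∃ w : ℕ → ℕ → F, (walkMat q g w).adjugate u v ≠ 0 := by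
  classical
  -- `D k x`: there is a path of length `k` from `x` to `v`
  obtain ⟨D, hD0, hDs⟩ : ∃ D : ℕ → ℕ → Prop, (∀ x, D 0 x ↔ x = v) ∧
      ∀ k x, D (k + 1) x ↔ ∃ y, g x y ∧ D k y :=
    ⟨fun k => Nat.rec (fun x => x = v) (fun _ r x => ∃ y, g x y ∧ r y) k, fun _ => Iff.rfl,
      fun _ _ => Iff.rfl⟩
  have hD : ∀ x : ℕ, Relation.ReflTransGen g x v → ∃ k, D k x := by
    intro x hx
    induction hx using Relation.ReflTransGen.head_induction_on with
    | refl => exact ⟨0, (hD0 _).mpr rfl⟩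
    | head hxy _ ih => obtain ⟨k, hk⟩ := ih; exact ⟨k + 1, (hDs _ _).mpr ⟨_, hxy, hk⟩⟩
  let R : ℕ → Prop := fun x => ∃ k, D k x
  let dist : ℕ → ℕ := fun x => if h : ∃ k, D k x then Nat.find h else 0
  -- The first step of a shortest path to `v`.
  have hnext : ∀ x, R x → x ≠ v → ∃ y, g x y ∧ R y ∧ dist y < dist x := by
    intro x hx hxv
    have hx : ∃ k, D k x := hx
    have hs : D (Nat.find hx) x := Nat.find_spec hx
    have hdx : dist x = Nat.find hx := dif_pos hx
    cases hk : Nat.find hx with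
    | zero => rw [hk, hD0] at hs; exact absurd hs hxv
    | succ k =>
      rw [hk, hDs] at hs
      obtain ⟨y, hy, hyk⟩ := hs
      have hR : ∃ k, D k y := ⟨k, hyk⟩
      refine ⟨y, hy, hR, ?_⟩
      have : dist y = Nat.find hR := dif_pos hR
      have h2 := Nat.find_min' hR hyk
      omega
  choose! nx hnx using hnext
  -- Weight one exactly on the edges of a shortest-path forest towards `v`.
  let w : ℕ → ℕ → F := fun x y => if R x ∧ x ≠ v ∧ y = nx x then 1 else 0
  refine ⟨w, ?_⟩
  set M := walkMat q g w with hM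
  have hMa : ∀ i j : Fin q, M i j = (if i = j then 1 else 0) -
      if R i ∧ (i : ℕ) ≠ v ∧ (j : ℕ) = nx i then 1 else 0 := by
    intro i j
    rw [hM, walkMat_apply, walk]
    simp only [w, Fin.ext_iff]
    congr 1
    by_cases h : R i ∧ (i : ℕ) ≠ v ∧ (j : ℕ) = nx i
    · rw [if_pos h, if_pos]
      rw [h.2.2]; exact (hnx _ h.1 h.2.1).1
    · rw [if_neg h]; simp
  have hdist : ∀ i j : Fin q, M i j ≠ 0 → i = j ∨ dist j < dist i := by
    intro i j h
    rw [hMa] at h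
    by_cases hij : i = j
    · exact Or.inl hij
    · right
      rw [if_neg hij, zero_sub, neg_ne_zero] at h
      by_cases h' : R i ∧ (i : ℕ) ≠ v ∧ (j : ℕ) = nx i
      · rw [h'.2.2]; exact (hnx _ h'.1 h'.2.1).2.2
      · rw [if_neg h'] at h; exact absurd rfl h
  have hdiag : ∀ i : Fin q, M i i = 1 := by
    intro i
    rw [hMa, if_pos rfl, if_neg, sub_zero]
    rintro ⟨h1, h2, h3⟩
    have := (hnx _ h1 h2).2.2
    rw [← h3] at this
    exact lt_irrefl _ this
  -- Off the diagonal `M` is supported on pairs along which the distance drops, so it is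
  -- unitriangular for the order by distance.
  have hdet : M.det = 1 := by
    have hb : M.BlockTriangular (fun i => OrderDual.toDual (dist i)) := by
      intro i j hij
      by_contra h
      have hij' : dist i < dist j := hij
      rcases hdist i j h with rfl | h <;> omega
    rw [hb.det]
    refine Finset.prod_eq_one fun a _ => ?_
    have : M.toSquareBlock (fun i => OrderDual.toDual (dist i)) a = 1 := by
      ext ⟨i, hi⟩ ⟨j, hj⟩
      simp only [Matrix.toSquareBlock_def, Matrix.of_apply, Matrix.one_apply, Subtype.mk.injEq]
      split_ifs with h
      · rw [h]; exact hdiag j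
      · by_contra h'
        have he : dist i = dist j := OrderDual.toDual.injective (hi.trans hj.symm)
        rcases hdist i j h' with h2 | h2
        · exact h h2
        · omega
    rw [this, Matrix.det_one]
  -- A node of the forest other than `v` has a single successor, which lies in the forest too;
  -- therefore `M` maps this indicator to the unit vector at `v`. Applying the adjugate, which is
  -- the inverse, shows that its column `v` is the indicator.
  let c : Fin q → F := fun x => if R x then 1 else 0
  have hMc : M.mulVec c = Pi.single v 1 := by
    ext i
    simp only [Matrix.mulVec, dotProduct, hMa, sub_mul, Finset.sum_sub_distrib]
    have h1 : ∑ j, (if i = j then (1 : F) else 0) * c j = c i := by simp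
    rw [h1]
    by_cases hi : R i ∧ (i : ℕ) ≠ v
    · obtain ⟨hg1, hg2, _⟩ := hnx _ hi.1 hi.2
      have hlt := (hg _ _ hg1).2
      have h2 : ∑ j : Fin q, (if R i ∧ (i : ℕ) ≠ v ∧ (j : ℕ) = nx i then (1 : F) else 0) * c j =
          c ⟨nx i, hlt⟩ := by
        rw [Finset.sum_eq_single ⟨nx i, hlt⟩]
        · simp [hi]
        · intro j _ hj
          rw [if_neg, zero_mul]
          rintro ⟨_, _, h⟩
          exact hj (Fin.ext h)
        · simp
      rw [h2]
      have hiv : i ≠ v := fun h => hi.2 (by rw [h])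
      simp only [c, hi.1, hg2, if_true, sub_self]
      rw [Pi.single_eq_of_ne hiv]
    · have h2 : ∑ j : Fin q, (if R i ∧ (i : ℕ) ≠ v ∧ (j : ℕ) = nx i then (1 : F) else 0) * c j =
          0 := Finset.sum_eq_zero fun j _ => by
        rw [if_neg fun h => hi ⟨h.1, h.2.1⟩, zero_mul]
      rw [h2, sub_zero]
      by_cases hiv : i = v
      · subst hiv
        have : R (i : ℕ) := ⟨0, (hD0 _).mpr rfl⟩
        simp [c, this]
      · have : ¬R i := fun h => hi ⟨h, fun h' => hiv (Fin.ext h')⟩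
        rw [Pi.single_eq_of_ne hiv]
        simp [c, this]
  have hadj : M.adjugate.mulVec (M.mulVec c) = c := by
    rw [Matrix.mulVec_mulVec, Matrix.adjugate_mul, hdet, one_smul, Matrix.one_mulVec]
  rw [hMc] at hadj
  have := congrFun hadj u
  rw [Matrix.mulVec_single_one, Matrix.col_apply] at this
  rw [this]
  simp [c, hD _ huv, R]

/-- Multiplication by the adjugate gives `M.det • N = d • M.adjugate`. So probabilistic statements
about the adjugate, which is polynomial in the weights, apply to whichever scaled inverse was
computed. -/
theorem adjugate_ne_zero_imp {q : ℕ} {M N : Matrix (Fin q) (Fin q) F} {d : F} (hd : d ≠ 0)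
    (h : M * N = d • (1 : Matrix (Fin q) (Fin q) F)) {u v : Fin q} (ha : M.adjugate u v ≠ 0) :
    N u v ≠ 0 := by
  have h1 : M.det • N = d • M.adjugate := by
    have := congrArg (M.adjugate * ·) h
    simp only [← Matrix.mul_assoc, Matrix.adjugate_mul, Matrix.mul_smul, Matrix.mul_one,
      Matrix.smul_mul, Matrix.one_mul] at this
    exact this
  intro h0
  have := congrFun (congrFun h1 u) v
  simp only [Matrix.smul_apply, h0, smul_eq_mul, mul_zero] at this
  exact mul_ne_zero hd ha this.symm

/-- Sylvester's identity `det (1 + A * B) = det (1 + B * A)` in scaled form. It moves a determinant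
between the small matrix of a low-rank change and the full matrix, both for leading minors of `1 -
W` and for the core of an update. -/
theorem det_add_ne_zero {a b : Type*} [Fintype a] [DecidableEq a] [Fintype b] [DecidableEq b]
    {M N : Matrix a a F} {μ : F} (hμ : μ ≠ 0) (h : M * N = μ • (1 : Matrix a a F))
    (U : Matrix a b F) (E : Matrix b a F) (hd : (M + U * E).det ≠ 0) :
    (μ • (1 : Matrix b b F) + E * N * U).det ≠ 0 := by
  have hN : N.det ≠ 0 := by
    intro h0
    have := congrArg Matrix.det h
    rw [Matrix.det_mul, h0, mul_zero, Matrix.det_smul, Matrix.det_one, mul_one] at this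
    exact pow_ne_zero _ hμ this.symm
  have e1 : μ • (1 : Matrix b b F) + E * N * U = μ • (1 + E * (μ⁻¹ • (N * U))) := by
    rw [smul_add, Matrix.mul_smul, smul_smul, mul_inv_cancel₀ hμ, one_smul, Matrix.mul_assoc]
  have hNM : N * M = μ • (1 : Matrix a a F) := by
    have h1 : M * (μ⁻¹ • N) = 1 := by
      rw [Matrix.mul_smul, h, smul_smul, inv_mul_cancel₀ hμ, one_smul]
    have h2 := mul_eq_one_comm.mp h1
    rw [Matrix.smul_mul] at h2
    rw [← h2, smul_smul, mul_inv_cancel₀ hμ, one_smul]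
  have e2 : 1 + (μ⁻¹ • (N * U)) * E = (μ⁻¹ • N) * (M + U * E) := by
    rw [Matrix.mul_add, Matrix.smul_mul μ⁻¹ N M, hNM, smul_smul, inv_mul_cancel₀ hμ, one_smul,
      Matrix.smul_mul, Matrix.smul_mul, Matrix.mul_assoc N]
  rw [e1, Matrix.det_smul, Matrix.det_one_add_mul_comm, e2, Matrix.det_mul, Matrix.det_smul]
  exact mul_ne_zero (pow_ne_zero _ hμ) (mul_ne_zero (mul_ne_zero (pow_ne_zero _ (inv_ne_zero hμ))
    hN) hd)

/-- Leading minors of `1 - W` are determinants of subgraphs. -/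
theorem det_blk_walk_ne_zero {q : ℕ} {g : ℕ → ℕ → Prop} {w : ℕ → ℕ → F} {i : ℕ} (hi : i ≤ q)
    (h : (walkMat q (fun x y => g x y ∧ x < i) w).det ≠ 0) :
    (blk (walk g w) 0 0 i i).det ≠ 0 := by
  classical
  -- If only edges leaving nodes below `i` are kept, `1 - W` becomes `1 + U * E`, where `U` includes
  -- the first `i` coordinates and `E` holds the first `i` rows of `-W`. The swapped product is the
  -- leading minor.
  let U : Matrix (Fin q) (Fin i) F := .of fun x a => if (x : ℕ) = a then 1 else 0
  let E : Matrix (Fin i) (Fin q) F := .of fun a x => -if g a x then w a x else 0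
  have hU : ∀ (a : Fin i) (f : Fin q → F), ∑ x, f x * U x a = f (Fin.castLE hi a) := by
    intro a f
    rw [Finset.sum_eq_single (Fin.castLE hi a)]
    · simp [U]
    · intro b _ hb
      have : (b : ℕ) ≠ a := fun h => hb (Fin.ext h)
      simp [U, this]
    · simp
  have key := det_add_ne_zero (M := (1 : Matrix (Fin q) (Fin q) F)) (N := 1) (μ := 1) one_ne_zero
    (by simp) U E ?_
  · convert key using 2
    ext a b
    simp only [one_smul, Matrix.mul_one, Matrix.add_apply, Matrix.mul_apply, hU]
    simp [blk, walk, E, Matrix.one_apply, Fin.ext_iff, sub_eq_add_neg]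
  · convert h using 2
    ext x y
    rw [walkMat_apply]
    simp only [Matrix.add_apply, Matrix.mul_apply, walk, Matrix.one_apply, Fin.ext_iff,
      sub_eq_add_neg]
    congr 1
    by_cases hx : (x : ℕ) < i
    · rw [Finset.sum_eq_single ⟨x, hx⟩]
      · simp [U, E, hx]
      · intro b _ hb
        have : (x : ℕ) ≠ b := fun h => hb (Fin.ext h.symm)
        simp [U, this]
      · simp
    · rw [if_neg fun h => hx h.2, neg_zero]
      refine Finset.sum_eq_zero fun b _ => ?_
      have : (x : ℕ) ≠ b := by have := b.2; omega
      simp [U, this]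

end Walks

/-! ### Low-rank change of a scaled inverse -/

/-- The graph `g'` arises from `g` by changes between the nodes `S 0, …, S (k - 1)` and by the
removal of all edges that leave the nodes in `del`. -/
structure Change (q k : ℕ) (S : ℕ → ℕ) (del : ℕ → Prop) (g g' : ℕ → ℕ → Prop) : Prop where
  lt : ∀ i < k, S i < q
  inj : ∀ i < k, ∀ j < k, S i = S j → i = j
  row : ∀ x, (∀ i < k, S i ≠ x) → ∀ y, g' x y ↔ g x y
  col : ∀ x y, ¬del x → (∀ i < k, S i ≠ y) → (g' x y ↔ g x y)
  del : ∀ x, del x → ∀ y, ¬g' x y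

/-- The graph in which only the edges leaving `S 0, …, S (i - 1)` have been changed. -/
def partGraph (k : ℕ) (S : ℕ → ℕ) (g g' : ℕ → ℕ → Prop) (i x y : ℕ) : Prop :=
  ((∃ l < i, l < k ∧ S l = x) ∧ g' x y) ∨ ((¬∃ l < i, l < k ∧ S l = x) ∧ g x y)

section Woodbury
variable {F : Type*} [Field F] {q k kk : ℕ} {S : ℕ → ℕ} {del : ℕ → Prop} {g g' : ℕ → ℕ → Prop}

open scoped Classical in
/-- The part of the change that concerns the changed nodes. -/
noncomputable def changeMat (k : ℕ) (S : ℕ → ℕ) (del : ℕ → Prop) (g g' : ℕ → ℕ → Prop)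
    (w : ℕ → ℕ → F) (i j : ℕ) : F :=
  if i < k ∧ j < k then
    if del (S i) then if i = j then 1 else 0 else walk g' w (S i) (S j) - walk g w (S i) (S j)
  else 0

/-- The entries of `n` at the changed nodes. -/
def restrictMat (k : ℕ) (S : ℕ → ℕ) (n : ℕ → ℕ → F) (i j : ℕ) : F :=
  if i < k ∧ j < k then n (S i) (S j) else 0

open scoped Classical in
/-- The matrix whose inverse is needed to update the inverse. -/
noncomputable def coreMat (k kk : ℕ) (S : ℕ → ℕ) (del : ℕ → Prop) (g g' : ℕ → ℕ → Prop)
    (w n : ℕ → ℕ → F) (μ : F) (i j : ℕ) : F :=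
  (if i = j ∧ ¬(i < k ∧ del (S i)) then μ else 0) +
    ∑ l ∈ Finset.range kk, changeMat k S del g g' w i l * restrictMat k S n l j

/-- The entry of the updated inverse. -/
def coreEntry (k : ℕ) (S : ℕ → ℕ) (n z : ℕ → ℕ → F) (ξ : F) (u v : ℕ) : F :=
  ξ * n u v - ∑ i ∈ Finset.range k, n u (S i) * ∑ j ∈ Finset.range k, z i j * n (S j) v

/-- The columns of the identity matrix at the changed nodes. -/
def selCols (F : Type*) [Field F] (q k : ℕ) (S : ℕ → ℕ) (a : ℕ) : Matrix (Fin q) (Fin a) F :=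
  .of fun x i => if (i : ℕ) < k ∧ S i = x then 1 else 0

/-- The changed rows. -/
noncomputable def changeRows (q k : ℕ) (S : ℕ → ℕ) (g g' : ℕ → ℕ → Prop) (w : ℕ → ℕ → F) (a : ℕ) :
    Matrix (Fin a) (Fin q) F :=
  .of fun i x => if (i : ℕ) < k then walk g' w (S i) x - walk g w (S i) x else 0

theorem sum_mul_selCols (h : ∀ i < k, S i < q) {a : ℕ} (i : Fin a) (f : ℕ → F) :
    ∑ x : Fin q, f x * selCols F q k S a x i = if (i : ℕ) < k then f (S i) else 0 := by
  split_ifs with hi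
  · rw [Finset.sum_eq_single ⟨S i, h i hi⟩]
    · simp [selCols, hi]
    · intro b _ hb
      have : S i ≠ b := fun h => hb (Fin.ext h.symm)
      simp [selCols, this]
    · simp
  · exact Finset.sum_eq_zero fun x _ => by simp [selCols, hi]

theorem sum_selCols_mul_of {a : ℕ} (hinj : ∀ i < k, ∀ j < k, S i = S j → i = j) (x : Fin q)
    (f : Fin a → F) (l : Fin a) (hl : (l : ℕ) < k) (hx : S l = x) :
    ∑ i, selCols F q k S a x i * f i = f l := by
  rw [Finset.sum_eq_single l]
  · simp [selCols, hl, hx]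
  · intro b _ hb
    have : ¬((b : ℕ) < k ∧ S b = x) := fun h =>
      hb (Fin.ext (hinj _ h.1 _ hl (h.2.trans hx.symm)))
    simp [selCols, this]
  · simp

theorem sum_selCols_mul_of_not {a : ℕ} (x : Fin q) (f : Fin a → F)
    (hx : ∀ i < k, i < a → S i ≠ x) : ∑ i, selCols F q k S a x i * f i = 0 :=
  Finset.sum_eq_zero fun i _ => by
    have : ¬((i : ℕ) < k ∧ S i = x) := fun h => hx i h.1 i.2 h.2
    simp [selCols, this]

/-- The number `a` of columns is free. For `a ≥ k` this is the whole change, padded by zero columns;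
for smaller `a` it is the partial change that belongs to a leading minor of the core. -/
theorem walkMat_partGraph (hc : Change q k S del g g') (w : ℕ → ℕ → F) (a : ℕ) :
    walkMat q g w + selCols F q k S a * changeRows q k S g g' w a =
      walkMat q (partGraph k S g g' a) w := by
  classical
  ext x y
  rw [Matrix.add_apply, walkMat_apply, walkMat_apply, Matrix.mul_apply]
  by_cases hx : ∃ l < a, l < k ∧ S l = x
  · obtain ⟨l, hla, hlk, hl⟩ := id hx
    rw [sum_selCols_mul_of hc.inj x _ ⟨l, hla⟩ hlk hl]
    rw [walk_congr (g := partGraph k S g g' a) (g' := g') (by simp [partGraph, hx])]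
    simp [changeRows, hlk, hl]
  · rw [sum_selCols_mul_of_not _ _ fun i hk ha h => hx ⟨i, ha, hk, h⟩, add_zero]
    exact walk_congr (by simp [partGraph, hx])

theorem partGraph_eq (hc : Change q k S del g g') {a : ℕ} (ha : k ≤ a) :
    partGraph k S g g' a = g' := by
  ext x y
  unfold partGraph
  by_cases hx : ∃ l < a, l < k ∧ S l = x
  · simp [hx]
  · have := hc.row x (fun i hi h => hx ⟨i, by omega, hi, h⟩) y
    simp [hx, this]

variable {w n : ℕ → ℕ → F} {μ : F}

-- This is why the update looks only at entries of `n` in the rows of changed nodes. At a live node,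
-- the changed row is supported on changed columns. At a deleted node the new row is a unit vector,
-- so the difference is that vector minus a row of `M`, and multiplication by the scaled inverse
-- gives a row of `n` minus `μ` at one place.
open scoped Classical in
theorem changeRows_mul (hc : Change q k S del g g')
    (hn : walkMat q g w * blk n 0 0 q q = μ • (1 : Matrix (Fin q) (Fin q) F)) (a : ℕ)
    (i : Fin a) (y : Fin q) :
    (changeRows q k S g g' w a * blk n 0 0 q q) i y =
      ∑ l ∈ Finset.range k, changeMat k S del g g' w i l * n (S l) y -
        if (i : ℕ) < k ∧ del (S i) ∧ S i = y then μ else 0 := by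
  have hM : ∀ x y : Fin q, ∑ z : Fin q, walk g w x z * n z y = if x = y then μ else 0 := by
    intro x y
    have := congrFun (congrFun hn x) y
    simp only [Matrix.mul_apply, walkMat_apply, Matrix.smul_apply, Matrix.one_apply, smul_eq_mul,
      mul_ite, mul_one, mul_zero] at this
    simpa [blk] using this
  simp only [Matrix.mul_apply, changeRows, Matrix.of_apply]
  by_cases hi : (i : ℕ) < k
  · simp only [hi, if_true, true_and]
    by_cases hd : del (S i)
    · have h1 : ∀ z : Fin q, walk g' w (S i) z - walk g w (S i) z =
          (if S i = z then 1 else 0) - walk g w (S i) z := by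
        intro z
        simp only [walk, hc.del _ hd, if_false, sub_zero]
      simp only [h1, sub_mul, Finset.sum_sub_distrib]
      have h2 := hM ⟨S i, hc.lt i hi⟩ y
      simp only [Fin.ext_iff] at h2
      have h3 : ∀ z : Fin q, blk n 0 0 q q z y = n z y := fun z => by simp [blk]
      simp only [h3, h2, hd, true_and]
      congr 1
      rw [Finset.sum_eq_single ⟨S i, hc.lt i hi⟩, Finset.sum_eq_single (i : ℕ)]
      · simp [changeMat, hi, hd]
      · intro l hl hli
        simp [changeMat, hd, Ne.symm hli]
      · simp [hi]
      · intro b _ hb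
        have : S i ≠ b := fun h => hb (Fin.ext h.symm)
        simp [this]
      · simp
    · simp only [hd, false_and, if_false, sub_zero]
      have h1 : ∀ z : Fin q, (walk g' w (S i) z - walk g w (S i) z) * n z y =
          ∑ l ∈ Finset.range k, (if S l = z then changeMat k S del g g' w i l * n (S l) y
            else 0) := by
        intro z
        by_cases hz : ∃ l < k, S l = z
        · obtain ⟨l, hl, hlz⟩ := hz
          rw [Finset.sum_eq_single l]
          · simp [changeMat, hi, hl, hd, hlz]
          · intro b hb hbl
            rw [if_neg fun h => hbl (hc.inj _ (Finset.mem_range.mp hb) _ hl (h.trans hlz.symm))]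
          · simp [hl]
        · rw [Finset.sum_eq_zero fun l hl => if_neg fun h => hz ⟨l, Finset.mem_range.mp hl, h⟩,
            walk_congr (hc.col (S i) z hd fun l hl h => hz ⟨l, hl, h⟩), sub_self, zero_mul]
      have h3 : ∀ z : Fin q, blk n 0 0 q q z y = n z y := fun z => by simp [blk]
      simp only [h3, h1]
      rw [Finset.sum_comm]
      refine Finset.sum_congr rfl fun l hl => ?_
      rw [Finset.sum_eq_single ⟨S l, hc.lt l (Finset.mem_range.mp hl)⟩]
      · simp
      · intro b _ hb
        rw [if_neg fun h => hb (Fin.ext h.symm)]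
      · simp
  · simp [hi, changeMat]

/-- Restricted to changed columns, the term `-μ` of a deleted node falls on the diagonal and cancels
the scale there; this explains the exceptional diagonal of `coreMat`. -/
theorem coreMat_eq (hc : Change q k S del g g') (hk : k ≤ kk)
    (hn : walkMat q g w * blk n 0 0 q q = μ • (1 : Matrix (Fin q) (Fin q) F)) (a : ℕ) :
    blk (coreMat k kk S del g g' w n μ) 0 0 a a = μ • (1 : Matrix (Fin a) (Fin a) F) +
      changeRows q k S g g' w a * blk n 0 0 q q * selCols F q k S a := by
  classical
  ext i j
  rw [Matrix.add_apply, Matrix.mul_apply]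
  have h1 : ∀ x : Fin q, (changeRows q k S g g' w a * blk n 0 0 q q) i x * selCols F q k S a x j =
      (fun y : ℕ => ∑ l ∈ Finset.range k, changeMat k S del g g' w i l * n (S l) y -
        if (i : ℕ) < k ∧ del (S i) ∧ S i = y then μ else 0) x * selCols F q k S a x j := by
    intro x; rw [changeRows_mul hc hn]
  rw [(Finset.sum_congr rfl fun x _ => h1 x).trans (sum_mul_selCols hc.lt j
    fun y : ℕ => ∑ l ∈ Finset.range k, changeMat k S del g g' w i l * n (S l) y -
      if (i : ℕ) < k ∧ del (S i) ∧ S i = y then μ else 0)]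
  simp only [blk, Matrix.of_apply, coreMat, Matrix.smul_apply, Matrix.one_apply, smul_eq_mul,
    zero_add, mul_ite, mul_one, mul_zero, Fin.ext_iff]
  have h2 : ∑ l ∈ Finset.range kk, changeMat k S del g g' w i l * restrictMat k S n l j =
      if (j : ℕ) < k then ∑ l ∈ Finset.range k, changeMat k S del g g' w i l * n (S l) (S j)
        else 0 := by
    split_ifs with hj
    · rw [← Finset.sum_subset (Finset.range_mono hk)]
      · refine Finset.sum_congr rfl fun l hl => ?_
        simp [restrictMat, Finset.mem_range.mp hl, hj]
      · intro l _ hl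
        simp [restrictMat, Finset.mem_range.not.mp hl]
    · exact Finset.sum_eq_zero fun l _ => by simp [restrictMat, hj]
  rw [h2]
  by_cases hij : (i : ℕ) = j
  · rw [hij]
    by_cases hj : (j : ℕ) < k <;> by_cases hd : del (S j) <;> simp [hj, hd]
  · by_cases hj : (j : ℕ) < k
    · have : ¬((i : ℕ) < k ∧ del (S i) ∧ S i = S j) := fun h => hij (hc.inj _ h.1 _ hj h.2.2)
      simp [hij, hj, this]
    · simp [hij, hj]

/-- By Sylvester's identity a leading minor of the core is controlled by the determinant for the
graph in which only the first `a` changed nodes have their new edges. That determinant is again a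
nonzero polynomial in the weights. -/
theorem coreMat_minor_ne_zero (hc : Change q k S del g g') (hk : k ≤ kk)
    (hn : walkMat q g w * blk n 0 0 q q = μ • (1 : Matrix (Fin q) (Fin q) F)) (hμ : μ ≠ 0) (a : ℕ)
    (hd : (walkMat q (partGraph k S g g' a) w).det ≠ 0) :
    (blk (coreMat k kk S del g g' w n μ) 0 0 a a).det ≠ 0 := by
  rw [coreMat_eq hc hk hn]
  refine det_add_ne_zero hμ hn _ _ ?_
  rwa [walkMat_partGraph hc]

/-- The updated inverse. -/
theorem exists_updated_inverse (hc : Change q k S del g g') (hk : k ≤ kk)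
    (hn : walkMat q g w * blk n 0 0 q q = μ • (1 : Matrix (Fin q) (Fin q) F))
    {x : ℕ → ℕ → F} {ξ : F} (hx : blk (coreMat k kk S del g g' w n μ) 0 0 kk kk * blk x 0 0 kk kk =
      ξ • (1 : Matrix (Fin kk) (Fin kk) F)) {z : ℕ → ℕ → F}
    (hz : ∀ i < k, ∀ j < k, z i j =
      ∑ l ∈ Finset.range kk, x i l * changeMat k S del g g' w l j) :
    ∃ N : Matrix (Fin q) (Fin q) F, walkMat q g' w * N = (ξ * μ) • (1 : Matrix (Fin q) (Fin q) F) ∧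
      ∀ u v : Fin q, ¬del v → N u v = coreEntry k S n z ξ u v := by
  classical
  set M := walkMat q g w
  set Nh : Matrix (Fin q) (Fin q) F := blk n 0 0 q q
  set U : Matrix (Fin q) (Fin kk) F := selCols F q k S kk
  set G : Matrix (Fin kk) (Fin q) F := changeRows q k S g g' w kk * Nh with hG
  set X : Matrix (Fin kk) (Fin kk) F := blk (coreMat k kk S del g g' w n μ) 0 0 kk kk with hX
  set Y : Matrix (Fin kk) (Fin kk) F := blk x 0 0 kk kk
  have hXe : X = μ • (1 : Matrix (Fin kk) (Fin kk) F) + G * U := coreMat_eq hc hk hn kk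
  have hM' : walkMat q g' w = M + U * changeRows q k S g g' w kk := by
    rw [walkMat_partGraph hc, partGraph_eq hc hk]
  have h1 : walkMat q g' w * Nh = μ • (1 : Matrix (Fin q) (Fin q) F) + U * G := by
    rw [hM', add_mul, hn, Matrix.mul_assoc]
  -- With `X * Y = ξ • 1` this is the error term of `h1`, scaled by `ξ`; subtracting it from `ξ •
  -- Nh` leaves a scaled inverse.
  have h2 : walkMat q g' w * (Nh * (U * (Y * G))) = ξ • (U * G) := by
    rw [← Matrix.mul_assoc, h1, Matrix.add_mul, Matrix.smul_mul, Matrix.one_mul]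
    have : μ • (U * (Y * G)) + U * G * (U * (Y * G)) = U * ((X * Y) * G) := by
      rw [hXe]
      simp only [Matrix.add_mul, Matrix.mul_add, Matrix.smul_mul, Matrix.mul_smul, Matrix.one_mul,
        Matrix.mul_assoc]
    rw [this, hx, Matrix.smul_mul, Matrix.one_mul, Matrix.mul_smul]
  refine ⟨ξ • Nh - Nh * (U * (Y * G)), ?_, ?_⟩
  · rw [Matrix.mul_sub, Matrix.mul_smul, h1, h2, smul_add, smul_smul, add_sub_cancel_right]
  · intro u v hv
    have hGv : ∀ i : Fin kk, G i v = ∑ l ∈ Finset.range k, changeMat k S del g g' w i l * n (S l) v := by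
      intro i
      rw [hG, changeRows_mul hc hn, if_neg, sub_zero]
      rintro ⟨_, h, h'⟩
      -- The correction `-μ` lives in the columns of deleted nodes, and `v` is not deleted.
      exact hv (h' ▸ h)
    have hYG : ∀ i : Fin kk, (i : ℕ) < k → (Y * G) i v = ∑ j ∈ Finset.range k, z i j * n (S j) v := by
      intro i hi
      rw [Matrix.mul_apply]
      simp only [hGv, Finset.mul_sum]
      rw [Finset.sum_comm]
      refine Finset.sum_congr rfl fun j hj => ?_
      rw [hz i hi j (Finset.mem_range.mp hj), Finset.sum_range, Finset.sum_mul]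
      refine Finset.sum_congr rfl fun l _ => ?_
      simp [Y, blk, mul_assoc]
    have hNh : ∀ x y : Fin q, Nh x y = n x y := fun x y => by simp [Nh, blk]
    rw [Matrix.sub_apply, Matrix.smul_apply, smul_eq_mul, hNh, coreEntry, ← Matrix.mul_assoc,
      Matrix.mul_apply]
    congr 1
    have h3 : ∀ i : Fin kk, (Nh * U) u i = if (i : ℕ) < k then n u (S i) else 0 := by
      intro i
      rw [Matrix.mul_apply]
      simp only [hNh]
      exact sum_mul_selCols hc.lt i fun y => n u y
    have h4 : ∀ i : Fin kk, (Nh * U) u i * (Y * G) i v = (fun i : ℕ => if i < k then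
        n u (S i) * ∑ j ∈ Finset.range k, z i j * n (S j) v else 0) i := by
      intro i
      rw [h3]
      by_cases hi : (i : ℕ) < k
      · simp only [hi, if_true, hYG i hi]
      · simp [hi]
    simp only [h4]
    rw [← Finset.sum_range (fun i : ℕ => if i < k then
      n u (S i) * ∑ j ∈ Finset.range k, z i j * n (S j) v else 0),
      ← Finset.sum_subset (Finset.range_mono hk) fun i _ hi => if_neg (by simpa using hi)]
    exact Finset.sum_congr rfl fun i hi => if_pos (Finset.mem_range.mp hi)

end Woodbury

/-! ### Counting outcomes of random words -/

/-- An event that depends on the first `T` random words, by counting. -/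
theorem coinMeasure_le_card (W T : ℕ) (P : (Fin T → Fin (2 ^ W)) → Prop) [DecidablePred P] :
    coinMeasure W {coins | P fun i => coins i} ≤
      (Finset.univ.filter P).card * (((2 ^ W) ^ T : ℕ) : ENNReal)⁻¹ := by
  have : Nonempty (Fin (2 ^ W)) := ⟨⟨0, by positivity⟩⟩
  have hone : ∀ y : Fin (2 ^ W), ProbabilityTheory.uniformOn (Set.univ : Set (Fin (2 ^ W))) {y} =
      ((2 ^ W : ℕ) : ENNReal)⁻¹ := by
    intro y
    rw [ProbabilityTheory.uniformOn_univ]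
    simp [Measure.count_singleton]
  have hcyl : ∀ x : Fin T → Fin (2 ^ W), coinMeasure W {coins | ∀ i : Fin T, coins i = x i} =
      (((2 ^ W) ^ T : ℕ) : ENNReal)⁻¹ := by
    intro x
    have hP : IsProbabilityMeasure
        (ProbabilityTheory.uniformOn (Set.univ : Set (Fin (2 ^ W)))) :=
      ProbabilityTheory.isProbabilityMeasure_uniformOn Set.finite_univ Set.univ_nonempty
    have : {coins : Coins W | ∀ i : Fin T, coins i = x i} =
        Set.pi (Finset.range T : Set ℕ) fun i => if h : i < T then {x ⟨i, h⟩} else Set.univ := by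
      ext y
      simp only [Set.mem_setOf_eq, Set.mem_pi, Finset.coe_range, Set.mem_Iio]
      constructor
      · intro h i hi
        rw [dif_pos hi]; exact h ⟨i, hi⟩
      · intro h i
        have := h i i.2
        rw [dif_pos i.2] at this; exact this
    rw [this, coinMeasure, Measure.infinitePi_pi _ fun i _ => by measurability]
    have hg : ∀ i ∈ Finset.range T, ProbabilityTheory.uniformOn (Set.univ : Set (Fin (2 ^ W)))
        (if h : i < T then {x ⟨i, h⟩} else Set.univ) = ((2 ^ W : ℕ) : ENNReal)⁻¹ := by
      intro i hi
      rw [dif_pos (Finset.mem_range.mp hi), hone]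
    rw [Finset.prod_congr rfl hg, Finset.prod_const, Finset.card_range, Nat.cast_pow _ T,
      ENNReal.inv_pow]
  have hsub : {coins : Coins W | P fun i => coins i} ⊆
      ⋃ x ∈ Finset.univ.filter P, {coins | ∀ i : Fin T, coins i = x i} := by
    intro y hy
    simp only [Set.mem_iUnion]
    exact ⟨fun i => y i, by simpa using hy, fun i => rfl⟩
  refine (measure_mono hsub).trans ((measure_biUnion_finset_le _ _).trans ?_)
  simp [hcyl]

section Counting
open Finset

/-- Residues of uniform words are uniform. -/
theorem card_filter_mod {ι : Type*} [Fintype ι] [DecidableEq ι] {Wd M N : ℕ} (h : Wd = M * N)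
    (P : (ι → Fin N) → Prop) [DecidablePred P] (hN : 0 < N) :
    (univ.filter fun y : ι → Fin Wd => P fun i => ⟨y i % N, Nat.mod_lt _ hN⟩).card =
      M ^ Fintype.card ι * (univ.filter P).card := by
  subst h
  have h1 : (univ.filter fun y : ι → Fin (M * N) => P fun i => ⟨y i % N, Nat.mod_lt _ hN⟩).card =
      ((univ : Finset (ι → Fin M)) ×ˢ univ.filter P).card := by
    refine card_bij' (fun y _ => (fun i => (y i).divNat, fun i => (y i).modNat))
      (fun z _ i => finProdFinEquiv (z.1 i, z.2 i)) ?_ ?_ ?_ ?_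
    · intro y hy
      simp only [mem_filter, mem_univ, true_and, mem_product] at hy ⊢
      exact hy
    · intro z hz
      simp only [mem_filter, mem_univ, true_and, mem_product] at hz ⊢
      have : (fun i => ⟨finProdFinEquiv (z.1 i, z.2 i) % N, Nat.mod_lt _ hN⟩) = z.2 := by
        funext i
        have := (z.2 i).2
        refine Fin.ext ?_
        simp [finProdFinEquiv, Nat.add_mul_mod_self_left, Nat.mod_eq_of_lt this]
      rw [this]
      exact hz
    · intro y _
      funext i
      exact finProdFinEquiv.apply_symm_apply (y i)
    · intro z _
      refine Prod.ext (funext fun i => ?_) (funext fun i => ?_)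
      · exact congrArg Prod.fst (finProdFinEquiv.symm_apply_apply (z.1 i, z.2 i))
      · exact congrArg Prod.snd (finProdFinEquiv.symm_apply_apply (z.1 i, z.2 i))
  rw [h1, card_product]
  simp

/-- Independent repetition. -/
theorem card_filter_blocks {Ω : Type*} [Fintype Ω] [DecidableEq Ω] (R m : ℕ)
    (B : (Fin m → Ω) → Prop) [DecidablePred B] :
    (univ.filter fun y : Fin (R * m) → Ω => ∀ r : Fin R, B fun i => y (finProdFinEquiv (r, i))).card =
      (univ.filter B).card ^ R := by
  have : (univ.filter B).card ^ R =
      (Fintype.piFinset fun _ : Fin R => univ.filter B).card := by simp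
  rw [this]
  refine card_bij' (fun y _ r i => y (finProdFinEquiv (r, i)))
    (fun z _ k => z (finProdFinEquiv.symm k).1 (finProdFinEquiv.symm k).2) ?_ ?_ ?_ ?_
  · intro y hy
    simpa using hy
  · intro z hz
    rw [Finset.mem_filter]
    refine ⟨mem_univ _, fun r => ?_⟩
    have h : (fun i => z (finProdFinEquiv.symm (finProdFinEquiv (r, i))).1
        (finProdFinEquiv.symm (finProdFinEquiv (r, i))).2) = z r := by
      funext i; rw [Equiv.symm_apply_apply]
    have hz' := Fintype.mem_piFinset.mp hz r
    exact h ▸ (mem_filter.mp hz').2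
  · intro y _
    funext k
    exact congrArg y (finProdFinEquiv.apply_symm_apply k)
  · intro z _
    funext r i
    simp

/-- Two stages: the first either fails or determines a second event. -/
theorem card_filter_stages {Ω : Type*} [Fintype Ω] [DecidableEq Ω] (K m b : ℕ)
    (A : (Fin K → Ω) → Prop) [DecidablePred A] (B : (Fin K → Ω) → (Fin m → Ω) → Prop)
    [∀ x, DecidablePred (B x)] (hB : ∀ x, ¬A x → (univ.filter (B x)).card ≤ b) :
    (univ.filter fun y : Fin (K + m) → Ω => A (fun i => y (Fin.castAdd m i)) ∨
      (¬A (fun i => y (Fin.castAdd m i)) ∧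
        B (fun i => y (Fin.castAdd m i)) fun i => y (Fin.natAdd K i))).card ≤
      (univ.filter A).card * Fintype.card Ω ^ m + Fintype.card Ω ^ K * b := by
  have h1 : (univ.filter fun y : Fin (K + m) → Ω => A (fun i => y (Fin.castAdd m i)) ∨
      (¬A (fun i => y (Fin.castAdd m i)) ∧
        B (fun i => y (Fin.castAdd m i)) fun i => y (Fin.natAdd K i))).card =
      (univ.filter fun z : (Fin K → Ω) × (Fin m → Ω) => A z.1 ∨ (¬A z.1 ∧ B z.1 z.2)).card := by
    refine card_bij' (fun y _ => (fun i => y (Fin.castAdd m i), fun i => y (Fin.natAdd K i)))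
      (fun z _ => Fin.append z.1 z.2) ?_ ?_ ?_ ?_
    · intro y hy; simpa using hy
    · intro z hz; simpa using hz
    · intro y _; exact Fin.append_castAdd_natAdd
    · intro z _; ext <;> simp
  rw [h1, filter_or]
  refine (card_union_le _ _).trans (Nat.add_le_add ?_ ?_)
  · have : (univ.filter fun z : (Fin K → Ω) × (Fin m → Ω) => A z.1) =
        univ.filter A ×ˢ univ := by ext; simp
    rw [this, card_product]
    simp
  · have : (univ.filter fun z : (Fin K → Ω) × (Fin m → Ω) => ¬A z.1 ∧ B z.1 z.2) =
        (univ.filter fun x => ¬A x).biUnion fun x => (univ.filter (B x)).image fun y => (x, y) := by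
      ext ⟨x, y⟩
      simp
    rw [this]
    refine card_biUnion_le.trans ((sum_le_card_nsmul _ _ b fun x hx => ?_).trans ?_)
    · exact card_image_le.trans (hB x (mem_filter.mp hx).2)
    · rw [smul_eq_mul]
      refine Nat.mul_le_mul_right _ ((card_le_univ _).trans ?_)
      simp

end Counting

/-! ### Density of primes -/

/-- The proportion of primes between `2 ^ (12 * a + 2)` and `2 ^ (14 * a + 8)`. -/
theorem card_primes_ge {a : ℕ} (ha : 1 ≤ a) :
    (2 : ℝ) ^ (14 * a + 8) ≤ 44 * a * ((Finset.range (2 ^ (14 * a + 8))).filter fun r =>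
      2 ^ (12 * a + 2) ≤ r ∧ r.Prime).card := by
  obtain ⟨e, he⟩ : ∃ e, e = 14 * a + 8 := ⟨_, rfl⟩
  rw [← he]
  have hpi := Chebyshev.pi_ge (2 ^ e)
  have hl2 : 0 < Real.log 2 := Real.log_pos (by norm_num)
  -- Chebyshev's lower bound; the `2` absorbs the logarithmic error term.
  have h1 : ((2 : ℝ) ^ e) / e - 2 ≤ Nat.primeCounting (2 ^ e) := by
    refine le_trans ?_ hpi
    have he0 : (0 : ℝ) < e := by exact_mod_cast (by omega : 0 < e)
    push_cast
    rw [Real.log_pow, le_div_iff₀ (by positivity)]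
    have hlog : Real.log ((2 : ℝ) ^ e + 1) ≤ (e + 1) * Real.log 2 := by
      have : (2 : ℝ) ^ e + 1 ≤ 2 ^ (e + 1) := by
        have : (1 : ℝ) ≤ 2 ^ e := one_le_pow₀ (by norm_num)
        rw [pow_succ]; linarith
      refine (Real.log_le_log (by positivity) this).trans (le_of_eq ?_)
      rw [Real.log_pow]; push_cast; ring
    have he1 : (1 : ℝ) ≤ e := by exact_mod_cast (by omega : 1 ≤ e)
    have : ((2 : ℝ) ^ e / e - 2) * (e * Real.log 2) = 2 ^ e * Real.log 2 - 2 * e * Real.log 2 := by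
      field_simp
    rw [this]
    nlinarith
  have h2 : Nat.primeCounting (2 ^ e) ≤ 2 ^ (12 * a + 2) + ((Finset.range (2 ^ e)).filter fun r =>
      2 ^ (12 * a + 2) ≤ r ∧ r.Prime).card := by
    rw [Nat.primeCounting, Nat.primeCounting', Nat.count_eq_card_filter_range]
    have hs : (Finset.range (2 ^ e + 1)).filter Nat.Prime ⊆ Finset.range (2 ^ (12 * a + 2)) ∪
        (Finset.range (2 ^ e)).filter fun r => 2 ^ (12 * a + 2) ≤ r ∧ r.Prime := by
      intro r hr
      simp only [Finset.mem_filter, Finset.mem_range, Finset.mem_union] at hr ⊢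
      rcases lt_or_ge r (2 ^ (12 * a + 2)) with h | h
      · exact Or.inl h
      · refine Or.inr ⟨lt_of_le_of_ne (Nat.lt_succ_iff.mp hr.1) fun h' => ?_, h, hr.2⟩
        -- The prime counting function includes the end point, which is a proper power and hence not
        -- prime.
        exact Nat.Prime.not_prime_pow (by omega : 2 ≤ e) (h' ▸ hr.2)
    refine (Finset.card_le_card hs).trans ((Finset.card_union_le _ _).trans ?_)
    rw [Finset.card_range]
  set g := ((Finset.range (2 ^ e)).filter fun r => 2 ^ (12 * a + 2) ≤ r ∧ r.Prime).card
  have h2' : (Nat.primeCounting (2 ^ e) : ℝ) ≤ 2 ^ (12 * a + 2) + g := by exact_mod_cast h2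
  -- The candidates that are too small take away at most half of the lower bound. Together with `e ≤
  -- 22 * a` this gives the constant `44`.
  have h3 : (2 * (14 * a + 8)) * (2 ^ (12 * a + 2) + 2) ≤ 2 ^ e := by
    have e1 : (2 : ℕ) ^ e = 2 ^ (12 * a + 2) * (64 * (2 ^ a * 2 ^ a)) := by
      rw [he, show 14 * a + 8 = (12 * a + 2) + (6 + (a + a)) by ring]
      simp only [pow_add]; norm_num
    have e2 : a < 2 ^ a := Nat.lt_two_pow_self
    have e3 : 4 ≤ 2 ^ (12 * a + 2) := by
      calc 4 = 2 ^ 2 := by norm_num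
        _ ≤ _ := Nat.pow_le_pow_right (by norm_num) (by omega)
    rw [e1]
    have e4 : 2 ^ (12 * a + 2) + 2 ≤ 2 ^ (12 * a + 2) * 2 := by omega
    have e5 : 2 * (14 * a + 8) * 2 ≤ 64 * (2 ^ a * 2 ^ a) := by nlinarith
    calc 2 * (14 * a + 8) * (2 ^ (12 * a + 2) + 2)
        ≤ 2 * (14 * a + 8) * (2 ^ (12 * a + 2) * 2) := Nat.mul_le_mul_left _ e4
      _ = 2 ^ (12 * a + 2) * (2 * (14 * a + 8) * 2) := by ring
      _ ≤ _ := Nat.mul_le_mul_left _ e5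
  have h3' : (2 * (e : ℝ)) * (2 ^ (12 * a + 2) + 2) ≤ 2 ^ e := by
    have : (e : ℝ) = 14 * a + 8 := by rw [he]; push_cast; ring
    rw [this]; exact_mod_cast h3
  have he0 : (0 : ℝ) < e := by exact_mod_cast (by omega : 0 < e)
  have h4 : (2 : ℝ) ^ e ≤ e * (g + 2 ^ (12 * a + 2) + 2) := by
    have : (2 : ℝ) ^ e / e ≤ g + 2 ^ (12 * a + 2) + 2 := by linarith
    rwa [div_le_iff₀' he0] at this
  have h5 : (e : ℝ) ≤ 22 * a := by
    have : e ≤ 22 * a := by omega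
    exact_mod_cast this
  have hg : (0 : ℝ) ≤ g := by positivity
  nlinarith


/-! ### The Schwartz–Zippel bound for the random weights -/

section SchwartzZippel
variable {F : Type*} [Field F]

theorem totalDegree_det_le {σ : Type*} {q : ℕ} (M : Matrix (Fin q) (Fin q) (MvPolynomial σ F))
    (h : ∀ i j, (M i j).totalDegree ≤ 1) : M.det.totalDegree ≤ q := by
  rw [Matrix.det_apply]
  refine (MvPolynomial.totalDegree_finsetSum _ _).trans (Finset.sup_le fun s _ => ?_)
  refine (MvPolynomial.totalDegree_smul_le _ _).trans ?_
  refine (MvPolynomial.totalDegree_finset_prod _ _).trans ?_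
  refine (Finset.sum_le_sum fun i _ => h _ _).trans ?_
  simp

/-- Schwartz–Zippel on the sample set `0, …, q0 - 1`, whose elements stay distinct modulo `p`
because `q0 ≤ p`. The size of this set is independent of `p`, so the same random words serve every
prime. -/
theorem card_eval_eq_zero_le {p q q0 m : ℕ} [hp : Fact p.Prime] (h0 : q0 ≤ p) (hq0 : 0 < q0)
    {P : MvPolynomial (Fin m) (ZMod p)} (hP : P ≠ 0) (hd : P.totalDegree ≤ q) :
    (Finset.univ.filter fun z : Fin m → Fin q0 =>
      MvPolynomial.eval (fun i => ((z i : ℕ) : ZMod p)) P = 0).card * q0 ≤ q * q0 ^ m := by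
  classical
  have hinj : Function.Injective fun x : Fin q0 => ((x : ℕ) : ZMod p) := by
    intro x y h
    have := (ZMod.natCast_eq_natCast_iff' _ _ _).mp h
    rw [Nat.mod_eq_of_lt (x.2.trans_le h0), Nat.mod_eq_of_lt (y.2.trans_le h0)] at this
    exact Fin.ext this
  set S : Finset (ZMod p) := Finset.univ.map ⟨_, hinj⟩ with hS
  have hcard : S.card = q0 := by simp [hS]
  have key := MvPolynomial.schwartz_zippel_totalDegree hP S
  rw [hcard] at key
  have hle : (Finset.univ.filter fun z : Fin m → Fin q0 =>
      MvPolynomial.eval (fun i => ((z i : ℕ) : ZMod p)) P = 0).card ≤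
      ((Fintype.piFinset fun _ : Fin m => S).filter fun f => MvPolynomial.eval f P = 0).card := by
    refine Finset.card_le_card_of_injOn (fun z i => ((z i : ℕ) : ZMod p)) ?_ ?_
    · intro z hz
      simp only [Finset.coe_filter, Finset.mem_univ, true_and, Set.mem_setOf_eq] at hz
      simp [hz, hS]
    · intro z _ z' _ h
      funext i
      exact hinj (congrFun h i)
  rw [div_le_div_iff₀ (by positivity) (by positivity)] at key
  have key' : ((Fintype.piFinset fun _ : Fin m => S).filter fun f =>
      MvPolynomial.eval f P = 0).card * q0 ≤ P.totalDegree * q0 ^ m := by exact_mod_cast key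
  exact (Nat.mul_le_mul_right _ hle).trans (key'.trans (Nat.mul_le_mul_right _ hd))

/-- The weights in a list of `q * q` numbers. -/
def weightsOf {q : ℕ} (y : Fin (q * q) → F) (i j : ℕ) : F :=
  if h : i * q + j < q * q then y ⟨i * q + j, h⟩ else 0

theorem weightsOf_apply {q : ℕ} (y : Fin (q * q) → F) (i j : Fin q) :
    weightsOf y i j = y (finProdFinEquiv (i, j)) := by
  rw [weightsOf, dif_pos (idx_lt i.2 j.2)]
  congr 1
  ext
  simp [finProdFinEquiv]; ring

theorem walkMat_congr {q : ℕ} {g : ℕ → ℕ → Prop} {w w' : ℕ → ℕ → F}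
    (h : ∀ i j : Fin q, w i j = w' i j) : walkMat q g w = walkMat q g w' := by
  ext i j
  show walkMat q g w i j = walkMat q g w' i j
  rw [walkMat_apply, walkMat_apply, walk, walk, h]

open scoped Classical in
/-- The matrix `1 - W` with indeterminate weights. -/
noncomputable def walkPoly (F : Type*) [Field F] (q : ℕ) (g : ℕ → ℕ → Prop) :
    Matrix (Fin q) (Fin q) (MvPolynomial (Fin (q * q)) F) :=
  .of fun i j => (if i = j then 1 else 0) -
    if g i j then MvPolynomial.X (finProdFinEquiv (i, j)) else 0

theorem totalDegree_walkPoly (q : ℕ) (g : ℕ → ℕ → Prop) (i j : Fin q) :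
    (walkPoly F q g i j).totalDegree ≤ 1 := by
  rw [walkPoly, Matrix.of_apply]
  refine (MvPolynomial.totalDegree_sub _ _).trans (max_le ?_ ?_)
  · split_ifs <;> simp
  · split_ifs <;> simp [MvPolynomial.totalDegree_X]

theorem map_walkPoly {q : ℕ} (g : ℕ → ℕ → Prop) (y : Fin (q * q) → F) :
    (MvPolynomial.eval y).mapMatrix (walkPoly F q g) = walkMat q g (weightsOf y) := by
  ext i j
  show _ = walkMat q g (weightsOf y) i j
  rw [walkMat_apply, walk, RingHom.mapMatrix_apply, Matrix.map_apply, walkPoly, Matrix.of_apply,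
    weightsOf_apply]
  by_cases h1 : i = j <;> by_cases h2 : g i j <;> simp [h1, h2, Fin.ext_iff] <;> simp_all [Fin.ext_iff]

/-- At weight zero the matrix is the identity. -/
theorem det_walkPoly_ne_zero (q : ℕ) (g : ℕ → ℕ → Prop) : (walkPoly F q g).det ≠ 0 := by
  intro h
  have := congrArg (MvPolynomial.eval (0 : Fin (q * q) → F)) h
  rw [RingHom.map_det, map_walkPoly, map_zero] at this
  have h1 : walkMat q g (weightsOf (0 : Fin (q * q) → F)) = 1 := by
    ext i j
    show walkMat q g _ i j = _
    rw [walkMat_apply, walk, weightsOf_apply]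
    simp [Matrix.one_apply, Fin.ext_iff]
  rw [h1, Matrix.det_one] at this
  exact one_ne_zero this

/-- A polynomial that is nonzero at one point is nonzero, and the shortest-path forest provides the
point. -/
theorem adjugate_walkPoly_ne_zero {q : ℕ} {g : ℕ → ℕ → Prop} (hg : ∀ x y, g x y → x < q ∧ y < q)
    {u v : Fin q} (huv : Relation.ReflTransGen g (u : ℕ) v) :
    (walkPoly F q g).adjugate u v ≠ 0 := by
  obtain ⟨w, hw⟩ := exists_adjugate_ne_zero (F := F) hg huv
  intro h
  set y : Fin (q * q) → F := fun k => w (finProdFinEquiv.symm k).1 (finProdFinEquiv.symm k).2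
  have h1 : walkMat q g (weightsOf y) = walkMat q g w :=
    walkMat_congr fun i j => by
      rw [weightsOf_apply]; simp only [y, Equiv.symm_apply_apply]
  have h2 := congrArg (fun M : Matrix (Fin q) (Fin q) F => M u v)
    (RingHom.map_adjugate (MvPolynomial.eval y) (walkPoly F q g))
  simp only [RingHom.mapMatrix_apply, Matrix.map_apply] at h2
  rw [h, map_zero, ← RingHom.mapMatrix_apply, map_walkPoly, h1] at h2
  exact hw h2.symm

/-- An entry of the adjugate is the determinant after one row has been replaced by a unit vector, so
the degree bound for determinants applies. -/
theorem totalDegree_adjugate_walkPoly (q : ℕ) (g : ℕ → ℕ → Prop) (u v : Fin q) :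
    ((walkPoly F q g).adjugate u v).totalDegree ≤ q := by
  rw [Matrix.adjugate_apply]
  refine totalDegree_det_le _ fun i j => ?_
  rw [Matrix.updateRow_apply]
  split_ifs
  · rw [Pi.single_apply]; split_ifs <;> simp
  · exact totalDegree_walkPoly q g i j

/-- The weights are bad for the pair `u, v` if some determinant vanishes. -/
def BadWeights (q : ℕ) (gs : List (ℕ → ℕ → Prop)) (g' : ℕ → ℕ → Prop) (u v : Fin q)
    (w : ℕ → ℕ → F) : Prop :=
  (∃ g ∈ gs, (walkMat q g w).det = 0) ∨ (walkMat q g' w).adjugate u v = 0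

-- A union bound over `gs.length + 1` polynomials of degree at most `q`. The assumption `hlen` makes
-- the sample set so large that at most the fraction `1 / q` of the weights is bad.
open scoped Classical in
theorem card_badWeights_le {p q q0 : ℕ} [hp : Fact p.Prime] (h0 : q0 ≤ p) (hq0 : 0 < q0)
    {gs : List (ℕ → ℕ → Prop)} {g' : ℕ → ℕ → Prop} (hg : ∀ x y, g' x y → x < q ∧ y < q)
    {u v : Fin q} (huv : Relation.ReflTransGen g' (u : ℕ) v)
    (hlen : (gs.length + 1) * q * q ≤ q0) :
    (Finset.univ.filter fun z : Fin (q * q) → Fin q0 => BadWeights q gs g' u v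
      (weightsOf fun i => ((z i : ℕ) : ZMod p))).card * q ≤ q0 ^ (q * q) := by
  let Ps : List (MvPolynomial (Fin (q * q)) (ZMod p)) :=
    (walkPoly (ZMod p) q g').adjugate u v :: gs.map fun g => (walkPoly (ZMod p) q g).det
  let Z : MvPolynomial (Fin (q * q)) (ZMod p) → Finset (Fin (q * q) → Fin q0) := fun P =>
    Finset.univ.filter fun z => MvPolynomial.eval (fun i => ((z i : ℕ) : ZMod p)) P = 0
  have hZ : ∀ P ∈ Ps, (Z P).card * q0 ≤ q * q0 ^ (q * q) := by
    intro P hP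
    rcases List.mem_cons.mp hP with rfl | hP
    · exact card_eval_eq_zero_le h0 hq0 (adjugate_walkPoly_ne_zero hg huv)
        (totalDegree_adjugate_walkPoly q g' u v)
    · obtain ⟨g, _, rfl⟩ := List.mem_map.mp hP
      exact card_eval_eq_zero_le h0 hq0 (det_walkPoly_ne_zero q g)
        (totalDegree_det_le _ (totalDegree_walkPoly q g))
  have hsub : (Finset.univ.filter fun z : Fin (q * q) → Fin q0 => BadWeights q gs g' u v
      (weightsOf fun i => ((z i : ℕ) : ZMod p))) ⊆ Ps.toFinset.biUnion Z := by
    intro z hz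
    rw [Finset.mem_filter] at hz
    rw [Finset.mem_biUnion]
    rcases hz.2 with ⟨g, hg, h⟩ | h
    · refine ⟨(walkPoly (ZMod p) q g).det, ?_, ?_⟩
      · rw [List.mem_toFinset]
        exact List.mem_cons_of_mem _ (List.mem_map_of_mem hg)
      · simp only [Z, Finset.mem_filter, Finset.mem_univ, true_and]
        rw [RingHom.map_det, map_walkPoly]; exact h
    · refine ⟨(walkPoly (ZMod p) q g').adjugate u v, ?_, ?_⟩
      · rw [List.mem_toFinset]
        exact List.mem_cons_self
      · simp only [Z, Finset.mem_filter, Finset.mem_univ, true_and]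
        have h2 := congrArg (fun M : Matrix (Fin q) (Fin q) (ZMod p) => M u v)
          (RingHom.map_adjugate (MvPolynomial.eval fun i => ((z i : ℕ) : ZMod p))
            (walkPoly (ZMod p) q g'))
        simp only [RingHom.mapMatrix_apply, Matrix.map_apply] at h2
        rw [h2, ← RingHom.mapMatrix_apply, map_walkPoly]; exact h
  have hcard : (Ps.toFinset.biUnion Z).card * q0 ≤ (gs.length + 1) * (q * q0 ^ (q * q)) := by
    calc (Ps.toFinset.biUnion Z).card * q0 ≤ (∑ P ∈ Ps.toFinset, (Z P).card) * q0 :=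
          Nat.mul_le_mul_right _ Finset.card_biUnion_le
      _ = ∑ P ∈ Ps.toFinset, (Z P).card * q0 := Finset.sum_mul _ _ _
      _ ≤ Ps.toFinset.card • (q * q0 ^ (q * q)) :=
          Finset.sum_le_card_nsmul _ _ _ fun P hP => hZ P (List.mem_toFinset.mp hP)
      _ ≤ (gs.length + 1) * (q * q0 ^ (q * q)) := by
          rw [smul_eq_mul]
          refine Nat.mul_le_mul_right _ ((List.toFinset_card_le _).trans ?_)
          simp [Ps]
  refine Nat.le_of_mul_le_mul_right ?_ hq0
  calc _ ≤ ((Ps.toFinset.biUnion Z).card * q) * q0 :=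
        Nat.mul_le_mul_right _ (Nat.mul_le_mul_right _ (Finset.card_le_card hsub))
    _ = (Ps.toFinset.biUnion Z).card * q0 * q := by ring
    _ ≤ (gs.length + 1) * (q * q0 ^ (q * q)) * q := Nat.mul_le_mul_right _ hcard
    _ = q0 ^ (q * q) * ((gs.length + 1) * q * q) := by ring
    _ ≤ _ := Nat.mul_le_mul_left _ hlen

end SchwartzZippel

/-! ### The random prime and the failure probability -/

/-- The last prime that is at least `q0` among the residues of `x 0, …, x (K - 1)`. -/
def pickPrime (q0 N : ℕ) (x : ℕ → ℕ) : ℕ → ℕ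
  | 0 => 2
  | j + 1 => if q0 ≤ x j % N ∧ (x j % N).Prime then x j % N else pickPrime q0 N x j

theorem pickPrime_prime (q0 N : ℕ) (x : ℕ → ℕ) (K : ℕ) : (pickPrime q0 N x K).Prime := by
  induction K with
  | zero => exact Nat.prime_two
  | succ j ih =>
    rw [pickPrime]
    split_ifs with h
    · exact h.2
    · exact ih

theorem pickPrime_lt {q0 N : ℕ} (hN : 2 < N) (x : ℕ → ℕ) (K : ℕ) : pickPrime q0 N x K < N := by
  induction K with
  | zero => exact hN
  | succ j ih =>
    rw [pickPrime]
    split_ifs with h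
    · exact Nat.mod_lt _ (by omega)
    · exact ih

theorem le_pickPrime {q0 N : ℕ} {x : ℕ → ℕ} {K : ℕ}
    (h : ∃ j < K, q0 ≤ x j % N ∧ (x j % N).Prime) : q0 ≤ pickPrime q0 N x K := by
  induction K with
  | zero => obtain ⟨j, hj, _⟩ := h; omega
  | succ K ih =>
    rw [pickPrime]
    split_ifs with h'
    · exact h'.1
    · obtain ⟨j, hj, hj'⟩ := h
      rcases Nat.lt_succ_iff_lt_or_eq.mp hj with hj | rfl
      · exact ih ⟨j, hj, hj'⟩
      · exact absurd hj' h'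

theorem pickPrime_congr {q0 N : ℕ} {x y : ℕ → ℕ} {K : ℕ} (h : ∀ j < K, x j = y j) :
    pickPrime q0 N x K = pickPrime q0 N y K := by
  induction K with
  | zero => rfl
  | succ K ih =>
    rw [pickPrime, pickPrime, h K (by omega), ih fun j hj => h j (by omega)]

/-- The probability that no candidate is a prime, in terms of cardinalities. -/
theorem card_no_prime_le {a R Wd : ℕ} (ha : 1 ≤ a) (hW : 2 ^ (14 * a + 8) ∣ Wd) :
    (Finset.univ.filter fun x : Fin (132 * R * (a * a)) → Fin Wd => ∀ j,
      ¬(2 ^ (12 * a + 2) ≤ (x j : ℕ) % 2 ^ (14 * a + 8) ∧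
        ((x j : ℕ) % 2 ^ (14 * a + 8)).Prime)).card * (16 ^ a) ^ R ≤ Wd ^ (132 * R * (a * a)) := by
  have hg := card_primes_ge ha
  obtain ⟨M, hM⟩ := hW
  rw [mul_comm] at hM
  set K := 132 * R * (a * a) with hK
  have hN : 0 < 2 ^ (14 * a + 8) := by positivity
  generalize 2 ^ (12 * a + 2) = q0 at *
  have hN2 : (2 : ℝ) ^ (14 * a + 8) = ((2 ^ (14 * a + 8) : ℕ) : ℝ) := by push_cast; rfl
  rw [hN2] at hg
  generalize 2 ^ (14 * a + 8) = N at *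
  let good : ℕ → Prop := fun r => q0 ≤ r ∧ r.Prime
  have e1 := card_filter_mod (ι := Fin K) hM (fun z => ∀ j, ¬good (z j)) hN
  have e2 : (Finset.univ.filter fun z : Fin K → Fin N => ∀ j, ¬good (z j)).card =
      (Finset.univ.filter fun r : Fin N => ¬good r).card ^ K := by
    have : (Finset.univ.filter fun z : Fin K → Fin N => ∀ j, ¬good (z j)) =
        Fintype.piFinset fun _ => Finset.univ.filter fun r : Fin N => ¬good r := by
      ext z; simp
    rw [this]; simp
  have e3 : (Finset.univ.filter fun r : Fin N => ¬good r).card +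
      ((Finset.range N).filter good).card = N := by
    have : ((Finset.range N).filter good).card = (Finset.univ.filter fun r : Fin N => good r).card := by
      rw [Finset.card_filter, Finset.card_filter, Finset.sum_range]
    rw [this, add_comm, Finset.card_filter_add_card_filter_not]
    simp
  set b := (Finset.univ.filter fun r : Fin N => ¬good r).card
  set G := ((Finset.range N).filter good).card
  show (Finset.univ.filter fun x : Fin K → Fin Wd => ∀ j, ¬good ((x j : ℕ) % N)).card * _ ≤ _
  rw [e1, e2, Fintype.card_fin, hM, mul_pow, mul_assoc]
  refine Nat.mul_le_mul_left _ ?_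
  have hN' : (0 : ℝ) < N := by exact_mod_cast hN
  have ha' : (0 : ℝ) < a := by exact_mod_cast ha
  have hb : (b : ℝ) = N - G := by
    have : ((b + G : ℕ) : ℝ) = N := by rw [e3]
    push_cast at this; linarith
  have hbn : (b : ℝ) ≤ N * Real.exp (-(1 / (44 * a))) := by
    have h1 : 1 - 1 / (44 * (a : ℝ)) ≤ Real.exp (-(1 / (44 * a))) := by
      have := Real.add_one_le_exp (-(1 / (44 * (a : ℝ)))); linarith
    have h2 : (N : ℝ) * (1 / (44 * a)) ≤ G := by
      rw [mul_one_div, div_le_iff₀ (by positivity)]; linarith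
    have h3 := mul_le_mul_of_nonneg_left h1 hN'.le
    rw [hb]; nlinarith
  -- The number of candidates is `132 = 3 * 44` times `R * a ^ 2`, so the failure probability is at
  -- most `exp (-3 * a * R)`, which has to be at most `16 ^ (-a * R)`.
  have h16 : (16 : ℝ) ≤ Real.exp 3 := by
    have h := Real.exp_one_gt_d9
    have h3 : Real.exp 3 = Real.exp 1 ^ 3 := by rw [← Real.exp_nat_mul]; norm_num
    rw [h3]
    have h2 : (2.7 : ℝ) ≤ Real.exp 1 := by linarith
    calc (16 : ℝ) ≤ 2.7 ^ 3 := by norm_num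
      _ ≤ _ := pow_le_pow_left₀ (by norm_num) h2 3
  have hfin : ((b : ℝ)) ^ K * (16 ^ a) ^ R ≤ (N : ℝ) ^ K := by
    have h1 : (b : ℝ) ^ K ≤ (N : ℝ) ^ K * Real.exp (-(3 * (a * R))) := by
      refine (pow_le_pow_left₀ (by positivity) hbn K).trans (le_of_eq ?_)
      rw [mul_pow, ← Real.exp_nat_mul]
      congr 2
      rw [hK]; push_cast; field_simp; ring
    have h2 : ((16 : ℝ) ^ a) ^ R ≤ Real.exp (3 * (a * R)) := by
      have : Real.exp (3 * (a * R)) = (Real.exp 3) ^ (a * R) := by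
        rw [← Real.exp_nat_mul]; push_cast; congr 1; ring
      rw [this, ← pow_mul]
      exact pow_le_pow_left₀ (by norm_num) h16 _
    calc (b : ℝ) ^ K * (16 ^ a) ^ R ≤ ((N : ℝ) ^ K * Real.exp (-(3 * (a * R)))) *
          Real.exp (3 * (a * R)) := mul_le_mul h1 h2 (by positivity) (by positivity)
      _ = (N : ℝ) ^ K := by rw [mul_assoc, ← Real.exp_add]; simp
  exact_mod_cast hfin

/-- Either no prime is found, or one is found and all rounds are bad. -/
def BadCoins (a R : ℕ) (B : ∀ p : ℕ, (Fin (16 ^ a * 16 ^ a) → ZMod p) → Prop) (x : ℕ → ℕ) : Prop :=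
  (∀ j < 132 * R * (a * a), ¬(2 ^ (12 * a + 2) ≤ x j % 2 ^ (14 * a + 8) ∧
    (x j % 2 ^ (14 * a + 8)).Prime)) ∨
  (2 ^ (12 * a + 2) ≤ pickPrime (2 ^ (12 * a + 2)) (2 ^ (14 * a + 8)) x (132 * R * (a * a)) ∧
    ∀ r < R, B (pickPrime (2 ^ (12 * a + 2)) (2 ^ (14 * a + 8)) x (132 * R * (a * a))) fun i =>
      ((x (132 * R * (a * a) + (r * (16 ^ a * 16 ^ a) + i)) % 2 ^ (12 * a + 2) : ℕ) : ZMod _))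

-- Both kinds of failure have probability at most `q ^ (-(c + 1))` with `q = 16 ^ a`: the absence of
-- a prime by `card_no_prime_le`, and the failure of all rounds because the rounds use disjoint
-- random words. Since `q ≥ 2` and `q ≥ n`, twice this is at most `n ^ (-c)`.
open scoped Classical in
theorem coinMeasure_badCoins_le {W a c n : ℕ} (ha : 1 ≤ a) (hnq : n ≤ 16 ^ a)
    (hW : 14 * a + 8 ≤ W) {B : ∀ p : ℕ, (Fin (16 ^ a * 16 ^ a) → ZMod p) → Prop}
    (hB : ∀ p : ℕ, p.Prime → 2 ^ (12 * a + 2) ≤ p →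
      (Finset.univ.filter fun z : Fin (16 ^ a * 16 ^ a) → Fin (2 ^ (12 * a + 2)) =>
        B p fun i => ((z i : ℕ) : ZMod p)).card * 16 ^ a ≤
        (2 ^ (12 * a + 2)) ^ (16 ^ a * 16 ^ a)) :
    coinMeasure W {coins | BadCoins a (c + 1) B fun i => coins i} ≤ ((n : ENNReal) ^ c)⁻¹ := by
  set R := c + 1 with hR
  have hno := card_no_prime_le (R := R) (Wd := 2 ^ W) ha (pow_dvd_pow 2 hW)
  have hq0W : 2 ^ (12 * a + 2) ∣ 2 ^ W := pow_dvd_pow 2 (by omega)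
  unfold BadCoins
  have hq0 : 0 < 2 ^ (12 * a + 2) := by positivity
  have hq2 : 2 ≤ 16 ^ a := by
    calc 2 ≤ 16 ^ 1 := by norm_num
      _ ≤ 16 ^ a := Nat.pow_le_pow_right (by norm_num) ha
  generalize 2 ^ (12 * a + 2) = q0 at *
  generalize 2 ^ (14 * a + 8) = N at *
  generalize 132 * R * (a * a) = K at *
  generalize 16 ^ a = q at *
  generalize q * q = m at *
  let ext : (Fin K → Fin (2 ^ W)) → ℕ → ℕ := fun x j => if h : j < K then x ⟨j, h⟩ else 0
  let A : (Fin K → Fin (2 ^ W)) → Prop := fun x => ∀ j, ¬(q0 ≤ (x j : ℕ) % N ∧ ((x j : ℕ) % N).Prime)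
  let B' : (Fin K → Fin (2 ^ W)) → (Fin (R * m) → Fin (2 ^ W)) → Prop := fun x y =>
    q0 ≤ pickPrime q0 N (ext x) K ∧ ∀ r : Fin R, B (pickPrime q0 N (ext x) K) fun i =>
      (((y (finProdFinEquiv (r, i)) : ℕ) % q0 : ℕ) : ZMod _)
  -- The first `K` words determine the prime. Once they are fixed, the bad weights form a product
  -- over the `R` rounds.
  have hB' : ∀ x, ¬A x → (Finset.univ.filter (B' x)).card ≤ ((2 ^ W) ^ m / q) ^ R := by
    intro x _
    by_cases hx : q0 ≤ pickPrime q0 N (ext x) K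
    · simp only [B', hx, true_and]
      rw [card_filter_blocks R m (fun y : Fin m → Fin (2 ^ W) => B (pickPrime q0 N (ext x) K) fun i =>
        (((y i : ℕ) % q0 : ℕ) : ZMod _))]
      refine Nat.pow_le_pow_left ?_ R
      obtain ⟨M, hM⟩ := hq0W
      rw [mul_comm] at hM
      have := card_filter_mod (ι := Fin m) hM (fun z => B (pickPrime q0 N (ext x) K) fun i =>
        ((z i : ℕ) : ZMod _)) hq0
      simp only at this
      rw [this, Fintype.card_fin, Nat.le_div_iff_mul_le (by omega), hM, mul_pow, mul_assoc]
      exact Nat.mul_le_mul_left _ (hB _ (pickPrime_prime _ _ _ _) hx)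
    · simp [B', hx]
  have hcount := card_filter_stages K (R * m) _ A B' hB'
  let P : (Fin (K + R * m) → Fin (2 ^ W)) → Prop := fun y =>
    A (fun i => y (Fin.castAdd _ i)) ∨ (¬A (fun i => y (Fin.castAdd _ i)) ∧
        B' (fun i => y (Fin.castAdd _ i)) fun i => y (Fin.natAdd K i))
  refine (measure_mono (t := {coins | P fun i => coins i}) ?_).trans
    ((coinMeasure_le_card W (K + R * m) P).trans ?_)
  · intro coins hc
    simp only [Set.mem_setOf_eq] at hc ⊢
    by_cases hA : A fun i : Fin K => coins i
    · exact Or.inl hA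
    · refine Or.inr ⟨hA, ?_⟩
      rcases hc with hc | hc
      · exact absurd (fun j : Fin K => hc j j.2) hA
      · have he : pickPrime q0 N (ext fun i : Fin K => coins i) K =
            pickPrime q0 N (fun i => coins i) K :=
          pickPrime_congr fun j hj => by simp [ext, hj]
        show q0 ≤ pickPrime q0 N (ext fun i : Fin K => coins i) K ∧ ∀ r : Fin R,
          B (pickPrime q0 N (ext fun i : Fin K => coins i) K) fun i =>
            (((coins (K + (finProdFinEquiv (r, i) : ℕ)) : ℕ) % q0 : ℕ) : ZMod _)
        rw [he]
        refine ⟨hc.1, fun r => ?_⟩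
        have hi : ∀ i : Fin m, K + (finProdFinEquiv (r, i) : ℕ) = K + (r * m + i) := fun i => by
          simp only [finProdFinEquiv, Equiv.coe_fn_mk]; ring
        simp only [hi]
        exact hc.2 r r.2
  · set T := (2 ^ W) ^ (K + R * m) with hT
    have hT0 : T ≠ 0 := by positivity
    have hcount' : (Finset.univ.filter fun y : Fin (K + R * m) → Fin (2 ^ W) =>
        A (fun i => y (Fin.castAdd _ i)) ∨ (¬A (fun i => y (Fin.castAdd _ i)) ∧
        B' (fun i => y (Fin.castAdd _ i)) fun i => y (Fin.natAdd K i))).card * n ^ c ≤ T := by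
      set X := (Finset.univ.filter fun y : Fin (K + R * m) → Fin (2 ^ W) =>
        A (fun i => y (Fin.castAdd _ i)) ∨ (¬A (fun i => y (Fin.castAdd _ i)) ∧
        B' (fun i => y (Fin.castAdd _ i)) fun i => y (Fin.natAdd K i))).card
      have h1 : X * q ^ R ≤ 2 * T := by
        have h2 : (Finset.univ.filter A).card * q ^ R ≤ (2 ^ W) ^ K := hno
        have h3 : ((2 ^ W) ^ m / q) ^ R * q ^ R ≤ (2 ^ W) ^ (R * m) := by
          rw [← mul_pow, mul_comm R m, pow_mul]
          exact Nat.pow_le_pow_left (Nat.div_mul_le_self _ _) _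
        rw [Fintype.card_fin] at hcount
        calc X * q ^ R ≤ ((Finset.univ.filter A).card * (2 ^ W) ^ (R * m) +
              (2 ^ W) ^ K * ((2 ^ W) ^ m / q) ^ R) * q ^ R := Nat.mul_le_mul_right _ hcount
          _ = (Finset.univ.filter A).card * q ^ R * (2 ^ W) ^ (R * m) +
              (2 ^ W) ^ K * (((2 ^ W) ^ m / q) ^ R * q ^ R) := by ring
          _ ≤ (2 ^ W) ^ K * (2 ^ W) ^ (R * m) + (2 ^ W) ^ K * (2 ^ W) ^ (R * m) :=
              Nat.add_le_add (Nat.mul_le_mul_right _ h2) (Nat.mul_le_mul_left _ h3)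
          _ = 2 * T := by rw [hT, pow_add]; ring
      have h4 : n ^ c * 2 ≤ q ^ R := by
        rw [hR, pow_succ]
        exact Nat.mul_le_mul (Nat.pow_le_pow_left hnq c) hq2
      have h5 : X * (n ^ c * 2) ≤ X * q ^ R := Nat.mul_le_mul_left _ h4
      have h6 : X * (n ^ c * 2) = (X * n ^ c) * 2 := by ring
      omega
    rw [ENNReal.le_inv_iff_mul_le, mul_right_comm, ← div_eq_mul_inv,
      ENNReal.div_le_iff (by exact_mod_cast hT0) (by simp), one_mul]
    exact_mod_cast hcount'


/-! ## Preprocessing: parameters and the prime -/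

/-- Compute `a = clog 16 n` (variable `26`), `16 ^ a` (`27`) and some powers of two. -/
def sizeCmd : Cmd :=
  .asg 26 1 ;; .asg 27 16 ;; .asg 28 2048 ;;
    .loop (.inp 0 - .var 27) (.asg 27 (.var 27 * 16) ;; .asg 28 (.var 28 * 128) ;;
      .asg 26 (.var 26 + 1)) ;;
    .asg 29 (.var 28 * .var 28) ;; .asg 30 (.var 27 * .var 27 * .var 27 * 4)

/-- Set variable `35` to zero if variable `32` is divisible by some `d` with `2 ≤ d` below the value
of variable `28`. -/
def trialCmd : Cmd :=
  .asg 35 1 ;; .forC 33 (.var 28)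
    (.ite (.var 33 - 1) (.ite (.var 32 % .var 33) .skip (.asg 35 0)) .skip)

/-- Find a prime (variable `1`). -/
def primeCmd (R : ℕ) : Cmd :=
  .asg 1 2 ;; .forC 34 (.lit (132 * R) * (.var 26 * .var 26))
    (.rnd 32 (.var 29) ;; .ite (.var 32 + 1 - .var 30) (trialCmd ;; .ite (.var 35)
      (.asg 1 (.var 32)) .skip) .skip)

/-- The values of the variables computed by `sizeCmd`. -/
structure Sizes (a : ℕ) (σ : St) : Prop where
  lv : σ.v 26 = a
  q : σ.v 27 = 16 ^ a
  s : σ.v 28 = 2 ^ (7 * a + 4)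
  N : σ.v 29 = 2 ^ (14 * a + 8)
  q0 : σ.v 30 = 2 ^ (12 * a + 2)

theorem Sizes.congr {a : ℕ} {σ σ' : St} (h : Sizes a σ) (hv : ∀ x, 26 ≤ x → x ≤ 30 → σ'.v x = σ.v x) :
    Sizes a σ' :=
  ⟨(hv _ (by omega) (by omega)).trans h.lv, (hv _ (by omega) (by omega)).trans h.q,
    (hv _ (by omega) (by omega)).trans h.s, (hv _ (by omega) (by omega)).trans h.N,
    (hv _ (by omega) (by omega)).trans h.q0⟩

theorem sizeCmd_runs {E : Env} {n : ℕ} (hinp : E.inp.getD 0 0 = n) (hn : 2 ≤ n)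
    (hV : 2 ^ (14 * Nat.clog 16 n + 8) < E.V) (σ : St) :
    Runs E sizeCmd σ (4 * Nat.clog 16 n + 6) (Sizes (Nat.clog 16 n)) := by
  obtain ⟨a, ha⟩ : ∃ a, a = Nat.clog 16 n := ⟨_, rfl⟩
  have ha1 : 1 ≤ a := ha ▸ Nat.clog_pos (by norm_num) (by omega)
  have hlt : ∀ b, b < a ↔ 16 ^ b < n := fun b => ha ▸ Nat.lt_clog_iff_pow_lt (by norm_num)
  rw [← ha] at hV ⊢
  have e16 : ∀ b : ℕ, (16 : ℕ) ^ b = 2 ^ (4 * b) := fun b => by rw [pow_mul]; norm_num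
  have hVb : ∀ b ≤ a, 16 ^ b < E.V ∧ 2 ^ (7 * b + 4) < E.V ∧ b < E.V := by
    intro b hb
    have h1 : (2 : ℕ) ^ (4 * b) ≤ 2 ^ (14 * a + 8) := Nat.pow_le_pow_right (by norm_num) (by omega)
    have h2 : (2 : ℕ) ^ (7 * b + 4) ≤ 2 ^ (14 * a + 8) :=
      Nat.pow_le_pow_right (by norm_num) (by omega)
    have h3 : b < 2 ^ b := Nat.lt_two_pow_self
    have h4 : (2 : ℕ) ^ b ≤ 2 ^ (14 * a + 8) := Nat.pow_le_pow_right (by norm_num) (by omega)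
    rw [e16]
    omega
  have loop : ∀ (m b : ℕ) (σ : St), b + m = a → 1 ≤ b → σ.v 26 = b → σ.v 27 = 16 ^ b →
      σ.v 28 = 2 ^ (7 * b + 4) → Runs E (.loop (.inp 0 - .var 27) (.asg 27 (.var 27 * 16) ;;
        .asg 28 (.var 28 * 128) ;; .asg 26 (.var 26 + 1))) σ (m * 4 + 1) fun σ' =>
        σ'.v 26 = a ∧ σ'.v 27 = 16 ^ a ∧ σ'.v 28 = 2 ^ (7 * a + 4) := by
    intro m
    induction m with
    | zero =>
      intro b σ hb _ h26 h27 h28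
      obtain rfl : b = a := by omega
      refine Runs.loop_end ?_ ⟨h26, h27, h28⟩
      have := (hlt b).not.mp (lt_irrefl b)
      simp only [Ex.eval_sub, Ex.eval_inp, Ex.eval_ofNat, hinp, Ex.eval_var, h27]
      omega
    | succ m ih =>
      intro b σ hb hb1 h26 h27 h28
      have hba := (hlt b).mp (by omega)
      have e27 : σ.v 27 * 16 = 16 ^ (b + 1) := by rw [h27, pow_succ]
      have e28 : σ.v 28 * 128 = 2 ^ (7 * (b + 1) + 4) := by
        rw [h28, show 7 * (b + 1) + 4 = 7 * b + 4 + 7 by ring, pow_add _ (7 * b + 4)]; norm_num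
      obtain ⟨v1, v2, v3⟩ := hVb (b + 1) (by omega)
      refine (Runs.loop_step (s := 1 + 1 + 1) (t := m * 4 + 1) ?_ (Runs.asg_seq ?_
        (Runs.asg_seq ?_ (Runs.asg ?_ (ih (b + 1) _ (by omega) (by omega) ?_ ?_ ?_))))).time
        (by omega)
      · simp only [Ex.eval_sub, Ex.eval_inp, Ex.eval_ofNat, hinp, Ex.eval_var, h27]
        omega
      · simpa [e27] using v1
      · simpa [e28] using v2
      · simpa [h26] using v3
      · simp [h26]
      · simpa using e27
      · simpa using e28
  obtain ⟨v1, v2, v3⟩ := hVb 1 ha1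
  refine Runs.time (s := ((a - 1) * 4 + 1 + (1 + 1)) + 1 + 1 + 1) ?_ (by omega)
  refine Runs.asg_seq (by simpa using v3) (Runs.asg_seq (by simpa using v1)
    (Runs.asg_seq (by simpa using v2) ?_))
  refine Runs.seq (s := (a - 1) * 4 + 1) (t := 1 + 1) (loop (a - 1) 1 _ (by omega) le_rfl ?_ ?_ ?_) ?_
  · simp
  · simp
  · simp
  rintro σ₁ ⟨h26, h27, h28⟩ -
  refine Runs.asg_seq ?_ (Runs.asg ?_ ⟨?_, ?_, ?_, ?_, ?_⟩)
  · have : σ₁.v 28 * σ₁.v 28 = 2 ^ (14 * a + 8) := by rw [h28, ← pow_add]; congr 1; ring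
    simpa [this] using hV
  · have : σ₁.v 27 * σ₁.v 27 * σ₁.v 27 * 4 = 2 ^ (12 * a + 2) := by
      rw [h27, e16, ← pow_add, ← pow_add, pow_add _ _ 2]; congr 2; ring
    have h2 : (2 : ℕ) ^ (12 * a + 2) ≤ 2 ^ (14 * a + 8) :=
      Nat.pow_le_pow_right (by norm_num) (by omega)
    simp [this]; omega
  · simpa using h26
  · simpa using h27
  · simpa using h28
  · simp [h28, ← pow_add]; ring
  · simp only [St.set_v, Ex.eval_mul, Ex.eval_var, Ex.eval_ofNat]
    norm_num [h27, e16]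
    rw [← pow_add, ← pow_add, pow_add _ _ 2]; congr 2; ring

theorem trialCmd_runs {E : Env} {σ : St} {m r : ℕ} (h28 : σ.v 28 = m) (h32 : σ.v 32 = r)
    (hm : m < E.V) (hV : 1 < E.V) :
    Runs E trialCmd σ (m * 5 + 3) fun σ' =>
      (σ'.v 35 ≠ 0 ↔ ∀ d < m, 2 ≤ d → ¬d ∣ r) := by
  have hsucc : ∀ k, (∀ d < k + 1, 2 ≤ d → ¬d ∣ r) ↔ (∀ d < k, 2 ≤ d → ¬d ∣ r) ∧ (2 ≤ k → ¬k ∣ r) := by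
    intro k
    constructor
    · exact fun h => ⟨fun d hd => h d (by omega), fun h2 => h k (by omega) h2⟩
    · rintro ⟨h1, h2⟩ d hd
      rcases Nat.lt_succ_iff_lt_or_eq.mp hd with hd | rfl
      exacts [h1 d hd, h2]
  refine Runs.time (s := m * (3 + 2) + 2 + 1) (Runs.asg_seq (by simpa using hV) ?_) (by omega)
  refine Runs.forC (fun k σ' => (σ'.v 35 ≠ 0 ↔ ∀ d < k, 2 ≤ d → ¬d ∣ r)) hm (by simp)
    (fun σ' k _ _ _ hf => ?_) (by simp) ?_ (fun σ' h _ _ => h)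
  · simp only [Ex.eval_var]; rw [hf.v _ (by simp)]; simpa using h28
  · intro σ' k hk hI hv hf
    have h32' : σ'.v 32 = r := by rw [hf.v _ (by simp)]; simpa using h32
    refine Runs.ite (t := 2) (fun h => Runs.ite (t := 1) (fun h' => ?_) fun h' => ?_) fun h => ?_
    · simp only [Ex.eval_mod, Ex.eval_var, hv, h32'] at h'
      refine (Runs.skip ?_).time (by norm_num)
      simp only [St.set_v, hsucc]
      rw [if_neg (by norm_num), hI]
      exact ⟨fun h1 => ⟨h1, fun _ hd => h' (Nat.mod_eq_zero_of_dvd hd)⟩, fun h1 => h1.1⟩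
    · simp only [Ex.eval_sub, Ex.eval_var, hv, Ex.eval_ofNat] at h
      simp only [Ex.eval_mod, Ex.eval_var, hv, h32'] at h'
      refine Runs.asg (by simp; omega) ?_
      simp only [St.set_v, hsucc]
      rw [if_neg (by norm_num), if_pos trivial]
      simp only [Ex.eval_ofNat, ne_eq, not_true_eq_false, false_iff]
      exact fun h1 => h1.2 (by omega) (Nat.dvd_of_mod_eq_zero h')
    · simp only [Ex.eval_sub, Ex.eval_var, hv, Ex.eval_ofNat] at h
      refine (Runs.skip ?_).time (by norm_num)
      simp only [St.set_v, hsucc]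
      rw [if_neg (by norm_num), hI]
      exact ⟨fun h1 => ⟨h1, fun h2 => by omega⟩, fun h1 => h1.1⟩

/-- A composite number below `m * m` has a prime factor below `m`; conversely `m ≤ r` keeps `r`
itself out of the range of trial divisors. -/
theorem prime_iff_trial {m r : ℕ} (h1 : m ≤ r) (h2 : r < m * m) (h3 : 2 ≤ r) :
    r.Prime ↔ ∀ d < m, 2 ≤ d → ¬d ∣ r := by
  constructor
  · intro hr d hd h2d hdr
    rcases (Nat.dvd_prime hr).mp hdr with h | h <;> omega
  · intro h
    by_contra hr
    have hsq := Nat.minFac_sq_le_self (by omega) hr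
    have hm : r.minFac < m := by
      by_contra h'
      have : m * m ≤ r.minFac ^ 2 := by
        rw [sq]; exact Nat.mul_le_mul (not_lt.mp h') (not_lt.mp h')
      omega
    exact h _ hm (Nat.minFac_prime (by omega)).two_le (Nat.minFac_dvd r)

theorem primeCmd_runs {E : Env} {R a : ℕ} {σ : St} (ha : 1 ≤ a) (hs : Sizes a σ) (hu : σ.used = 0)
    (hV : 2 ^ (14 * a + 8) < E.V) (hK : 132 * R * (a * a) < E.V) :
    Runs E (primeCmd R) σ (132 * R * (a * a) * (2 ^ (7 * a + 4) * 5 + 9) + 3) fun σ' =>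
      σ'.v 1 = pickPrime (2 ^ (12 * a + 2)) (2 ^ (14 * a + 8)) (fun i => E.coins i)
        (132 * R * (a * a)) ∧ σ'.used = 132 * R * (a * a) := by
  have hmm : 2 ^ (7 * a + 4) * 2 ^ (7 * a + 4) = 2 ^ (14 * a + 8) := by
    rw [← pow_add]; congr 1; ring
  -- Only candidates that are at least `2 ^ (12 * a + 2)` reach the trial division, so they are not
  -- below the range of trial divisors.
  have hmq : 2 ^ (7 * a + 4) ≤ 2 ^ (12 * a + 2) := Nat.pow_le_pow_right (by norm_num) (by omega)
  have hm2 : 2 ≤ 2 ^ (7 * a + 4) := by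
    calc 2 = 2 ^ 1 := by norm_num
      _ ≤ _ := Nat.pow_le_pow_right (by norm_num) (by omega)
  have hq0 := hs.q0
  have hN := hs.N
  have hs7 := hs.s
  have hN2 : 2 < 2 ^ (14 * a + 8) := by
    calc 2 < 2 ^ 2 := by norm_num
      _ ≤ _ := Nat.pow_le_pow_right (by norm_num) (by omega)
  generalize 2 ^ (14 * a + 8) = N at *
  generalize 2 ^ (7 * a + 4) = m at *
  generalize 2 ^ (12 * a + 2) = q0 at *
  have hmN : m ≤ N := by nlinarith
  refine Runs.time (s := 132 * R * (a * a) * ((1 + (m * 5 + 3 + (1 + 1) + 1)) + 2) + 2 + 1)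
    (Runs.asg_seq (by simp; omega) ?_) (by nlinarith)
  refine Runs.forC (fun k σ' => σ'.v 1 = pickPrime q0 N (fun i => E.coins i) k ∧ σ'.used = k) hK
    (by simp [trialCmd]) (fun σ' k _ _ _ hf => ?_) ⟨by simp [pickPrime], by simpa using hu⟩ ?_
    (fun σ' h _ _ => h)
  · simp only [Ex.eval_mul, Ex.eval_lit, Ex.eval_var]
    rw [hf.v _ (by simp [trialCmd]), St.set_v, if_neg (by norm_num), hs.lv]
  · intro σ' k hk hI hv hf
    have fv : ∀ x, 26 ≤ x → x ≤ 30 → σ'.v x = σ.v x := fun x h1 h2 => by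
      rw [hf.v x (by simp [trialCmd]; omega), St.set_v, if_neg (by omega)]
    have e29 : σ'.v 29 = N := by rw [fv _ (by norm_num) (by norm_num), hN]
    refine Runs.seq (Runs.rnd (by
      simp only [Ex.eval_var, e29]
      exact (Nat.mod_lt _ (by omega)).trans hV) rfl) ?_
    rintro σ₁ rfl -
    simp only [Ex.eval_var, e29, hI.2]
    set r := (E.coins k : ℕ) % N with hr
    have hrN : r < N := Nat.mod_lt _ (by omega)
    refine Runs.ite (t := m * 5 + 3 + (1 + 1)) (fun h => ?_) fun h => ?_
    · simp only [Ex.eval_sub, Ex.eval_add, Ex.eval_var, St.set_v, St.draw_v, Ex.eval_ofNat] at h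
      norm_num at h
      rw [fv _ (by norm_num) (by norm_num), hq0] at h
      refine Runs.seq (trialCmd_runs (m := m) (r := r) (by simp [fv, hs7]) (by simp) (by omega)
        (by omega)) fun σ₂ h2 hf2 => ?_
      rw [← prime_iff_trial (by omega) (by rw [hmm]; exact hrN) (by omega)] at h2
      have g1 : σ₂.v 1 = pickPrime q0 N (fun i => E.coins i) k := by
        rw [hf2.v _ (by simp [trialCmd])]; simpa using hI.1
      have g32 : σ₂.v 32 = r := by
        rw [hf2.v _ (by simp [trialCmd])]; simp
      have gu : σ₂.used = k + 1 := by
        rw [hf2.used (by simp [trialCmd])]; simp [hI.2]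
      refine Runs.ite (t := 1) (fun h3 => ?_) fun h3 => ?_
      · refine Runs.asg (by simp [g32]; omega) ⟨?_, by simpa using gu⟩
        have : q0 ≤ (E.coins k : ℕ) % N ∧ ((E.coins k : ℕ) % N).Prime := ⟨by omega, h2.mp h3⟩
        simp [pickPrime, this, g32, hr]
      · refine (Runs.skip ⟨?_, by simpa using gu⟩).time (by norm_num)
        have : ¬(q0 ≤ (E.coins k : ℕ) % N ∧ ((E.coins k : ℕ) % N).Prime) :=
          fun h4 => h2.mpr h4.2 h3
        simp [pickPrime, this, g1]
    · simp only [Ex.eval_sub, Ex.eval_add, Ex.eval_var, St.set_v, St.draw_v, Ex.eval_ofNat] at h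
      norm_num at h
      rw [fv _ (by norm_num) (by norm_num), hq0] at h
      refine (Runs.skip ⟨?_, by simp [hI.2]⟩).time (by omega)
      have : ¬(q0 ≤ (E.coins k : ℕ) % N ∧ ((E.coins k : ℕ) % N).Prime) := by omega
      simp [pickPrime, this, hI.1]


/-! ### Inversion with fresh denominators -/

/-- Clear the denominators. -/
def clearCmd : Cmd := .fill 36 37 (.var 2) 1 4 (.var 36) 0

theorem clearCmd_runs {E : Env} {p Q : ℕ} {σ : St} {m : ℕ → ℕ → ZMod p} (hQV : Q < E.V)
    (hV1 : 1 < E.V) (hm : HoldsMat (σ.h 3) Q m) (h0 : ∀ a, σ.h 0 a = 0) (h1 : σ.v 1 = p)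
    (h2 : σ.v 2 = Q) : Runs E clearCmd σ (Q * 7 + 2) fun σ' => MatSt σ' Q m (0 : ℕ → ZMod p) := by
  refine (Runs.fill (fun a _ => a) (fun _ _ => 0) (by norm_num) hQV hV1 (fun σ' hf => ?_)
    (fun _ _ => rfl) (fun σ' a b _ _ _ ha hb _ => ⟨by simpa using ha, rfl, by omega⟩)
    fun a b a' b' _ _ _ _ h => ⟨h, by omega⟩).mono (by omega) ?_
  · simpa [h2] using hf.v 2 (by simp)
  rintro σ₁ ⟨g1, -⟩ hfr
  refine ⟨?_, fun i hi => ?_, ?_, ?_, ?_⟩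
  · rw [hfr.h 3 (by simp)]; exact hm
  · simpa using g1 i 0 hi (by norm_num)
  · rw [hfr.h 0 (by simp)]; exact h0
  · rw [hfr.v 1 (by simp)]; exact h1
  · rw [hfr.v 2 (by simp)]; exact h2

/-- Clear the denominators and invert the matrix in array `3`. -/
def invertCmd (P : Program) : Cmd := clearCmd ;; invCmd P

theorem invertCmd_noV (P : Program) {x : ℕ}
    (h : x < 3 ∨ 17 < x ∧ x < 20 ∨ x = 23 ∨ 25 < x ∧ x < 36 ∨ 37 < x) : (invertCmd P).NoV x := by
  have := invCmd_noV P (x := x) (by omega)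
  simp [invertCmd, clearCmd, this]; omega

theorem invertCmd_noA (P : Program) {x : ℕ} (h : 4 < x) : (invertCmd P).NoA x := by
  simp [invertCmd, clearCmd, invCmd_noA P h]; omega

theorem invertCmd_noR (P : Program) : (invertCmd P).NoR := by
  simp [invertCmd, clearCmd, invCmd_noR P]

/-- The time of `invertCmd` with stride `Q` for a matrix of size `2 ^ lev`. -/
def invertTime (P : Program) (tm : ℕ → ℕ) (Q lev : ℕ) : ℕ := Q * 7 + invTime P tm lev + 6

/-- The only facts about the inversion that are used later. That entries outside the inverted block
stay in place matters in the update, where that block is surrounded by other data. -/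
theorem invertCmd_runs {P : Program} {κ : ℕ} {tm : ℕ → ℕ} {E : Env} {p Q : ℕ} [hp : Fact p.Prime]
    {σ : St} {m : ℕ → ℕ → ZMod p} (hP : MulProgram P κ tm) {lev : ℕ}
    (hf : ∀ j < lev, MulFit P κ tm E.V p (2 ^ j)) (hlev : 2 ^ lev ≤ Q) (hQ : Q * Q ≤ E.V)
    (hQV : Q < E.V) (hpV : p < E.V) (hm : HoldsMat (σ.h 3) Q m) (h0 : ∀ a, σ.h 0 a = 0)
    (h1 : σ.v 1 = p) (h2 : σ.v 2 = Q) (h23 : σ.v 23 = 2 ^ lev) :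
    Runs E (invertCmd P) σ (invertTime P tm Q lev) fun σ' =>
      ∃ (x : ℕ → ℕ → ZMod p) (d : ℕ → ZMod p), MatSt σ' Q x d ∧
      blk m 0 0 (2 ^ lev) (2 ^ lev) * blk x 0 0 (2 ^ lev) (2 ^ lev) =
        d 0 • (1 : Matrix (Fin (2 ^ lev)) (Fin (2 ^ lev)) (ZMod p)) ∧
      ((∀ i ≤ 2 ^ lev, (blk m 0 0 i i).det ≠ 0) → d 0 ≠ 0) ∧
      ∀ i j, ¬(i < 2 ^ lev ∧ j < 2 ^ lev) → x i j = m i j := by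
  have hV1 : 1 < E.V := hp.out.one_lt.trans hpV
  refine Runs.time (s := (Q * 7 + 2) + (invTime P tm lev + 4)) ?_ (by unfold invertTime; omega)
  refine Runs.seq (clearCmd_runs hQV hV1 hm h0 h1 h2) ?_
  intro σ₁ hm₁ hfr
  refine (invCmd_runs hP hf hlev hQ hpV hm₁
    (by rw [hfr.v 23 (by simp [clearCmd])]; exact h23)).mono le_rfl ?_
  intro σ₂ h₂ _
  exact ⟨_, _, h₂, blockInv_mul lev 0 m 0, blockInv_ne_zero lev 0 m 0,
    fun i j hij => (blockInv_of_outside lev 0 m 0).1 i j (by omega)⟩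

/-! ### The adjacency matrix and the random weights -/

/-- The array `a` holds the adjacency matrix of `g`. -/
def HoldsGraph (a : ℕ → ℕ) (q : ℕ) (g : ℕ → ℕ → Prop) : Prop :=
  ∀ i j, i < q → j < q → (g i j → a (i * q + j) = 1) ∧ (¬g i j → a (i * q + j) = 0)

/-- The edges of `G` as a relation between numbers. -/
def natAdj {n : ℕ} (G : Digraph (Fin n)) (i j : ℕ) : Prop :=
  ∃ (hi : i < n) (hj : j < n), G.Adj ⟨i, hi⟩ ⟨j, hj⟩

/-- Copy the adjacency matrix to array `5`, with stride `q`. -/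
def graphCmd : Cmd :=
  .fill 36 37 (.var 27) (.var 27) 5 (.var 36 * .var 27 + .var 37)
    ((.inp 0 - .var 36) / (.inp 0 - .var 36) * ((.inp 0 - .var 37) / (.inp 0 - .var 37)) *
      .inp (1 + (.var 36 * .inp 0 + .var 37)))

theorem graphCmd_runs {E : Env} {n q : ℕ} {G : Digraph (Fin n)} (hinp : E.inp = graphWords G)
    (hqV : q < E.V) (hV : 1 < E.V) {σ : St} (hq : σ.v 27 = q) :
    Runs E graphCmd σ (q * (q * 3 + 4) + 2) fun σ' => HoldsGraph (σ'.h 5) q (natAdj G) := by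
  classical
  have hin : ∀ i j (hi : i < n) (hj : j < n), E.inp.getD (1 + (i * n + j)) 0 =
      if G.Adj ⟨i, hi⟩ ⟨j, hj⟩ then 1 else 0 := by
    intro i j hi hj
    have := flatten_ofFn_getD (fun i j : Fin n => if G.Adj i j then 1 else 0) [] hi hj
    rw [List.append_nil] at this
    rw [hinp, graphWords, add_comm, List.getD_cons_succ, ← this]
  have h0 : E.inp.getD 0 0 = n := by rw [hinp, graphWords, List.getD_cons_zero]
  refine (Runs.fill (fun a b => a * q + b) (fun a b => if natAdj G a b then 1 else 0)
    (by norm_num) hqV hqV (fun σ' hf => ?_) (fun σ' hf => ?_)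
    (fun σ' a b ha hb hf hi hj _ => ⟨?_, ?_, ?_⟩)
    fun a b a' b' _ hb _ hb' h => idx_inj hb hb' h).mono le_rfl ?_
  · simpa [hq] using hf.v 27 (by simp)
  · simpa [hq] using hf.v 27 (by simp)
  · have := hf.v 27 (by simp)
    simp [hi, hj, this, hq]
  -- With truncated subtraction and `0 / 0 = 0`, the quotient `(n - i) / (n - i)` indicates `i < n`.
  -- So the nodes from `n` up to `q - 1` are isolated.
  · simp only [Ex.eval_mul, Ex.eval_div, Ex.eval_sub, Ex.eval_inp, Ex.eval_ofNat, Ex.eval_var, hi, hj,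
      Ex.eval_add, h0]
    by_cases han : a < n
    · by_cases hbn : b < n
      · rw [Nat.div_self (by omega), Nat.div_self (by omega), hin a b han hbn]
        simp [natAdj, han, hbn]
      · have : n - b = 0 := by omega
        simp [natAdj, hbn, this]
    · have : n - a = 0 := by omega
      simp [natAdj, han, this]
  · split_ifs <;> omega
  · rintro σ' ⟨h1, -⟩ -
    intro i j hi hj
    rw [h1 i j hi hj]
    exact ⟨fun h => if_pos h, fun h => if_neg h⟩

/-- Draw the weights of round `r`. -/
def weightCmd (r : ℕ) : Cmd :=
  .forC 36 (.var 27) (.forC 37 (.var 27) (.rnd 38 (.var 30) ;;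
    .sto (10 + 4 * r) (.var 36 * .var 27 + .var 37) (.var 38 % .var 1)))

/-- Residues modulo the power of two `q0` are uniform, unlike residues modulo `p`. The second
reduction changes nothing once `q0 ≤ p`; it keeps the entries reduced when the search has fallen
back to `p = 2`. -/
theorem weightCmd_runs {E : Env} {r q q0 p U : ℕ} {σ : St} (hq : σ.v 27 = q) (hq0 : σ.v 30 = q0)
    (hp : σ.v 1 = p) (hu : σ.used = U) (hqV : q < E.V) (h0V : q0 < E.V) (h0 : 0 < q0) (hpV : p < E.V)
    (hp0 : 0 < p) :
    Runs E (weightCmd r) σ (q * (q * 4 + 4) + 2) fun σ' => σ'.used = U + q * q ∧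
      ∀ x < q * q, σ'.h (10 + 4 * r) x = (E.coins (U + x) : ℕ) % q0 % p := by
  let I : ℕ → St → Prop := fun x σ' => σ'.used = U + x ∧
    ∀ y < x, σ'.h (10 + 4 * r) y = (E.coins (U + y) : ℕ) % q0 % p
  refine Runs.forC (fun l => I (l * q)) hqV (by simp) (fun σ' _ _ _ _ hf => ?_) ?_ ?_ ?_
  · simpa [hq] using hf.v 27 (by simp)
  · exact ⟨by simpa using hu, fun y hy => by omega⟩
  · intro σ₁ l hl hI hv hf
    refine (Runs.forC (t := 1 + 1) (fun m => I (l * q + m)) hqV (by simp)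
      (fun σ' _ _ _ _ hf' => ?_) (by simpa [I] using hI) ?_ ?_).time (by omega)
    · simp only [Ex.eval_var]; rw [hf'.v 27 (by simp), hf.v 27 (by simp), hq]
    · intro σ₂ m hm hI₂ hv₂ hf₂
      have e : ∀ x, x ≠ 36 → x ≠ 37 → x ≠ 38 → σ₂.v x = σ.v x := fun x h1 h2 h3 => by
        rw [hf₂.v x (by simp [h1, h2, h3]), hf.v x (by simp [h1, h2, h3])]
      have e36 : σ₂.v 36 = l := by rw [hf₂.v 36 (by simp), hv]
      have hlt : (E.coins (U + (l * q + m)) : ℕ) % q0 < q0 := Nat.mod_lt _ h0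
      refine Runs.seq (s := 1) (t := 1) (Runs.rnd ?_ rfl) ?_
      · simp only [Ex.eval_var, e 30 (by norm_num) (by norm_num) (by norm_num), hq0]
        exact (Nat.mod_lt _ h0).trans h0V
      rintro σ₃ rfl -
      simp only [Ex.eval_var, e 30 (by norm_num) (by norm_num) (by norm_num), hq0, hI₂.1]
      refine Runs.sto ?_ ⟨?_, ?_⟩
      · simp only [Ex.eval_mod, Ex.eval_var, St.set_v, St.draw_v]
        norm_num
        rw [e 1 (by norm_num) (by norm_num) (by norm_num), hp]
        exact (Nat.mod_lt _ hp0).trans hpV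
      · simp [hI₂.1]; ring
      · intro y hy
        simp only [St.set_h, St.put_h_same, Ex.eval_add, Ex.eval_mul, Ex.eval_mod, Ex.eval_var,
          St.set_v, St.draw_v, St.draw_h]
        norm_num
        rw [e 27 (by norm_num) (by norm_num) (by norm_num),
          e 1 (by norm_num) (by norm_num) (by norm_num), e36, hv₂, hq, hp]
        split_ifs with h
        · rw [h]
        · exact hI₂.2 y (by omega)
    · intro σ₂ hI₂ _ _
      refine ⟨?_, fun y hy => ?_⟩
      · have := hI₂.1
        simp only [St.set_used, this]; ring
      · exact hI₂.2 y (by rw [add_mul] at hy; omega)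
  · intro σ' hI _ _
    exact hI

/-! ### Rounds of the preprocessing -/

/-- The results of round `r` of the preprocessing: the weights, the scaled inverse and the scale. -/
structure Round {p : ℕ} [Fact p.Prime] (q : ℕ) (g : ℕ → ℕ → Prop) (r : ℕ) (w n : ℕ → ℕ → ZMod p)
    (μ : ZMod p) (σ : St) : Prop where
  wt : HoldsMat (σ.h (10 + 4 * r)) q w
  nh : HoldsMat (σ.h (11 + 4 * r)) q n
  scale : σ.h (13 + 4 * r) 0 = μ.val
  inv : walkMat q g w * blk n 0 0 q q = μ • (1 : Matrix (Fin q) (Fin q) (ZMod p))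
  ne_zero : (∀ i ≤ q, (walkMat q (fun x y => g x y ∧ x < i) w).det ≠ 0) → μ ≠ 0

/-- The position in a matrix with stride `q`. -/
def idxEx : Ex := .var 36 * .var 27 + .var 37

/-- Round `r` of the preprocessing. -/
def roundCmd (P : Program) (r : ℕ) : Cmd :=
  weightCmd r ;;
  .fill 36 37 (.var 27) (.var 27) 3 idxEx ((1 - ((.var 36 - .var 37) + (.var 37 - .var 36)) +
    .var 1 - .ld 5 idxEx * .ld (10 + 4 * r) idxEx) % .var 1) ;;
  .asg 2 (.var 27) ;; .asg 23 (.var 27) ;; invertCmd P ;;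
  .fill 36 37 (.var 27) (.var 27) (11 + 4 * r) idxEx (.ld 3 idxEx) ;;
  .sto (13 + 4 * r) 0 (.ld 4 0)

theorem roundCmd_noV (P : Program) (r : ℕ) {x : ℕ} (h : x = 1 ∨ 25 < x ∧ x < 36) :
    (roundCmd P r).NoV x := by
  have := invertCmd_noV P (x := x) (by omega)
  simp [roundCmd, weightCmd, this]; omega

theorem roundCmd_noA (P : Program) (r : ℕ) {x : ℕ}
    (h : 4 < x ∧ x < 10 ∨ 9 < x ∧ (x < 10 + 4 * r ∨ 13 + 4 * r < x)) : (roundCmd P r).NoA x := by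
  have := invertCmd_noA P (x := x) (by omega)
  simp [roundCmd, weightCmd, this]; omega

theorem val_add_sub {p : ℕ} [hp : Fact p.Prime] (δ : ℕ) (x : ZMod p) :
    (δ + p - x.val) % p = ((δ : ZMod p) - x).val := by
  rw [← ZMod.val_natCast, Nat.cast_sub ((ZMod.val_lt x).le.trans (Nat.le_add_left _ _))]
  simp

/-- The time of a round. -/
def roundTime (P : Program) (tm : ℕ → ℕ) (q lev : ℕ) : ℕ :=
  10 * (q * q) + 12 * q + invertTime P tm q lev + 9

theorem roundCmd_runs {P : Program} {κ : ℕ} {tm : ℕ → ℕ} {E : Env} {p q q0 U lev r : ℕ}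
    [hp : Fact p.Prime] {σ : St} {g : ℕ → ℕ → Prop} (hP : MulProgram P κ tm)
    (hf : ∀ j < lev, MulFit P κ tm E.V p (2 ^ j)) (hlev : q = 2 ^ lev) (hQ : q * q ≤ E.V)
    (hqV : q < E.V) (hpV : p < E.V) (h0V : q0 < E.V) (h0 : 0 < q0) (hq : σ.v 27 = q)
    (hq0 : σ.v 30 = q0) (h1 : σ.v 1 = p) (hu : σ.used = U) (hsim : ∀ a, σ.h 0 a = 0)
    (hg : HoldsGraph (σ.h 5) q g) :
    Runs E (roundCmd P r) σ (roundTime P tm q lev) fun σ' => (∃ (n : ℕ → ℕ → ZMod p) (μ : ZMod p),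
      Round q g r (weightsOf fun i : Fin (q * q) => (((E.coins (U + i) : ℕ) % q0 : ℕ) : ZMod p))
        n μ σ') ∧ σ'.used = U + q * q ∧ ∀ a, σ'.h 0 a = 0 := by
  classical
  set w : ℕ → ℕ → ZMod p := weightsOf fun i : Fin (q * q) =>
    (((E.coins (U + i) : ℕ) % q0 : ℕ) : ZMod p) with hw
  have hV1 : 1 < E.V := hp.out.one_lt.trans hpV
  refine Runs.time (s := (q * (q * 4 + 4) + 2) + ((q * (q * 3 + 4) + 2) + ((invertTime P tm q lev +
    ((q * (q * 3 + 4) + 2) + 1)) + 1 + 1))) ?_ (by unfold roundTime; ring_nf; omega)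
  refine Runs.seq (weightCmd_runs hq hq0 h1 hu hqV h0V h0 hpV hp.out.pos) ?_
  rintro σ₁ ⟨u1, w1⟩ hf1
  have e1 : ∀ x, x ≠ 36 → x ≠ 37 → x ≠ 38 → σ₁.v x = σ.v x := fun x a b c =>
    hf1.v x (by simp [weightCmd, a, b, c])
  have hW1 : HoldsMat (σ₁.h (10 + 4 * r)) q w := by
    intro i j hi hj
    have hij := idx_lt hi hj
    rw [w1 _ hij, hw, weightsOf, dif_pos hij, ZMod.val_natCast]
  refine Runs.seq (Runs.fill (fun a b => a * q + b) (fun a b => (walk g w a b).val) (by norm_num)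
    hqV hqV (fun σ' hf => ?_) (fun σ' hf => ?_) (fun σ' a b ha hb hf hi hj _ => ⟨?_, ?_, ?_⟩)
    fun a b a' b' _ hb _ hb' h => idx_inj hb hb' h) ?_
  · simpa [e1, hq] using hf.v 27 (by simp)
  · simpa [e1, hq] using hf.v 27 (by simp)
  · have := hf.v 27 (by simp)
    simp [idxEx, hi, hj, this, e1, hq]
  · have e27 := hf.v 27 (by simp)
    have e01 := hf.v 1 (by simp)
    have e5 := hf.h 5 (by simp)
    have e10 := hf.h (10 + 4 * r) (by simp; omega)
    have hid : idxEx.eval E.inp σ' = a * q + b := by simp [idxEx, hi, hj, e27, e1, hq]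
    simp only [Ex.eval_mod, Ex.eval_sub, Ex.eval_add, Ex.eval_mul, Ex.eval_ld, hid, Ex.eval_var,
      hi, hj, e01, e5, e10, hW1 a b ha hb, e1 1 (by norm_num) (by norm_num) (by norm_num), h1,
      Ex.eval_ofNat]
    rw [hf1.h 5 (by simp [weightCmd]; omega)]
    -- With truncated subtraction, `(a - b) + (b - a)` is the distance of `a` and `b`.
    have hδ : ((1 - (a - b + (b - a)) : ℕ) : ZMod p) = if a = b then 1 else 0 := by
      split_ifs with h
      · subst h; simp
      · have : 1 - (a - b + (b - a)) = 0 := by omega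
        rw [this]; simp
    by_cases hab : g a b
    · rw [(hg a b ha hb).1 hab, one_mul, val_add_sub, hδ, walk, if_pos hab]
    · have := val_add_sub (p := p) (1 - (a - b + (b - a))) 0
      rw [ZMod.val_zero] at this
      rw [(hg a b ha hb).2 hab, zero_mul, this, hδ, walk, if_neg hab]
  · exact (ZMod.val_lt _).trans hpV
  rintro σ₂ ⟨m2, -⟩ hf2
  have e2 : ∀ x, x ≠ 36 → x ≠ 37 → x ≠ 38 → σ₂.v x = σ.v x := fun x a b c => by
    rw [hf2.v x (by simp [a, b]), e1 x a b c]
  have e27 : σ₂.v 27 = q := by rw [e2 27 (by norm_num) (by norm_num) (by norm_num), hq]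
  refine Runs.asg_seq (by simpa [e27] using hqV) (Runs.asg_seq (by simpa [e27] using hqV) ?_)
  refine Runs.seq (invertCmd_runs (p := p) (Q := q) (m := walk g w) hP hf hlev.ge hQ hqV hpV ?_ ?_
    ?_ ?_ ?_) ?_
  · exact fun i j hi hj => m2 i j hi hj
  · intro a
    simp only [St.set_h]
    rw [hf2.h 0 (by simp), hf1.h 0 (by simp [weightCmd]; omega), hsim]
  · simp [e2, h1]
  · simp [e27]
  · simp [e27, hlev]
  rintro σ₃ ⟨x, d, i, i4, i5, -⟩ hf3
  have hq1 : 0 < q := by rw [hlev]; positivity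
  have e3 : σ₃.v 27 = q := by rw [hf3.v 27 (invertCmd_noV P (by omega))]; simp [e27]
  refine Runs.seq (Runs.fill (fun a b => a * q + b) (fun a b => (x a b).val) (by norm_num)
    hqV hqV (fun σ' hf => ?_) (fun σ' hf => ?_) (fun σ' a b ha hb hf hi hj _ => ⟨?_, ?_, ?_⟩)
    fun a b a' b' _ hb _ hb' h => idx_inj hb hb' h) ?_
  · simpa [e3] using hf.v 27 (by simp)
  · simpa [e3] using hf.v 27 (by simp)
  · have := hf.v 27 (by simp)
    simp [idxEx, hi, hj, this, e3]
  · have e27 := hf.v 27 (by simp)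
    have hid : idxEx.eval E.inp σ' = a * q + b := by simp [idxEx, hi, hj, e27, e3]
    rw [Ex.eval_ld, hid, hf.h 3 (by simp; omega), i.mat a b ha hb]
  · exact (ZMod.val_lt _).trans hpV
  rintro σ₄ ⟨m4, -⟩ hf4
  have h40 : σ₄.h 4 0 = (d 0).val := by rw [hf4.h 4 (by simp; omega), i.den 0 hq1]
  refine Runs.sto (by simp [h40]; exact (ZMod.val_lt _).trans hpV) ⟨⟨x, d 0, ⟨?_, ?_, ?_, ?_, ?_⟩⟩,
    ?_, ?_⟩
  · rw [St.put_h_ne _ _ _ (by omega), hf4.h _ (by simp), hf3.h _ (invertCmd_noA P (by omega))]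
    simp only [St.set_h]
    rw [hf2.h _ (by simp; omega)]
    exact hW1
  · rw [St.put_h_ne _ _ _ (by omega)]
    exact fun i j hi hj => m4 i j hi hj
  · simp [h40]
  · rw [← hlev] at i4; exact i4
  · intro h
    refine i5 fun i hi => det_blk_walk_ne_zero (q := q) (by omega) (h i (by omega))
  · rw [St.put_used, hf4.used (by simp), hf3.used (invertCmd_noR P)]
    simp only [St.set_used]
    rw [hf2.used (by simp), u1]
  · intro a
    rw [St.put_h_ne _ _ _ (by omega), hf4.h 0 (by simp; omega)]
    exact i.sim a

/-- The first `R` rounds. -/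
def roundsCmd (P : Program) : ℕ → Cmd
  | 0 => .skip
  | R + 1 => roundsCmd P R ;; roundCmd P R

theorem roundsCmd_noV (P : Program) {x : ℕ} (h : x = 1 ∨ 25 < x ∧ x < 36) (R : ℕ) :
    (roundsCmd P R).NoV x := by
  induction R with
  | zero => trivial
  | succ R ih => exact ⟨ih, roundCmd_noV P R h⟩

theorem roundsCmd_noA (P : Program) {x : ℕ} (h : 4 < x ∧ x < 10) (R : ℕ) :
    (roundsCmd P R).NoA x := by
  induction R with
  | zero => trivial
  | succ R ih => exact ⟨ih, roundCmd_noA P R (Or.inl h)⟩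

/-- The weights of round `r`, where the first weight of round `0` is the random word `K`. -/
def roundWeights (p q q0 K : ℕ) (x : ℕ → ℕ) (r : ℕ) : ℕ → ℕ → ZMod p :=
  fun i j => if h : i * q + j < q * q then
    (fun i : Fin (q * q) => ((x (K + (r * (q * q) + i)) % q0 : ℕ) : ZMod p)) ⟨i * q + j, h⟩ else 0

theorem Round.congr {p q r : ℕ} [Fact p.Prime] {g : ℕ → ℕ → Prop} {w n : ℕ → ℕ → ZMod p} {μ : ZMod p}
    {σ σ' : St} (h : Round q g r w n μ σ) (h0 : σ'.h (10 + 4 * r) = σ.h (10 + 4 * r))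
    (h1 : σ'.h (11 + 4 * r) = σ.h (11 + 4 * r)) (h3 : σ'.h (13 + 4 * r) 0 = σ.h (13 + 4 * r) 0) :
    Round q g r w n μ σ' :=
  ⟨h0 ▸ h.wt, h1 ▸ h.nh, h3.trans h.scale, h.inv, h.ne_zero⟩

/-- The number of rounds is a constant, so they are unrolled in the program, and round `r` owns the
arrays `10 + 4 * r` to `13 + 4 * r`. Later rounds therefore preserve the results of earlier ones,
and the rounds consume disjoint stretches of random words. -/
theorem roundsCmd_runs {P : Program} {κ : ℕ} {tm : ℕ → ℕ} {E : Env} {p q q0 K lev : ℕ}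
    [hp : Fact p.Prime] {σ : St} {g : ℕ → ℕ → Prop} (hP : MulProgram P κ tm)
    (hf : ∀ j < lev, MulFit P κ tm E.V p (2 ^ j)) (hlev : q = 2 ^ lev) (hQ : q * q ≤ E.V)
    (hqV : q < E.V) (hpV : p < E.V) (h0V : q0 < E.V) (h0 : 0 < q0) (hq : σ.v 27 = q)
    (hq0 : σ.v 30 = q0) (h1 : σ.v 1 = p) (hu : σ.used = K) (hsim : ∀ a, σ.h 0 a = 0)
    (hg : HoldsGraph (σ.h 5) q g) (R : ℕ) :
    Runs E (roundsCmd P R) σ (R * roundTime P tm q lev) fun σ' =>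
      (∀ r < R, ∃ (n : ℕ → ℕ → ZMod p) (μ : ZMod p),
        Round q g r (roundWeights p q q0 K (fun i => E.coins i) r) n μ σ') ∧
      σ'.used = K + R * (q * q) ∧ ∀ a, σ'.h 0 a = 0 := by
  induction R with
  | zero =>
    refine (Runs.skip ⟨fun r hr => by omega, by simpa using hu, hsim⟩).time (by simp)
  | succ R ih =>
    refine Runs.time (Runs.seq ih ?_) (by rw [add_mul, one_mul])
    rintro σ₁ ⟨r1, u1, s1⟩ hf1
    have hv : ∀ x, x = 1 ∨ 25 < x ∧ x < 36 → σ₁.v x = σ.v x :=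
      fun x hx => hf1.v x (roundsCmd_noV P hx R)
    refine (roundCmd_runs (r := R) (g := g) hP hf hlev hQ hqV hpV h0V h0 (by rw [hv _ (by omega), hq])
      (by rw [hv _ (by omega), hq0]) (by rw [hv _ (by omega), h1]) u1 s1
      (by rw [hf1.h 5 (roundsCmd_noA P (by omega) R)]; exact hg)).mono le_rfl ?_
    rintro σ₂ ⟨⟨n, μ, hr⟩, u2, s2⟩ hf2
    refine ⟨fun r hrR => ?_, by rw [u2]; ring, s2⟩
    rcases Nat.lt_succ_iff_lt_or_eq.mp hrR with hlt | rfl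
    · obtain ⟨n', μ', hr'⟩ := r1 r hlt
      exact ⟨n', μ', hr'.congr (hf2.h _ (roundCmd_noA P R (by omega)))
        (hf2.h _ (roundCmd_noA P R (by omega))) (by rw [hf2.h _ (roundCmd_noA P R (by omega))])⟩
    · refine ⟨n, μ, ?_⟩
      convert hr using 1
      funext i j
      simp only [roundWeights, weightsOf, add_assoc]

/-- The preprocessing. -/
def prepCmd (P : Program) (R : ℕ) : Cmd :=
  sizeCmd ;; primeCmd R ;; graphCmd ;; roundsCmd P R

/-- The result of the preprocessing. -/
structure Prepared (p a R : ℕ) [Fact p.Prime] (g : ℕ → ℕ → Prop) (w : ℕ → ℕ → ℕ → ZMod p) (σ : St) :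
    Prop where
  sizes : Sizes a σ
  mod : σ.v 1 = p
  sim : ∀ a, σ.h 0 a = 0
  pos : ∀ a, σ.h 6 a = 0
  del : ∀ a, σ.h 9 a = 0
  graph : HoldsGraph (σ.h 5) (16 ^ a) g
  rounds : ∀ r < R, ∃ (n : ℕ → ℕ → ZMod p) (μ : ZMod p), Round (16 ^ a) g r (w r) n μ σ

/-- The time of the preprocessing. -/
def prepTime (P : Program) (tm : ℕ → ℕ) (R a : ℕ) : ℕ :=
  (4 * a + 6) + ((132 * R * (a * a) * (2 ^ (7 * a + 4) * 5 + 9) + 3) +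
    ((16 ^ a * (16 ^ a * 3 + 4) + 2) + R * roundTime P tm (16 ^ a) (4 * a)))

theorem prepCmd_runs {P : Program} {κ : ℕ} {tm : ℕ → ℕ} {E : Env} {n R a p : ℕ}
    {G : Digraph (Fin n)} (hP : MulProgram P κ tm) (hinp : E.inp = graphWords G) (hn : 2 ≤ n)
    (ha : a = Nat.clog 16 n) (hV : 2 ^ (14 * a + 8) < E.V) (hK : 132 * R * (a * a) < E.V)
    [hp : Fact p.Prime] (hpe : p = pickPrime (2 ^ (12 * a + 2)) (2 ^ (14 * a + 8))
      (fun i => E.coins i) (132 * R * (a * a)))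
    (hf : ∀ j < 4 * a, MulFit P κ tm E.V p (2 ^ j)) :
    Runs E (prepCmd P R) St.zero (prepTime P tm R a) (Prepared p a R (natAdj G)
      (roundWeights p (16 ^ a) (2 ^ (12 * a + 2)) (132 * R * (a * a)) fun i => E.coins i)) := by
  have ha1 : 1 ≤ a := ha ▸ Nat.clog_pos (by norm_num) (by omega)
  have h0 : E.inp.getD 0 0 = n := by rw [hinp, graphWords, List.getD_cons_zero]
  have e16 : (16 : ℕ) ^ a = 2 ^ (4 * a) := by rw [pow_mul]; norm_num
  have hle : ∀ e ≤ 14 * a + 8, (2 : ℕ) ^ e < E.V := fun e he =>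
    (Nat.pow_le_pow_right (by norm_num) he).trans_lt hV
  have hqV : 16 ^ a < E.V := e16 ▸ hle _ (by omega)
  have hQ : 16 ^ a * 16 ^ a ≤ E.V := by
    rw [e16, ← pow_add]; exact (hle _ (by omega)).le
  have hV1 : 1 < E.V := hle 0 (by omega)
  have hN2 : 2 < 2 ^ (14 * a + 8) := by
    calc 2 < 2 ^ 2 := by norm_num
      _ ≤ _ := Nat.pow_le_pow_right (by norm_num) (by omega)
  have hpV : p < E.V := by rw [hpe]; exact (pickPrime_lt hN2 _ _).trans hV
  have hs := sizeCmd_runs h0 hn (by rw [← ha]; exact hV) St.zero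
  rw [← ha] at hs
  refine Runs.seq hs ?_
  intro σ₁ s1 f1
  refine Runs.seq (primeCmd_runs (R := R) ha1 s1 (f1.used (by simp [sizeCmd])) hV hK) ?_
  rintro σ₂ ⟨p2, u2⟩ f2
  have s2 : Sizes a σ₂ := s1.congr fun x h1 h2 => f2.v x (by simp [primeCmd, trialCmd]; omega)
  refine Runs.seq (graphCmd_runs hinp hqV hV1 s2.q) ?_
  intro σ₃ g3 f3
  have s3 : Sizes a σ₃ := s2.congr fun x h1 h2 => f3.v x (by simp [graphCmd]; omega)
  have z3 : ∀ k, k ≠ 5 → σ₃.h k = fun _ => 0 := by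
    intro k hk
    rw [f3.h k (by simp [graphCmd, hk]), f2.h k (by simp [primeCmd, trialCmd]),
      f1.h k (by simp [sizeCmd])]
    rfl
  have p3 : σ₃.v 1 = p := by rw [f3.v 1 (by simp [graphCmd]), p2, hpe]
  have u3 : σ₃.used = 132 * R * (a * a) := by rw [f3.used (by simp [graphCmd]), u2]
  refine (roundsCmd_runs (g := natAdj G) hP hf e16 hQ hqV hpV (hle _ (by omega)) (by positivity) s3.q
    s3.q0 p3 u3 (fun x => by rw [z3 0 (by norm_num)]) g3 R).mono le_rfl ?_
  rintro σ₄ ⟨r4, -, m4⟩ f4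
  refine ⟨s3.congr fun x h1 h2 => f4.v x (roundsCmd_noV P (by omega) R), ?_, m4, ?_, ?_, ?_, r4⟩
  · rw [f4.v 1 (roundsCmd_noV P (by omega) R), p3]
  · intro x; rw [f4.h 6 (roundsCmd_noA P (by omega) R), z3 6 (by norm_num)]
  · intro x; rw [f4.h 9 (roundsCmd_noA P (by omega) R), z3 9 (by norm_num)]
  · rw [f4.h 5 (roundsCmd_noA P (by omega) R)]; exact g3


/-! ## The graph after the updates -/

/-- The deleted nodes as a set of numbers. -/
def natDel {n : ℕ} (H : UpdatedGraph n) (x : ℕ) : Prop := ∃ h : x < n, (⟨x, h⟩ : Fin n) ∈ H.deleted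

/-- The edges that do not leave a deleted node. -/
def liveAdj {n : ℕ} (H : UpdatedGraph n) (x y : ℕ) : Prop := natAdj H.graph x y ∧ ¬natDel H x

theorem natAdj_insertEdge {n : ℕ} (H : UpdatedGraph n) (a b : Fin n) (x y : ℕ) :
    natAdj (H.apply (.insertEdge a b)).graph x y ↔ natAdj H.graph x y ∨ (x = a ∧ y = b) := by
  constructor
  · rintro ⟨hx, hy, h | ⟨h1, h2⟩⟩
    · exact Or.inl ⟨hx, hy, h⟩
    · exact Or.inr ⟨congrArg Fin.val h1, congrArg Fin.val h2⟩
  · rintro (⟨hx, hy, h⟩ | ⟨rfl, rfl⟩)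
    · exact ⟨hx, hy, Or.inl h⟩
    · exact ⟨a.2, b.2, Or.inr ⟨rfl, rfl⟩⟩

theorem natAdj_deleteEdge {n : ℕ} (H : UpdatedGraph n) (a b : Fin n) (x y : ℕ) :
    natAdj (H.apply (.deleteEdge a b)).graph x y ↔ natAdj H.graph x y ∧ ¬(x = a ∧ y = b) := by
  constructor
  · rintro ⟨hx, hy, h, h'⟩
    exact ⟨⟨hx, hy, h⟩, fun e => h' ⟨Fin.ext e.1, Fin.ext e.2⟩⟩
  · rintro ⟨⟨hx, hy, h⟩, h'⟩
    exact ⟨hx, hy, h, fun e => h' ⟨congrArg Fin.val e.1, congrArg Fin.val e.2⟩⟩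

theorem natDel_deleteNode {n : ℕ} (H : UpdatedGraph n) (a : Fin n) (x : ℕ) :
    natDel (H.apply (.deleteNode a)) x ↔ x = a ∨ natDel H x := by
  constructor
  · rintro ⟨hx, h | h⟩
    · exact Or.inl (congrArg Fin.val h)
    · exact Or.inr ⟨hx, h⟩
  · rintro (rfl | ⟨hx, h⟩)
    · exact ⟨a.2, Or.inl rfl⟩
    · exact ⟨hx, Or.inr h⟩

theorem applyUpdates_concat {n : ℕ} (G : Digraph (Fin n)) (U : List (GraphUpdate n))
    (u : GraphUpdate n) : applyUpdates G (U ++ [u]) = (applyUpdates G U).apply u := by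
  simp [applyUpdates]

theorem natAdj_applyUpdates {n : ℕ} (G : Digraph (Fin n)) (U : List (GraphUpdate n)) {x y : ℕ}
    (h : ∀ u ∈ U, ¬(u.words.getD 1 0 = x ∧ u.words.getD 2 0 = y)) :
    natAdj (applyUpdates G U).graph x y ↔ natAdj G x y := by
  induction U using List.reverseRecOn with
  | nil => rfl
  | append_singleton U u ih =>
    have ih := ih fun u hu => h u (by simp [hu])
    have hu := h u (by simp)
    rw [applyUpdates_concat]
    cases u with
    | insertEdge a b =>
      rw [natAdj_insertEdge, ih]
      have : ¬(x = a ∧ y = b) := fun e => hu ⟨e.1.symm, e.2.symm⟩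
      tauto
    | deleteEdge a b =>
      rw [natAdj_deleteEdge, ih]
      have : ¬(x = a ∧ y = b) := fun e => hu ⟨e.1.symm, e.2.symm⟩
      tauto
    | deleteNode a => exact ih

theorem natDel_applyUpdates {n : ℕ} (G : Digraph (Fin n)) (U : List (GraphUpdate n)) {x : ℕ}
    (h : natDel (applyUpdates G U) x) : ∃ u ∈ U, u.words.getD 1 0 = x := by
  induction U using List.reverseRecOn with
  | nil => obtain ⟨_, h⟩ := h; exact h.elim
  | append_singleton U u ih =>
    rw [applyUpdates_concat] at h
    have old : natDel (applyUpdates G U) x → ∃ u' ∈ U ++ [u], u'.words.getD 1 0 = x := fun h =>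
      let ⟨u', hu', e⟩ := ih h
      ⟨u', by simp [hu'], e⟩
    cases u with
    | insertEdge a b => exact old h
    | deleteEdge a b => exact old h
    | deleteNode a =>
      rcases (natDel_deleteNode _ a x).mp h with rfl | h
      · exact ⟨.deleteNode a, by simp, rfl⟩
      · exact old h

/-- Edges into deleted nodes may stay: such a node cannot be left, so a path that ends in a live
node never visits it. Deleting a node thus changes a single row of the matrix and no column. -/
theorem reachable_iff {n : ℕ} (H : UpdatedGraph n) (u v : Fin n) : H.Reachable u v ↔
    ¬natDel H u ∧ ¬natDel H v ∧ Relation.ReflTransGen (liveAdj H) u v := by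
  have hd : ∀ x : Fin n, natDel H x ↔ x ∈ H.deleted := fun x => ⟨fun ⟨_, h⟩ => h, fun h => ⟨x.2, h⟩⟩
  constructor
  · rintro ⟨hu, h⟩
    rw [hd, hd]
    refine ⟨hu, ?_⟩
    induction h with
    | refl => exact ⟨hu, .refl⟩
    | tail _ hbc ih => exact ⟨hbc.2, ih.2.tail ⟨⟨Fin.is_lt _, Fin.is_lt _, hbc.1⟩, by rw [hd]; exact ih.1⟩⟩
  · rintro ⟨hu, hv, h⟩
    rw [hd] at hu hv
    refine ⟨hu, ?_⟩
    have key : ∀ x : ℕ, Relation.ReflTransGen (liveAdj H) x v → ∀ hx : x < n,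
        Relation.ReflTransGen (fun x y => H.graph.Adj x y ∧ y ∉ H.deleted) (⟨x, hx⟩ : Fin n) v := by
      intro x h
      induction h using Relation.ReflTransGen.head_induction_on with
      | refl => intro _; exact .refl
      | @head x y hxy hyv ih =>
        intro hx
        obtain ⟨⟨_, hy, hadj⟩, _⟩ := hxy
        refine Relation.ReflTransGen.head ⟨hadj, ?_⟩ (ih hy)
        -- The next node is either the live end point, or it is left by an edge of `liveAdj` and is
        -- live for this reason.
        rcases Relation.ReflTransGen.cases_head hyv with rfl | ⟨z, hyz, _⟩
        · exact hv
        · exact fun hmem => hyz.2 ⟨hy, hmem⟩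
    exact key u h u.2

/-- An edge can differ only if an update names both of its end points, or if its start has been
deleted, and `S` lists all nodes that are named. -/
theorem change_applyUpdates {n q k : ℕ} {S : ℕ → ℕ} (hnq : n ≤ q) (G : Digraph (Fin n))
    (U : List (GraphUpdate n)) (hS : ∀ i < k, S i < n)
    (hinj : ∀ i < k, ∀ j < k, S i = S j → i = j)
    (hU : ∀ u ∈ U, (∃ i < k, S i = u.words.getD 1 0) ∧ ∃ i < k, S i = u.words.getD 2 0) :
    Change q k S (natDel (applyUpdates G U)) (natAdj G) (liveAdj (applyUpdates G U)) := by
  refine ⟨fun i hi => (hS i hi).trans_le hnq, hinj, fun x hx y => ?_, fun x y hx hy => ?_,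
    fun x hx y h => h.2 hx⟩
  · rw [liveAdj, natAdj_applyUpdates]
    · refine and_iff_left fun h => ?_
      obtain ⟨u, hu, e⟩ := natDel_applyUpdates G U h
      obtain ⟨⟨i, hi, hi'⟩, _⟩ := hU u hu
      exact hx i hi (hi'.trans e)
    · rintro u hu ⟨e, -⟩
      obtain ⟨⟨i, hi, hi'⟩, _⟩ := hU u hu
      exact hx i hi (hi'.trans e)
  · rw [liveAdj, natAdj_applyUpdates]
    · exact and_iff_left hx
    · rintro u hu ⟨-, e⟩
      obtain ⟨_, ⟨i, hi, hi'⟩⟩ := hU u hu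
      exact hy i hi (hi'.trans e)

theorem flatMap_words_getD {n : ℕ} (U : List (GraphUpdate n)) {t e : ℕ} (ht : t < U.length)
    (he : e < 3) : (U.flatMap GraphUpdate.words).getD (3 * t + e) 0 = U[t].words.getD e 0 := by
  have hlen : ∀ u : GraphUpdate n, u.words.length = 3 := by rintro (_ | _ | _) <;> rfl
  induction U generalizing t with
  | nil => simp at ht
  | cons u U ih =>
    rw [List.flatMap_cons]
    cases t with
    | zero => rw [List.getD_append _ _ _ _ (by rw [hlen]; omega)]; simp
    | succ t =>
      rw [List.getD_append_right _ _ _ _ (by rw [hlen]; omega), hlen]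
      have : 3 * (t + 1) + e - 3 = 3 * t + e := by omega
      rw [this, ih (by simpa using ht)]
      simp

theorem updateWords_getD {n : ℕ} (U : List (GraphUpdate n)) {t e : ℕ} (ht : t < U.length)
    (he : e < 3) : (updateWords U).getD (1 + e + 3 * t) 0 = U[t].words.getD e 0 := by
  rw [← flatMap_words_getD U ht he, updateWords, show 1 + e + 3 * t = (3 * t + e) + 1 by ring,
    List.getD_cons_succ]

/-- The third word of a node deletion is a dummy `0`, which is read as node `0`. Listing this node
as changed is harmless and keeps the updates uniform. -/
theorem words_getD_lt {n : ℕ} (hn : 2 ≤ n) (u : GraphUpdate n) {e : ℕ} (he : e = 1 ∨ e = 2) :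
    u.words.getD e 0 < n := by
  rcases he with rfl | rfl <;> cases u <;> simp [GraphUpdate.words] <;> omega

/-! ## Collecting the nodes that occur in the updates -/

/-- Give a number to the node in variable `x`, unless it has one. -/
def regCmd (x : ℕ) : Cmd :=
  .ite (.ld 6 (.var x)) .skip (.sto 7 (.var 44) (.var x) ;; .asg 44 (.var 44 + 1) ;;
    .sto 6 (.var x) (.var 44))

/-- The nodes `σ.h 7 0, …, σ.h 7 (k - 1)` have numbers. -/
structure Reg (n k : ℕ) (σ : St) : Prop where
  card : σ.v 44 = k
  lt : ∀ i < k, σ.h 7 i < n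
  pos : ∀ i < k, σ.h 6 (σ.h 7 i) = i + 1
  all : ∀ x, σ.h 6 x ≠ 0 → ∃ i < k, σ.h 7 i = x

theorem Reg.inj {n k : ℕ} {σ : St} (h : Reg n k σ) :
    ∀ i < k, ∀ j < k, σ.h 7 i = σ.h 7 j → i = j := fun i hi j hj e => by
  have := h.pos i hi
  rw [e, h.pos j hj] at this
  omega

theorem Reg.congr {n k : ℕ} {σ σ' : St} (h : Reg n k σ) (h6 : σ'.h 6 = σ.h 6) (h7 : σ'.h 7 = σ.h 7)
    (h44 : σ'.v 44 = σ.v 44) : Reg n k σ' :=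
  ⟨h44.trans h.card, h7 ▸ h.lt, by rw [h6, h7]; exact h.pos, by rw [h6, h7]; exact h.all⟩

/-- Append a node to a list, unless it occurs there. -/
def regStep (L : List ℕ) (y : ℕ) : List ℕ := if y ∈ L then L else L ++ [y]

/-- The nodes that occur in the updates, in the order of their numbers. -/
def numbering {n : ℕ} (U : List (GraphUpdate n)) : List ℕ :=
  U.foldl (fun L u => regStep (regStep L (u.words.getD 1 0)) (u.words.getD 2 0)) []

/-- Array `6` stores numbers shifted by one, so that its initial value zero means that a node has
not been numbered. The search for duplicates then takes constant time. -/
theorem regCmd_runs {E : Env} {x n k y : ℕ} {σ : St} (hx : x ≠ 44) (h : Reg n k σ) (hy : σ.v x = y)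
    (hyn : y < n) (hnV : n < E.V) (hkV : k + 1 < E.V) :
    Runs E (regCmd x) σ 4 fun σ' => (∃ k' ≤ k + 1, Reg n k' σ' ∧
      (List.range k').map (σ'.h 7) = regStep ((List.range k).map (σ.h 7)) y) ∧ σ'.h 6 y ≠ 0 ∧
      ∀ z, σ.h 6 z ≠ 0 → σ'.h 6 z ≠ 0 := by
  refine Runs.ite (t := 3) (fun hz => ?_) fun hz => ?_
  · simp only [Ex.eval_ld, Ex.eval_var, hy] at hz
    have hmem : y ∈ (List.range k).map (σ.h 7) := by simpa using h.all y hz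
    exact (Runs.skip ⟨⟨k, by omega, h, by rw [regStep, if_pos hmem]⟩, hz, fun _ h => h⟩).time
      (by norm_num)
  · simp only [Ex.eval_ld, Ex.eval_var, hy] at hz
    refine Runs.sto_seq (t := 2) (by simp [hy]; omega) (Runs.asg_seq (t := 1)
      (by simp [h.card]; omega) (Runs.sto (by simp [h.card]; omega) ?_))
    have hne : ∀ i < k, σ.h 7 i ≠ y := fun i hi e => by
      have := h.pos i hi
      rw [e] at this; omega
    simp only [Ex.eval_var, Ex.eval_add, Ex.eval_ofNat, St.put_v, St.set_v, hx, if_false, if_true,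
      h.card, hy]
    refine ⟨⟨k + 1, le_rfl, ⟨?_, ?_, ?_, ?_⟩, ?_⟩, ?_, ?_⟩
    · simp
    · intro i hi
      rw [St.put_h_ne _ _ _ (by norm_num)]
      simp only [St.set_h, St.put_h_same]
      split_ifs with hik
      · exact hyn
      · exact h.lt i (by omega)
    · intro i hi
      rw [St.put_h_ne _ _ _ (by norm_num : (7 : ℕ) ≠ 6)]
      simp only [St.set_h, St.put_h_same]
      rw [St.put_h_ne _ _ _ (by norm_num : (6 : ℕ) ≠ 7)]
      by_cases hik : i = k
      · simp [hik]
      · rw [if_neg hik, if_neg (hne i (by omega))]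
        exact h.pos i (by omega)
    · intro z hz'
      simp only [St.set_h, St.put_h_same] at hz'
      rw [St.put_h_ne _ _ _ (by norm_num : (6 : ℕ) ≠ 7)] at hz'
      rw [St.put_h_ne _ _ _ (by norm_num : (7 : ℕ) ≠ 6)]
      simp only [St.set_h, St.put_h_same]
      split_ifs at hz' with hzy
      · exact ⟨k, by omega, by simp [hzy]⟩
      · obtain ⟨i, hi, e⟩ := h.all z hz'
        exact ⟨i, by omega, by rw [if_neg (by omega)]; exact e⟩
    · have hmem : y ∉ (List.range k).map (σ.h 7) := by simpa using hne
      rw [regStep, if_neg hmem, List.range_succ, List.map_append]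
      rw [St.put_h_ne _ _ _ (by norm_num : (7 : ℕ) ≠ 6)]
      congr 1
      swap; · simp
      refine List.map_congr_left fun i hi => ?_
      rw [St.set_h, St.put_h_same, if_neg (List.mem_range.mp hi).ne]
    · simp
    · intro z hz'
      simp only [St.set_h, St.put_h_same]
      split_ifs
      · omega
      · rwa [St.put_h_ne _ _ _ (by norm_num : (6 : ℕ) ≠ 7)]

/-- Number the nodes that occur in the updates. -/
def collectCmd : Cmd :=
  .asg 44 0 ;; .forC 40 (.inp 0) (.asg 42 (.inp (2 + 3 * .var 40)) ;; regCmd 42 ;;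
    .asg 43 (.inp (3 + 3 * .var 40)) ;; regCmd 43)

theorem collectCmd_runs {E : Env} {n : ℕ} {U : List (GraphUpdate n)} {σ : St} (hn : 2 ≤ n)
    (hinp : E.inp = updateWords U) (h6 : ∀ x, σ.h 6 x = 0) (hnV : n < E.V)
    (hfV : 2 * U.length + 1 < E.V) :
    Runs E collectCmd σ (U.length * 12 + 3) fun σ' => ∃ k ≤ 2 * U.length, Reg n k σ' ∧
      (List.range k).map (σ'.h 7) = numbering U ∧
      ∀ u ∈ U, (∃ i < k, σ'.h 7 i = u.words.getD 1 0) ∧ ∃ i < k, σ'.h 7 i = u.words.getD 2 0 := by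
  refine Runs.time (s := (U.length * ((4 + 1 + 4 + 1) + 2) + 2) + 1) (Runs.asg_seq (by simp; omega) ?_)
    (by omega)
  refine Runs.forC (fun t σ' => (∃ k ≤ 2 * t, Reg n k σ' ∧
    (List.range k).map (σ'.h 7) = numbering (U.take t)) ∧ ∀ s < t, ∀ hs : s < U.length,
    σ'.h 6 (U[s].words.getD 1 0) ≠ 0 ∧ σ'.h 6 (U[s].words.getD 2 0) ≠ 0) (by omega)
    (by simp [regCmd]) (fun σ' t _ _ _ _ => ?_) ⟨⟨0, le_rfl, ⟨by simp, ?_, ?_, ?_⟩, by simp [numbering]⟩, ?_⟩ ?_ ?_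
  · simp [hinp, updateWords]
  · intro i hi; omega
  · intro i hi; omega
  · intro x hx; simp [h6] at hx
  · intro s hs; omega
  · rintro σ₁ t ht ⟨⟨k, hk, hr, hL⟩, hall⟩ hv hf
    have e1 : Ex.eval E.inp σ₁ (.inp (2 + 3 * .var 40)) = U[t].words.getD 1 0 := by
      simp only [Ex.eval_inp, Ex.eval_add, Ex.eval_mul, Ex.eval_ofNat, Ex.eval_var, hv, hinp]
      exact updateWords_getD U ht (e := 1) (by norm_num)
    have l1 := words_getD_lt hn U[t] (e := 1) (by simp)
    have l2 := words_getD_lt hn U[t] (e := 2) (by simp)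
    refine Runs.time (s := (4 + (4 + 1)) + 1) (Runs.asg_seq (by rw [e1]; omega) ?_) (by norm_num)
    rw [e1]
    refine Runs.seq (s := 4) (t := 4 + 1) (regCmd_runs (k := k) (y := U[t].words.getD 1 0) (by norm_num)
      (hr.congr rfl rfl (by simp)) (by simp) l1 hnV (by omega)) ?_
    rintro σ₂ ⟨⟨k₂, hk₂, hr₂, hL₂⟩, hp₂, hm₂⟩ hf₂
    have e2 : Ex.eval E.inp σ₂ (.inp (3 + 3 * .var 40)) = U[t].words.getD 2 0 := by
      simp only [Ex.eval_inp, Ex.eval_add, Ex.eval_mul, Ex.eval_ofNat, Ex.eval_var,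
        hf₂.v 40 (by simp [regCmd]), hinp]
      simp only [St.set_v]
      norm_num
      rw [hv]
      exact updateWords_getD U ht (e := 2) (by norm_num)
    refine Runs.asg_seq (by rw [e2]; omega) ?_
    rw [e2]
    refine (regCmd_runs (σ := σ₂.set 43 (U[t].words.getD 2 0)) (x := 43) (k := k₂) (y := U[t].words.getD 2 0) (by norm_num)
      (hr₂.congr rfl rfl (by simp)) (by simp) l2 hnV (by omega)).mono le_rfl ?_
    rintro σ₃ ⟨⟨k₃, hk₃, hr₃, hL₃⟩, hp₃, hm₃⟩ -
    refine ⟨⟨k₃, by omega, hr₃.congr rfl rfl (by simp), ?_⟩, fun s hs hsU => ?_⟩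
    · simp only [St.set_h] at hL₂ hL₃ ⊢
      rw [hL₃, hL₂, hL, List.take_succ_eq_append_getElem ht, numbering, numbering,
        List.foldl_append, List.foldl_cons, List.foldl_nil]
    simp only [St.set_h]
    rcases Nat.lt_succ_iff_lt_or_eq.mp hs with hs | rfl
    · obtain ⟨a1, a2⟩ := hall s hs hsU
      exact ⟨hm₃ _ (hm₂ _ a1), hm₃ _ (hm₂ _ a2)⟩
    · exact ⟨hm₃ _ hp₂, hp₃⟩
  · rintro σ' ⟨⟨k, hk, hr, hL⟩, hall⟩ - -
    refine ⟨k, hk, hr, by rw [hL, List.take_length], fun u hu => ?_⟩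
    obtain ⟨s, hs, rfl⟩ := List.mem_iff_getElem.mp hu
    obtain ⟨a1, a2⟩ := hall s hs hs
    exact ⟨hr.all _ a1, hr.all _ a2⟩


/-! ## Recording the changes -/

/-- The least power of two that is at least `k` (variable `44`) goes to variable `45`. -/
def padCmd : Cmd := .asg 45 1 ;; .loop (.var 44 - .var 45) (.asg 45 (.var 45 * 2))

theorem padCmd_runs {E : Env} {k : ℕ} {σ : St} (hk : σ.v 44 = k) (hV : 2 * k + 2 ≤ E.V) :
    Runs E padCmd σ (2 * Nat.clog 2 k + 2) fun σ' => σ'.v 45 = 2 ^ Nat.clog 2 k := by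
  obtain ⟨a, ha⟩ : ∃ a, a = Nat.clog 2 k := ⟨_, rfl⟩
  have hlt : ∀ b, b < a ↔ 2 ^ b < k := fun b => ha ▸ Nat.lt_clog_iff_pow_lt (by norm_num)
  rw [← ha]
  have loop : ∀ (m b : ℕ) (σ : St), b + m = a → σ.v 44 = k → σ.v 45 = 2 ^ b →
      Runs E (.loop (.var 44 - .var 45) (.asg 45 (.var 45 * 2))) σ (m * 2 + 1) fun σ' =>
        σ'.v 45 = 2 ^ a := by
    intro m
    induction m with
    | zero =>
      intro b σ hb h44 h45
      obtain rfl : b = a := by omega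
      refine Runs.loop_end ?_ h45
      have := (hlt b).not.mp (lt_irrefl b)
      simp only [Ex.eval_sub, Ex.eval_var, h44, h45]
      omega
    | succ m ih =>
      intro b σ hb h44 h45
      have hba := (hlt b).mp (by omega)
      have e : σ.v 45 * 2 = 2 ^ (b + 1) := by rw [h45, pow_succ]
      refine (Runs.loop_step (s := 1) (t := m * 2 + 1) ?_ (Runs.asg ?_ (ih (b + 1) _ (by omega)
        ?_ ?_))).time (by omega)
      · simp only [Ex.eval_sub, Ex.eval_var, h44, h45]
        omega
      · simp only [Ex.eval_mul, Ex.eval_var, Ex.eval_ofNat, h45]; omega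
      · simpa using h44
      · simpa using e
  exact (Runs.asg_seq (by simp; omega) (loop a 0 _ (by omega) (by simpa using hk) (by simp))).time
    (by omega)

open scoped Classical in
/-- How an edge has changed: `1` if it is new, `2` if it is gone. -/
noncomputable def edgeCode (g g' : Prop) : ℕ :=
  if g then if g' then 0 else 2 else if g' then 1 else 0

/-- The effect of the updates on the edges between the numbered nodes and on the set of deleted
nodes. -/
def recordCmd : Cmd :=
  .fill 36 37 (.var 45) (.var 45) 8 (.var 36 * .var 45 + .var 37) 0 ;;
  .forC 40 (.inp 0) (.asg 41 (.inp (1 + 3 * .var 40)) ;; .asg 42 (.inp (2 + 3 * .var 40)) ;;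
    .asg 43 (.inp (3 + 3 * .var 40)) ;;
    .asg 46 ((.ld 6 (.var 42) - 1) * .var 45 + (.ld 6 (.var 43) - 1)) ;;
    .ite (.var 41) (.ite (.var 41 - 1) (.sto 9 (.var 42) 1)
      (.sto 8 (.var 46) (2 * .ld 5 (.var 42 * .var 27 + .var 43))))
      (.sto 8 (.var 46) (1 - .ld 5 (.var 42 * .var 27 + .var 43))))

/-- The state after recording the updates that lead to the graph `H`. -/
structure Recorded {n : ℕ} (g : ℕ → ℕ → Prop) (k kk : ℕ) (H : UpdatedGraph n) (σ : St) : Prop where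
  code : ∀ i < k, ∀ j < k, σ.h 8 (i * kk + j) =
    edgeCode (g (σ.h 7 i) (σ.h 7 j)) (natAdj H.graph (σ.h 7 i) (σ.h 7 j))
  del : ∀ x < n, (natDel H x → σ.h 9 x = 1) ∧ (¬natDel H x → σ.h 9 x = 0)

/-- Each insertion or deletion overwrites the code of its edge, computed from the original graph in
array `5` and not from the current one. The last update of an edge alone decides its final state, so
the history need not be consulted. -/
theorem recordCmd_runs {E : Env} {n q k kk : ℕ} {G : Digraph (Fin n)} {U : List (GraphUpdate n)}
    {σ : St} (hn : 2 ≤ n) (hnq : n ≤ q) (hinp : E.inp = updateWords U) (hr : Reg n k σ)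
    (hU : ∀ u ∈ U, (∃ i < k, σ.h 7 i = u.words.getD 1 0) ∧ ∃ i < k, σ.h 7 i = u.words.getD 2 0)
    (hk : k ≤ kk) (h45 : σ.v 45 = kk) (h27 : σ.v 27 = q) (hg : HoldsGraph (σ.h 5) q (natAdj G))
    (h9 : ∀ x, σ.h 9 x = 0) (hV3 : 3 ≤ E.V) (hnV : n < E.V) (hkV : kk < E.V) (hkV' : kk * kk ≤ E.V)
    (hfV : U.length < E.V) :
    Runs E recordCmd σ ((kk * (kk * 3 + 4) + 2) + (U.length * 9 + 2))
      (Recorded (natAdj G) k kk (applyUpdates G U)) := by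
  classical
  refine Runs.seq (Runs.fill (fun a b => a * kk + b) (fun _ _ => 0) (by norm_num)
    hkV hkV (fun σ' hf => ?_) (fun σ' hf => ?_) (fun σ' a b ha hb hf hi hj _ => ⟨?_, rfl, by omega⟩)
    fun a b a' b' _ hb _ hb' h => idx_inj hb hb' h) ?_
  · simpa [h45] using hf.v 45 (by simp)
  · simpa [h45] using hf.v 45 (by simp)
  · have := hf.v 45 (by simp)
    simp [hi, hj, this, h45]
  rintro σ₁ ⟨z1, -⟩ f1
  have a1 : ∀ l, l ≠ 8 → σ₁.h l = σ.h l := fun l hl => f1.h l (by simp [hl])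
  have b1 : ∀ x, x ≠ 36 → x ≠ 37 → σ₁.v x = σ.v x := fun x h h' => f1.v x (by simp [h, h'])
  refine Runs.time (s := U.length * ((3 + 1 + 1 + 1 + 1) + 2) + 2) ?_ (by omega)
  refine Runs.forC (fun t σ' => Recorded (natAdj G) k kk (applyUpdates G (U.take t)) σ') hfV (by simp)
    (fun σ' t _ _ _ _ => ?_) ⟨?_, ?_⟩ ?_ ?_
  · simp [hinp, updateWords]
  · intro i hi j hj
    simp only [St.set_h, List.take_zero, a1 7 (by norm_num)]
    rw [z1 i j (by omega) (by omega)]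
    have h0 : edgeCode (natAdj G (σ.h 7 i) (σ.h 7 j)) (natAdj G (σ.h 7 i) (σ.h 7 j)) = 0 := by
      unfold edgeCode; split_ifs <;> rfl
    exact h0.symm
  · intro x _
    simp only [St.set_h, a1 9 (by norm_num), h9]
    exact ⟨fun ⟨_, h⟩ => h.elim, fun _ => trivial⟩
  · intro σ₂ t ht hI hv f2
    have a2 : ∀ l, l ≠ 8 → l ≠ 9 → σ₂.h l = σ.h l := fun l hl hl' => by
      rw [f2.h l (by simp [hl, hl']), a1 l hl]
    have b2 : ∀ x, x < 36 → σ₂.v x = σ.v x := fun x h => by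
      rw [f2.v x (by simp; omega), b1 x (by omega) (by omega)]
    have b45 : σ₂.v 45 = kk := by rw [f2.v 45 (by simp), b1 45 (by norm_num) (by norm_num), h45]
    have ew : ∀ e < 3, (updateWords U).getD (1 + e + 3 * t) 0 = U[t].words.getD e 0 :=
      fun e he => updateWords_getD U ht he
    obtain ⟨⟨i, hi, ei⟩, ⟨j, hj, ej⟩⟩ := hU U[t] (List.getElem_mem ht)
    have l1 := words_getD_lt hn U[t] (e := 1) (by simp)
    have l2 := words_getD_lt hn U[t] (e := 2) (by simp)
    have pi := hr.pos i hi
    have pj := hr.pos j hj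
    rw [ei] at pi
    rw [ej] at pj
    have htake : applyUpdates G (U.take (t + 1)) = (applyUpdates G (U.take t)).apply U[t] := by
      rw [List.take_succ_eq_append_getElem ht, applyUpdates_concat]
    set H := applyUpdates G (U.take t)
    have e0 := ew 0 (by norm_num)
    have e1 := ew 1 (by norm_num)
    have e2 := ew 2 (by norm_num)
    norm_num only at e0 e1 e2
    generalize hu : U[t] = u at *
    set A := u.words.getD 1 0 with hA
    set B := u.words.getD 2 0 with hB
    set C := u.words.getD 0 0 with hC
    have hCV : C < 3 := by cases u <;> simp [hC, GraphUpdate.words]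
    have v1 : Ex.eval E.inp σ₂ (.inp (1 + 3 * .var 40)) = C := by simpa [hinp, hv] using e0
    refine Runs.asg_seq (by rw [v1]; omega) ?_
    rw [v1]
    have v2 : Ex.eval E.inp (σ₂.set 41 C) (.inp (2 + 3 * .var 40)) = A := by simpa [hinp, hv] using e1
    refine Runs.asg_seq (by rw [v2]; omega) ?_
    rw [v2]
    have v3 : Ex.eval E.inp ((σ₂.set 41 C).set 42 A) (.inp (3 + 3 * .var 40)) = B := by
      simpa [hinp, hv] using e2
    refine Runs.asg_seq (by rw [v3]; omega) ?_
    rw [v3]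
    have v4 : Ex.eval E.inp (((σ₂.set 41 C).set 42 A).set 43 B)
        ((.ld 6 (.var 42) - 1) * .var 45 + (.ld 6 (.var 43) - 1)) = i * kk + j := by
      simp [a2, b45, pi, pj]
    have hij : i * kk + j < kk * kk := idx_lt (by omega) (by omega)
    refine Runs.asg_seq (by rw [v4]; omega) ?_
    rw [v4]
    set σ₃ := (((σ₂.set 41 C).set 42 A).set 43 B).set 46 (i * kk + j) with hσ₃
    have c3 : σ₃.h = σ₂.h := rfl
    have w41 : σ₃.v 41 = C := by simp [hσ₃]
    have w42 : σ₃.v 42 = A := by simp [hσ₃]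
    have w43 : σ₃.v 43 = B := by simp [hσ₃]
    have w46 : σ₃.v 46 = i * kk + j := by simp [hσ₃]
    have w27 : σ₃.v 27 = q := by simp [hσ₃, b2, h27]
    have hGAB := hg A B (by omega) (by omega)
    -- Distinct numbers belong to distinct nodes, so the other codes are unaffected.
    have hcode : ∀ i' < k, ∀ j' < k, ¬(i' = i ∧ j' = j) → ¬(σ.h 7 i' = A ∧ σ.h 7 j' = B) := by
      rintro i' hi' j' hj' hne ⟨h1, h2⟩
      exact hne ⟨hr.inj i' hi' i hi (h1.trans ei.symm), hr.inj j' hj' j hj (h2.trans ej.symm)⟩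
    have hidx : ∀ i' < k, ∀ j' < k, i' * kk + j' = i * kk + j → i' = i ∧ j' = j :=
      fun i' hi' j' hj' h => idx_inj (by omega) (by omega) h
    have hIc := hI.code
    have hId := hI.del
    rw [a2 7 (by norm_num) (by norm_num)] at hIc
    rw [htake]
    refine Runs.time (s := 1 + 1 + 1) (Runs.ite (t := 1 + 1) (fun h => Runs.ite (t := 1) (fun h' => ?_)
      fun h' => ?_) fun h => (Runs.time (s := 1) ?_ (by norm_num))) (by norm_num)
    · simp only [Ex.eval_sub, Ex.eval_var, w41, Ex.eval_ofNat] at h'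
      refine Runs.sto (by simp; omega) ?_
      simp only [Ex.eval_var, w42, Ex.eval_ofNat]
      cases u with
      | insertEdge a b => simp [hC, GraphUpdate.words] at h'
      | deleteEdge a b => simp [hC, GraphUpdate.words] at h'
      | deleteNode a =>
        have hAa : A = a := rfl
        refine ⟨fun i' hi' j' hj' => ?_, fun x hx => ?_⟩
        · simp only [St.set_h]
          rw [St.put_h_ne _ _ _ (by norm_num), St.put_h_ne _ _ _ (by norm_num), c3,
            a2 7 (by norm_num) (by norm_num)]
          exact hIc i' hi' j' hj'
        · simp only [St.set_h, St.put_h_same, natDel_deleteNode, c3, hAa]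
          split_ifs with hxa
          · simp [hxa]
          · simp only [hxa, false_or]; exact hId x hx
    · simp only [Ex.eval_sub, Ex.eval_var, w41, Ex.eval_ofNat] at h h'
      have vg : Ex.eval E.inp σ₃ (2 * .ld 5 (.var 42 * .var 27 + .var 43)) =
          edgeCode (natAdj G A B) False := by
        simp only [Ex.eval_mul, Ex.eval_ld, Ex.eval_add, Ex.eval_var, w42, w43, w27, c3,
          a2 5 (by norm_num) (by norm_num), Ex.eval_ofNat]
        by_cases hG : natAdj G A B
        · rw [hGAB.1 hG]; simp [edgeCode, hG]
        · rw [hGAB.2 hG]; simp [edgeCode, hG]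
      refine Runs.sto (by rw [vg]; unfold edgeCode; split_ifs <;> omega) ?_
      rw [vg]
      simp only [Ex.eval_var, w46]
      cases u with
      | insertEdge a b => simp [hC, GraphUpdate.words] at h
      | deleteNode a => simp [hC, GraphUpdate.words] at h'
      | deleteEdge a b =>
        have hAa : A = a := rfl
        have hBb : B = b := rfl
        refine ⟨fun i' hi' j' hj' => ?_, fun x hx => ?_⟩
        · simp only [St.set_h]
          rw [St.put_h_ne _ _ _ (by norm_num : (7 : ℕ) ≠ 8), c3, a2 7 (by norm_num) (by norm_num),
            St.put_h_same, c3]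
          have hd := natAdj_deleteEdge H a b (σ.h 7 i') (σ.h 7 j')
          by_cases hij' : i' = i ∧ j' = j
          · obtain ⟨rfl, rfl⟩ := hij'
            rw [if_pos rfl, ei, ej]
            rw [ei, ej] at hd
            have : ¬natAdj (H.apply (.deleteEdge a b)).graph A B := fun h0 => (hd.mp h0).2 ⟨hAa, hBb⟩
            simp only [this]
          · rw [if_neg fun h => hij' (hidx i' hi' j' hj' h), hIc i' hi' j' hj', hd]
            have := hcode i' hi' j' hj' hij'
            rw [hAa, hBb] at this
            simp only [this, not_false_eq_true, and_true]
        · simp only [St.set_h]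
          rw [St.put_h_ne _ _ _ (by norm_num), c3]
          exact hId x hx
    · simp only [Ex.eval_var, w41] at h
      have vg : Ex.eval E.inp σ₃ (1 - .ld 5 (.var 42 * .var 27 + .var 43)) =
          edgeCode (natAdj G A B) True := by
        simp only [Ex.eval_sub, Ex.eval_mul, Ex.eval_ld, Ex.eval_add, Ex.eval_var, w42, w43, w27, c3,
          a2 5 (by norm_num) (by norm_num), Ex.eval_ofNat]
        by_cases hG : natAdj G A B
        · rw [hGAB.1 hG]; simp [edgeCode, hG]
        · rw [hGAB.2 hG]; simp [edgeCode, hG]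
      refine Runs.sto (by rw [vg]; unfold edgeCode; split_ifs <;> omega) ?_
      rw [vg]
      simp only [Ex.eval_var, w46]
      cases u with
      | deleteEdge a b => simp [hC, GraphUpdate.words] at h
      | deleteNode a => simp [hC, GraphUpdate.words] at h
      | insertEdge a b =>
        have hAa : A = a := rfl
        have hBb : B = b := rfl
        refine ⟨fun i' hi' j' hj' => ?_, fun x hx => ?_⟩
        · simp only [St.set_h]
          rw [St.put_h_ne _ _ _ (by norm_num : (7 : ℕ) ≠ 8), c3, a2 7 (by norm_num) (by norm_num),
            St.put_h_same, c3]
          have hd := natAdj_insertEdge H a b (σ.h 7 i') (σ.h 7 j')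
          by_cases hij' : i' = i ∧ j' = j
          · obtain ⟨rfl, rfl⟩ := hij'
            rw [if_pos rfl, ei, ej]
            rw [ei, ej] at hd
            have : natAdj (H.apply (.insertEdge a b)).graph A B := hd.mpr (Or.inr ⟨hAa, hBb⟩)
            simp only [this]
          · rw [if_neg fun h => hij' (hidx i' hi' j' hj' h), hIc i' hi' j' hj', hd]
            have := hcode i' hi' j' hj' hij'
            rw [hAa, hBb] at this
            simp only [this, or_false]
        · simp only [St.set_h]
          rw [St.put_h_ne _ _ _ (by norm_num), c3]
          exact hId x hx
  · intro σ' h _ _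
    rwa [List.take_length] at h


/-! ### Assembling the matrices of the update -/

/-- Fill one of the four blocks of the matrix in array `3`. The size of the blocks is in variable
`45`. -/
def blockFill (a b : ℕ) (val : Ex) : Cmd :=
  .fill 36 37 (.var 45) (.var 45) 3
    ((Ex.lit a * .var 45 + .var 36) * .var 2 + (Ex.lit b * .var 45 + .var 37)) val

theorem blockFill_runs {E : Env} {a b kk : ℕ} {val : Ex} {σ : St} (f : ℕ → ℕ → ℕ) (ha : a ≤ 1)
    (hb : b ≤ 1) (hkV : kk < E.V) (h45 : σ.v 45 = kk) (h2 : σ.v 2 = kk + kk)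
    (hv : ∀ σ' i j, i < kk → j < kk → (∀ x, x ≠ 36 → x ≠ 37 → σ'.v x = σ.v x) →
      (∀ l, l ≠ 3 → σ'.h l = σ.h l) → σ'.v 36 = i → σ'.v 37 = j →
        val.eval E.inp σ' = f i j ∧ f i j < E.V) :
    Runs E (blockFill a b val) σ (kk * (kk * 3 + 4) + 2) fun σ' =>
      (∀ i j, i < kk → j < kk → σ'.h 3 ((a * kk + i) * (kk + kk) + (b * kk + j)) = f i j) ∧
      ∀ a' b', a' ≤ 1 → b' ≤ 1 → (a', b') ≠ (a, b) → ∀ i j, i < kk → j < kk →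
        σ'.h 3 ((a' * kk + i) * (kk + kk) + (b' * kk + j)) =
          σ.h 3 ((a' * kk + i) * (kk + kk) + (b' * kk + j)) := by
  have hlt : ∀ c i, c ≤ 1 → i < kk → c * kk + i < kk + kk := fun c i hc hi => by
    have : c * kk ≤ 1 * kk := Nat.mul_le_mul_right _ hc
    omega
  refine (Runs.fill (fun i j => (a * kk + i) * (kk + kk) + (b * kk + j)) f (by norm_num) hkV hkV
    (fun σ' hf => ?_) (fun σ' hf => ?_) (fun σ' i j hi hj hf h36 h37 _ => ⟨?_, ?_⟩)
    fun i j i' j' hi hj hi' hj' h => ?_).mono le_rfl ?_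
  · simpa [h45] using hf.v 45 (by simp)
  · simpa [h45] using hf.v 45 (by simp)
  · have e1 := hf.v 45 (by simp)
    have e2 := hf.v 2 (by simp)
    simp [h36, h37, e1, e2, h45, h2]
  · exact hv σ' i j hi hj (fun x h h' => hf.v x (by simp [h, h'])) (fun l h => hf.h l (by simp [h]))
      h36 h37
  · have := idx_inj (hlt b j hb hj) (hlt b j' hb hj') h
    omega
  · rintro σ' ⟨h1, h3⟩ -
    refine ⟨h1, fun a' b' ha' hb' hne i j hi hj => h3 _ fun i' j' hi' hj' h => hne ?_⟩
    obtain ⟨e1, e2⟩ := idx_inj (hlt b' j hb' hj) (hlt b j' hb hj') h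
    have key : ∀ {c c' x y : ℕ}, x < kk → y < kk → c * kk + x = c' * kk + y → c = c' :=
      fun hx hy h => (idx_inj hx hy h).1
    rw [key hi hi' e1, key hj hj' e2]

/-- A matrix that consists of four blocks. -/
def quad {F : Type*} (kk : ℕ) (a b c d : ℕ → ℕ → F) (i j : ℕ) : F :=
  if i < kk then if j < kk then a i j else b i (j - kk)
  else if j < kk then c (i - kk) j else d (i - kk) (j - kk)

theorem holdsMat_quad {p kk : ℕ} {h : ℕ → ℕ} {a b c d : ℕ → ℕ → ZMod p}
    (ha : ∀ i j, i < kk → j < kk → h ((0 * kk + i) * (kk + kk) + (0 * kk + j)) = (a i j).val)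
    (hb : ∀ i j, i < kk → j < kk → h ((0 * kk + i) * (kk + kk) + (1 * kk + j)) = (b i j).val)
    (hc : ∀ i j, i < kk → j < kk → h ((1 * kk + i) * (kk + kk) + (0 * kk + j)) = (c i j).val)
    (hd : ∀ i j, i < kk → j < kk → h ((1 * kk + i) * (kk + kk) + (1 * kk + j)) = (d i j).val) :
    HoldsMat h (kk + kk) (quad kk a b c d) := by
  intro i j hi hj
  simp only [zero_mul, zero_add, one_mul] at ha hb hc hd
  unfold quad
  split_ifs with h1 h2 h2
  · exact ha i j h1 h2
  · rw [← hb i (j - kk) h1 (by omega), Nat.add_sub_cancel' (by omega)]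
  · rw [← hc (i - kk) j (by omega) h2, Nat.add_sub_cancel' (by omega)]
  · rw [← hd (i - kk) (j - kk) (by omega) (by omega), Nat.add_sub_cancel' (by omega),
      Nat.add_sub_cancel' (by omega)]

/-- The state of the update phase when the changes have been recorded. -/
structure UpdSt (p q k kk : ℕ) (S : ℕ → ℕ) (del : ℕ → Prop) (g g' : ℕ → ℕ → Prop) (σ : St) :
    Prop where
  mod : σ.v 1 = p
  str : σ.v 2 = kk + kk
  size : σ.v 27 = q
  card : σ.v 44 = k
  pad : σ.v 45 = kk
  nodes : ∀ i < k, σ.h 7 i = S i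
  code : ∀ i < k, ∀ j < k, ¬del (S i) →
    σ.h 8 (i * kk + j) = edgeCode (g (S i) (S j)) (g' (S i) (S j))
  del : ∀ i < k, (del (S i) → σ.h 9 (S i) = 1) ∧ (¬del (S i) → σ.h 9 (S i) = 0)
  sim : ∀ x, σ.h 0 x = 0

theorem UpdSt.congr {p q k kk : ℕ} {S : ℕ → ℕ} {del : ℕ → Prop} {g g' : ℕ → ℕ → Prop} {σ σ' : St}
    (h : UpdSt p q k kk S del g g' σ) (hv : ∀ x, x = 1 ∨ x = 27 ∨ x = 44 ∨ x = 45 → σ'.v x = σ.v x)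
    (h2 : σ'.v 2 = kk + kk) (hh : ∀ l, l = 7 ∨ l = 8 ∨ l = 9 → σ'.h l = σ.h l)
    (h0 : ∀ x, σ'.h 0 x = 0) : UpdSt p q k kk S del g g' σ' where
  mod := (hv 1 (by simp)).trans h.mod
  str := h2
  size := (hv 27 (by simp)).trans h.size
  card := (hv 44 (by simp)).trans h.card
  pad := (hv 45 (by simp)).trans h.pad
  nodes := by rw [hh 7 (by simp)]; exact h.nodes
  code := by rw [hh 8 (by simp)]; exact h.code
  del := by rw [hh 9 (by simp)]; exact h.del
  sim := h0

/-- `1` if the value of variable `x` is the number of a node. -/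
def indEx (x : ℕ) : Ex := (.var 44 - .var x) / (.var 44 - .var x)

/-- The entry at the nodes with the numbers in the variables `36` and `37`. -/
def atEx (a : ℕ) : Ex := .ld a (.ld 7 (.var 36) * .var 27 + .ld 7 (.var 37))

/-- Whether the node with the number in variable `36` has been deleted. -/
def delEx : Ex := .ld 9 (.ld 7 (.var 36))

/-- Whether the variables `36` and `37` agree. -/
def diagEx : Ex := 1 - ((.var 36 - .var 37) + (.var 37 - .var 36))

/-- The code of the change at the nodes with the numbers in the variables `36` and `37`. -/
def codeEx : Ex := .ld 8 (.var 36 * .var 45 + .var 37)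

/-- The entry of `changeMat`. -/
def changeEx (r : ℕ) : Ex :=
  indEx 36 * indEx 37 * (delEx * diagEx + (1 - delEx) *
    (((.var 1 - atEx (10 + 4 * r)) * (codeEx % 2) + atEx (10 + 4 * r) * (codeEx / 2)) % .var 1))

/-- The scale on the diagonal. -/
def scaleEx (r : ℕ) : Ex := diagEx * (1 - indEx 36 * delEx) * .ld (13 + 4 * r) 0

/-- The entry of `restrictMat`. -/
def restrictEx (r : ℕ) : Ex := indEx 36 * indEx 37 * atEx (11 + 4 * r)

/-- Put the four blocks into place. -/
def blocksCmd (r : ℕ) : Cmd :=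
  blockFill 0 0 (scaleEx r) ;; blockFill 0 1 (changeEx r) ;; blockFill 1 0 (restrictEx r) ;;
    blockFill 1 1 0

section
variable {E : Env} {p q k kk r : ℕ} [hp : Fact p.Prime] {S : ℕ → ℕ} {del : ℕ → Prop}
  {g g' : ℕ → ℕ → Prop} {w n : ℕ → ℕ → ZMod p} {μ : ZMod p} {σ : St}

/-- The quotient `x / x` is `1`, except that `0 / 0 = 0`; this masks the padding beyond the `k`
changed nodes. -/
theorem eval_indEx (inp : List ℕ) {x : ℕ} (h : σ.v 44 = k) :
    (indEx x).eval inp σ = if σ.v x < k then 1 else 0 := by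
  simp only [indEx, Ex.eval_div, Ex.eval_sub, Ex.eval_var, h]
  split_ifs with hx
  · exact Nat.div_self (by omega)
  · simp; omega

theorem eval_diagEx (inp : List ℕ) {i j : ℕ} (h : σ.v 36 = i) (h' : σ.v 37 = j) :
    diagEx.eval inp σ = if i = j then 1 else 0 := by
  simp only [diagEx, Ex.eval_sub, Ex.eval_add, Ex.eval_var, Ex.eval_ofNat, h, h']
  split_ifs <;> omega

theorem UpdSt.eval_atEx (h : UpdSt p q k kk S del g g' σ) (hS : ∀ i < k, S i < q) (inp : List ℕ)
    {a i j : ℕ} (h36 : σ.v 36 = i) (h37 : σ.v 37 = j) (hi : i < k) (hj : j < k)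
    {m : ℕ → ℕ → ZMod p} (hm : HoldsMat (σ.h a) q m) :
    (atEx a).eval inp σ = (m (S i) (S j)).val := by
  simp only [atEx, Ex.eval_ld, Ex.eval_add, Ex.eval_mul, Ex.eval_var, h36, h37, h.nodes i hi,
    h.nodes j hj, h.size]
  exact hm _ _ (hS i hi) (hS j hj)

open scoped Classical in
theorem UpdSt.eval_delEx (h : UpdSt p q k kk S del g g' σ) (inp : List ℕ) {i : ℕ}
    (h36 : σ.v 36 = i) (hi : i < k) : delEx.eval inp σ = if del (S i) then 1 else 0 := by
  simp only [delEx, Ex.eval_ld, Ex.eval_var, h36, h.nodes i hi]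
  split_ifs with hd
  · exact (h.del i hi).1 hd
  · exact (h.del i hi).2 hd

theorem UpdSt.eval_restrictEx (h : UpdSt p q k kk S del g g' σ) (hS : ∀ i < k, S i < q)
    (inp : List ℕ) {i j : ℕ} (h36 : σ.v 36 = i) (h37 : σ.v 37 = j)
    (hm : HoldsMat (σ.h (11 + 4 * r)) q n) :
    (restrictEx r).eval inp σ = (restrictMat k S n i j).val := by
  simp only [restrictEx, Ex.eval_mul, eval_indEx inp h.card, h36, h37]
  unfold restrictMat
  by_cases hi : i < k
  · by_cases hj : j < k
    · rw [h.eval_atEx hS inp h36 h37 hi hj hm]; simp [hi, hj]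
    · simp [hj]
  · simp [hi]

open scoped Classical in
theorem UpdSt.eval_scaleEx (h : UpdSt p q k kk S del g g' σ) (inp : List ℕ) {i j : ℕ}
    (h36 : σ.v 36 = i) (h37 : σ.v 37 = j) (hμ : σ.h (13 + 4 * r) 0 = μ.val) :
    (scaleEx r).eval inp σ = (if i = j ∧ ¬(i < k ∧ del (S i)) then μ else 0).val := by
  simp only [scaleEx, Ex.eval_mul, Ex.eval_sub, eval_indEx inp h.card, eval_diagEx inp h36 h37,
    Ex.eval_ofNat, Ex.eval_ld, hμ, h36]
  by_cases hij : i = j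
  · by_cases hi : i < k
    · rw [h.eval_delEx inp h36 hi]
      by_cases hd : del (S i) <;> simp [hij ▸ hi, hij ▸ hd, hij]
    · simp [hij, hij ▸ hi]
  · simp [hij]

/-- A new edge, with code `1`, changes the entry of `1 - W` by minus its weight, and a lost edge,
with code `2`, by plus its weight. So `code % 2` and `code / 2` select `p - w` or `w`. -/
theorem UpdSt.eval_changeEx (h : UpdSt p q k kk S del g g' σ) (hS : ∀ i < k, S i < q)
    (inp : List ℕ) {i j : ℕ} (h36 : σ.v 36 = i) (h37 : σ.v 37 = j)
    (hm : HoldsMat (σ.h (10 + 4 * r)) q w) :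
    (changeEx r).eval inp σ = (changeMat k S del g g' w i j).val := by
  classical
  simp only [changeEx, Ex.eval_mul, Ex.eval_add, Ex.eval_sub, Ex.eval_mod, Ex.eval_div,
    eval_indEx inp h.card, eval_diagEx inp h36 h37, h36, h37, Ex.eval_var, h.mod, Ex.eval_ofNat]
  unfold changeMat
  by_cases hi : i < k
  swap
  · simp [hi]
  by_cases hj : j < k
  swap
  · simp [hj]
  rw [h.eval_delEx inp h36 hi, h.eval_atEx hS inp h36 h37 hi hj hm]
  by_cases hd : del (S i)
  · by_cases hij : i = j
    · simp [hj, hij ▸ hd, hij, ZMod.val_one]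
    · simp [hi, hj, hd, hij]
  have hc : codeEx.eval inp σ = edgeCode (g (S i) (S j)) (g' (S i) (S j)) := by
    simp only [codeEx, Ex.eval_ld, Ex.eval_add, Ex.eval_mul, Ex.eval_var, h36, h37, h.pad]
    exact h.code i hi j hj hd
  have hle := (ZMod.val_lt (w (S i) (S j))).le
  rw [hc, edgeCode]
  simp only [hi, hj, hd, if_true, if_false, and_self, one_mul, zero_mul, zero_add, Nat.sub_zero, walk]
  rw [← ZMod.val_natCast]
  congr 1
  by_cases hg : g (S i) (S j) <;> by_cases hg' : g' (S i) (S j) <;>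
    simp [hg, hg', Nat.cast_sub hle]

-- One in-place block product of this arrangement adds the product of the change and the restricted
-- inverse to the diagonal scale, which is the core. The change matrix remains next to it for the
-- product that follows the inversion.
open scoped Classical in
theorem blocksCmd_runs (h : UpdSt p q k kk S del g g' σ) (hS : ∀ i < k, S i < q) (hkV : kk < E.V)
    (hpV : p < E.V) (hr : Round q g r w n μ σ) :
    Runs E (blocksCmd r) σ (4 * (kk * (kk * 3 + 4) + 2)) fun σ' => HoldsMat (σ'.h 3) (kk + kk)
      (quad kk (fun i j => if i = j ∧ ¬(i < k ∧ del (S i)) then μ else 0)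
        (changeMat k S del g g' w) (restrictMat k S n) fun _ _ => 0) := by
  have hval : ∀ z : ZMod p, z.val < E.V := fun z => (ZMod.val_lt z).trans hpV
  have hst : ∀ σ' : St, (∀ x, x ≠ 36 → x ≠ 37 → σ'.v x = σ.v x) → (∀ l, l ≠ 3 → σ'.h l = σ.h l) →
      UpdSt p q k kk S del g g' σ' ∧ Round q g r w n μ σ' := fun σ' hv hh =>
    ⟨h.congr (fun x hx => hv x (by omega) (by omega)) ((hv 2 (by norm_num) (by norm_num)).trans h.str)
      (fun l hl => hh l (by omega)) (by rw [hh 0 (by norm_num)]; exact h.sim),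
      hr.congr (hh _ (by omega)) (hh _ (by omega)) (by rw [hh _ (by omega)])⟩
  have hfr : ∀ {a b : ℕ} {val : Ex} {σ₁ σ₂ : St}, Fr (blockFill a b val) σ₁ σ₂ →
      (∀ x, x ≠ 36 → x ≠ 37 → σ₁.v x = σ.v x) → (∀ l, l ≠ 3 → σ₁.h l = σ.h l) →
      (∀ x, x ≠ 36 → x ≠ 37 → σ₂.v x = σ.v x) ∧ ∀ l, l ≠ 3 → σ₂.h l = σ.h l :=
    fun hf hv hh => ⟨fun x h1 h2 => (hf.v x (by simp [blockFill, h1, h2])).trans (hv x h1 h2),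
      fun l hl => (hf.h l (by simp [blockFill, hl])).trans (hh l hl)⟩
  have h45 := h.pad
  have h2 := h.str
  refine Runs.time (s := (kk * (kk * 3 + 4) + 2) + ((kk * (kk * 3 + 4) + 2) +
    ((kk * (kk * 3 + 4) + 2) + (kk * (kk * 3 + 4) + 2)))) ?_ (by omega)
  refine Runs.seq (blockFill_runs
    (fun i j => ((if i = j ∧ ¬(i < k ∧ del (S i)) then μ else 0 : ZMod p)).val)
    (by norm_num) (by norm_num) hkV h45 h2 fun σ' i j _ _ hv hh h36 h37 =>
      ⟨(hst σ' hv hh).1.eval_scaleEx _ h36 h37 (hst σ' hv hh).2.scale, hval _⟩) ?_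
  rintro σ₁ ⟨m1, -⟩ f1
  obtain ⟨v1, h1⟩ := hfr f1 (fun _ _ _ => rfl) (fun _ _ => rfl)
  refine Runs.seq (blockFill_runs (fun i j => (changeMat k S del g g' w i j).val)
    (by norm_num) (by norm_num) hkV (by rw [v1 45 (by norm_num) (by norm_num), h45])
    (by rw [v1 2 (by norm_num) (by norm_num), h2]) fun σ' i j _ _ hv hh h36 h37 => ?_) ?_
  · obtain ⟨a1, a2⟩ := hst σ' (fun x a b => (hv x a b).trans (v1 x a b))
      fun l a => (hh l a).trans (h1 l a)
    exact ⟨a1.eval_changeEx hS _ h36 h37 a2.wt, hval _⟩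
  rintro σ₂ ⟨m2, k2⟩ f2
  obtain ⟨v2, h2'⟩ := hfr f2 v1 h1
  refine Runs.seq (blockFill_runs (fun i j => (restrictMat k S n i j).val)
    (by norm_num) (by norm_num) hkV (by rw [v2 45 (by norm_num) (by norm_num), h45])
    (by rw [v2 2 (by norm_num) (by norm_num), h2]) fun σ' i j _ _ hv hh h36 h37 => ?_) ?_
  · obtain ⟨a1, a2⟩ := hst σ' (fun x a b => (hv x a b).trans (v2 x a b))
      fun l a => (hh l a).trans (h2' l a)
    exact ⟨a1.eval_restrictEx hS _ h36 h37 a2.nh, hval _⟩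
  rintro σ₃ ⟨m3, k3⟩ f3
  obtain ⟨v3, h3'⟩ := hfr f3 v2 h2'
  refine (blockFill_runs (fun _ _ => (0 : ZMod p).val)
    (by norm_num) (by norm_num) hkV (by rw [v3 45 (by norm_num) (by norm_num), h45])
    (by rw [v3 2 (by norm_num) (by norm_num), h2]) fun σ' i j _ _ hv hh h36 h37 =>
      ⟨by simp, hval _⟩).mono le_rfl ?_
  rintro σ₄ ⟨m4, k4⟩ f4
  refine holdsMat_quad (fun i j hi hj => ?_) (fun i j hi hj => ?_) (fun i j hi hj => ?_) m4
  · rw [k4 0 0 (by norm_num) (by norm_num) (by simp) i j hi hj,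
      k3 0 0 (by norm_num) (by norm_num) (by simp) i j hi hj,
      k2 0 0 (by norm_num) (by norm_num) (by simp) i j hi hj, m1 i j hi hj]
  · rw [k4 0 1 (by norm_num) (by norm_num) (by simp) i j hi hj,
      k3 0 1 (by norm_num) (by norm_num) (by simp) i j hi hj, m2 i j hi hj]
  · rw [k4 1 0 (by norm_num) (by norm_num) (by simp) i j hi hj, m3 i j hi hj]

end


/-! ### Rounds of the update -/

/-- The results of round `r` of the update: what a query needs. -/
structure Fixed {p : ℕ} [Fact p.Prime] (q k kk : ℕ) (S : ℕ → ℕ) (del : ℕ → Prop)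
    (g g' : ℕ → ℕ → Prop) (r : ℕ) (w n z : ℕ → ℕ → ZMod p) (μ ξ : ZMod p) (σ : St) : Prop where
  nh : HoldsMat (σ.h (11 + 4 * r)) q n
  scale : σ.h (13 + 4 * r) 0 = μ.val
  scale' : σ.h (13 + 4 * r) 1 = ξ.val
  cor : ∀ i < k, ∀ j < k, σ.h (12 + 4 * r) (i * kk + j) = (z i j).val
  inv : ∃ N, walkMat q g' w * N = (ξ * μ) • (1 : Matrix (Fin q) (Fin q) (ZMod p)) ∧
    ∀ u v : Fin q, ¬del v → N u v = coreEntry k S n z ξ u v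
  ne_zero : (∀ i ≤ q, (walkMat q (fun x y => g x y ∧ x < i) w).det ≠ 0) →
    (∀ i ≤ k, (walkMat q (partGraph k S g g' i) w).det ≠ 0) → ξ * μ ≠ 0

theorem Fixed.congr {p : ℕ} [Fact p.Prime] {q k kk : ℕ} {S : ℕ → ℕ} {del : ℕ → Prop}
    {g g' : ℕ → ℕ → Prop} {r : ℕ} {w n z : ℕ → ℕ → ZMod p} {μ ξ : ZMod p} {σ σ' : St}
    (h : Fixed q k kk S del g g' r w n z μ ξ σ) (h1 : σ'.h (11 + 4 * r) = σ.h (11 + 4 * r))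
    (h2 : σ'.h (12 + 4 * r) = σ.h (12 + 4 * r)) (h3 : σ'.h (13 + 4 * r) = σ.h (13 + 4 * r)) :
    Fixed q k kk S del g g' r w n z μ ξ σ' :=
  ⟨h1 ▸ h.nh, h3 ▸ h.scale, h3 ▸ h.scale', h2 ▸ h.cor, h.inv, h.ne_zero⟩

/-- Round `r` of the update. -/
def fixCmd (P : Program) (r : ℕ) : Cmd :=
  blocksCmd r ;; clearCmd ;; .asg 20 0 ;; .asg 3 (.var 45) ;; callGemm P 0 0 0 1 1 0 1 1 ;;
  .asg 23 (.var 45) ;; invertCmd P ;;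
  .asg 20 0 ;; .asg 3 (.var 45) ;; callGemm P 1 1 0 0 0 1 0 1 ;;
  .fill 36 37 (.var 45) (.var 45) (12 + 4 * r) (.var 36 * .var 45 + .var 37)
    (.ld 3 ((.var 45 + .var 36) * .var 2 + (.var 45 + .var 37))) ;;
  .sto (13 + 4 * r) 1 (.ld 4 0)

theorem fixCmd_noA (P : Program) (r : ℕ) {x : ℕ}
    (h : 4 < x ∧ x < 12 + 4 * r ∨ 13 + 4 * r < x) : (fixCmd P r).NoA x := by
  have h1 := invertCmd_noA P (x := x) (by omega)
  have h2 := fun a b c d e f y z => callGemm_noA P a b c d e f y z (z := x) (by omega)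
  simp [fixCmd, blocksCmd, blockFill, clearCmd, h1, h2]; omega

/-- The time of a round of the update. -/
def fixTime (P : Program) (tm : ℕ → ℕ) (lev : ℕ) : ℕ :=
  5 * (2 ^ lev * (2 ^ lev * 3 + 4) + 2) + 2 * (gemmTime P tm (2 ^ lev) + 5) +
    invertTime P tm (2 ^ lev + 2 ^ lev) lev + ((2 ^ lev + 2 ^ lev) * 7 + 2) + 6

theorem blockGemm_quad {F : Type*} [CommRing F] {kk : ℕ} {a b c d : ℕ → ℕ → F} {i j : ℕ}
    (hi : i < kk) (hj : j < kk) :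
    blockGemm kk 0 0 0 kk kk 0 1 1 (quad kk a b c d) i j =
      a i j + ∑ l ∈ Finset.range kk, b i l * c l j := by
  unfold blockGemm
  rw [if_pos (by omega), one_mul, one_mul]
  congr 1
  · simp [quad, hi, hj]
  · refine Finset.sum_congr rfl fun l _ => ?_
    simp [quad, hi, hj]

/-- A block product forms the core in the upper left block, which is inverted in place, and another
one puts the inverse times the change matrix into the lower right block. That last product is the
matrix `z` of the query formula. -/
theorem fixCmd_runs {P : Program} {κ : ℕ} {tm : ℕ → ℕ} {E : Env} {p q k kk lev r : ℕ}
    [hp : Fact p.Prime] {S : ℕ → ℕ} {del : ℕ → Prop} {g g' : ℕ → ℕ → Prop} {w n : ℕ → ℕ → ZMod p}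
    {μ : ZMod p} {σ : St} (hP : MulProgram P κ tm) (hf : ∀ j ≤ lev, MulFit P κ tm E.V p (2 ^ j))
    (hlev : kk = 2 ^ lev) (hk : k ≤ kk) (hQ : (kk + kk) * (kk + kk) ≤ E.V) (hQV : kk + kk < E.V)
    (hc : Change q k S del g g') (h : UpdSt p q k kk S del g g' σ) (hr : Round q g r w n μ σ) :
    Runs E (fixCmd P r) σ (fixTime P tm lev) fun σ' => UpdSt p q k kk S del g g' σ' ∧
      ∃ (z : ℕ → ℕ → ZMod p) (ξ : ZMod p), Fixed q k kk S del g g' r w n z μ ξ σ' := by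
  classical
  have hfl := hf lev le_rfl
  rw [← hlev] at hfl
  have hpV := hfl.prime
  have hkV : kk < E.V := by omega
  have hkk : 1 ≤ kk := hlev ▸ Nat.one_le_two_pow
  have hV1 : 1 < E.V := hp.out.one_lt.trans hpV
  have b0 : (0 : ℕ) ≤ 1 := by norm_num
  have b1 : (1 : ℕ) ≤ 1 := le_rfl
  refine Runs.time (s := (4 * (kk * (kk * 3 + 4) + 2)) + (((kk + kk) * 7 + 2) +
    (((gemmTime P tm kk + 5) + ((invertTime P tm (kk + kk) lev + (((gemmTime P tm kk + 5) +
      ((kk * (kk * 3 + 4) + 2) + 1)) + 1 + 1)) + 1)) + 1 + 1))) ?_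
    (by unfold fixTime; rw [← hlev]; omega)
  refine Runs.seq (blocksCmd_runs h hc.lt hkV hpV hr) ?_
  intro σ₁ m1 f1
  set m := quad kk (fun i j => if i = j ∧ ¬(i < k ∧ del (S i)) then μ else 0)
        (changeMat k S del g g' w) (restrictMat k S n) (fun _ _ => 0) with hm
  have v1 : ∀ x, x ≠ 36 → x ≠ 37 → σ₁.v x = σ.v x := fun x a b =>
    f1.v x (by simp [blocksCmd, blockFill, a, b])
  have h1 : ∀ l, l ≠ 3 → σ₁.h l = σ.h l := fun l a => f1.h l (by simp [blocksCmd, blockFill, a])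
  refine Runs.seq (clearCmd_runs (p := p) (Q := kk + kk) (m := m) hQV hV1 m1
    (by rw [h1 0 (by norm_num)]; exact h.sim) (by rw [v1 1 (by norm_num) (by norm_num), h.mod])
    (by rw [v1 2 (by norm_num) (by norm_num), h.str])) ?_
  intro σ₂ m2 f2
  have v2 : ∀ x, x ≠ 36 → x ≠ 37 → σ₂.v x = σ.v x := fun x a b => by
    rw [f2.v x (by simp [clearCmd, a, b]), v1 x a b]
  have e45 : σ₂.v 45 = kk := by rw [v2 45 (by norm_num) (by norm_num), h.pad]
  refine Runs.asg_seq (by simp; omega) (Runs.asg_seq (by simpa [e45] using hkV) ?_)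
  set σ₃ := (σ₂.set 20 (Ex.eval E.inp σ₂ 0)).set 3 (Ex.eval E.inp (σ₂.set 20 (Ex.eval E.inp σ₂ 0))
    (.var 45)) with hσ₃
  have v3 : ∀ x, x ≠ 36 → x ≠ 37 → x ≠ 20 → x ≠ 3 → σ₃.v x = σ.v x := fun x a b c d => by
    simp [hσ₃, c, d, v2 x a b]
  have m3 : MatSt σ₃ (kk + kk) m (0 : ℕ → ZMod p) := m2.congr rfl (by simp [hσ₃]) (by simp [hσ₃])
  refine Runs.seq (callGemm_runs hP hfl hkk hQ (s := 0) (X := 1) (Y := 1) m3 (by simp [hσ₃, e45])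
    (by simp [hσ₃]) (by omega) b0 b0 b0 b1 b1 b0 hV1 hV1 (fun _ _ => rfl) fun _ _ => rfl) ?_
  rintro σ₄ ⟨m4, v4⟩ f4
  have v4' : ∀ x, x = 1 ∨ x = 2 ∨ 25 < x ∧ x < 36 ∨ 37 < x → σ₄.v x = σ.v x := fun x hx => by
    rw [v4 x (by omega), v3 x (by omega) (by omega) (by omega) (by omega)]
  simp only [zero_mul, one_mul, add_zero, zero_add, Nat.cast_one] at m4
  have e45' : σ₄.v 45 = kk := by rw [v4' 45 (by norm_num), h.pad]
  refine Runs.asg_seq (by simpa [e45'] using hkV) ?_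
  refine Runs.seq (invertCmd_runs (lev := lev) hP (fun j hj => hf j hj.le) (by omega) hQ hQV hpV m4.mat m4.sim
    (by simp [m4.mod]) (by simp [m4.str]) (by simp [e45', hlev])) ?_
  rintro σ₅ ⟨x, d, m5, x1, x2, x3⟩ f5
  rw [← hlev] at x1 x2 x3
  have v5 : ∀ x, x = 1 ∨ x = 2 ∨ 25 < x ∧ x < 36 ∨ 37 < x → σ₅.v x = σ.v x := fun x hx => by
    rw [f5.v x (invertCmd_noV P (by omega)), St.set_v, if_neg (by omega), v4' x hx]
  have e45'' : σ₅.v 45 = kk := by rw [v5 45 (by norm_num), h.pad]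
  refine Runs.asg_seq (by simp; omega) (Runs.asg_seq (by simpa [e45''] using hkV) ?_)
  set σ₆ := (σ₅.set 20 (Ex.eval E.inp σ₅ 0)).set 3 (Ex.eval E.inp (σ₅.set 20 (Ex.eval E.inp σ₅ 0))
    (.var 45)) with hσ₆
  have m6 : MatSt σ₆ (kk + kk) x d := m5.congr rfl (by simp [hσ₆]) (by simp [hσ₆])
  refine Runs.seq (callGemm_runs hP hfl hkk hQ (s := 0) (X := 0) (Y := 1) m6 (by simp [hσ₆, e45''])
    (by simp [hσ₆]) (by omega) b1 b1 b0 b0 b0 b1 (by omega) hV1 (fun _ _ => rfl) fun _ _ => rfl) ?_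
  rintro σ₇ ⟨m7, v7⟩ f7
  simp only [zero_mul, one_mul, add_zero, zero_add, Nat.cast_one, Nat.cast_zero] at m7
  have v7' : ∀ x, x = 1 ∨ x = 2 ∨ 25 < x ∧ x < 36 ∨ 37 < x → σ₇.v x = σ.v x := fun x hx => by
    rw [v7 x (by omega), hσ₆, St.set_v, if_neg (by omega), St.set_v, if_neg (by omega), v5 x hx]
  have h7 : ∀ l, 4 < l → σ₇.h l = σ.h l := fun l hl => by
    rw [f7.h l (callGemm_noA _ _ _ _ _ _ _ _ _ (by omega))]
    simp only [hσ₆, St.set_h]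
    rw [f5.h l (invertCmd_noA P hl), St.set_h, f4.h l (callGemm_noA _ _ _ _ _ _ _ _ _ (by omega))]
    simp only [hσ₃, St.set_h]
    rw [f2.h l (by simp [clearCmd]; omega), h1 l (by omega)]
  set z : ℕ → ℕ → ZMod p := fun i j => ∑ l ∈ Finset.range kk, x i l * changeMat k S del g g' w l j
    with hz
  refine Runs.seq (Runs.fill (fun i j => i * kk + j) (fun i j => (z i j).val) (by norm_num)
    hkV hkV (fun σ' hf => ?_) (fun σ' hf => ?_) (fun σ' i j hi hj hf h36 h37 _ => ⟨?_, ?_, ?_⟩)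
    fun i j i' j' _ hj _ hj' h => idx_inj hj hj' h) ?_
  · simpa [v7' 45, h.pad] using hf.v 45 (by simp)
  · simpa [v7' 45, h.pad] using hf.v 45 (by simp)
  · have := hf.v 45 (by simp)
    simp [h36, h37, this, v7' 45, h.pad]
  · have e1 := hf.v 45 (by simp)
    have e2 := hf.v 2 (by simp)
    have e3 := hf.h 3 (by simp; omega)
    simp only [Ex.eval_ld, Ex.eval_add, Ex.eval_mul, Ex.eval_var, e1, e2, e3, h36, h37,
      v7' 45 (by omega), h.pad, v7' 2 (by omega), h.str]
    rw [m7.mat _ _ (by omega) (by omega)]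
    congr 1
    unfold blockGemm
    rw [if_pos (by omega), zero_mul, one_mul, zero_add, hz]
    refine Finset.sum_congr rfl fun l hl => ?_
    have hl := Finset.mem_range.mp hl
    rw [x3 (0 + l) _ (by omega), zero_add, zero_add, Nat.add_sub_cancel_left,
      Nat.add_sub_cancel_left]
    congr 1
    unfold blockGemm
    rw [if_neg (by omega), hm]
    simp [quad, hl]
  · exact (ZMod.val_lt _).trans hpV
  rintro σ₈ ⟨c8, -⟩ f8
  have h4 : σ₈.h 4 0 = (d 0).val := by rw [f8.h 4 (by simp; omega), m7.den 0 (by omega)]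
  have v8 : ∀ x, x = 1 ∨ x = 2 ∨ 25 < x ∧ x < 36 ∨ 37 < x → σ₈.v x = σ.v x := fun x hx => by
    rw [f8.v x (by simp; omega), v7' x hx]
  have h8 : ∀ l, 4 < l → l ≠ 12 + 4 * r → σ₈.h l = σ.h l := fun l hl hl' => by
    rw [f8.h l (by simp [hl']), h7 l hl]
  refine Runs.sto (by simp [h4]; exact (ZMod.val_lt _).trans hpV) ⟨?_, z, d 0, ?_⟩
  · refine h.congr (fun x hx => ?_) ?_ (fun l hl => ?_) fun x => ?_
    · rw [St.put_v, v8 x (by omega)]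
    · rw [St.put_v, v8 2 (by omega), h.str]
    · rw [St.put_h_ne _ _ _ (by omega), h8 l (by omega) (by omega)]
    · rw [St.put_h_ne _ _ _ (by omega), f8.h 0 (by simp; omega), m7.sim]
  -- All leading blocks, not only the full one, are identified with those of the core, since the
  -- inversion asks for nonzero leading minors.
  have hcore : ∀ a ≤ kk, blk (blockGemm kk 0 0 0 kk kk 0 1 1 m) 0 0 a a =
      blk (coreMat k kk S del g g' w n μ) 0 0 a a := fun a ha => by
    ext i j
    simp only [blk, Matrix.of_apply, zero_add]
    rw [hm, blockGemm_quad (by omega) (by omega), coreMat]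
  refine ⟨?_, ?_, ?_, fun i hi j hj => ?_, ?_, fun hd hd' => ?_⟩
  · rw [St.put_h_ne _ _ _ (by omega), h8 _ (by omega) (by omega)]
    exact hr.nh
  · simp only [Ex.eval_ofNat, St.put_h_same]
    rw [if_neg (by norm_num), h8 _ (by omega) (by omega), hr.scale]
  · simp [h4]
  · rw [St.put_h_ne _ _ _ (by omega), c8 i j (by omega) (by omega)]
  · refine exists_updated_inverse hc hk hr.inv (x := x) ?_ fun i _ j _ => rfl
    rw [← hcore kk le_rfl]
    exact x1
  · refine mul_ne_zero (x2 fun i hi => ?_) (hr.ne_zero hd)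
    rw [hcore i hi]
    refine coreMat_minor_ne_zero hc hk hr.inv (hr.ne_zero hd) i ?_
    -- Minors that reach into the padding belong to the fully changed graph.
    rcases le_total i k with h | h
    · exact hd' i h
    · rw [partGraph_eq hc h, ← partGraph_eq hc le_rfl]
      exact hd' k le_rfl


/-- The first `R` rounds of the update. -/
def fixesCmd (P : Program) : ℕ → Cmd
  | 0 => .skip
  | R + 1 => fixesCmd P R ;; fixCmd P R

theorem fixesCmd_noA (P : Program) {x : ℕ} (R : ℕ) (h : 4 < x ∧ x < 12 ∨ 9 + 4 * R < x) :
    (fixesCmd P R).NoA x := by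
  induction R with
  | zero => trivial
  | succ R ih => exact ⟨ih (by omega), fixCmd_noA P R (by omega)⟩

section
variable {P : Program} {κ : ℕ} {tm : ℕ → ℕ} {E : Env} {p q k kk lev : ℕ} [hp : Fact p.Prime]
  {S : ℕ → ℕ} {del : ℕ → Prop} {g g' : ℕ → ℕ → Prop} {w : ℕ → ℕ → ℕ → ZMod p} {σ : St}

theorem fixesCmd_runs (hP : MulProgram P κ tm) (hf : ∀ j ≤ lev, MulFit P κ tm E.V p (2 ^ j))
    (hlev : kk = 2 ^ lev) (hk : k ≤ kk) (hQ : (kk + kk) * (kk + kk) ≤ E.V) (hQV : kk + kk < E.V)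
    (hc : Change q k S del g g') (h : UpdSt p q k kk S del g g' σ) (R : ℕ)
    (hr : ∀ r < R, ∃ (n : ℕ → ℕ → ZMod p) (μ : ZMod p), Round q g r (w r) n μ σ) :
    Runs E (fixesCmd P R) σ (R * fixTime P tm lev) fun σ' => UpdSt p q k kk S del g g' σ' ∧
      ∀ r < R, ∃ (n z : ℕ → ℕ → ZMod p) (μ ξ : ZMod p),
        Fixed q k kk S del g g' r (w r) n z μ ξ σ' := by
  induction R with
  | zero => exact (Runs.skip ⟨h, fun r hr => by omega⟩).time (by simp)
  | succ R ih =>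
    refine Runs.time (Runs.seq (ih fun r hrR => hr r (by omega)) ?_) (by rw [add_mul, one_mul])
    rintro σ₁ ⟨h1, r1⟩ hf1
    obtain ⟨n, μ, hr'⟩ := hr R (by omega)
    have ha : ∀ l, 9 + 4 * R < l → σ₁.h l = σ.h l := fun l hl => hf1.h l (fixesCmd_noA P R (by omega))
    refine (fixCmd_runs (r := R) hP hf hlev hk hQ hQV hc h1 (hr'.congr (ha _ (by omega))
      (ha _ (by omega)) (by rw [ha _ (by omega)]))).mono le_rfl ?_
    rintro σ₂ ⟨h2, z, ξ, r2⟩ hf2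
    refine ⟨h2, fun r hrR => ?_⟩
    rcases Nat.lt_succ_iff_lt_or_eq.mp hrR with hlt | rfl
    · obtain ⟨n', z', μ', ξ', hr''⟩ := r1 r hlt
      exact ⟨n', z', μ', ξ', hr''.congr (hf2.h _ (fixCmd_noA P R (by omega)))
        (hf2.h _ (fixCmd_noA P R (by omega))) (hf2.h _ (fixCmd_noA P R (by omega)))⟩
    · exact ⟨n, z, μ, ξ, r2⟩

end

/-! ### The update phase -/

/-- The update. -/
def updCmd (P : Program) (R : ℕ) : Cmd :=
  collectCmd ;; padCmd ;; recordCmd ;; .asg 2 (.var 45 + .var 45) ;; fixesCmd P R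

/-- The result of the update. -/
structure Updated (p q n k kk R : ℕ) [Fact p.Prime] (S : ℕ → ℕ) (D : ℕ → Prop)
    (g g' : ℕ → ℕ → Prop) (w : ℕ → ℕ → ℕ → ZMod p) (σ : St) : Prop where
  mod : σ.v 1 = p
  size : σ.v 27 = q
  card : σ.v 44 = k
  pad : σ.v 45 = kk
  nodes : ∀ i < k, σ.h 7 i = S i
  del : ∀ x < n, (D x → σ.h 9 x = 1) ∧ (¬D x → σ.h 9 x = 0)
  rounds : ∀ r < R, ∃ (n z : ℕ → ℕ → ZMod p) (μ ξ : ZMod p),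
    Fixed q k kk S D g g' r (w r) n z μ ξ σ

/-- The time of the update by `f` changes with `2 ^ lev` as the size of the matrices. -/
def updTime (P : Program) (tm : ℕ → ℕ) (R f lev : ℕ) : ℕ :=
  (f * 12 + 3) + ((2 * lev + 2) + (((2 ^ lev * (2 ^ lev * 3 + 4) + 2) + (f * 9 + 2)) +
    (R * fixTime P tm lev + 1)))

theorem numbering_spec {n k : ℕ} {U : List (GraphUpdate n)} {f : ℕ → ℕ}
    (h : (List.range k).map f = numbering U) :
    k = (numbering U).length ∧ ∀ i < k, f i = (numbering U).getD i 0 := by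
  refine ⟨by rw [← h]; simp, fun i hi => ?_⟩
  rw [← h]
  simp [hi]

theorem nodup_regStep {L : List ℕ} (h : L.Nodup) (y : ℕ) : (regStep L y).Nodup := by
  unfold regStep
  split_ifs with hy
  · exact h
  · exact h.append (List.nodup_singleton y) (by simpa [List.disjoint_singleton] using hy)

theorem mem_regStep {L : List ℕ} {x y : ℕ} : x ∈ regStep L y ↔ x ∈ L ∨ x = y := by
  unfold regStep
  split_ifs with hy
  · exact ⟨Or.inl, fun h => h.elim id fun h => h ▸ hy⟩
  · simp

theorem length_regStep_le (L : List ℕ) (y : ℕ) : (regStep L y).length ≤ L.length + 1 := by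
  unfold regStep
  split_ifs <;> simp

theorem numbering_concat {n : ℕ} (U : List (GraphUpdate n)) (u : GraphUpdate n) :
    numbering (U ++ [u]) =
      regStep (regStep (numbering U) (u.words.getD 1 0)) (u.words.getD 2 0) := by
  simp only [numbering, List.foldl_append, List.foldl_cons, List.foldl_nil]

theorem nodup_numbering {n : ℕ} (U : List (GraphUpdate n)) : (numbering U).Nodup := by
  induction U using List.reverseRecOn with
  | nil => exact List.nodup_nil
  | append_singleton U u ih =>
    rw [numbering_concat]
    exact nodup_regStep (nodup_regStep ih _) _

theorem mem_numbering {n : ℕ} {U : List (GraphUpdate n)} {x : ℕ} :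
    x ∈ numbering U ↔ ∃ u ∈ U, x = u.words.getD 1 0 ∨ x = u.words.getD 2 0 := by
  induction U using List.reverseRecOn with
  | nil => simp [numbering]
  | append_singleton U u ih =>
    rw [numbering_concat, mem_regStep, mem_regStep, ih]
    simp only [List.mem_append, List.mem_singleton, or_and_right, exists_or, exists_eq_left, or_assoc]

theorem length_numbering_le {n : ℕ} (U : List (GraphUpdate n)) :
    (numbering U).length ≤ 2 * U.length := by
  induction U using List.reverseRecOn with
  | nil => simp [numbering]
  | append_singleton U u ih =>
    rw [numbering_concat, List.length_append, List.length_singleton]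
    have h1 := length_regStep_le (numbering U) (u.words.getD 1 0)
    have h2 := length_regStep_le (regStep (numbering U) (u.words.getD 1 0)) (u.words.getD 2 0)
    omega

theorem lt_of_mem_numbering {n : ℕ} (hn : 2 ≤ n) (U : List (GraphUpdate n)) {x : ℕ} (hx : x ∈ numbering U) : x < n := by
  obtain ⟨u, -, rfl | rfl⟩ := mem_numbering.mp hx <;> exact words_getD_lt hn u (by simp)

/-- The numbering has no repetitions. However many updates there are, the matrices of the update
thus fit into the cells reserved for `n × n` data, and no bound on their number is needed. -/
theorem length_numbering_le_card {n : ℕ} (hn : 2 ≤ n) (U : List (GraphUpdate n)) :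
    (numbering U).length ≤ n := by
  rw [← List.toFinset_card_of_nodup (nodup_numbering U)]
  refine (Finset.card_le_card (t := Finset.range n) fun x hx => ?_).trans_eq (Finset.card_range n)
  exact Finset.mem_range.mpr (lt_of_mem_numbering hn U (by simpa using hx))

theorem change_numbering {n : ℕ} (hn : 2 ≤ n) (U : List (GraphUpdate n)) (G : Digraph (Fin n)) {q : ℕ} (hnq : n ≤ q) :
    Change q (numbering U).length (fun i => (numbering U).getD i 0)
      (natDel (applyUpdates G U)) (natAdj G) (liveAdj (applyUpdates G U)) := by
  refine change_applyUpdates hnq G U (fun i hi => ?_) (fun i hi j hj h => ?_) fun u hu => ?_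
  · rw [List.getD_eq_getElem _ _ hi]
    exact lt_of_mem_numbering hn U (List.getElem_mem hi)
  · simp only [List.getD_eq_getElem _ _ hi, List.getD_eq_getElem _ _ hj] at h
    exact (nodup_numbering U).getElem_inj_iff.mp h
  · have key : ∀ x ∈ numbering U, ∃ i < (numbering U).length, (numbering U).getD i 0 = x := by
      intro x hx
      obtain ⟨i, hi, e⟩ := List.mem_iff_getElem.mp hx
      exact ⟨i, hi, by rw [List.getD_eq_getElem _ _ hi, e]⟩
    exact ⟨key _ (mem_numbering.mpr ⟨u, hu, Or.inl rfl⟩), key _ (mem_numbering.mpr ⟨u, hu, Or.inr rfl⟩)⟩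

theorem updCmd_runs {P : Program} {κ : ℕ} {tm : ℕ → ℕ} {E : Env} {n R a p : ℕ} {G : Digraph (Fin n)}
    {U : List (GraphUpdate n)} [hp : Fact p.Prime] {w : ℕ → ℕ → ℕ → ZMod p} {σ : St}
    (hP : MulProgram P κ tm) (hinp : E.inp = updateWords U) (hn : 2 ≤ n) (hna : n ≤ 16 ^ a)
    (hV : 2 ^ (14 * a + 8) < E.V) (hU : 2 * U.length + 1 < E.V)
    (hf : ∀ j ≤ 4 * a, MulFit P κ tm E.V p (2 ^ j)) (h : Prepared p a R (natAdj G) w σ) :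
    Runs E (updCmd P R) σ (updTime P tm R U.length (Nat.clog 2 (numbering U).length)) fun σ' =>
      Updated p (16 ^ a) n (numbering U).length (2 ^ Nat.clog 2 (numbering U).length) R
        (fun i => (numbering U).getD i 0) (natDel (applyUpdates G U)) (natAdj G)
        (liveAdj (applyUpdates G U)) w σ' := by
  have hkn := length_numbering_le_card hn U
  obtain ⟨lev, hlev⟩ : ∃ lev, lev = Nat.clog 2 (numbering U).length := ⟨_, rfl⟩
  obtain ⟨kk, hkk⟩ : ∃ kk, kk = 2 ^ lev := ⟨_, rfl⟩
  have e16 : (16 : ℕ) ^ a = 2 ^ (4 * a) := by rw [pow_mul]; norm_num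
  have hlev4 : lev ≤ 4 * a := by
    rw [hlev]
    exact Nat.clog_le_of_le_pow (by omega)
  have hle : ∀ e ≤ 14 * a + 8, (2 : ℕ) ^ e < E.V := fun e he =>
    (Nat.pow_le_pow_right (by norm_num) he).trans_lt hV
  have hkkq : kk ≤ 2 ^ (4 * a) := hkk ▸ Nat.pow_le_pow_right (by norm_num) hlev4
  have hk : (numbering U).length ≤ kk := by
    rw [hkk, hlev]; exact Nat.le_pow_clog (by norm_num) _
  have hQ2 : (kk + kk) * (kk + kk) < E.V := by
    refine lt_of_le_of_lt ?_ (hle (8 * a + 2) (by omega))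
    have : (2 : ℕ) ^ (8 * a + 2) = (2 ^ (4 * a) + 2 ^ (4 * a)) * (2 ^ (4 * a) + 2 ^ (4 * a)) := by
      rw [pow_add, show 8 * a = 4 * a + 4 * a by ring, pow_add]; ring
    rw [this]
    exact Nat.mul_le_mul (by omega) (by omega)
  have hkk1 : 1 ≤ kk := hkk ▸ Nat.one_le_two_pow
  have hQV : kk + kk < E.V := by nlinarith
  have hkV : kk * kk ≤ E.V := by nlinarith
  have h7 : (2 : ℕ) ^ 8 < E.V := hle 8 (by omega)
  have hnV : n + n + 2 ≤ E.V := by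
    have := hle (4 * a + 3) (by omega)
    rw [pow_add] at this
    have h1 : 1 ≤ 2 ^ (4 * a) := Nat.one_le_two_pow
    omega
  rw [← hlev, ← hkk]
  refine Runs.time (s := (U.length * 12 + 3) + ((2 * lev + 2) +
    (((kk * (kk * 3 + 4) + 2) + (U.length * 9 + 2)) + (R * fixTime P tm lev + 1)))) ?_
    (by unfold updTime; rw [← hkk])
  refine Runs.seq (collectCmd_runs hn hinp h.pos (by omega) hU) ?_
  rintro σ₁ ⟨k, hk1, hr, hL, hall⟩ f1
  obtain ⟨rfl, hS⟩ := numbering_spec hL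
  have v1 : ∀ x < 40, σ₁.v x = σ.v x := fun x hx => f1.v x (by simp [collectCmd, regCmd]; omega)
  have h1 : ∀ l, l ≠ 6 → l ≠ 7 → σ₁.h l = σ.h l := fun l a b =>
    f1.h l (by simp [collectCmd, regCmd, a, b])
  refine Runs.seq ((padCmd_runs (E := E) hr.card (by omega)).time (by rw [hlev])) ?_
  intro σ₂ e45 f2
  rw [← hlev, ← hkk] at e45
  have v2 : ∀ x, x ≠ 45 → σ₂.v x = σ₁.v x := fun x hx => f2.v x (by simp [padCmd, hx])
  have h2 : ∀ l, σ₂.h l = σ₁.h l := fun l => f2.h l (by simp [padCmd])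
  have hr2 : Reg n (numbering U).length σ₂ := hr.congr (h2 6) (h2 7) (v2 44 (by norm_num))
  refine Runs.seq (recordCmd_runs (E := E) (q := 16 ^ a) (G := G) hn hna hinp hr2 (by rw [h2 7]; exact hall) hk
    e45 (by rw [v2 27 (by norm_num), v1 27 (by norm_num), h.sizes.q])
    (by rw [h2, h1 5 (by norm_num) (by norm_num)]; exact h.graph)
    (by rw [h2, h1 9 (by norm_num) (by norm_num)]; exact h.del) (by omega) (by omega) (by omega)
    hkV (by omega)) ?_
  intro σ₃ rec f3
  have v3 : ∀ x, x < 36 ∨ 43 < x ∧ x < 46 → σ₃.v x = σ₂.v x := fun x hx =>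
    f3.v x (by simp [recordCmd]; omega)
  have h3 : ∀ l, l ≠ 8 → l ≠ 9 → σ₃.h l = σ₂.h l := fun l a b => f3.h l (by simp [recordCmd, a, b])
  have v3' : ∀ x < 36, σ₃.v x = σ.v x := fun x hx => by
    rw [v3 x (by omega), v2 x (by omega), v1 x (by omega)]
  have h3' : ∀ l, l ≠ 6 → l ≠ 7 → l ≠ 8 → l ≠ 9 → σ₃.h l = σ.h l := fun l a b c d => by
    rw [h3 l c d, h2, h1 l a b]
  have e45' : σ₃.v 45 = kk := by rw [v3 45 (by omega), e45]
  have e7 : σ₃.h 7 = σ₁.h 7 := by rw [h3 7 (by norm_num) (by norm_num), h2]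
  have hlt : ∀ i < (numbering U).length, σ₁.h 7 i < n := hr.lt
  refine Runs.asg_seq (by simpa [e45'] using hQV) ?_
  refine (fixesCmd_runs (p := p) (g := natAdj G) (g' := liveAdj (applyUpdates G U))
    (del := natDel (applyUpdates G U)) (S := fun i => (numbering U).getD i 0) (w := w) (lev := lev) hP
    (fun j hj => hf j (by omega)) hkk hk hQ2.le hQV (change_numbering hn U G hna) ?_ R
    fun r hr => ?_).mono le_rfl ?_
  · refine ⟨?_, by simp [e45'], ?_, ?_, by simpa using e45', fun i hi => ?_, fun i hi j hj hd => ?_,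
      fun i hi => ?_, fun x => ?_⟩
    · simp [v3' 1, h.mod]
    · simp [v3' 27, h.sizes.q]
    · simp only [St.set_v]
      rw [if_neg (by norm_num), v3 44 (by norm_num), hr2.card]
    · simp only [St.set_h]; rw [e7, hS i hi]
    · have := rec.code i hi j hj
      rw [e7, hS i hi, hS j hj] at this
      simp only [St.set_h]
      rw [this]
      congr 1
      -- The recorded codes ignore node deletions, but they are used only in rows of live nodes,
      -- where `liveAdj` and `natAdj` agree.
      exact propext ⟨fun h => ⟨h, hd⟩, fun h => h.1⟩
    · have := rec.del _ (hlt i hi)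
      rw [hS i hi] at this
      exact this
    · simp only [St.set_h]
      rw [h3' 0 (by norm_num) (by norm_num) (by norm_num) (by norm_num), h.sim]
  · obtain ⟨n', μ, hr'⟩ := h.rounds r hr
    exact ⟨n', μ, hr'.congr (h3' _ (by omega) (by omega) (by omega) (by omega))
      (h3' _ (by omega) (by omega) (by omega) (by omega))
      (by rw [St.set_h, h3' _ (by omega) (by omega) (by omega) (by omega)])⟩
  · rintro σ₄ ⟨u, hr4⟩ f4
    refine ⟨u.mod, u.size, u.card, u.pad, u.nodes, ?_, hr4⟩
    rw [f4.h 9 (fixesCmd_noA P R (by omega))]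
    exact rec.del


/-! ### Queries -/

/-- Round `r` of a query for the nodes in the variables `50` and `51`. -/
def askCmd (r : ℕ) : Cmd :=
  .asg 52 0 ;;
  .forC 36 (.var 44) (.asg 53 0 ;;
    .forC 37 (.var 44) (.asg 53 ((.var 53 + .ld (12 + 4 * r) (.var 36 * .var 45 + .var 37) *
      .ld (11 + 4 * r) (.ld 7 (.var 37) * .var 27 + .var 51)) % .var 1)) ;;
    .asg 52 ((.var 52 + .ld (11 + 4 * r) (.var 50 * .var 27 + .ld 7 (.var 36)) * .var 53) % .var 1)) ;;
  .ite ((((.var 1 - .var 52) + .ld (13 + 4 * r) 1 * .ld (11 + 4 * r) (.var 50 * .var 27 + .var 51)) %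
      .var 1) * (.ld (13 + 4 * r) 1 * .ld (13 + 4 * r) 0 % .var 1))
    (.asg 0 1) .skip

/-- The first `R` rounds of a query. -/
def asksCmd : ℕ → Cmd
  | 0 => .skip
  | R + 1 => asksCmd R ;; askCmd R

/-- The query. -/
def queryCmd (R : ℕ) : Cmd :=
  .asg 0 0 ;; .asg 50 (.inp 0) ;; .asg 51 (.inp 1) ;;
    .ite (.ld 9 (.var 50) + .ld 9 (.var 51)) .skip (asksCmd R)

theorem asksCmd_noV {x : ℕ} (h : 0 < x ∧ x < 36 ∨ 37 < x ∧ x < 52) (R : ℕ) : (asksCmd R).NoV x := by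
  induction R with
  | zero => trivial
  | succ R ih => exact ⟨ih, by simp [askCmd]; omega⟩

theorem asksCmd_noA (x R : ℕ) : (asksCmd R).NoA x := by
  induction R with
  | zero => trivial
  | succ R ih => exact ⟨ih, by simp [askCmd]⟩

/-- The time of a query when `k` nodes have been changed. -/
def queryTime (R k : ℕ) : ℕ := R * (k * (k * 3 + 6) + 5) + 4

section
variable {E : Env} {p q n k kk R : ℕ} [hp : Fact p.Prime] {S : ℕ → ℕ} {D : ℕ → Prop}
  {g g' : ℕ → ℕ → Prop} {w : ℕ → ℕ → ℕ → ZMod p} {σ : St}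

theorem Updated.congr {σ' : St} (h : Updated p q n k kk R S D g g' w σ)
    (hv : ∀ x, x = 1 ∨ x = 27 ∨ x = 44 ∨ x = 45 → σ'.v x = σ.v x) (hh : ∀ l, σ'.h l = σ.h l) :
    Updated p q n k kk R S D g g' w σ' where
  mod := (hv 1 (by simp)).trans h.mod
  size := (hv 27 (by simp)).trans h.size
  card := (hv 44 (by simp)).trans h.card
  pad := (hv 45 (by simp)).trans h.pad
  nodes := by rw [hh 7]; exact h.nodes
  del := by rw [hh 9]; exact h.del
  rounds r hr := by
    obtain ⟨m, z, μ, ξ, hf⟩ := h.rounds r hr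
    exact ⟨m, z, μ, ξ, hf.congr (hh _) (hh _) (hh _)⟩

theorem val_add_mul_mod (x a b : ZMod p) : (x.val + a.val * b.val) % p = (x + a * b).val := by
  rw [← ZMod.val_natCast]; simp

/-- The two nested loops evaluate the bilinear form in `coreEntry`. The final test multiplies the
entry and the scale, both reduced, as natural numbers, so it is nonzero exactly if both are. -/
theorem askCmd_runs {r u v : ℕ} {m z : ℕ → ℕ → ZMod p} {μ ξ : ZMod p} (hS : ∀ i < k, S i < q)
    (hpV : p < E.V) (hkV : k < E.V) (hu : u < q) (hv : v < q)
    (h : Updated p q n k kk R S D g g' w σ) (h50 : σ.v 50 = u) (h51 : σ.v 51 = v)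
    (hf : Fixed q k kk S D g g' r (w r) m z μ ξ σ) :
    Runs E (askCmd r) σ (k * (k * 3 + 6) + 5) fun σ' =>
      ((coreEntry k S m z ξ u v ≠ 0 ∧ ξ * μ ≠ 0) ∧ σ'.v 0 = 1) ∨
      ((coreEntry k S m z ξ u v = 0 ∨ ξ * μ = 0) ∧ σ'.v 0 = σ.v 0) := by
  have hval : ∀ z : ZMod p, z.val < E.V := fun z => (ZMod.val_lt z).trans hpV
  have hV1 : 1 < E.V := hp.out.one_lt.trans hpV
  let acc : ℕ → ZMod p := fun i => ∑ l ∈ Finset.range i, m u (S l) *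
    ∑ j ∈ Finset.range k, z l j * m (S j) v
  refine Runs.time (s := ((k * ((1 + (k * (1 + 2) + 2) + 1) + 2) + 2) + (1 + 1)) + 1) ?_
    (le_of_eq (by ring))
  refine Runs.asg_seq (by simp; omega) ?_
  refine Runs.seq (s := k * ((1 + (k * (1 + 2) + 2) + 1) + 2) + 2) (t := 1 + 1)
    (R := fun σ' => σ'.v 52 = (acc k).val) ?_ ?_
  · refine Runs.forC (fun i σ' => σ'.v 52 = (acc i).val) hkV (by simp) (fun σ' i _ _ _ hf' => ?_)
      (by simp [acc]) ?_ fun σ' h _ _ => h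
    · simpa [h.card] using hf'.v 44 (by simp)
    · intro σ₁ i hi hI h36 f1
      have a1 : ∀ l, σ₁.h l = σ.h l := fun l => f1.h l (by simp)
      have v1 : ∀ x, x ≠ 36 → x ≠ 37 → x ≠ 52 → x ≠ 53 → σ₁.v x = σ.v x := fun x a b c d => by
        rw [f1.v x (by simp [a, b, c, d])]; simp [c]
      refine Runs.time (s := ((k * (1 + 2) + 2) + 1) + 1) (Runs.asg_seq (by simp; omega) ?_) (by omega)
      refine Runs.seq (s := k * (1 + 2) + 2) (t := 1)
        (R := fun σ' => σ'.v 53 = (∑ l ∈ Finset.range k, z i l * m (S l) v).val) ?_ ?_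
      · refine Runs.forC (fun j σ' => σ'.v 53 = (∑ l ∈ Finset.range j, z i l * m (S l) v).val) hkV
          (by simp) (fun σ' i _ _ _ hf' => ?_) (by simp) ?_ fun σ' h _ _ => h
        · have := hf'.v 44 (by simp)
          simpa [v1, h.card] using this
        · intro σ₂ j hj hJ h37 f2
          have a2 : ∀ l, σ₂.h l = σ.h l := fun l => by rw [f2.h l (by simp)]; exact a1 l
          have v2 : ∀ x, x ≠ 36 → x ≠ 37 → x ≠ 52 → x ≠ 53 → σ₂.v x = σ.v x := fun x a b c d => by
            rw [f2.v x (by simp [b, d])]; simp [d, v1 x a b c d]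
          have h36' : σ₂.v 36 = i := by rw [f2.v 36 (by simp)]; simpa using h36
          have e : Ex.eval E.inp σ₂ ((.var 53 + .ld (12 + 4 * r) (.var 36 * .var 45 + .var 37) *
              .ld (11 + 4 * r) (.ld 7 (.var 37) * .var 27 + .var 51)) % .var 1) =
              (∑ l ∈ Finset.range (j + 1), z i l * m (S l) v).val := by
            simp only [Ex.eval_mod, Ex.eval_add, Ex.eval_mul, Ex.eval_ld, Ex.eval_var, a2, hJ, h36', h37,
              v2 45 (by norm_num) (by norm_num) (by norm_num) (by norm_num),
              v2 27 (by norm_num) (by norm_num) (by norm_num) (by norm_num),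
              v2 51 (by norm_num) (by norm_num) (by norm_num) (by norm_num),
              v2 1 (by norm_num) (by norm_num) (by norm_num) (by norm_num), h.pad, h.size, h.mod, h51,
              hf.cor i hi j hj, h.nodes j hj, hf.nh _ _ (hS j hj) hv]
            rw [val_add_mul_mod, Finset.sum_range_succ]
          exact Runs.asg (by rw [e]; exact hval _) (by simp [e])
      · intro σ₂ hJ f2
        have a2 : ∀ l, σ₂.h l = σ.h l := fun l => by rw [f2.h l (by simp)]; exact a1 l
        have v2 : ∀ x, x ≠ 36 → x ≠ 37 → x ≠ 52 → x ≠ 53 → σ₂.v x = σ.v x := fun x a b c d => by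
          rw [f2.v x (by simp [b, d])]; simp [d, v1 x a b c d]
        have h36' : σ₂.v 36 = i := by rw [f2.v 36 (by simp)]; simpa using h36
        have h52 : σ₂.v 52 = (acc i).val := by rw [f2.v 52 (by simp)]; simpa using hI
        have e : Ex.eval E.inp σ₂ ((.var 52 + .ld (11 + 4 * r) (.var 50 * .var 27 + .ld 7 (.var 36)) *
            .var 53) % .var 1) = (acc (i + 1)).val := by
          simp only [Ex.eval_mod, Ex.eval_add, Ex.eval_mul, Ex.eval_ld, Ex.eval_var, a2, hJ, h36', h52,
            v2 27 (by norm_num) (by norm_num) (by norm_num) (by norm_num),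
            v2 50 (by norm_num) (by norm_num) (by norm_num) (by norm_num),
            v2 1 (by norm_num) (by norm_num) (by norm_num) (by norm_num), h.size, h.mod, h50,
            h.nodes i hi, hf.nh _ _ hu (hS i hi)]
          rw [val_add_mul_mod]
          simp only [acc]
          rw [Finset.sum_range_succ]
        exact Runs.asg (by rw [e]; exact hval _) (by simp [e])
  · intro σ₁ h52 f1
    have a1 : ∀ l, σ₁.h l = σ.h l := fun l => by rw [f1.h l (by simp)]; rfl
    have v1 : ∀ x, x ≠ 36 → x ≠ 37 → x ≠ 52 → x ≠ 53 → σ₁.v x = σ.v x := fun x a b c d => by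
      rw [f1.v x (by simp [a, b, c, d])]; simp [c]
    have e : Ex.eval E.inp σ₁ ((((.var 1 - .var 52) + .ld (13 + 4 * r) 1 *
        .ld (11 + 4 * r) (.var 50 * .var 27 + .var 51)) % .var 1) *
          (.ld (13 + 4 * r) 1 * .ld (13 + 4 * r) 0 % .var 1)) =
        (coreEntry k S m z ξ u v).val * (ξ * μ).val := by
      simp only [Ex.eval_mod, Ex.eval_add, Ex.eval_sub, Ex.eval_mul, Ex.eval_ld, Ex.eval_var, a1, h52,
        v1 27 (by norm_num) (by norm_num) (by norm_num) (by norm_num),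
        v1 50 (by norm_num) (by norm_num) (by norm_num) (by norm_num),
        v1 51 (by norm_num) (by norm_num) (by norm_num) (by norm_num),
        v1 1 (by norm_num) (by norm_num) (by norm_num) (by norm_num), h.size, h.mod, h50, h51,
        hf.nh _ _ hu hv, Ex.eval_ofNat, hf.scale, hf.scale']
      rw [← ZMod.val_mul]
      congr 1
      rw [← ZMod.val_natCast]
      congr 1
      rw [Nat.cast_add, Nat.cast_sub (ZMod.val_lt _).le]
      simp only [CharP.cast_eq_zero, ZMod.natCast_val, ZMod.cast_id', id_eq, Nat.cast_mul, coreEntry,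
        acc]
      ring
    refine Runs.ite (t := 1) (fun hne => Runs.asg (by simpa using hV1) ?_) fun h0 =>
      (Runs.skip ?_).time (by norm_num)
    · rw [e] at hne
      exact Or.inl ⟨⟨fun h => hne (by simp [h]), fun h => hne (by rw [h]; simp)⟩, by simp⟩
    · rw [e, Nat.mul_eq_zero, ZMod.val_eq_zero, ZMod.val_eq_zero] at h0
      exact Or.inr ⟨h0, v1 0 (by norm_num) (by norm_num) (by norm_num) (by norm_num)⟩

theorem asksCmd_runs {u v : ℕ} (hS : ∀ i < k, S i < q)
    (hpV : p < E.V) (hkV : k < E.V) (hu : u < q) (hv : v < q)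
    (h : Updated p q n k kk R S D g g' w σ) (h50 : σ.v 50 = u) (h51 : σ.v 51 = v) (h0 : σ.v 0 = 0)
    {r : ℕ} (hr : r ≤ R) :
    Runs E (asksCmd r) σ (r * (k * (k * 3 + 6) + 5)) fun σ' =>
      (σ'.v 0 ≠ 0 → ∃ s < r, ∃ (m z : ℕ → ℕ → ZMod p) (μ ξ : ZMod p),
        Fixed q k kk S D g g' s (w s) m z μ ξ σ ∧ coreEntry k S m z ξ u v ≠ 0 ∧ ξ * μ ≠ 0) ∧
      (σ'.v 0 = 0 → ∀ s < r, ∃ (m z : ℕ → ℕ → ZMod p) (μ ξ : ZMod p),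
        Fixed q k kk S D g g' s (w s) m z μ ξ σ ∧ (coreEntry k S m z ξ u v = 0 ∨ ξ * μ = 0)) := by
  induction r with
  | zero => exact (Runs.skip ⟨fun h => absurd h0 h, fun _ s hs => by omega⟩).time (by simp)
  | succ r ih =>
    refine Runs.time (Runs.seq (ih (by omega)) ?_) (by rw [add_mul, one_mul])
    rintro σ₁ ⟨i1, i2⟩ f1
    have v1 : ∀ x, 0 < x ∧ x < 36 ∨ 37 < x ∧ x < 52 → σ₁.v x = σ.v x := fun x hx =>
      f1.v x (asksCmd_noV hx r)
    have a1 : ∀ l, σ₁.h l = σ.h l := fun l => f1.h l (asksCmd_noA l r)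
    obtain ⟨m, z, μ, ξ, hf⟩ := h.rounds r (by omega)
    refine (askCmd_runs (r := r) hS hpV hkV hu hv (h.congr (fun x hx => v1 x (by omega)) a1)
      (by rw [v1 50 (by norm_num), h50]) (by rw [v1 51 (by norm_num), h51])
      (hf.congr (a1 _) (a1 _) (a1 _))).mono le_rfl ?_
    rintro σ₂ (⟨⟨c1, c2⟩, c3⟩ | ⟨c1, c3⟩) -
    · exact ⟨fun _ => ⟨r, by omega, m, z, μ, ξ, hf, c1, c2⟩, fun h => by omega⟩
    · rw [c3]
      refine ⟨fun hne => ?_, fun he s hs => ?_⟩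
      · obtain ⟨s, hs, h⟩ := i1 hne
        exact ⟨s, by omega, h⟩
      · rcases Nat.lt_succ_iff_lt_or_eq.mp hs with hs | rfl
        · exact i2 he s hs
        · exact ⟨m, z, μ, ξ, hf, c1⟩

/-- A positive answer rests on a nonzero entry of a true scaled inverse with nonzero scale, hence on
a path. After a negative answer for live nodes, a round whose determinants do not vanish has a
nonzero scale, so its entry, and with it that of the adjugate, vanishes. Deleted end points are
rejected beforehand. -/
theorem queryCmd_runs {u v : ℕ} (hinp : E.inp = [u, v]) (hS : ∀ i < k, S i < q) (hnq : n ≤ q)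
    (hpV : p < E.V) (hkV : k < E.V) (hnV : n < E.V) (hu : u < n) (hv : v < n)
    (h : Updated p q n k kk R S D g g' w σ) :
    Runs E (queryCmd R) σ (queryTime R k) fun σ' => Updated p q n k kk R S D g g' w σ' ∧
      (σ'.v 0 ≠ 0 → ¬D u ∧ ¬D v ∧ Relation.ReflTransGen g' u v) ∧
      (σ'.v 0 = 0 → ¬D u → ¬D v → ∀ r < R,
        (∀ i ≤ q, (walkMat q (fun x y => g x y ∧ x < i) (w r)).det ≠ 0) →
        (∀ i ≤ k, (walkMat q (partGraph k S g g' i) (w r)).det ≠ 0) →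
        (walkMat q g' (w r)).adjugate ⟨u, hu.trans_le hnq⟩ ⟨v, hv.trans_le hnq⟩ = 0) := by
  have hdel := h.del
  have e0 : Ex.eval E.inp (σ.set 0 (Ex.eval E.inp σ 0)) (.inp 0) = u := by simp [hinp]
  refine Runs.time (s := (R * (k * (k * 3 + 6) + 5) + 1) + 1 + 1 + 1) ?_ le_rfl
  refine Runs.asg_seq (by simp; omega) (Runs.asg_seq (by rw [e0]; omega) ?_)
  rw [e0]
  have e1 : Ex.eval E.inp ((σ.set 0 (Ex.eval E.inp σ 0)).set 50 u) (.inp 1) = v := by simp [hinp]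
  refine Runs.asg_seq (by rw [e1]; omega) ?_
  rw [e1]
  set σ₁ := ((σ.set 0 (Ex.eval E.inp σ 0)).set 50 u).set 51 v with hσ₁
  have v1 : ∀ x, x ≠ 0 → x ≠ 50 → x ≠ 51 → σ₁.v x = σ.v x := fun x a b c => by simp [hσ₁, a, b, c]
  have h1 : Updated p q n k kk R S D g g' w σ₁ :=
    h.congr (fun x hx => v1 x (by omega) (by omega) (by omega)) fun _ => rfl
  have w50 : σ₁.v 50 = u := by simp [hσ₁]
  have w51 : σ₁.v 51 = v := by simp [hσ₁]
  have w0 : σ₁.v 0 = 0 := by simp [hσ₁]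
  refine Runs.ite (fun hne => ?_) fun hz => ?_
  · refine (Runs.skip ⟨h1, fun h => absurd w0 h, fun _ hu' hv' => ?_⟩).time (Nat.zero_le _)
    refine absurd ?_ hne
    simp only [Ex.eval_add, Ex.eval_ld, Ex.eval_var, w50, w51]
    rw [(h1.del u hu).2 hu', (h1.del v hv).2 hv']
  · simp only [Ex.eval_add, Ex.eval_ld, Ex.eval_var, w50, w51] at hz
    have hu' : ¬D u := fun hd => by have := (h1.del u hu).1 hd; omega
    have hv' : ¬D v := fun hd => by have := (h1.del v hv).1 hd; omega
    refine (asksCmd_runs hS hpV hkV (hu.trans_le hnq) (hv.trans_le hnq) h1 w50 w51 w0 le_rfl).mono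
      le_rfl ?_
    rintro σ₂ ⟨c1, c2⟩ f2
    refine ⟨h1.congr (fun x hx => f2.v x (asksCmd_noV (by omega) R)) fun l =>
      f2.h l (asksCmd_noA l R), fun hne => ⟨hu', hv', ?_⟩, fun h0 _ _ r hr hg1 hg2 => ?_⟩
    · obtain ⟨s, -, m, z, μ, ξ, hf, hc, hx⟩ := c1 hne
      obtain ⟨N, hN, hN'⟩ := hf.inv
      exact reflTransGen_of_ne_zero (u := ⟨u, hu.trans_le hnq⟩) (v := ⟨v, hv.trans_le hnq⟩) hx hN
        (by rw [hN' _ _ hv']; exact hc)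
    · obtain ⟨m, z, μ, ξ, hf, hc⟩ := c2 h0 r hr
      obtain ⟨N, hN, hN'⟩ := hf.inv
      have hx := hf.ne_zero hg1 hg2
      by_contra ha
      refine adjugate_ne_zero_imp hx hN ha ?_
      rw [hN' _ _ hv']
      exact hc.resolve_right hx

end


/-! ## The exponent is at least two -/

theorem Instr.step_mem {W : ℕ} {inp : List ℕ} {coins : Coins W} {c c' : Config} {i : Instr}
    (h : i.step W inp coins c = some c') : ∃ d, ∀ x, x ≠ d → c'.mem x = c.mem x := by
  have hw : ∀ (c₀ : Config) d x, c₀.mem = c.mem → c₀.write W d x = some c' →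
      ∃ d, ∀ x, x ≠ d → c'.mem x = c.mem x := by
    intro c₀ d x h0 h
    unfold Config.write at h
    split_ifs at h with hx
    cases h
    exact ⟨d, fun y hy => by rw [← h0]; exact Function.update_of_ne hy _ _⟩
  cases i with
  | jmp l => cases h; exact ⟨0, fun _ _ => rfl⟩
  | jz a l => cases h; exact ⟨0, fun _ _ => rfl⟩
  | jlt a b l => cases h; exact ⟨0, fun _ _ => rfl⟩
  | halt => cases h
  | const d k => exact hw c _ _ rfl h
  | op o d a b => exact hw c _ _ rfl h
  | load d a => exact hw c _ _ rfl h
  | store d a => exact hw c _ _ rfl h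
  | read d a => exact hw c _ _ rfl h
  | rand d => exact hw { c with used := c.used + 1 } _ _ rfl h

/-- In `T` steps at most `T` cells are written. -/
theorem run_mem {W : ℕ} {P : Program} {inp : List ℕ} {coins : Coins W} {T : ℕ} {c c' : Config}
    (h : run W P inp coins T c = some c') :
    ∃ s : Finset ℕ, s.card ≤ T ∧ ∀ x ∉ s, c'.mem x = c.mem x := by
  induction T generalizing c with
  | zero => simp [run] at h
  | succ T ih =>
    rw [run] at h
    split at h
    · cases h
    · cases h; exact ⟨∅, by simp, fun _ _ => rfl⟩
    · obtain ⟨c₁, h1, h2⟩ := Option.bind_eq_some_iff.mp h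
      obtain ⟨d, hd⟩ := Instr.step_mem h1
      obtain ⟨s, hs, hs'⟩ := ih h2
      refine ⟨insert d s, (Finset.card_insert_le _ _).trans (by omega), fun x hx => ?_⟩
      rw [Finset.mem_insert, not_or] at hx
      rw [hs' x hx.2, hd x hx.1]

end WordRAM

/-- An output of `m ^ 2` nonzero cells needs `m ^ 2` steps. -/
theorem MatMulExponent.two_le {ω : ℝ} (h : MatMulExponent ω) : 2 ≤ ω := by
  obtain ⟨P, κ, C, hP⟩ := h
  have key : ∀ m : ℕ, 1 ≤ m → (m : ℝ) ^ 2 ≤ C * (m : ℝ) ^ ω := by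
    intro m hm
    -- The all-ones matrix times the identity: every cell of the product is nonzero, while the
    -- memory starts with zeros, so each of these cells has to be written.
    obtain ⟨c, hc, hc'⟩ := hP 2 m Nat.prime_two hm (.of fun _ _ => 1) 1 fun _ => ⟨0, by positivity⟩
    obtain ⟨s, hs, hs'⟩ := run_mem hc
    have hsub : (Finset.univ.image fun x : Fin m × Fin m => c.mem 0 + x.1 * m + x.2) ⊆ s := by
      intro x hx
      obtain ⟨⟨i, j⟩, -, rfl⟩ := Finset.mem_image.mp hx
      by_contra hns
      have h1 := hs' _ hns
      rw [hc' i j, Matrix.mul_one] at h1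
      exact absurd h1 (by simp [Config.initial, ZMod.val_one])
    have hcard : m * m ≤ s.card := by
      refine le_trans ?_ (Finset.card_le_card hsub)
      rw [Finset.card_image_of_injective]
      · simp
      · rintro ⟨i, j⟩ ⟨i', j'⟩ h
        obtain ⟨h1, h2⟩ := idx_inj j.2 j'.2 (show (i : ℕ) * m + j = i' * m + j' by
          simp only at h; omega)
        exact Prod.ext (Fin.ext h1) (Fin.ext h2)
    have : ((m * m : ℕ) : ℝ) ≤ C * (m : ℝ) ^ ω :=
      (Nat.cast_le.mpr (hcard.trans hs)).trans (Nat.floor_le (by positivity))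
    rw [pow_two]; exact_mod_cast this
  by_contra! hω
  -- If `ω < 2`, then `m ^ (2 - ω)` would exceed the constant `C` for large `m`.
  have hlim := (tendsto_rpow_atTop (sub_pos.mpr hω)).comp tendsto_natCast_atTop_atTop
  obtain ⟨m, hm1, hm⟩ := ((Filter.eventually_ge_atTop 1).and
    (hlim.eventually_gt_atTop (C : ℝ))).exists
  have hm0 : (0 : ℝ) < m := by exact_mod_cast hm1
  have h1 := key m hm1
  have h2 : (m : ℝ) ^ 2 = (m : ℝ) ^ (2 - ω) * (m : ℝ) ^ ω := by
    rw [← Real.rpow_add hm0, sub_add_cancel]; norm_cast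
  rw [h2] at h1
  exact absurd (le_of_mul_le_mul_right h1 (Real.rpow_pos_of_pos hm0 ω)) (not_le.mpr hm)

namespace WordRAM

/-! ## Bounds for the running times -/

section
variable {ω : ℝ} (P : Program) (K R : ℕ)

theorem sq_le_rpow (hω : 2 ≤ ω) (m : ℕ) (hm : 1 ≤ m) : (m : ℝ) ^ 2 ≤ (m : ℝ) ^ ω := by
  have : (1 : ℝ) ≤ m := by exact_mod_cast hm
  have h := Real.rpow_le_rpow_of_exponent_le this hω
  rwa [Real.rpow_ofNat] at h

/-- The time of the multiplication program. -/
noncomputable def mulTime (ω : ℝ) (K m : ℕ) : ℕ := ⌊(K : ℝ) * (m : ℝ) ^ ω⌋₊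

theorem gemmTime_le (hω : 2 ≤ ω) {m : ℕ} (hm : 1 ≤ m) :
    (gemmTime P (mulTime ω K) m : ℝ) ≤ (K * (P.length + 12) + 41 : ℕ) * (m : ℝ) ^ ω := by
  have h1 : (1 : ℝ) ≤ m := by exact_mod_cast hm
  have h2 := sq_le_rpow hω m hm
  have h3 : (mulTime ω K m : ℝ) ≤ K * (m : ℝ) ^ ω := Nat.floor_le (by positivity)
  have h4 : (0 : ℝ) ≤ P.length + 12 := by positivity
  have h5 := mul_le_mul_of_nonneg_right h3 h4
  unfold gemmTime
  push_cast
  nlinarith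

/-- Doubling the size multiplies the bound by `2 ^ ω ≥ 4`, but there are only two recursive calls,
so the top level dominates. The constant `4 * A + 30` solves `2 * x + 8 * A + 60 = 4 * x`. -/
theorem invTime_le (hω : 2 ≤ ω) (j : ℕ) : (invTime P (mulTime ω K) j : ℝ) ≤
    (4 * (K * (P.length + 12) + 41) + 30 : ℕ) * ((2 ^ j : ℕ) : ℝ) ^ ω := by
  obtain ⟨A, hAe⟩ : ∃ A, A = K * (P.length + 12) + 41 := ⟨_, rfl⟩
  rw [← hAe]
  induction j with
  | zero =>
    simp only [invTime, pow_zero, Nat.cast_one, Real.one_rpow, mul_one]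
    push_cast
    have : (0 : ℝ) ≤ A := by positivity
    linarith
  | succ j ih =>
    have hg := gemmTime_le P K hω (m := 2 ^ j) Nat.one_le_two_pow
    rw [← hAe] at hg
    have hx : 1 ≤ ((2 ^ j : ℕ) : ℝ) ^ ω :=
      Real.one_le_rpow (by exact_mod_cast Nat.one_le_two_pow) (by linarith)
    have h2 : (4 : ℝ) ≤ 2 ^ ω := by
      have := sq_le_rpow hω 2 (by norm_num)
      norm_num at this
      exact this
    have e : ((2 ^ (j + 1) : ℕ) : ℝ) ^ ω = 2 ^ ω * ((2 ^ j : ℕ) : ℝ) ^ ω := by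
      rw [← Real.mul_rpow (by norm_num) (by positivity)]
      push_cast; ring_nf
    rw [e]
    simp only [invTime]
    push_cast at ih hg hx ⊢
    set x : ℝ := ((2 : ℝ) ^ j) ^ ω
    have hA : (0 : ℝ) ≤ A := by positivity
    have : (4 * (A : ℝ) + 30) * (4 * x) ≤ (4 * (A : ℝ) + 30) * (2 ^ ω * x) := by gcongr
    have h3 : (gemmTime P (mulTime ω K) (2 ^ j) : ℝ) ≤ A * x := hg
    nlinarith

theorem sq_le_two_pow (a : ℕ) : a * a ≤ 2 * 2 ^ a := by
  have : ∀ b, (b + 3) * (b + 3) ≤ 2 * 2 ^ (b + 3) := by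
    intro b
    induction b with
    | zero => norm_num
    | succ b ih => rw [show b + 1 + 3 = (b + 3) + 1 by ring, pow_succ]; nlinarith
  match a with
  | 0 => norm_num
  | 1 => norm_num
  | 2 => norm_num
  | b + 3 => exact this b

/-- The constant in the running time of the inversion. -/
def invConst (P : Program) (K : ℕ) : ℕ := 4 * (K * (P.length + 12) + 41) + 30

/-- The prime search makes about `a ^ 2 * 2 ^ (7 * a)` trial divisions, up to constants. Since `q ^
2 = 2 ^ (8 * a)` and `a * a ≤ 2 * 2 ^ a`, this is `O(q ^ 2)` and below the cost of the inversions
because `2 ≤ ω`. -/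
theorem prepTime_le (hω : 2 ≤ ω) (a : ℕ) : (prepTime P (mulTime ω K) R a : ℝ) ≤
    (R * (invConst P K + 132 * 178 + 44) + 22 : ℕ) * ((16 ^ a : ℕ) : ℝ) ^ ω := by
  have e16 : (16 : ℕ) ^ a = 2 ^ (4 * a) := by rw [pow_mul]; norm_num
  obtain ⟨q, hq⟩ : ∃ q, q = 16 ^ a := ⟨_, rfl⟩
  have hq1 : 1 ≤ q := hq ▸ Nat.one_le_pow _ _ (by norm_num)
  have hinv := invTime_le P K hω (4 * a)
  rw [← e16, ← hq] at hinv
  have hx := sq_le_rpow hω q hq1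
  have haq : a ≤ q * q := by
    have := (Nat.lt_pow_self (n := a) (by norm_num : 1 < 16)).le
    rw [← hq] at this
    nlinarith
  have hpr : a * a * (2 ^ (7 * a + 4) * 5 + 9) ≤ 178 * (q * q) := by
    have h1 := sq_le_two_pow a
    have h2 : q * q = 2 ^ a * 2 ^ (7 * a) := by rw [hq, e16, ← pow_add, ← pow_add]; ring_nf
    have h3 : 1 ≤ 2 ^ (7 * a) := Nat.one_le_two_pow
    calc a * a * (2 ^ (7 * a + 4) * 5 + 9) ≤ 2 * 2 ^ a * (2 ^ (7 * a + 4) * 5 + 9) :=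
          Nat.mul_le_mul_right _ h1
      _ ≤ 2 * 2 ^ a * (89 * 2 ^ (7 * a)) := Nat.mul_le_mul_left _ (by rw [pow_add]; omega)
      _ = 178 * (q * q) := by rw [h2]; ring
  have hnat : prepTime P (mulTime ω K) R a ≤ 22 * (q * q) +
      R * (132 * 178 * (q * q) + (44 * (q * q) + invTime P (mulTime ω K) (4 * a))) := by
    unfold prepTime roundTime invertTime
    rw [← hq]
    have h1 : q ≤ q * q := by nlinarith
    have h2 : 132 * R * (a * a) * (2 ^ (7 * a + 4) * 5 + 9) ≤ R * (132 * 178 * (q * q)) := by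
      calc 132 * R * (a * a) * (2 ^ (7 * a + 4) * 5 + 9) =
            R * (132 * (a * a * (2 ^ (7 * a + 4) * 5 + 9))) := by ring
        _ ≤ _ := Nat.mul_le_mul_left _ (by omega)
    have h3 : R * (10 * (q * q) + 12 * q + (q * 7 + invTime P (mulTime ω K) (4 * a) + 6) + 9) ≤
        R * (44 * (q * q) + invTime P (mulTime ω K) (4 * a)) := Nat.mul_le_mul_left _ (by omega)
    have h4 : q * (q * 3 + 4) = 3 * (q * q) + 4 * q := by ring
    rw [mul_add R (132 * 178 * (q * q))]
    omega
  have hreal : (prepTime P (mulTime ω K) R a : ℝ) ≤ 22 * (q : ℝ) ^ 2 +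
      R * (23496 * (q : ℝ) ^ 2 + (44 * (q : ℝ) ^ 2 + invTime P (mulTime ω K) (4 * a))) := by
    have : ((prepTime P (mulTime ω K) R a : ℕ) : ℝ) ≤ _ := Nat.cast_le.mpr hnat
    push_cast at this
    rw [pow_two]
    exact this
  rw [← hq]
  refine hreal.trans ?_
  have hR : (0 : ℝ) ≤ R := by positivity
  calc _ ≤ 22 * (q : ℝ) ^ ω + R * (23496 * (q : ℝ) ^ ω + (44 * (q : ℝ) ^ ω +
        (invConst P K : ℕ) * (q : ℝ) ^ ω)) := by
        unfold invConst; gcongr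
    _ = _ := by push_cast; ring

/-- An update names at most two nodes, and rounding up to a power of two costs at most another
factor `2`, so the matrices have size at most `4 * F`. -/
theorem updTime_le (hω : 2 ≤ ω) {f F k : ℕ} (hF : F = max 1 f) (hk : k ≤ 2 * f) :
    (updTime P (mulTime ω K) R f (Nat.clog 2 k) : ℝ) ≤
      (R * (3 * invConst P K + 100) + 43 : ℕ) * ((4 * F : ℕ) : ℝ) ^ ω := by
  obtain ⟨lev, hlev⟩ : ∃ lev, lev = Nat.clog 2 k := ⟨_, rfl⟩
  obtain ⟨y, hy⟩ : ∃ y, y = 2 ^ lev := ⟨_, rfl⟩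
  have hF1 : 1 ≤ F := hF ▸ le_max_left _ _
  have hfF : f ≤ F := hF ▸ le_max_right _ _
  have hyF : y ≤ 4 * F := by
    rcases Nat.lt_or_ge 1 k with h | h
    · have := Nat.pow_pred_clog_lt_self (b := 2) (by norm_num) h
      have h0 : 0 < Nat.clog 2 k := Nat.clog_pos (by norm_num) (by omega)
      rw [← hlev] at this h0
      rw [hy, ← Nat.succ_pred_eq_of_pos h0, pow_succ]
      omega
    · rw [hy, hlev, Nat.clog_of_right_le_one h]; omega
  have hy1 : 1 ≤ y := hy ▸ Nat.one_le_two_pow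
  have hly : lev ≤ y := hy ▸ (Nat.lt_pow_self (by norm_num)).le
  have hgemm := gemmTime_le P K hω hy1
  have hinv := invTime_le P K hω lev
  rw [← hy] at hinv
  obtain ⟨Z, hZ⟩ : ∃ Z : ℝ, Z = ((4 * F : ℕ) : ℝ) ^ ω := ⟨_, rfl⟩
  have hyZ : (y : ℝ) ^ ω ≤ Z := hZ ▸ Real.rpow_le_rpow (by positivity) (by exact_mod_cast hyF)
    (by linarith)
  have hy2 : (y : ℝ) ^ 2 ≤ Z := (sq_le_rpow hω y hy1).trans hyZ
  have hFZ : (F : ℝ) ≤ Z := by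
    refine le_trans ?_ ((sq_le_rpow hω (4 * F) (by omega)).trans_eq hZ.symm)
    have : (1 : ℝ) ≤ F := by exact_mod_cast hF1
    push_cast
    nlinarith
  have hnat : updTime P (mulTime ω K) R f lev ≤ 23 * F + 20 * (y * y) + R * (98 * (y * y) +
      2 * gemmTime P (mulTime ω K) y + invTime P (mulTime ω K) lev) := by
    unfold updTime fixTime invertTime
    rw [← hy]
    have h1 : y ≤ y * y := by nlinarith
    have h4 : y * (y * 3 + 4) = 3 * (y * y) + 4 * y := by ring
    have h3 := Nat.mul_le_mul_left R (show 5 * (y * (y * 3 + 4) + 2) +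
      2 * (gemmTime P (mulTime ω K) y + 5) + ((y + y) * 7 + invTime P (mulTime ω K) lev + 6) +
        ((y + y) * 7 + 2) + 6 ≤ 98 * (y * y) + 2 * gemmTime P (mulTime ω K) y +
          invTime P (mulTime ω K) lev by omega)
    omega
  have hreal : (updTime P (mulTime ω K) R f lev : ℝ) ≤ 23 * F + 20 * (y : ℝ) ^ 2 +
      R * (98 * (y : ℝ) ^ 2 + 2 * gemmTime P (mulTime ω K) y + invTime P (mulTime ω K) lev) := by
    have : ((updTime P (mulTime ω K) R f lev : ℕ) : ℝ) ≤ _ := Nat.cast_le.mpr hnat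
    push_cast at this
    rw [pow_two]
    exact this
  rw [← hlev, ← hZ]
  refine hreal.trans ?_
  have hZ0 : 0 ≤ Z := by rw [hZ]; positivity
  have hg' : (gemmTime P (mulTime ω K) y : ℝ) ≤ (invConst P K : ℕ) * Z := by
    refine hgemm.trans (mul_le_mul ?_ hyZ (by positivity) (by positivity))
    exact_mod_cast (by unfold invConst; omega : K * (P.length + 12) + 41 ≤ invConst P K)
  have hi' : (invTime P (mulTime ω K) lev : ℝ) ≤ (invConst P K : ℕ) * Z :=
    hinv.trans (by unfold invConst; gcongr)
  calc _ ≤ 23 * Z + 20 * Z + R * (98 * Z + 2 * ((invConst P K : ℕ) * Z) + (invConst P K : ℕ) * Z) := by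
        gcongr
    _ ≤ _ := by
        push_cast
        have hR : (0 : ℝ) ≤ R := by positivity
        nlinarith [mul_nonneg hR hZ0]

theorem queryTime_le {f F k : ℕ} (hF : F = max 1 f) (hk : k ≤ 2 * f) :
    queryTime R k + 1 ≤ (R * 29 + 5) * F ^ 2 := by
  have hF1 : 1 ≤ F := hF ▸ le_max_left _ _
  have hfF : f ≤ F := hF ▸ le_max_right _ _
  have hkF : k ≤ 2 * F := by omega
  have h1 : k * (k * 3 + 6) + 5 ≤ 29 * F ^ 2 := by
    have := Nat.mul_le_mul hkF (show k * 3 + 6 ≤ 2 * F * 3 + 6 by omega)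
    nlinarith
  have h2 := Nat.mul_le_mul_left R h1
  unfold queryTime
  nlinarith

end

theorem clog_le_log {n : ℕ} (hn : 2 ≤ n) : (Nat.clog 2 n : ℝ) ≤ 3 * Real.log n := by
  have h := Nat.pow_pred_clog_lt_self (b := 2) (by norm_num) (by omega : 1 < n)
  have h0 : 0 < Nat.clog 2 n := Nat.clog_pos (by norm_num) (by omega)
  obtain ⟨b, hb⟩ : ∃ b, Nat.clog 2 n = b + 1 := ⟨_, (Nat.succ_pred_eq_of_pos h0).symm⟩
  rw [hb, Nat.pred_succ] at h
  rw [hb]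
  have h1 : ((2 : ℝ) ^ b) ≤ n := by exact_mod_cast h.le
  have h2 := Real.log_le_log (by positivity) h1
  rw [Real.log_pow] at h2
  have h3 : Real.log 2 ≤ Real.log n := Real.log_le_log (by norm_num) (by exact_mod_cast hn)
  have h4 := Real.log_two_gt_d9
  push_cast
  have hb0 : (0 : ℝ) ≤ b := by positivity
  nlinarith


/-! ## Truncating the memory -/

theorem St.keep_v {H s : ℕ} {σ : St} {x : ℕ} (h : 3 * x < s) : (σ.keep H s).v x = σ.v x :=
  if_pos h

theorem St.keep_h {H s N : ℕ} {σ : St} {k a : ℕ} (hs : 3 * (N * H) ≤ s) (hk : k < H) (ha : a < N) :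
    (σ.keep H s).h k a = σ.h k a := by
  have := idx_lt ha hk
  exact if_pos (by omega)

theorem St.keep_h_zero {H s : ℕ} {σ : St} {k a : ℕ} (h : σ.h k a = 0) : (σ.keep H s).h k a = 0 := by
  simp only [St.keep, h, ite_self]

/-- What matters lies in variables with small names and in the first `q * q` entries of fewer than
`H` arrays; the facts about zero arrays survive any truncation. -/
theorem Prepared.keep {p a R : ℕ} [Fact p.Prime] {g : ℕ → ℕ → Prop} {w : ℕ → ℕ → ℕ → ZMod p} {σ : St}
    (h : Prepared p a R g w σ) {H s : ℕ} (hH : 4 * R + 10 ≤ H) (hs : 3 * (16 ^ a * 16 ^ a * H) ≤ s)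
    (hs' : 160 ≤ s) : Prepared p a R g w (σ.keep H s) where
  sizes := h.sizes.congr fun x _ _ => St.keep_v (by omega)
  mod := (St.keep_v (by omega)).trans h.mod
  sim x := St.keep_h_zero (h.sim x)
  pos x := St.keep_h_zero (h.pos x)
  del x := St.keep_h_zero (h.del x)
  graph i j hi hj := by
    rw [St.keep_h hs (by omega) (idx_lt hi hj)]
    exact h.graph i j hi hj
  rounds r hr := by
    obtain ⟨n, μ, hf⟩ := h.rounds r hr
    have h0 : 0 < 16 ^ a * 16 ^ a := by positivity
    exact ⟨n, μ, fun i j hi hj => by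
        rw [St.keep_h hs (by omega) (idx_lt hi hj)]; exact hf.wt i j hi hj, fun i j hi hj => by
        rw [St.keep_h hs (by omega) (idx_lt hi hj)]; exact hf.nh i j hi hj,
      (St.keep_h hs (by omega) h0).trans hf.scale, hf.inv, hf.ne_zero⟩

theorem Updated.keep {p q n k kk R : ℕ} [Fact p.Prime] {S : ℕ → ℕ} {D : ℕ → Prop}
    {g g' : ℕ → ℕ → Prop} {w : ℕ → ℕ → ℕ → ZMod p} {σ : St}
    (h : Updated p q n k kk R S D g g' w σ) {H s : ℕ} (hH : 4 * R + 10 ≤ H)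
    (hs : 3 * (q * q * H) ≤ s) (hs' : 160 ≤ s) (hq : 2 ≤ q) (hn : n ≤ q) (hk : k ≤ kk) (hkk : kk ≤ q) :
    Updated p q n k kk R S D g g' w (σ.keep H s) where
  mod := (St.keep_v (by omega)).trans h.mod
  size := (St.keep_v (by omega)).trans h.size
  card := (St.keep_v (by omega)).trans h.card
  pad := (St.keep_v (by omega)).trans h.pad
  nodes i hi := by rw [St.keep_h hs (by omega) (by nlinarith), h.nodes i hi]
  del x hx := by rw [St.keep_h hs (by omega) (by nlinarith)]; exact h.del x hx
  rounds r hr := by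
    obtain ⟨m, z, μ, ξ, hf⟩ := h.rounds r hr
    exact ⟨m, z, μ, ξ, fun i j hi hj => by
        rw [St.keep_h hs (by omega) (idx_lt hi hj)]; exact hf.nh i j hi hj,
      (St.keep_h hs (by omega) (by nlinarith)).trans hf.scale,
      (St.keep_h hs (by omega) (by nlinarith)).trans hf.scale', fun i hi j hj => by
        have h1 : i * kk + j < kk * kk := idx_lt (by omega) (by omega)
        rw [St.keep_h hs (by omega) (by nlinarith)]; exact hf.cor i hi j hj, hf.inv, hf.ne_zero⟩

/-! ## The word size -/

theorem lt_two_pow_mul {x c k e b : ℕ} (hb : 1 ≤ b) (h : x ≤ c * 2 ^ (k * b)) (he : c + k ≤ e) :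
    x < 2 ^ (e * b) := by
  have h1 : c < 2 ^ (c * b) :=
    Nat.lt_two_pow_self.trans_le (Nat.pow_le_pow_right (by norm_num) (Nat.le_mul_of_pos_right _ hb))
  calc x ≤ c * 2 ^ (k * b) := h
    _ < 2 ^ (c * b) * 2 ^ (k * b) := Nat.mul_lt_mul_of_pos_right h1 (by positivity)
    _ = 2 ^ ((c + k) * b) := by rw [← pow_add, add_mul]
    _ ≤ 2 ^ (e * b) := Nat.pow_le_pow_right (by norm_num) (Nat.mul_le_mul_right _ he)

/-- The word size that the multiplication program needs. -/
noncomputable def mulWord (P : Program) (κ K : ℕ) (ω : ℝ) : ℕ :=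
  22 * κ + (P.map Instr.bound).sum + P.length + K + 4 * ⌈ω⌉₊ + 36

/-- Matrix size, modulus and running time of the multiplications are all bounded by a constant times
`2 ^ (k * b)` for a constant `k`, so a constant multiple of `b` bits is enough. The number `22`
comes from `14 * a + 8 ≤ 22 * b`. -/
theorem mulFit_of_le {P : Program} {κ K : ℕ} {ω : ℝ} {e a b p j : ℕ} (hω : 0 ≤ ω) (hb : 1 ≤ b)
    (hab : a ≤ b) (he : mulWord P κ K ω ≤ e) (hp : p < 2 ^ (14 * a + 8)) (hj : j ≤ 4 * a) :
    MulFit P κ (mulTime ω K) (2 ^ (e * b)) p (2 ^ j) := by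
  unfold mulWord at he
  have hj2 : 2 ^ j ≤ 2 ^ (4 * b) := Nat.pow_le_pow_right (by norm_num) (by omega)
  refine ⟨?_, fun i hi => ?_, ?_, ?_, ?_, ?_⟩
  · refine Nat.pow_le_pow_right (by norm_num) ?_
    have h1 : Nat.clog 2 (max (2 ^ j) p) ≤ 22 * b := by
      refine Nat.clog_le_of_le_pow (max_le ?_ ?_)
      · exact Nat.pow_le_pow_right (by norm_num) (by omega)
      · exact hp.le.trans (Nat.pow_le_pow_right (by norm_num) (by omega))
    calc κ * Nat.clog 2 (max (2 ^ j) p) ≤ κ * (22 * b) := Nat.mul_le_mul_left _ h1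
      _ = 22 * κ * b := by ring
      _ ≤ e * b := Nat.mul_le_mul_right _ (by omega)
  · have h1 : i.bound ≤ (P.map Instr.bound).sum :=
      List.single_le_sum (by simp) _ (List.mem_map_of_mem hi)
    exact lt_two_pow_mul (c := (P.map Instr.bound).sum) (k := 0) hb (by simpa using h1) (by omega)
  · exact lt_two_pow_mul (c := P.length) (k := 0) hb (by simp) (by omega)
  · refine lt_two_pow_mul (c := K) (k := 4 * ⌈ω⌉₊) hb ?_ (by omega)
    refine Nat.floor_le_of_le ?_
    push_cast
    refine mul_le_mul_of_nonneg_left ?_ (by positivity)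
    have h1 : (1 : ℝ) ≤ 2 ^ j := one_le_pow₀ (by norm_num)
    calc ((2 : ℝ) ^ j) ^ ω ≤ ((2 : ℝ) ^ j) ^ (⌈ω⌉₊ : ℝ) :=
          Real.rpow_le_rpow_of_exponent_le h1 (Nat.le_ceil ω)
      _ = ((2 : ℝ) ^ j) ^ ⌈ω⌉₊ := Real.rpow_natCast _ _
      _ ≤ ((2 : ℝ) ^ (4 * b)) ^ ⌈ω⌉₊ := pow_le_pow_left₀ (by positivity) (by exact_mod_cast hj2) _
      _ = 2 ^ (4 * ⌈ω⌉₊ * b) := by rw [← pow_mul]; congr 1; ring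
  · refine lt_two_pow_mul (c := 4) (k := 8) hb ?_ (by omega)
    have h1 : 2 ^ (8 * b) = 2 ^ (4 * b) * 2 ^ (4 * b) := by rw [← pow_add]; congr 1; ring
    have h2 := Nat.mul_le_mul hj2 hj2
    have h3 : 1 ≤ 2 ^ (8 * b) := Nat.one_le_two_pow
    omega
  · exact hp.trans_le (Nat.pow_le_pow_right (by norm_num)
      (le_trans (by omega : _ ≤ 22 * b) (Nat.mul_le_mul_right _ (by omega))))

/-! ## The inputs -/

theorem getD_lt_of_forall {l : List ℕ} {V : ℕ} (hV : 0 < V) (h : ∀ x ∈ l, x < V) (a : ℕ) :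
    l.getD a 0 < V := by
  by_cases ha : a < l.length
  · rw [List.getD_eq_getElem _ _ ha]; exact h _ (List.getElem_mem ha)
  · rw [List.getD_eq_default _ _ (by omega)]; exact hV

theorem graphWords_lt {n V : ℕ} (hn : 2 ≤ n) (hV : n < V) (G : Digraph (Fin n)) :
    ∀ x ∈ graphWords G, x < V := by
  classical
  intro x hx
  simp only [graphWords, List.mem_cons, List.mem_flatten, List.mem_ofFn] at hx
  obtain rfl | ⟨l, ⟨i, rfl⟩, hx⟩ := hx
  · exact hV
  · obtain ⟨j, rfl⟩ := List.mem_ofFn.mp hx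
    split_ifs <;> omega

theorem updateWords_lt {n V : ℕ} {U : List (GraphUpdate n)} (hV : n < V) (hn : 2 ≤ n)
    (hU : U.length < V) : ∀ x ∈ updateWords U, x < V := by
  intro x hx
  simp only [updateWords, List.mem_cons, List.mem_flatMap] at hx
  obtain rfl | ⟨u, -, hx⟩ := hx
  · exact hU
  · cases u <;> simp only [GraphUpdate.words, List.mem_cons, List.not_mem_nil, or_false] at hx <;>
      obtain rfl | rfl | rfl := hx <;> omega

/-- Here the absence of repetitions is used: it makes the number of updates polynomial in `n`, so
that it fits into a word. -/
theorem length_le_of_nodup {n : ℕ} {U : List (GraphUpdate n)} (hU : U.Nodup) :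
    U.length ≤ 3 * (n * n) := by
  let φ : GraphUpdate n → Fin 3 × Fin n × Fin n
    | .insertEdge a b => (0, a, b)
    | .deleteEdge a b => (1, a, b)
    | .deleteNode x => (2, x, x)
  have hφ : Function.Injective φ := by
    intro u v h
    cases u <;> cases v <;> simp_all [φ]
  have := (hU.map hφ).length_le_card
  simpa using this

/-! ## The running times -/

theorem le_floor_of_le {ω : ℝ} {x A B s m M C : ℕ} (hω : 0 ≤ ω) (hx : (x : ℝ) ≤ A * (M : ℝ) ^ ω)
    (hM : M ≤ s * m) (hM1 : 1 ≤ M) (hC : (A + 1) * B * s ^ ⌈ω⌉₊ ≤ C) :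
    (x + 1) * B ≤ ⌊(C : ℝ) * (m : ℝ) ^ ω⌋₊ := by
  have hs : 1 ≤ s := by
    rcases Nat.eq_zero_or_pos s with rfl | h
    · omega
    · exact h
  have h1 : (1 : ℝ) ≤ (M : ℝ) ^ ω := Real.one_le_rpow (by exact_mod_cast hM1) hω
  have h2 : (M : ℝ) ^ ω ≤ (s : ℝ) ^ ⌈ω⌉₊ * (m : ℝ) ^ ω := by
    calc (M : ℝ) ^ ω ≤ ((s * m : ℕ) : ℝ) ^ ω :=
          Real.rpow_le_rpow (by positivity) (by exact_mod_cast hM) hω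
      _ = (s : ℝ) ^ ω * (m : ℝ) ^ ω := by
          rw [Nat.cast_mul, Real.mul_rpow (by positivity) (by positivity)]
      _ ≤ _ := by
          refine mul_le_mul_of_nonneg_right ?_ (by positivity)
          rw [← Real.rpow_natCast]
          exact Real.rpow_le_rpow_of_exponent_le (by exact_mod_cast hs) (Nat.le_ceil ω)
  refine Nat.le_floor ?_
  push_cast
  have hC' : ((A : ℝ) + 1) * B * (s : ℝ) ^ ⌈ω⌉₊ ≤ C := by exact_mod_cast hC
  calc ((x : ℝ) + 1) * B ≤ ((A + 1) * (M : ℝ) ^ ω) * B := by gcongr; linarith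
    _ ≤ ((A + 1) * ((s : ℝ) ^ ⌈ω⌉₊ * (m : ℝ) ^ ω)) * B := by gcongr
    _ = ((A + 1) * B * (s : ℝ) ^ ⌈ω⌉₊) * (m : ℝ) ^ ω := by ring
    _ ≤ _ := by gcongr


/-! ## The oracle -/

/-- The graphs whose determinants have to be nonzero. -/
def testGraphs (q k : ℕ) (S : ℕ → ℕ) (g g' : ℕ → ℕ → Prop) : List (ℕ → ℕ → Prop) :=
  (List.range (q + 1)).map (fun i x y => g x y ∧ x < i) ++
    (List.range (k + 1)).map (partGraph k S g g')

/-- The weights that give a wrong answer. -/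
def BadAt (q k : ℕ) (S : ℕ → ℕ) (g g' : ℕ → ℕ → Prop) (u v : Fin q) (p : ℕ)
    (y : Fin (q * q) → ZMod p) : Prop :=
  ∃ _ : Fact p.Prime, BadWeights q (testGraphs q k S g g') g' u v (weightsOf y)

-- There are `(q + 1) + (k + 1)` determinants and one entry of an adjugate, at most `4 * q`
-- polynomials in all, and the sample set has `4 * q ^ 3` elements.
open scoped Classical in
theorem card_badAt_le {a k p : ℕ} {S : ℕ → ℕ} {g g' : ℕ → ℕ → Prop} {u v : Fin (16 ^ a)}
    (ha : 1 ≤ a) (hk : k ≤ 16 ^ a) (hg : ∀ x y, g' x y → x < 16 ^ a ∧ y < 16 ^ a)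
    (huv : Relation.ReflTransGen g' (u : ℕ) v) (hp : p.Prime) (h0 : 2 ^ (12 * a + 2) ≤ p) :
    (Finset.univ.filter fun z : Fin (16 ^ a * 16 ^ a) → Fin (2 ^ (12 * a + 2)) =>
      BadAt (16 ^ a) k S g g' u v p fun i => ((z i : ℕ) : ZMod p)).card * 16 ^ a ≤
        (2 ^ (12 * a + 2)) ^ (16 ^ a * 16 ^ a) := by
  have := Fact.mk hp
  have hq : 16 ≤ 16 ^ a := Nat.le_self_pow (by omega) 16
  have e : (2 : ℕ) ^ (12 * a + 2) = 4 * (16 ^ a * 16 ^ a * 16 ^ a) := by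
    rw [show (16 : ℕ) = 2 ^ 4 by norm_num, ← pow_mul, ← pow_add, ← pow_add, pow_add]
    ring_nf
  refine le_trans (le_of_eq ?_) (card_badWeights_le (gs := testGraphs (16 ^ a) k S g g') h0
    (by positivity) hg huv ?_)
  · congr 2
    ext z
    simp only [Finset.mem_filter, Finset.mem_univ, true_and]
    exact ⟨fun ⟨_, h⟩ => h, fun h => ⟨_, h⟩⟩
  · rw [e]
    simp only [testGraphs, List.length_append, List.length_map, List.length_range]
    calc (16 ^ a + 1 + (k + 1) + 1) * 16 ^ a * 16 ^ a ≤ (4 * 16 ^ a) * 16 ^ a * 16 ^ a := by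
          gcongr; omega
      _ = _ := by ring

/-- The properties of the state between queries. -/
structure Answers (H V p a n R : ℕ) [Fact p.Prime] (G : Digraph (Fin n)) (U : List (GraphUpdate n))
    (w : ℕ → ℕ → ℕ → ZMod p) (C : Config) : Prop where
  pc : C.pc = 0
  state : ∃ σ, Rep H σ C ∧ σ.Bounded V ∧ Updated p (16 ^ a) n (numbering U).length
    (2 ^ Nat.clog 2 (numbering U).length) R (fun i => (numbering U).getD i 0)
    (natDel (applyUpdates G U)) (natAdj G) (liveAdj (applyUpdates G U)) w σ

section
variable {P : Program} {κ K R H D B e n : ℕ} {ω : ℝ} {W : ℕ}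

/-- The constants of the oracle. -/
structure Consts (P : Program) (κ K R H D B e : ℕ) (ω : ℝ) : Prop where
  two_le : 2 ≤ ω
  mul : MulProgram P κ (mulTime ω K)
  word : mulWord P κ K ω + 132 * R + 3 * H ≤ e
  lit : (prepCmd P R).maxlit + (updCmd P R).maxlit + (queryCmd R).maxlit ≤ e
  arr : (prepCmd P R).maxarr + (updCmd P R).maxarr + (queryCmd R).maxarr + 4 * R + 10 < H
  deg : (prepCmd P R).maxdeg + (updCmd P R).maxdeg + (queryCmd R).maxdeg < D
  len : ((prepCmd P R).code H 0).length + ((updCmd P R).code H 0).length +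
    ((queryCmd R).code H 0).length < B

theorem clog_bounds (hn : 2 ≤ n) : 1 ≤ Nat.clog 16 n ∧ Nat.clog 16 n ≤ Nat.clog 2 n ∧
    n ≤ 16 ^ Nat.clog 16 n ∧ 16 ^ Nat.clog 16 n ≤ 16 * n := by
  have h0 : 0 < Nat.clog 16 n := Nat.clog_pos (by norm_num) (by omega)
  refine ⟨h0, ?_, Nat.le_pow_clog (by norm_num) _, ?_⟩
  · exact Nat.clog_anti_left (by norm_num) (by norm_num)
  · have := Nat.pow_pred_clog_lt_self (b := 16) (by norm_num) (by omega : 1 < n)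
    rw [← Nat.succ_pred_eq_of_pos h0, pow_succ]
    omega

namespace Consts

theorem mulWord_le (h : Consts P κ K R H D B e ω) : mulWord P κ K ω ≤ e := by have := h.word; omega

theorem thirtySix_le (h : Consts P κ K R H D B e ω) : 36 ≤ e := by
  have := h.mulWord_le
  unfold mulWord at this; omega

/-- Stored values occupy `e * b` bits while a word has `D` times as many, which leaves room for
expressions of degree up to `D`. -/
theorem fit (h : Consts P κ K R H D B e ω) {b : ℕ} (hb : 1 ≤ b) (hW : W = e * D * b) : Fit W (2 ^ (e * b)) H D := by
  have h36 := h.thirtySix_le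
  have heb : e ≤ e * b := Nat.le_mul_of_pos_right _ hb
  refine ⟨?_, ?_, ?_⟩
  · simpa using Nat.pow_le_pow_right (n := 2) (by norm_num) (show 1 ≤ e * b by omega)
  · exact lt_two_pow_mul (c := 3 * H) (k := 0) hb (by simp) (by have := h.word; omega)
  · rw [hW, ← pow_mul]; exact le_of_eq (congrArg _ (by ring))

theorem lit_lt (h : Consts P κ K R H D B e ω) {b : ℕ} (hb : 1 ≤ b) {x : ℕ} (hx : x ≤ e) :
    x < 2 ^ (e * b) :=
  (hx.trans (Nat.le_mul_of_pos_right _ hb)).trans_lt Nat.lt_two_pow_self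

theorem pow_lt (h : Consts P κ K R H D B e ω) {a b : ℕ} (hb : 1 ≤ b) (hab : a ≤ b) :
    2 ^ (14 * a + 8) < 2 ^ (e * b) := by
  refine lt_two_pow_mul (c := 1) (k := 22) hb ?_ (by have := h.thirtySix_le; omega)
  rw [one_mul]
  exact Nat.pow_le_pow_right (by norm_num) (by omega)

theorem card_lt (h : Consts P κ K R H D B e ω) (hn : 2 ≤ n) : n < 2 ^ (e * Nat.clog 2 n) := by
  refine lt_two_pow_mul (c := 1) (k := 1) (Nat.clog_pos (by norm_num) (by omega)) ?_
    (by have := h.thirtySix_le; omega)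
  rw [one_mul, one_mul]
  exact Nat.le_pow_clog (by norm_num) _

theorem updates_lt (h : Consts P κ K R H D B e ω) (hn : 2 ≤ n) {U : List (GraphUpdate n)}
    (hU : U.Nodup) : 2 * U.length + 1 < 2 ^ (e * Nat.clog 2 n) := by
  refine lt_two_pow_mul (c := 7) (k := 2) (Nat.clog_pos (by norm_num) (by omega)) ?_
    (by have := h.thirtySix_le; omega)
  have h1 : n ≤ 2 ^ Nat.clog 2 n := Nat.le_pow_clog (by norm_num) _
  have h2 : n * n ≤ 2 ^ (2 * Nat.clog 2 n) := by
    rw [two_mul, pow_add]; exact Nat.mul_le_mul h1 h1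
  have h3 := length_le_of_nodup hU
  have h4 : 1 ≤ n * n := by nlinarith
  omega

variable {G : Digraph (Fin n)} {U : List (GraphUpdate n)} {p s : ℕ} [hp : Fact p.Prime]

theorem preprocess_run (h : Consts P κ K R H D B e ω) (hn : 2 ≤ n)
    (hW : W = e * D * Nat.clog 2 n) (coins : Coins W)
    (hpe : p = pickPrime (2 ^ (12 * Nat.clog 16 n + 2)) (2 ^ (14 * Nat.clog 16 n + 8))
      (fun i => coins i) (132 * R * (Nat.clog 16 n * Nat.clog 16 n)))
    (hs : 3 * (16 ^ Nat.clog 16 n * 16 ^ Nat.clog 16 n * H) ≤ s) (hs' : 160 ≤ s) {T : ℕ}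
    (hT : (prepTime P (mulTime ω K) R (Nat.clog 16 n) + 1) * B ≤ T) :
    ∃ C, run W ((prepCmd P R).prog H) (graphWords G) coins T Config.initial = some C ∧
      ∃ σ, Rep H σ (C.keep s) ∧ σ.Bounded (2 ^ (e * Nat.clog 2 n)) ∧
        Prepared p (Nat.clog 16 n) R (natAdj G) (roundWeights p (16 ^ Nat.clog 16 n)
          (2 ^ (12 * Nat.clog 16 n + 2)) (132 * R * (Nat.clog 16 n * Nat.clog 16 n))
            fun i => coins i) σ := by
  obtain ⟨ha, hab, hna, -⟩ := clog_bounds hn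
  have hb : 1 ≤ Nat.clog 2 n := ha.trans hab
  have hV0 : 0 < 2 ^ (e * Nat.clog 2 n) := by positivity
  have hK : 132 * R * (Nat.clog 16 n * Nat.clog 16 n) < 2 ^ (e * Nat.clog 2 n) := by
    refine lt_two_pow_mul (c := 132 * R) (k := 2) hb (Nat.mul_le_mul_left _ ?_)
      (by have := h.word; unfold mulWord at this; omega)
    have h1 : Nat.clog 16 n ≤ 2 ^ Nat.clog 2 n := hab.trans Nat.lt_two_pow_self.le
    rw [two_mul, pow_add]
    exact Nat.mul_le_mul h1 h1
  have hlit := h.lit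
  have harr := h.arr
  have hdeg := h.deg
  have hlen := h.len
  obtain ⟨C, hC, σ, hr, hbd, hq, -⟩ := run_prog (E := ⟨W, 2 ^ (e * Nat.clog 2 n), graphWords G, coins⟩)
    (h.fit hb hW) (getD_lt_of_forall hV0 (graphWords_lt hn (h.card_lt hn) G))
    (prepCmd_runs (p := p) h.mul rfl hn rfl (h.pow_lt hb hab) hK hpe fun j hj =>
      mulFit_of_le (by linarith [h.two_le]) hb hab h.mulWord_le
        (hpe ▸ pickPrime_lt (by rw [pow_add]; have : 1 ≤ 2 ^ (14 * Nat.clog 16 n) := Nat.one_le_two_pow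
                                omega) _ _) hj.le)
    ⟨fun _ => hV0, fun _ _ => hV0⟩ (h.lit_lt hb (by omega)) (by omega) (by omega) (by omega)
    Config.initial (rep_zero H) rfl hT
  exact ⟨C, hC, _, hr.keep s, hbd.keep H s, hq.keep (by omega) hs hs'⟩

theorem size_le (hn : 2 ≤ n) :
    2 ^ Nat.clog 2 (numbering U).length ≤ 16 ^ Nat.clog 16 n := by
  have e16 : (16 : ℕ) ^ Nat.clog 16 n = 2 ^ (4 * Nat.clog 16 n) := by rw [pow_mul]; norm_num
  rw [e16]
  refine Nat.pow_le_pow_right (by norm_num) (Nat.clog_le_of_le_pow ?_)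
  rw [← e16]
  exact (length_numbering_le_card hn U).trans (clog_bounds hn).2.2.1

theorem update_run (h : Consts P κ K R H D B e ω) (hn : 2 ≤ n) (hU : U.Nodup)
    (hW : W = e * D * Nat.clog 2 n) (coins : Coins W) (hp14 : p < 2 ^ (14 * Nat.clog 16 n + 8))
    (hs : 3 * (16 ^ Nat.clog 16 n * 16 ^ Nat.clog 16 n * H) ≤ s) (hs' : 160 ≤ s) {T : ℕ}
    (hT : (updTime P (mulTime ω K) R U.length (Nat.clog 2 (numbering U).length) + 1) * B ≤ T)
    {w : ℕ → ℕ → ℕ → ZMod p} {C₀ : Config} (hpc : C₀.pc = 0) {σ₀ : St} (hr₀ : Rep H σ₀ C₀)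
    (hb₀ : σ₀.Bounded (2 ^ (e * Nat.clog 2 n)))
    (h₀ : Prepared p (Nat.clog 16 n) R (natAdj G) w σ₀) :
    ∃ C, run W ((updCmd P R).prog H) (updateWords U) coins T C₀ = some C ∧
      Answers H (2 ^ (e * Nat.clog 2 n)) p (Nat.clog 16 n) n R G U w (C.keep s) := by
  obtain ⟨ha, hab, hna, -⟩ := clog_bounds hn
  have hb : 1 ≤ Nat.clog 2 n := ha.trans hab
  have hV0 : 0 < 2 ^ (e * Nat.clog 2 n) := by positivity
  have hUV := h.updates_lt hn hU
  have hlit := h.lit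
  have harr := h.arr
  have hdeg := h.deg
  have hlen := h.len
  obtain ⟨C, hC, σ, hr, hbd, hq, -⟩ := run_prog
    (E := ⟨W, 2 ^ (e * Nat.clog 2 n), updateWords U, coins⟩) (h.fit hb hW)
    (getD_lt_of_forall hV0 (updateWords_lt (h.card_lt hn) hn
      (show U.length < 2 ^ (e * Nat.clog 2 n) by omega)))
    (updCmd_runs h.mul rfl hn hna (h.pow_lt hb hab) hUV (fun j hj =>
      mulFit_of_le (by linarith [h.two_le]) hb hab h.mulWord_le hp14 hj) h₀)
    hb₀ (h.lit_lt hb (by omega)) (by omega) (by omega) (by omega) C₀ hr₀ hpc hT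
  exact ⟨C, hC, rfl, _, hr.keep s, hbd.keep H s, hq.keep (by omega) hs hs'
    (le_trans (by norm_num) (Nat.pow_le_pow_right (n := 16) (by norm_num) ha)) hna
      (Nat.le_pow_clog (by norm_num) _) (size_le hn)⟩

theorem query_run (h : Consts P κ K R H D B e ω) (hn : 2 ≤ n)
    (hW : W = e * D * Nat.clog 2 n) (coins : Coins W) (hp14 : p < 2 ^ (14 * Nat.clog 16 n + 8))
    (hs : 3 * (16 ^ Nat.clog 16 n * 16 ^ Nat.clog 16 n * H) ≤ s) (hs' : 160 ≤ s) {T : ℕ}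
    (hT : (queryTime R (numbering U).length + 1) * B ≤ T)
    {w : ℕ → ℕ → ℕ → ZMod p} {C₀ : Config}
    (h₀ : Answers H (2 ^ (e * Nat.clog 2 n)) p (Nat.clog 16 n) n R G U w C₀) (u v : Fin n) :
    ∃ C, run W ((queryCmd R).prog H) [(u : ℕ), v] coins T C₀ = some C ∧
      Answers H (2 ^ (e * Nat.clog 2 n)) p (Nat.clog 16 n) n R G U w (C.keep s) ∧
      (C.mem 0 ≠ 0 → (applyUpdates G U).Reachable u v) ∧
      (C.mem 0 = 0 → (applyUpdates G U).Reachable u v → ∀ r < R,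
        BadWeights (16 ^ Nat.clog 16 n) (testGraphs (16 ^ Nat.clog 16 n) (numbering U).length
          (fun i => (numbering U).getD i 0) (natAdj G) (liveAdj (applyUpdates G U)))
          (liveAdj (applyUpdates G U)) ⟨u, u.2.trans_le (clog_bounds hn).2.2.1⟩
          ⟨v, v.2.trans_le (clog_bounds hn).2.2.1⟩ (w r)) := by
  obtain ⟨ha, hab, hna, -⟩ := clog_bounds hn
  have hb : 1 ≤ Nat.clog 2 n := ha.trans hab
  have hV0 : 0 < 2 ^ (e * Nat.clog 2 n) := by positivity
  have hnV := h.card_lt hn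
  have hlit := h.lit
  have harr := h.arr
  have hdeg := h.deg
  have hlen := h.len
  obtain ⟨hpc, σ₀, hr₀, hb₀, hu₀⟩ := h₀
  have hkn := length_numbering_le_card hn U
  obtain ⟨C, hC, σ, hr, hbd, ⟨hq, hq1, hq2⟩, -⟩ := run_prog
    (E := ⟨W, 2 ^ (e * Nat.clog 2 n), [(u : ℕ), v], coins⟩) (h.fit hb hW)
    (getD_lt_of_forall hV0 (by
      intro x hx
      simp only [List.mem_cons, List.not_mem_nil, or_false] at hx
      exact (show x < n by omega).trans hnV))
    (queryCmd_runs rfl (change_numbering hn U G hna).lt hna (hp14.trans (h.pow_lt hb hab))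
      (by simp only; omega) hnV u.2 v.2 hu₀)
    hb₀ (h.lit_lt hb (by omega)) (by omega) (by omega) (by omega) C₀ hr₀ hpc hT
  have h0 : C.mem 0 = σ.v 0 := hr.var 0
  refine ⟨C, hC, ⟨rfl, _, hr.keep s, hbd.keep H s, hq.keep (by omega) hs hs'
    (le_trans (by norm_num) (Nat.pow_le_pow_right (n := 16) (by norm_num) ha)) hna
      (Nat.le_pow_clog (by norm_num) _) (size_le hn)⟩, fun hne => ?_, fun hz hre r hrR => ?_⟩
  · exact (reachable_iff _ u v).mpr (hq1 (h0 ▸ hne))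
  · obtain ⟨h1, h2, -⟩ := (reachable_iff _ u v).mp hre
    by_contra hbad
    unfold BadWeights at hbad
    rw [not_or] at hbad
    refine hbad.2 (hq2 (h0 ▸ hz) h1 h2 r hrR (fun i hi hd => hbad.1 ⟨_, ?_, hd⟩)
      fun i hi hd => hbad.1 ⟨_, ?_, hd⟩)
    · exact List.mem_append_left _ (List.mem_map.mpr ⟨i, List.mem_range.mpr (by omega), rfl⟩)
    · exact List.mem_append_right _ (List.mem_map.mpr ⟨i, List.mem_range.mpr (by omega), rfl⟩)

end Consts

end


/-! ### The programs of the oracle and the theorem -/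

theorem exists_consts {ω : ℝ} {P : Program} {κ K : ℕ} (hω : 2 ≤ ω)
    (hP : MulProgram P κ (mulTime ω K)) (R : ℕ) : ∃ H D B e, Consts P κ K R H D B e ω := by
  -- `H`, `D` and `B` are the successors forced by the three uses of `Nat.lt_succ_self`. There is no
  -- circularity: the commands do not depend on `H`, and only their code does.
  refine ⟨_, _, _, mulWord P κ K ω + 132 * R + 3 *
    ((prepCmd P R).maxarr + (updCmd P R).maxarr + (queryCmd R).maxarr + 4 * R + 10 + 1) +
    ((prepCmd P R).maxlit + (updCmd P R).maxlit + (queryCmd R).maxlit), hω, hP, ?_, ?_,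
    Nat.lt_succ_self _, Nat.lt_succ_self _, Nat.lt_succ_self _⟩
  · exact Nat.le_add_right _ _
  · exact Nat.le_add_left _ _

/-- The programs of the oracle. -/
def oracle (P : Program) (R H D e : ℕ) : OraclePrograms where
  preprocess := (prepCmd P R).prog H
  update := (updCmd P R).prog H
  query := (queryCmd R).prog H
  wordFactor := e * D

/-- The number of cells of the data structure. The results of an update overwrite cells that have
been reserved here, so that the update needs no additional cells. -/
def oracleCells (H n : ℕ) : ℕ := 768 * H * n ^ 2 + 160

/-- The constant in the bounds for time and space. -/
noncomputable def oracleConst (P : Program) (K R H D B e : ℕ) (ω : ℝ) : ℕ :=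
  (R * (invConst P K + 132 * 178 + 44) + 22 + 1) * B * 16 ^ ⌈ω⌉₊ +
    (R * (3 * invConst P K + 100) + 43 + 1) * B * 4 ^ ⌈ω⌉₊ + (R * 29 + 5) * B +
      (768 * H + 160) * (e * D) * 3

section
variable {P : Program} {κ K R H D B e n : ℕ} {ω : ℝ} {G : Digraph (Fin n)} {U : List (GraphUpdate n)}
  {L : OraclePrograms.Limits}

/-- If no candidate is a large prime, the random words are bad by definition, whatever the fallback
prime does. Otherwise the chosen prime is large enough and all rounds are bad for it. -/
theorem badCoins_of_badWeights {a R k p : ℕ} [hp : Fact p.Prime] {S : ℕ → ℕ}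
    {g g' : ℕ → ℕ → Prop} {u v : Fin (16 ^ a)} {x : ℕ → ℕ}
    (hpe : p = pickPrime (2 ^ (12 * a + 2)) (2 ^ (14 * a + 8)) x (132 * R * (a * a)))
    (h : ∀ r < R, BadWeights (16 ^ a) (testGraphs (16 ^ a) k S g g') g' u v
      (roundWeights p (16 ^ a) (2 ^ (12 * a + 2)) (132 * R * (a * a)) x r)) :
    BadCoins a R (BadAt (16 ^ a) k S g g' u v) x := by
  by_cases hno : ∃ j < 132 * R * (a * a), 2 ^ (12 * a + 2) ≤ x j % 2 ^ (14 * a + 8) ∧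
      (x j % 2 ^ (14 * a + 8)).Prime
  · refine Or.inr ⟨le_pickPrime hno, fun r hr => ?_⟩
    rw [← hpe]
    exact ⟨hp, h r hr⟩
  · exact Or.inl fun j hj hh => hno ⟨j, hj, hh⟩

/-- For every outcome of the random words, each query is answered in time, and never wrongly unless
the random words are bad. -/
theorem Consts.exists_answer (h : Consts P κ K R H D B e ω) (hn : 2 ≤ n) (hU : U.Nodup)
    (hL : L =
      { preprocessTime := ⌊(oracleConst P K R H D B e ω : ℝ) * (n : ℝ) ^ ω⌋₊
        updateTime := ⌊(oracleConst P K R H D B e ω : ℝ) * ((max 1 U.length : ℕ) : ℝ) ^ ω⌋₊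
        queryTime := oracleConst P K R H D B e ω * (max 1 U.length) ^ 2
        cells := oracleCells H n
        extraCells := 0 })
    (qs : List (Fin n × Fin n)) (u v : Fin n) (coins : Coins ((oracle P R H D e).wordSize n)) :
    ∃ b : Bool, (oracle P R H D e).answer L G U qs (u, v) coins = some b ∧
      (b = true → (applyUpdates G U).Reachable u v) ∧
      (b = false → (applyUpdates G U).Reachable u v →
        BadCoins (Nat.clog 16 n) R (BadAt (16 ^ Nat.clog 16 n) (numbering U).length
          (fun i => (numbering U).getD i 0) (natAdj G) (liveAdj (applyUpdates G U))
          ⟨u, u.2.trans_le (clog_bounds hn).2.2.1⟩ ⟨v, v.2.trans_le (clog_bounds hn).2.2.1⟩)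
          fun i => coins i) := by
  obtain ⟨ha, hab, hna, hqn⟩ := clog_bounds hn
  set a := Nat.clog 16 n
  have hω0 : 0 ≤ ω := by linarith [h.two_le]
  have hq1 : 1 ≤ 16 ^ a := Nat.one_le_pow _ _ (by norm_num)
  have hs : 3 * (16 ^ a * 16 ^ a * H) ≤ oracleCells H n := by
    have h1 := Nat.mul_le_mul_right H (Nat.mul_le_mul hqn hqn)
    have h2 : 3 * (16 * n * (16 * n) * H) = 768 * H * n ^ 2 := by ring
    unfold oracleCells
    omega
  have hs' : 160 ≤ oracleCells H n := Nat.le_add_left _ _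
  have ht1 : (prepTime P (mulTime ω K) R a + 1) * B ≤ L.preprocessTime := by
    rw [hL]
    refine le_floor_of_le hω0 (prepTime_le P K R h.two_le a) hqn hq1 ?_
    unfold oracleConst
    omega
  have hk := length_numbering_le U
  have ht2 : (updTime P (mulTime ω K) R U.length (Nat.clog 2 (numbering U).length) + 1) * B ≤
      L.updateTime := by
    rw [hL]
    refine le_floor_of_le hω0 (updTime_le P K R h.two_le rfl hk) le_rfl (by omega) ?_
    unfold oracleConst
    omega
  have ht3 : (queryTime R (numbering U).length + 1) * B ≤ L.queryTime := by
    rw [hL]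
    calc (queryTime R (numbering U).length + 1) * B ≤ (R * 29 + 5) * (max 1 U.length) ^ 2 * B :=
          Nat.mul_le_mul_right _ (queryTime_le R rfl hk)
      _ = (R * 29 + 5) * B * (max 1 U.length) ^ 2 := by ring
      _ ≤ _ := Nat.mul_le_mul_right _ (by unfold oracleConst; omega)
  have hc : L.cells = oracleCells H n := by rw [hL]
  have hc' : L.cells + L.extraCells = oracleCells H n := by rw [hL]; rfl
  have hK2 : 2 < 2 ^ (14 * a + 8) := by
    rw [pow_add]
    have : 1 ≤ 2 ^ (14 * a) := Nat.one_le_two_pow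
    omega
  obtain ⟨p, hpe⟩ : ∃ p, p = pickPrime (2 ^ (12 * a + 2)) (2 ^ (14 * a + 8)) (fun i => coins i)
    (132 * R * (a * a)) := ⟨_, rfl⟩
  have hp : Fact p.Prime := ⟨hpe ▸ pickPrime_prime _ _ _ _⟩
  have hp14 : p < 2 ^ (14 * a + 8) := hpe ▸ pickPrime_lt hK2 _ _
  obtain ⟨C₁, r1, σ₁, rep1, bd1, prep⟩ :=
    h.preprocess_run (G := G) hn rfl coins hpe hs hs' ht1
  obtain ⟨C₂, r2, ans2⟩ := h.update_run hn hU rfl coins hp14 hs hs' ht2 rfl rep1 bd1 prep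
  let w := roundWeights p (16 ^ a) (2 ^ (12 * a + 2)) (132 * R * (a * a)) fun i => coins i
  have step := fun (C : Config) (hC : Answers H (2 ^ (e * Nat.clog 2 n)) p a n R G U w C)
    (u v : Fin n) => h.query_run (w := w) hn rfl coins hp14 hs hs' ht3 hC u v
  -- Queries alter only scratch data, so the invariant between queries is restored and earlier
  -- queries have no influence on later ones.
  have fold : ∀ (qs : List (Fin n × Fin n)) (C : Config),
      Answers H (2 ^ (e * Nat.clog 2 n)) p a n R G U w C → ∃ C', qs.foldlM (m := Option)
        (fun c q' => ((oracle P R H D e).runQuery L coins c q').map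
          (Config.keep (L.cells + L.extraCells))) C = some C' ∧
        Answers H (2 ^ (e * Nat.clog 2 n)) p a n R G U w C' := by
    intro qs
    induction qs with
    | nil => exact fun C hC => ⟨C, rfl, hC⟩
    | cons q qs ih =>
      intro C hC
      obtain ⟨C', hC', hA, -⟩ := step C hC q.1 q.2
      obtain ⟨C'', hC'', hA'⟩ := ih _ hA
      refine ⟨C'', ?_, hA'⟩
      rw [List.foldlM_cons, hc']
      rw [hc'] at hC''
      have : (oracle P R H D e).runQuery L coins C q = some C' := hC'
      rw [this]
      exact hC''
  obtain ⟨C₃, r3, ans3⟩ := fold qs _ ans2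
  obtain ⟨C₄, r4, -, s1, s2⟩ := step C₃ ans3 u v
  have r4' : (oracle P R H D e).runQuery L coins C₃ (u, v) = some C₄ := r4
  have hpre : (oracle P R H D e).afterPreprocess L G coins = some (C₁.keep (oracleCells H n)) := by
    unfold OraclePrograms.afterPreprocess
    rw [hc]
    exact congrArg (Option.map _) r1
  have hupd : (oracle P R H D e).afterUpdate L G U coins = some (C₂.keep (oracleCells H n)) := by
    unfold OraclePrograms.afterUpdate
    rw [hpre, hc']
    exact congrArg (Option.map _) r2
  refine ⟨decide (C₄.mem 0 ≠ 0), ?_, fun hb => s1 (of_decide_eq_true hb), fun hb hre => ?_⟩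
  · unfold OraclePrograms.answer
    rw [hupd, Option.bind_some, r3, Option.bind_some, r4', Option.map_some]
  · have hz : C₄.mem 0 = 0 := not_not.mp (of_decide_eq_false hb)
    exact badCoins_of_badWeights hpe (s2 hz hre)

theorem liveAdj_lt (H : UpdatedGraph n) {q : ℕ} (hnq : n ≤ q) (x y : ℕ) (h : liveAdj H x y) :
    x < q ∧ y < q := by
  obtain ⟨⟨hx, hy, -⟩, -⟩ := h
  exact ⟨hx.trans_le hnq, hy.trans_le hnq⟩

end

end WordRAM

theorem theorem2 (ω : ℝ) (hω : MatMulExponent ω) (c : ℕ) :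
    ∃ (O : OraclePrograms) (C : ℕ) (cells : ℕ → ℕ) (extraCells : ℕ → ℕ → ℕ),
      -- the preprocessed data structure has `O(n² log n)` bits
      (∀ n : ℕ, 2 ≤ n →
        ((cells n * O.wordSize n : ℕ) : ℝ) ≤ C * (n : ℝ) ^ 2 * Real.log n) ∧
      -- an update by `f` changes stores additional `O(f² log n)` bits
      (∀ n f : ℕ, 2 ≤ n →
        ((extraCells n f * O.wordSize n : ℕ) : ℝ) ≤
          C * ((max 1 f : ℕ) : ℝ) ^ 2 * Real.log n) ∧
      ∀ (n : ℕ) (_ : 2 ≤ n) (G : Digraph (Fin n)) (U : List (GraphUpdate n)) (_ : U.Nodup)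
        (L : OraclePrograms.Limits)
        (_ : L =
          { preprocessTime := ⌊(C : ℝ) * (n : ℝ) ^ ω⌋₊
            updateTime := ⌊(C : ℝ) * ((max 1 U.length : ℕ) : ℝ) ^ ω⌋₊
            queryTime := C * (max 1 U.length) ^ 2
            cells := cells n
            extraCells := extraCells n U.length })
        (qs : List (Fin n × Fin n)) (u v : Fin n),
        -- every query is answered within the time limits, whatever the random words are,
        -- and the answer is never wrongly positive
        (∀ coins : WordRAM.Coins (O.wordSize n), ∃ b : Bool,
          O.answer L G U qs (u, v) coins = some b ∧
            (b = true → (applyUpdates G U).Reachable u v)) ∧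
        -- the answer is correct with high probability
        WordRAM.coinMeasure (O.wordSize n)
            {coins | ∃ b : Bool, O.answer L G U qs (u, v) coins = some b ∧
              ¬(b = true ↔ (applyUpdates G U).Reachable u v)} ≤
          ((n : ENNReal) ^ c)⁻¹ := by
  classical
  have hω2 := hω.two_le
  obtain ⟨P, κ, K, hP⟩ := hω
  obtain ⟨H, D, B, e, h⟩ := exists_consts hω2 (hP : MulProgram P κ (mulTime ω K)) (c + 1)
  have hlog : ∀ n : ℕ, 2 ≤ n → 0 ≤ Real.log n := fun n hn =>
    Real.log_nonneg (by exact_mod_cast (by omega : 1 ≤ n))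
  refine ⟨oracle P (c + 1) H D e, oracleConst P K (c + 1) H D B e ω, oracleCells H, fun _ _ => 0,
    fun n hn => ?_, fun n f hn => ?_, fun n hn G U hU L hL qs u v => ⟨fun coins => ?_, ?_⟩⟩
  · have h1 : oracleCells H n * (e * D) * 3 ≤ oracleConst P K (c + 1) H D B e ω * n ^ 2 := by
      have hn2 : 1 ≤ n ^ 2 := Nat.one_le_pow _ _ (by omega)
      calc oracleCells H n * (e * D) * 3 ≤ ((768 * H + 160) * n ^ 2) * (e * D) * 3 := by
            unfold oracleCells; gcongr; nlinarith
        _ = (768 * H + 160) * (e * D) * 3 * n ^ 2 := by ring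
        _ ≤ _ := Nat.mul_le_mul_right _ (Nat.le_add_left _ _)
    have h2 := clog_le_log hn
    have h3 : ((oracleCells H n * (e * D) * 3 : ℕ) : ℝ) ≤
      (oracleConst P K (c + 1) H D B e ω * n ^ 2 : ℕ) := Nat.cast_le.mpr h1
    have e1 : (oracleCells H n * (oracle P (c + 1) H D e).wordSize n : ℕ) =
      oracleCells H n * (e * D) * Nat.clog 2 n := by
      simp only [OraclePrograms.wordSize, oracle]; ring
    rw [e1, Nat.cast_mul]
    calc ((oracleCells H n * (e * D) : ℕ) : ℝ) * (Nat.clog 2 n : ℝ) ≤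
          ((oracleCells H n * (e * D) : ℕ) : ℝ) * (3 * Real.log n) := by gcongr
      _ = ((oracleCells H n * (e * D) * 3 : ℕ) : ℝ) * Real.log n := by push_cast; ring
      _ ≤ (oracleConst P K (c + 1) H D B e ω * n ^ 2 : ℕ) * Real.log n :=
          mul_le_mul_of_nonneg_right h3 (hlog n hn)
      _ = _ := by push_cast; ring
  · rw [zero_mul, Nat.cast_zero]
    have := hlog n hn
    positivity
  · obtain ⟨b, h1, h2, -⟩ := h.exists_answer (G := G) hn hU hL qs u v coins
    exact ⟨b, h1, h2⟩
  -- If there is no path, a wrong answer is impossible and the event is empty. Otherwise a wrong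
  -- answer forces bad random words.
  · by_cases hre : (applyUpdates G U).Reachable u v
    · obtain ⟨ha, hab, hna, -⟩ := clog_bounds hn
      have hW : 14 * Nat.clog 16 n + 8 ≤ (oracle P (c + 1) H D e).wordSize n := by
        have h1 := h.thirtySix_le
        have h2 := h.deg
        have h3 : 36 * 1 * Nat.clog 2 n ≤ e * D * Nat.clog 2 n :=
          Nat.mul_le_mul_right _ (Nat.mul_le_mul h1 (by omega))
        simp only [OraclePrograms.wordSize, oracle]
        omega
      refine le_trans (measure_mono ?_) (coinMeasure_badCoins_le ha hna hW
        (B := BadAt (16 ^ Nat.clog 16 n) (numbering U).length (fun i => (numbering U).getD i 0)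
          (natAdj G) (liveAdj (applyUpdates G U)) ⟨u, u.2.trans_le (clog_bounds hn).2.2.1⟩
          ⟨v, v.2.trans_le (clog_bounds hn).2.2.1⟩) fun p hp h0 => ?_)
      · rintro coins ⟨b, hb, hne⟩
        obtain ⟨b', h1, -, h3⟩ := h.exists_answer (G := G) hn hU hL qs u v coins
        obtain rfl : b' = b := Option.some_injective _ (h1.symm.trans hb)
        refine h3 ?_ hre
        simpa [hre] using hne
      · convert card_badAt_le (u := ⟨u, u.2.trans_le hna⟩) (v := ⟨v, v.2.trans_le hna⟩) ha
          ((length_numbering_le_card hn U).trans hna) (liveAdj_lt (applyUpdates G U) hna)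
          ((reachable_iff _ u v).mp hre).2.2 hp h0
    · refine le_trans (le_of_eq ?_) zero_le
      convert measure_empty (μ := WordRAM.coinMeasure ((oracle P (c + 1) H D e).wordSize n))
      refine Set.eq_empty_iff_forall_notMem.mpr fun coins ⟨b, hb, hne⟩ => ?_
      obtain ⟨b', h1, h2, -⟩ := h.exists_answer (G := G) hn hU hL qs u v coins
      obtain rfl : b' = b := Option.some_injective _ (h1.symm.trans hb)
      exact hne ⟨h2, fun hr => absurd hr hre⟩
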